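/- Let $\widetilde G$ be a simply connected semisimple algebraic group over $\mathbb C$ with Borel subgroup $\widetilde B^+=\widetilde H U^+$, maximal torus $\widetilde H$, simple roots $\alpha_s$ $(s\in S)$, simple coroots $\alpha_s^\vee$, fundamental weights $\varpi_s$, and root homomorphisms $x_s,y_s$ coming from homomorphisms $\varphi_s:SL_2\to\widetilde G$. Let $G=\widetilde G/Z(\widetilde G)$, with Cartan subgroup $H$ and Borel subgroup $B^+=HU^+$, and let $H^s=\varpi_s^\vee:\mathbb G_m\to H$ be the fundamental coweights, $\mathbb E^s=x_s(1)$, $\mathbb F^s=y_s(1)$. Put $\overline r_s=\varphi_s\begin{pmatrix}0&-1\\1&0\end{pmatrix}$, let $\overline{w_0}$ be the product of the $\overline r_s$ along a reduced word of the longest Weyl group element $w_0$, and define $s^*$ by $\alpha_{s^*}=-w_0\alpha_s$. *Configurations.* A flag is an element of $G/B^+$ (the Borel subgroup $gB^+g^{-1}$ being the coset $gB^+$), a decorated flag is an element of $G/U^+$; $[U^+]$ is the base point and $B^-=\overline{w_0}.B^+$. A pair of flags is generic if it is in the $G$-orbit of $(B^+,B^-)$. A pinning is a pair $p=(\widehat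 B_1,B_2)$ of a decorated flag and a flag whose underlying pair of flags is generic; each is $g.p_{\rm std}$ for a unique $g\in G$, where $p_{\rm std}=([U^+],B^-)$, and its opposite is $p^*=g\overline{w_0}.p_{\rm std}$. $\mathrm{Conf}_3\mathcal P_G$ is the set of $G$-orbits of $(B_1,B_2,B_3;p_{12},p_{23},p_{31})$, where $p_{i,i+1}$ is a pinning over $(B_i,B_{i+1})$ (cyclic indices). The basic Wilson lines $b_L,b_R:\mathrm{Conf}_3\mathcal P_G\to G$ are defined as follows: $p_{31}=(b_L.p_{\rm std})^*$ in the representative with $p_{12}=p_{\rm std}$, and $p_{12}=(b_R.p_{\rm std})^*$ in the representative with $p_{31}=p_{\rm std}$. *Evaluation maps.* For a word $\mathbf s=(s_1,\dots,s_N)$ let $n^s(\mathbf s)$ be the number of occurrences of $s$, $k(s,i)$ the position of the $i$-th occurrence, $I(\mathbf s)=\{(s,i)\mid s\in S,\ 0\le i\le n^s(\mathbf s)\}$ and $I_\infty(\mathbf s)=I(\mathbf s)\sqcup\{(s,-\infty)\mid s\in S\}$. Then $ev^+_{\mathbf s}:\mathbb G_m^{I(\mathbf s)}\to G$ is $$ev^+_{\mathbf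 s}(\mathbf x)=\Big(\prod_{s\in S}H^s(x^s_0)\Big)\,\mathbb E^{s_1}H^{s_1}(x_{(1)})\cdots\mathbb E^{s_N}H^{s_N}(x_{(N)}),\qquad x_{(k)}=x^{s}_i\ \text{ if } k=k(s,i),$$ and $ev^-_{\mathbf s}$ is obtained by replacing each $\mathbb E$ by $\mathbb F$. Let $\mathbf s^*_{\rm op}=(s_N^*,\dots,s_1^*)$ and let $\iota^*:\mathbb G_m^{I(\mathbf s)}\to\mathbb G_m^{I(\mathbf s^*_{\rm op})}$ be induced by the bijection $\iota:I(\mathbf s^*_{\rm op})\to I(\mathbf s)$, $(s^*,i)\mapsto(s,n^s(\mathbf s)-i)$. *Goncharov–Shen coordinates.* Let $\mathbf s$ be a reduced word of $w_0$. Let $\chi_s:U^+\to\mathbb A^1$ be the additive character with $\chi_s(x_t(a))=\delta_{st}a$ (the generalized minor $\Delta_{\varpi_s,r_s\varpi_s}$), and $W_s$ the $G$-invariant function with $W_s([U^+],B^-,u.B^-)=\chi_s(u)$ for $u\in U^+$. For a configuration take the unique chain of flags $B_2=B_2^0,\dots,B_2^N=B_3$ in which $(B_2^{k-1},B_2^k)$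 is in the $G$-orbit of $(B^+,\overline r_{s_k^*}.B^+)$, and suppose that all pairs $(B_1,B_2^k)$ are generic. Let $\widehat B_1,\widehat B_1'$ be the decorated flags over $B_1$ given by $p_{12}$, $p_{31}^*$. With $k(s,0)=0$, the coordinates are $$X_{\binom s0}=W_s(\widehat B_1,B_2,B_2^{k(s,1)}),\qquad X_{\binom si}=\frac{W_s(\widehat B_1,B_2^{k(s,i)},B_2^{k(s,i+1)})}{W_s(\widehat B_1,B_2^{k(s,i-1)},B_2^{k(s,i)})}\ \ (0<i<n^s(\mathbf s)),$$ $$X_{\binom s{n^s(\mathbf s)}}=W_s(\widehat B_1',B_2^{k(s,n^s(\mathbf s)-1)},B_2^{k(s,n^s(\mathbf s))})^{-1},\qquad X_{\binom s{-\infty}}=\frac{\Lambda_{s_k}(\widetilde B_1,\widetilde B_2^{k})}{\Lambda_{s_k}(\widetilde B_1,\widetilde B_2^{k-1})},$$ where $k$ is determined by $r_{s_N}\cdots r_{s_{k+1}}(\alpha_{s_k}^\vee)=\alpha_s^\vee$, $\Lambda_t$ is the $\widetilde G$-invariant function on generic pairs of elements of $\widetilde G/U^+$ with $\Lambda_t(h.[U^+],\overline{w_0}.[U^+])=h^{\varpi_t}$,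 $\widetilde B_1$ is a lift of $\widehat B_1$ to $\widetilde G/U^+$, and $(\widetilde B_2^k)_k$ is a lift of $(B_2^k)_k$ to $\widetilde G/U^+$ such that $\widetilde B_2^0$ lifts the decorated flag of $p_{23}$ and $(\widetilde B_2^{k},\widetilde B_2^{k-1})$ is in the $\widetilde G$-orbit of $([U^+],\overline r_{s_k^*}.[U^+])$. **Theorem.** For every reduced word $\mathbf s$ of $w_0$, there is a unique injective map $\psi_{\mathbf s}:\mathbb G_m^{I_\infty(\mathbf s)}\to\mathrm{Conf}_3\mathcal P_G$ inverse to the coordinate system $(X_{\binom si})_{(s,i)\in I_\infty(\mathbf s)}$ (that is, a configuration lies in the domain of the coordinates and has coordinates $\mathbf X\in\mathbb G_m^{I_\infty(\mathbf s)}$ if and only if it equals $\psi_{\mathbf s}(\mathbf X)$), and $$\psi_{\mathbf s}^*b_L=ev^+_{\mathbf s},\qquad \psi_{\mathbf s}^*b_R=ev^-_{\mathbf s^*_{\rm op}}\circ\iota^*,$$ where the right-hand sides are regarded as maps on $\mathbb G_m^{I_\infty(\mathbf s)}$ through the projection to $\mathbb G_m^{I(\mathbf s)}$. -/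

import Mathlib

open LieAlgebra LieAlgebra.IsKilling Module

noncomputable section

namespace Pinnings

open scoped Classical

/-! ### The simply connected group, its root subgroups and the Weyl group

`L` is a finite-dimensional semisimple complex Lie algebra with Cartan subalgebra `H`, and `V` is a
finite-dimensional `L`-module. Groups are identified with their groups of complex points. -/

section Groups

variable {L : Type*} [LieRing L] [LieAlgebra ℂ L] [FiniteDimensional ℂ L] [IsKilling ℂ L]
variable (H : LieSubalgebra ℂ L) [H.IsCartanSubalgebra]
variable (V : Type*) [AddCommGroup V] [Module ℂ V] [FiniteDimensional ℂ V]
  [LieRingModule L V] [LieModule ℂ L V]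

/-- Simple roots `α_s` (through `base`, the index set being `S = base.support`) together with
root vectors `e s`, `f s` of weights `α_s`, `-α_s` normalized by `⁅e s, f s⁆ = α_s^∨`: the choice
of a Borel subgroup containing the maximal torus and of the homomorphisms `x_s, y_s`. -/
structure Splitting where
  base : (rootSystem H).Base
  e : base.support → L
  f : base.support → L
  e_mem : ∀ s, e s ∈ rootSpace H (s.1.1 : H → ℂ)
  f_mem : ∀ s, f s ∈ rootSpace H (-(s.1.1 : H → ℂ))
  lie_e_f : ∀ s, ⁅e s, f s⁆ = (coroot s.1.1 : H)

/-- The weights of `V` generate the whole weight lattice (the linear forms on `H` that are integral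
on all coroots). Equivalently, the character lattice of the maximal torus of the algebraic group
generated by the root subgroups in `GL(V)` is the weight lattice, i.e. this group
is simply connected, with Lie algebra `L`. -/
def GeneratesWeightLattice : Prop :=
  ∀ μ : Dual ℂ H, (∀ α : H.root, ∃ n : ℤ, μ (coroot α.1) = n) →
    μ ∈ AddSubgroup.closure (Set.range (LieModule.Weight.toLinear ℂ H V))

variable {H}

/-- The element `exp x` of `GL(V)` for a root vector `x`. -/
def rootExp (χ : H → ℂ) (hχ : χ ≠ 0) (x : L) (hx : x ∈ rootSpace H χ) : (End ℂ V)ˣ :=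
  letI : Module ℚ (End ℂ V) := Module.compHom _ (algebraMap ℚ ℂ)
  have h : IsNilpotent (LieModule.toEnd ℂ L V x) :=
    LieModule.isNilpotent_toEnd_of_mem_rootSpace (M := V) H hχ hx
  { val := IsNilpotent.exp (LieModule.toEnd ℂ L V x)
    inv := IsNilpotent.exp (-LieModule.toEnd ℂ L V x)
    val_inv := IsNilpotent.exp_mul_exp_neg_self h
    inv_val := IsNilpotent.exp_neg_mul_exp_self h }

variable (H)

/-- The group `G̃`: the subgroup of `GL(V)` generated by all root subgroups. -/
def SCGroup : Subgroup (End ℂ V)ˣ :=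
  Subgroup.closure {g | ∃ (χ : H → ℂ) (hχ : χ ≠ 0) (x : L) (hx : x ∈ rootSpace H χ),
    g = rootExp V χ hχ x hx}

/-- The adjoint group `G = G̃ / Z(G̃)`. -/
abbrev AdjGroup : Type _ := SCGroup H V ⧸ Subgroup.center (SCGroup H V)

/-- The projection `G̃ → G`. -/
def proj : SCGroup H V →* AdjGroup H V := QuotientGroup.mk' _

variable {H}

set_option linter.unusedSectionVars false in
theorem root_ne_zero (α : H.root) : (α.1 : H → ℂ) ≠ 0 := by
  have h := α.2
  simp only [LieSubalgebra.root, Finset.mem_filter] at h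
  exact fun h0 => h.2 h0

namespace Splitting

variable (D : Splitting H)

/-- The index set of the simple roots. -/
abbrev S : Type _ := D.base.support

/-- The unipotent radical `U⁺` of the Borel subgroup of `G̃`, generated by the root
subgroups of all positive roots. -/
def scU : Subgroup (SCGroup H V) :=
  Subgroup.closure {g | ∃ (α : H.root) (_ : D.base.IsPos α) (x : L)
    (hx : x ∈ rootSpace H (α.1 : H → ℂ)), (g : (End ℂ V)ˣ) = rootExp V _ (root_ne_zero α) x hx}

/-- `x_s(a) = exp (a e_s)` in `G̃`. -/
def scx (s : D.S) (a : ℂ) : SCGroup H V :=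
  ⟨rootExp V _ (root_ne_zero s.1) (a • D.e s) (Submodule.smul_mem _ a (D.e_mem s)),
    Subgroup.subset_closure ⟨_, _, _, _, rfl⟩⟩

/-- `y_s(a) = exp (a f_s)` in `G̃`. -/
def scy (s : D.S) (a : ℂ) : SCGroup H V :=
  ⟨rootExp V _ (neg_ne_zero.mpr (root_ne_zero s.1)) (a • D.f s)
      (Submodule.smul_mem _ a (D.f_mem s)),
    Subgroup.subset_closure ⟨_, _, _, _, rfl⟩⟩

/-- `α_s^∨(a) = φ_s(diag(a, a⁻¹))`, where `φ_s : SL₂ → G̃`, using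
`diag(a, a⁻¹) = x(a) y(-a⁻¹) x(a) (x(1) y(-1) x(1))⁻¹` in `SL₂`. -/
def scCoroot (s : D.S) (a : ℂˣ) : SCGroup H V :=
  D.scx V s a * D.scy V s (-(a⁻¹ : ℂˣ)) * D.scx V s a *
    (D.scx V s 1 * D.scy V s (-1) * D.scx V s 1)⁻¹

/-- The maximal torus `H̃` of `G̃`: its cocharacter lattice is spanned by the simple coroots. -/
def scT : Subgroup (SCGroup H V) :=
  Subgroup.closure {g | ∃ (s : D.S) (a : ℂˣ), g = D.scCoroot V s a}

/-- `r̄_s = φ_s((0, -1; 1, 0))`, using `(0, -1; 1, 0) = x(-1) y(1) x(-1)` in `SL₂`. -/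
def scr (s : D.S) : SCGroup H V := D.scx V s (-1) * D.scy V s 1 * D.scx V s (-1)

/-- The product of simple reflections along a word, acting on the dual of the Cartan subalgebra. -/
def weylWord (l : List D.S) : Dual ℂ H ≃ₗ[ℂ] Dual ℂ H :=
  (l.map fun s => (rootSystem H).reflection s.1).prod

/-- A word in the simple reflections is reduced if no shorter word has the same product. -/
def IsReduced (l : List D.S) : Prop :=
  ∀ m : List D.S, D.weylWord m = D.weylWord l → l.length ≤ m.length

/-- `l` is a reduced word of the longest element `w₀` of the Weyl group. -/
def IsLongestWord (l : List D.S) : Prop :=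
  D.IsReduced l ∧ ∀ m : List D.S, D.IsReduced m → m.length ≤ l.length

/-- A fixed reduced word of `w₀`. -/
def w0Word : List D.S := Classical.epsilon D.IsLongestWord

/-- The lift `w̄₀` of `w₀` to `G̃`; it does not depend on the reduced word of `w₀`. -/
def scw0 : SCGroup H V := (D.w0Word.map (D.scr V)).prod

/-- The involution `s ↦ s*` of `S` given by `α_{s*} = -w₀ α_s`. -/
def star (s : D.S) : D.S :=
  @Classical.epsilon D.S ⟨s⟩ fun t =>
    (rootSystem H).root t.1 = -D.weylWord D.w0Word ((rootSystem H).root s.1)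

/-- The character `h ↦ h^{ϖ_s}` of `H̃` (the fundamental weight `ϖ_s`),
with `α_t^∨(a)^{ϖ_s} = a^{δ_{st}}`. -/
def fundWeight (s : D.S) : D.scT V →* ℂˣ :=
  Classical.epsilon fun χ : D.scT V →* ℂˣ => ∀ (t : D.S) (a : ℂˣ),
    χ ⟨D.scCoroot V t a, Subgroup.subset_closure ⟨t, a, rfl⟩⟩ = if s = t then a else 1

/-! ### The adjoint group -/

/-- `x_s(a)` in `G`. -/
def x (s : D.S) (a : ℂ) : AdjGroup H V := proj H V (D.scx V s a)

/-- `y_s(a)` in `G`. -/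
def y (s : D.S) (a : ℂ) : AdjGroup H V := proj H V (D.scy V s a)

/-- `r̄_s` in `G`. -/
def r (s : D.S) : AdjGroup H V := proj H V (D.scr V s)

/-- `w̄₀` in `G`. -/
def w0 : AdjGroup H V := proj H V (D.scw0 V)

/-- The Cartan subgroup of `G`. -/
def T : Subgroup (AdjGroup H V) := (D.scT V).map (proj H V)

/-- The subgroup `U⁺` of `G`. -/
def U : Subgroup (AdjGroup H V) := (D.scU V).map (proj H V)

/-- The Borel subgroup `B⁺` of `G`. -/
def B : Subgroup (AdjGroup H V) := D.T V ⊔ D.U V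

/-- `𝔼^s = x_s(1)`. -/
def E (s : D.S) : AdjGroup H V := D.x V s 1

/-- `𝔽^s = y_s(1)`. -/
def F (s : D.S) : AdjGroup H V := D.y V s 1

/-- `H^s(a) = ϖ_s^∨(a)`: the element `h` of the Cartan subgroup of `G` with
`h^{α_t} = a^{δ_{st}}` for all `t`. -/
def coweight (s : D.S) (a : ℂˣ) : AdjGroup H V :=
  Classical.epsilon fun h : AdjGroup H V => h ∈ D.T V ∧ ∀ (t : D.S) (b : ℂ),
    h * D.x V t b * h⁻¹ = D.x V t ((if s = t then (a : ℂ) else 1) * b)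

theorem simple_isPos (s : D.S) : D.base.IsPos s.1 := by
  rw [RootPairing.Base.isPos_iff, D.base.height_one_of_mem_support s.2]
  norm_num

theorem x_mem_U (s : D.S) (a : ℂ) : D.x V s a ∈ D.U V :=
  Subgroup.mem_map_of_mem _ (Subgroup.subset_closure
    ⟨s.1, D.simple_isPos s, a • D.e s, Submodule.smul_mem _ a (D.e_mem s), rfl⟩)

/-- The additive character `χ_s` of `U⁺`, with `χ_s(x_t(a)) = δ_{st} a`. On `U⁺` it
is the generalized minor `Δ_{ϖ_s, r_s ϖ_s}`. -/
def chi (s : D.S) : D.U V → ℂ :=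
  Classical.epsilon fun χ : D.U V → ℂ => (∀ u v, χ (u * v) = χ u + χ v) ∧
    ∀ (t : D.S) (a : ℂ), χ ⟨D.x V t a, D.x_mem_U V t a⟩ = if s = t then a else 0

/-! ### Flags, decorated flags and pinnings -/

/-- Decorated flags for `G̃`. -/
abbrev SCDecFlag : Type _ := SCGroup H V ⧸ D.scU V

/-- Decorated flags (the principal affine space of `G`). -/
abbrev DecFlag : Type _ := AdjGroup H V ⧸ D.U V

/-- Flags. The coset `g B⁺` stands for the Borel subgroup `g B⁺ g⁻¹`. -/
abbrev Flag : Type _ := AdjGroup H V ⧸ D.B V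

theorem U_le_B : D.U V ≤ D.B V := le_sup_right

variable {V}

/-- The flag underlying a decorated flag. -/
def toFlag : D.DecFlag V → D.Flag V := Subgroup.quotientMapOfLE (D.U_le_B V)

theorem toFlag_smul (g : AdjGroup H V) (A : D.DecFlag V) :
    D.toFlag (g • A) = g • D.toFlag A := by
  obtain ⟨a, rfl⟩ := QuotientGroup.mk_surjective A
  rfl

/-- `Ã` is a lift to `G̃ / U⁺` of the decorated flag `A`. -/
def Lifts (A' : D.SCDecFlag V) (A : D.DecFlag V) : Prop :=
  ∃ g : SCGroup H V, A' = (g : D.SCDecFlag V) ∧ A = (proj H V g : D.DecFlag V)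

variable (V)

/-- The base point `[U⁺]` for `G̃`. -/
def scBase : D.SCDecFlag V := ((1 : SCGroup H V) : D.SCDecFlag V)

/-- The base point `[U⁺]` for `G`. -/
def decBase : D.DecFlag V := ((1 : AdjGroup H V) : D.DecFlag V)

/-- The flag `B⁺`. -/
def flagPlus : D.Flag V := ((1 : AdjGroup H V) : D.Flag V)

/-- The flag `B⁻ = w̄₀ B⁺ w̄₀⁻¹`. -/
def flagMinus : D.Flag V := D.w0 V • D.flagPlus V

variable {V}

/-- A pair of flags is generic if it is a translate of `(B⁺, B⁻)`. -/
def Generic (B₁ B₂ : D.Flag V) : Prop :=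
  ∃ g : AdjGroup H V, g • B₁ = D.flagPlus V ∧ g • B₂ = D.flagMinus V

/-- The pair `(B₁, B₂)` of flags has `w`-distance `r_t`. -/
def HasDist (t : D.S) (B₁ B₂ : D.Flag V) : Prop :=
  ∃ g : AdjGroup H V, B₁ = g • D.flagPlus V ∧ B₂ = g • D.r V t • D.flagPlus V

/-- The pair `(A₁, A₂)` of decorated flags for `G̃` has `w`-distance `r_t` and `h`-invariant `1`. -/
def HasUnitDist (t : D.S) (A₁ A₂ : D.SCDecFlag V) : Prop :=
  ∃ g : SCGroup H V, A₁ = g • D.scBase V ∧ A₂ = g • D.scr V t • D.scBase V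

/-- `Λ_s`, on generic pairs: the `G̃`-invariant function with `Λ_s(h.[U⁺], w̄₀.[U⁺]) = h^{ϖ_s}`. -/
def Lam (s : D.S) (A₁ A₂ : D.SCDecFlag V) : ℂˣ :=
  Classical.epsilon fun z : ℂˣ => ∃ (g : SCGroup H V) (h : D.scT V),
    A₁ = g • (h : SCGroup H V) • D.scBase V ∧ A₂ = g • D.scw0 V • D.scBase V ∧
      z = D.fundWeight V s h

/-- The Goncharov--Shen potential: the `G`-invariant function with
`W_s([U⁺], B⁻, u.B⁻) = χ_s(u)` for `u ∈ U⁺`. -/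
def W (s : D.S) (A : D.DecFlag V) (B₂ B₃ : D.Flag V) : ℂ :=
  Classical.epsilon fun z : ℂ => ∃ (g : AdjGroup H V) (u : D.U V),
    g • A = D.decBase V ∧ g • B₂ = D.flagMinus V ∧
      g • B₃ = (u : AdjGroup H V) • D.flagMinus V ∧ z = D.chi V s u

variable (V)

/-- A pinning: a decorated flag and a flag whose underlying pair of flags is generic. -/
@[ext]
structure Pinning where
  dec : D.DecFlag V
  flag : D.Flag V
  generic : D.Generic (D.toFlag dec) flag

variable {D V}

/-- The flag `π₊(p)`. -/
def Pinning.fst (p : D.Pinning V) : D.Flag V := D.toFlag p.dec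

/-- The flag `π₋(p)`. -/
def Pinning.snd (p : D.Pinning V) : D.Flag V := p.flag

theorem Generic.smul (g : AdjGroup H V) {B₁ B₂ : D.Flag V} (h : D.Generic B₁ B₂) :
    D.Generic (g • B₁) (g • B₂) := by
  obtain ⟨k, h₁, h₂⟩ := h
  exact ⟨k * g⁻¹, by rw [mul_smul, inv_smul_smul, h₁], by rw [mul_smul, inv_smul_smul, h₂]⟩

instance : MulAction (AdjGroup H V) (D.Pinning V) where
  smul g p := ⟨g • p.dec, g • p.flag, by rw [D.toFlag_smul]; exact p.generic.smul g⟩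
  one_smul p := Pinning.ext (one_smul _ p.dec) (one_smul _ p.flag)
  mul_smul g k p := Pinning.ext (mul_smul g k p.dec) (mul_smul g k p.flag)

theorem Pinning.fst_smul (g : AdjGroup H V) (p : D.Pinning V) : (g • p).fst = g • p.fst :=
  D.toFlag_smul g p.dec

theorem Pinning.snd_smul (g : AdjGroup H V) (p : D.Pinning V) : (g • p).snd = g • p.snd := rfl

variable (D V)

/-- The standard pinning `p_std = ([U⁺], B⁻)`. -/
def pstd : D.Pinning V where
  dec := D.decBase V
  flag := D.flagMinus V
  generic := ⟨1, one_smul _ _, one_smul _ _⟩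

variable {D V}

/-- The element `g` of `G` with `p = g.p_std`. -/
def Pinning.elt (p : D.Pinning V) : AdjGroup H V :=
  Classical.epsilon fun g : AdjGroup H V => p = g • D.pstd V

/-- The opposite pinning: `(g.p_std)* = g w̄₀.p_std`. -/
def Pinning.opp (p : D.Pinning V) : D.Pinning V := (p.elt * D.w0 V) • D.pstd V

variable (D V)

/-- Three flags `B₁, B₂, B₃` with pinnings `p₁₂, p₂₃, p₃₁` over the consecutive pairs of them.
The flags are recorded by the pinnings. -/
@[ext]
structure Triangle where
  p12 : D.Pinning V
  p23 : D.Pinning V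
  p31 : D.Pinning V
  h1 : p31.snd = p12.fst
  h2 : p12.snd = p23.fst
  h3 : p23.snd = p31.fst

instance : MulAction (AdjGroup H V) (D.Triangle V) where
  smul g t := ⟨g • t.p12, g • t.p23, g • t.p31,
    by rw [Pinning.fst_smul, Pinning.snd_smul, t.h1],
    by rw [Pinning.fst_smul, Pinning.snd_smul, t.h2],
    by rw [Pinning.fst_smul, Pinning.snd_smul, t.h3]⟩
  one_smul t := Triangle.ext (one_smul _ t.p12) (one_smul _ t.p23) (one_smul _ t.p31)
  mul_smul g k t :=
    Triangle.ext (mul_smul g k t.p12) (mul_smul g k t.p23) (mul_smul g k t.p31)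

/-- The configuration space of triangles of pinnings: the set of `G`-orbits. -/
abbrev Conf3 : Type _ := MulAction.orbitRel.Quotient (AdjGroup H V) (D.Triangle V)

variable {D V}

/-- The configuration of a triangle. -/
def Triangle.conf (t : D.Triangle V) : D.Conf3 V :=
  Quotient.mk (MulAction.orbitRel (AdjGroup H V) (D.Triangle V)) t

variable (D V)

/-- The basic Wilson line `b_L`: if the representative is normalized by `p₁₂ = p_std`,
then `p₃₁ = (b_L.p_std)*`. -/
def bL (C : D.Conf3 V) : AdjGroup H V :=
  Classical.epsilon fun b : AdjGroup H V => ∃ t : D.Triangle V, t.conf = C ∧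
    t.p12 = D.pstd V ∧ t.p31 = (b • D.pstd V).opp

/-- The basic Wilson line `b_R`: if the representative is normalized by `p₃₁ = p_std`,
then `p₁₂ = (b_R.p_std)*`. -/
def bR (C : D.Conf3 V) : AdjGroup H V :=
  Classical.epsilon fun b : AdjGroup H V => ∃ t : D.Triangle V, t.conf = C ∧
    t.p31 = D.pstd V ∧ t.p12 = (b • D.pstd V).opp

/-! ### Index sets and evaluation maps -/

variable {D}

/-- The index set `I(l)` of pairs `(s, i)` with `0 ≤ i ≤ n^s(l)`. -/
abbrev Idx (l : List D.S) : Type _ := Σ s : D.S, Fin (l.count s + 1)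

/-- The index set `I_∞(l)`: the pairs of `I(l)` and the pairs `(s, -∞)`, with `⊥` for `-∞`. -/
abbrev IdxInf (l : List D.S) : Type _ := Σ s : D.S, WithBot (Fin (l.count s + 1))

/-- The restriction of coordinates along the inclusion of `I(l)` in `I_∞(l)`. -/
def restr (l : List D.S) (X : IdxInf l → ℂˣ) : Idx l → ℂˣ :=
  fun p => X ⟨p.1, (p.2 : WithBot _)⟩

/-- The index `(s, i)` carried by the letter at position `k`: this letter is `s`, and it is the
`i`-th occurrence of `s` in `l`. -/
def letterIdx (l : List D.S) (k : Fin l.length) : Idx l :=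
  ⟨l[k], ⟨(l.take (k + 1)).count l[k],
    Nat.lt_succ_of_le ((List.take_sublist (k + 1) l).count_le _)⟩⟩

/-- The number `k(s, i)` of the position of the `i`-th occurrence of `s` in `l`, where positions
are numbered from `1`; also `k(s, 0) = 0`. -/
def pos (l : List D.S) (s : D.S) (i : ℕ) : ℕ := sInf {k | (l.take k).count s = i}

/-- The common form of the evaluation maps:
`∏_s H^s(x^s_0)` (commuting factors) times the ordered product of the `M^{s_k} H^{s_k}(x_k)`. -/
def evMap (M : D.S → AdjGroup H V) (l : List D.S) (X : Idx l → ℂˣ) : AdjGroup H V :=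
  (Finset.univ.toList.map fun s : D.S => D.coweight V s (X ⟨s, 0⟩)).prod *
    (List.ofFn fun k : Fin l.length =>
      M l[k] * D.coweight V l[k] (X (letterIdx l k))).prod

/-- The evaluation map `ev⁺`. -/
def evPlus (l : List D.S) (X : Idx l → ℂˣ) : AdjGroup H V := evMap V (D.E V) l X

/-- The evaluation map `ev⁻`. -/
def evMinus (l : List D.S) (X : Idx l → ℂˣ) : AdjGroup H V := evMap V (D.F V) l X

/-- The word `l*_op = (s_N*, …, s_1*)` for `l = (s_1, …, s_N)`. -/
def starOp (l : List D.S) : List D.S := (l.map D.star).reverse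

/-- The bijection `ι : I(l*_op) → I(l)`, `(s*, i) ↦ (s, n^s(l) - i)`. -/
def iota (l : List D.S) (p : Idx (starOp l)) : Idx l :=
  ⟨D.star p.1, ⟨l.count (D.star p.1) - p.2, Nat.lt_succ_of_le (Nat.sub_le _ _)⟩⟩

/-- The isomorphism of tori `ι*` induced by `ι`. -/
def iotaPull (l : List D.S) (X : Idx l → ℂˣ) : Idx (starOp l) → ℂˣ := fun p => X (iota l p)

/-! ### Goncharov--Shen coordinates -/

/-- The coroot `r_{s_N} ⋯ r_{s_{k+1}} (α_{s_k}^∨)`, where `s_k` is the letter at position `k`. -/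
def beta (l : List D.S) (k : Fin l.length) : H :=
  ((l.drop (k + 1)).reverse.map fun s => (rootSystem H).coreflection s.1).prod (coroot l[k].1.1)

variable {V}

/-- A chain of flags `B₂ = B₂^0, …, B₂^N = B₃` of type `(s_1*, …, s_N*)`, all of whose members
are generic with respect to `B₁`. -/
structure IsChain (l : List D.S) (t : D.Triangle V) (Φ : ℕ → D.Flag V) : Prop where
  left : Φ 0 = t.p23.fst
  right : Φ l.length = t.p31.fst
  dist : ∀ k : Fin l.length, D.HasDist (D.star l[k]) (Φ k) (Φ (k + 1))
  generic : ∀ k ≤ l.length, D.Generic t.p12.fst (Φ k)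

/-- A lift of the chain `Φ` to decorated flags for `G̃` which starts with a lift of the decorated
flag at `B₂` given by `p₂₃`, with `h(B̃₂^k, B̃₂^{k-1}) = 1`. -/
structure IsChainLift (l : List D.S) (t : D.Triangle V) (Φ : ℕ → D.Flag V)
    (Ψ : ℕ → D.SCDecFlag V) : Prop where
  left : D.Lifts (Ψ 0) t.p23.dec
  lift : ∀ k ≤ l.length, ∃ A : D.DecFlag V, D.Lifts (Ψ k) A ∧ D.toFlag A = Φ k
  dist : ∀ k : Fin l.length, D.HasUnitDist (D.star l[k]) (Ψ (k + 1)) (Ψ k)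

/-- The configuration `C` lies in the domain of the Goncharov--Shen coordinates
associated with `l`, and `X` is the family of its coordinates. -/
def IsGSCoord (l : List D.S) (C : D.Conf3 V) (X : IdxInf l → ℂˣ) : Prop :=
  ∃ (t : D.Triangle V) (Φ : ℕ → D.Flag V) (Ψ : ℕ → D.SCDecFlag V) (A : D.SCDecFlag V),
    t.conf = C ∧ IsChain l t Φ ∧ IsChainLift l t Φ Ψ ∧ D.Lifts A t.p12.dec ∧
    ∀ s : D.S,
      (∀ i : Fin (l.count s + 1),
        ((i : ℕ) = 0 →
          (X ⟨s, i⟩ : ℂ) = D.W s t.p12.dec (Φ 0) (Φ (pos l s 1))) ∧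
        (0 < (i : ℕ) → (i : ℕ) < l.count s →
          (X ⟨s, i⟩ : ℂ) = D.W s t.p12.dec (Φ (pos l s i)) (Φ (pos l s (i + 1))) /
            D.W s t.p12.dec (Φ (pos l s (i - 1))) (Φ (pos l s i))) ∧
        ((i : ℕ) = l.count s →
          (X ⟨s, i⟩ : ℂ) =
            (D.W s t.p31.opp.dec (Φ (pos l s (i - 1))) (Φ (pos l s i)))⁻¹)) ∧
      ∃ k : Fin l.length, beta l k = coroot s.1.1 ∧
        X ⟨s, ⊥⟩ = D.Lam l[k] A (Ψ (k + 1)) / D.Lam l[k] A (Ψ k)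

/-- `ψ` is the coordinate chart of Goncharov--Shen: the embedding of the torus
that is inverse to the family of coordinates. -/
def IsGSChart (l : List D.S) (ψ : (IdxInf l → ℂˣ) → D.Conf3 V) : Prop :=
  Function.Injective ψ ∧ ∀ C X, IsGSCoord l C X ↔ ψ X = C

end Splitting

end Groups

end Pinnings

end

/-! Normalize a triangle by `p₁₂ = p_std`. A flag at simple distance `s*` from `u.B⁻` that is again
generic to `B⁺` has the form `u x_s(a).B⁻` with `a ≠ 0` (`hasDist_and_generic_iff`). Hence the chain
from `B₂` to `B₃` is `B₂^k = x_{s_1}(a_1) ⋯ x_{s_k}(a_k).B⁻`. With `u` the full product of these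
factors, the two remaining pinnings add one element of the Cartan subgroup each: `z`, with `p₃₁ = u
z w̄₀.p_std`, and `d`, the torus part of the decoration of `p₂₃`. So a configuration in the domain
of the coordinates is given by parameters `(a, z, d)` (`isGSCoord_iff`).

The potential `W_s` is additive along the chain. Between consecutive occurrences of `s` exactly one
factor `x_s(a_k)` is met, so the potential there is `a_k`; for the decoration of `p₃₁*` it is `a_k /
z_s`. The ratios that define the coordinates therefore telescope: `X_0 ⋯ X_i` is the parameter of
occurrence `i + 1` of `s`, and the product over all `i` is `z_s` (`pp_eq_iff`, `coordFormulas_iff`).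
At the position `k` with `β_k = α_s^∨`, the prefix of the word before `k` carries `α_{s_k}` to
`α_{s*}`. Hence `X_{s,-∞}` equals `d_{s*}` times a quantity that depends on `a` only (`Lam_chain`).
This change of parameters is invertible. Every choice of parameters comes from a triangle because
`w̄₀ u w̄₀⁻¹` lies in the big Bruhat cell (`exists_triangle`), and the parameters are recovered from
the configuration because the factors of `u` are unique (`xprod_injective`). This gives the chart
(`exists_chart`).

In these terms `b_L = u z`. In `ev⁺`, moving all factors `H^s` to the right replaces `𝔼^{s_k}` by
`x_{s_k}` of a partial product, which is `a_k`, and leaves `z` at the end (`evMap_eq`); so `ev⁺ = u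
z`. Likewise `b_R = w̄₀ b_L⁻¹ w̄₀`: inversion reverses the word and conjugation by `w̄₀` turns `x_s`
into `y_{s*}`, which produces `ev⁻` on the opposite word with reversed indices
(`CoordRel.evMinus_eq`).

The structure theory of the group generated by exponentials in `GL(V)` is developed along the way.
Laurent polynomial identities in `SL₂` show that coroots act on `V` by integral weights. Conjugation
by a regular dominant cocharacter makes elements of `U⁺` polynomial in `a^N`, and elements of `U⁻`
polynomial in `a^{-N}`, with constant term `1`. This replaces algebraic geometry in the uniqueness
of the Gauss decomposition (`Up.eq_of_eq_mul`) and in the construction of the characters `χ_s`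
(`chi_spec`). Bruhat cells and the exchange condition identify the big cell (`Cell.wordRefl_eq`) and
place the centre in the torus (`center_le`). Braid relations and Matsumoto's theorem make `w̄₀`
independent of the word (`scrw_eq_of_wordRefl_eq`) and fix the signs in its action on the Chevalley
generators (`cj_scw0`). -/

noncomputable section

namespace Pinnings

open scoped Classical

/-! ### Exponentials of nilpotent elements -/

section NilpotentExp

variable {A : Type*} [Ring A] [Algebra ℂ A]

/-- The exponential of a nilpotent element of a complex algebra. -/
def nexp (x : A) : A :=
  letI : Module ℚ A := Module.compHom _ (algebraMap ℚ ℂ)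
  IsNilpotent.exp x

theorem nexp_eq_sum {x : A} {n : ℕ} (h : x ^ n = 0) :
    nexp x = ∑ i ∈ Finset.range n, ((i.factorial : ℂ)⁻¹) • x ^ i := by
  let _ : Module ℚ A := Module.compHom _ (algebraMap ℚ ℂ)
  rw [nexp, IsNilpotent.exp_eq_sum h]
  refine Finset.sum_congr rfl fun i _ => ?_
  -- The rational scalars act on `A` through `ℂ`, so the coefficient `1 / i!` can be read in `ℂ`.
  change (algebraMap ℚ ℂ ((i.factorial : ℚ)⁻¹)) • x ^ i = _
  simp

theorem nexp_add_of_commute {x y : A} (h : Commute x y) (hx : IsNilpotent x)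
    (hy : IsNilpotent y) : nexp (x + y) = nexp x * nexp y :=
  let _ : Module ℚ A := Module.compHom _ (algebraMap ℚ ℂ)
  IsNilpotent.exp_add_of_commute h hx hy

@[simp]
theorem nexp_zero : nexp (0 : A) = 1 :=
  let _ : Module ℚ A := Module.compHom _ (algebraMap ℚ ℂ)
  IsNilpotent.exp_zero

theorem nexp_mul_nexp_neg {x : A} (h : IsNilpotent x) : nexp x * nexp (-x) = 1 :=
  let _ : Module ℚ A := Module.compHom _ (algebraMap ℚ ℂ)
  IsNilpotent.exp_mul_exp_neg_self h

theorem nexp_neg_mul_nexp {x : A} (h : IsNilpotent x) : nexp (-x) * nexp x = 1 :=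
  let _ : Module ℚ A := Module.compHom _ (algebraMap ℚ ℂ)
  IsNilpotent.exp_neg_mul_exp_self h

theorem nexp_smul_add {x : A} (h : IsNilpotent x) (a b : ℂ) :
    nexp ((a + b) • x) = nexp (a • x) * nexp (b • x) := by
  rw [add_smul]
  exact nexp_add_of_commute (((Commute.refl x).smul_left a).smul_right b) (h.smul a) (h.smul b)

theorem map_nexp {B : Type*} [Ring B] [Algebra ℂ B] (f : A →ₐ[ℂ] B) {x : A} (h : IsNilpotent x) :
    f (nexp x) = nexp (f x) := by
  obtain ⟨n, hn⟩ := h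
  rw [nexp_eq_sum hn, nexp_eq_sum (n := n) (by rw [← map_pow, hn, map_zero]), map_sum]
  simp

/-- Right multiplication reverses products, so `map_nexp` does not apply; powers of a single element
are not affected by the reversal. -/
theorem nexp_mulRight {x : A} (h : IsNilpotent x) :
    nexp (LinearMap.mulRight ℂ x : End ℂ A) = LinearMap.mulRight ℂ (nexp x) := by
  obtain ⟨n, hn⟩ := h
  have hp : ∀ k, (LinearMap.mulRight ℂ x : End ℂ A) ^ k = LinearMap.mulRight ℂ (x ^ k) :=
    LinearMap.pow_mulRight ℂ A x
  rw [nexp_eq_sum hn, nexp_eq_sum (n := n) (by rw [hp, hn]; ext; simp)]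
  ext y
  simp [hp, Finset.mul_sum]

variable (A) in
/-- The commutator with `x`. -/
def comm (x : A) : A →ₗ[ℂ] A := LinearMap.mulLeft ℂ x - LinearMap.mulRight ℂ x

theorem comm_apply (x y : A) : comm A x y = x * y - y * x := rfl

/-- `exp x * y * exp (-x) = exp (ad x) y`. -/
theorem nexp_mul_mul_nexp_neg {x : A} (h : IsNilpotent x) :
    ∃ N, ∀ n ≥ N, ∀ y, nexp x * y * nexp (-x) =
      ∑ i ∈ Finset.range n, ((i.factorial : ℂ)⁻¹) • ((comm A x : End ℂ A) ^ i) y := by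
  have hl : IsNilpotent (LinearMap.mulLeft ℂ x : End ℂ A) :=
    (LinearMap.isNilpotent_mulLeft_iff ℂ x).mpr h
  have hr : IsNilpotent (LinearMap.mulRight ℂ (-x) : End ℂ A) :=
    (LinearMap.isNilpotent_mulRight_iff ℂ (-x)).mpr h.neg
  have hc : Commute (LinearMap.mulLeft ℂ x : End ℂ A) (LinearMap.mulRight ℂ (-x)) :=
    LinearMap.commute_mulLeft_right x (-x)
  have e0 : (comm A x : End ℂ A) = LinearMap.mulLeft ℂ x + LinearMap.mulRight ℂ (-x) := by
    ext y; simp [comm_apply, sub_eq_add_neg]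
  obtain ⟨N, hN⟩ : IsNilpotent (comm A x : End ℂ A) := e0 ▸ hc.isNilpotent_add hl hr
  refine ⟨N, fun n hn y => ?_⟩
  have h2 : nexp (LinearMap.mulLeft ℂ x : End ℂ A) = LinearMap.mulLeft ℂ (nexp x) :=
    (map_nexp (Algebra.lmul ℂ A) h).symm
  -- Left and right multiplication commute, so `exp (ad x)` is the product of their exponentials.
  -- The order of nilpotency of `ad x` bounds the sum uniformly in `y`.
  have h3 := nexp_eq_sum (x := (comm A x : End ℂ A)) (n := n) (pow_eq_zero_of_le hn hN)
  rw [e0, nexp_add_of_commute hc hl hr, h2, nexp_mulRight h.neg, ← e0] at h3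
  have := LinearMap.congr_fun h3 y
  simpa [mul_assoc] using this

/-- The case of `exp (ad x) y` with `(ad x)³ y = 0`. -/
theorem nexp_mul_eq {x y z w : A} (h : IsNilpotent x) (hz : x * y - y * x = z)
    (hw : x * z - z * x = (2 : ℂ) • w) (hw' : x * w = w * x) :
    nexp x * y = (y + z + w) * nexp x := by
  obtain ⟨N, hN⟩ := nexp_mul_mul_nexp_neg h
  have key := hN (N + 3) (by omega) y
  have h1 : ((comm A x : End ℂ A) ^ 1) y = z := by simp [comm_apply, hz]
  have h2 : ((comm A x : End ℂ A) ^ 2) y = (2 : ℂ) • w := by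
    simp [pow_two, comm_apply, hz, hw]
  have h3 : ∀ i, ((comm A x : End ℂ A) ^ (i + 3)) y = 0 := by
    intro i
    rw [pow_add, Module.End.mul_apply, pow_succ', Module.End.mul_apply, h2]
    simp [comm_apply, hw']
  -- Only the terms of degree 0, 1 and 2 survive; the factor `2` in `hw` cancels `1 / 2!`.
  rw [Finset.sum_range_succ', Finset.sum_range_succ', Finset.sum_range_succ',
    Finset.sum_eq_zero (fun i _ => by rw [h3, smul_zero])] at key
  simp only [zero_add, h1, h2, pow_zero, Module.End.one_apply, Nat.factorial] at key
  have h4 : nexp x * y * nexp (-x) = y + z + w := by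
    rw [key, smul_smul]
    norm_num
    abel
  rw [← h4, mul_assoc _ (nexp (-x)), nexp_neg_mul_nexp h, mul_one]

end NilpotentExp

/-! ### Independence of integral powers -/

section Laurent

variable {A : Type*} [AddCommGroup A] [Module ℂ A]

/-- Distinct integral powers of a variable in `ℂˣ` are linearly independent. -/
theorem eq_zero_of_sum_zpow_smul (s : Finset ℤ) (c : ℤ → A)
    (h : ∀ a : ℂˣ, ∑ k ∈ s, ((a ^ k : ℂˣ) : ℂ) • c k = 0) : ∀ k ∈ s, c k = 0 := by
  let χ : ℤ → (ℂˣ →* ℂ) := fun k => (Units.coeHom ℂ).comp (zpowGroupHom k)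
  have hχ : Function.Injective χ := by
    intro k l hkl
    -- The characters `a ↦ a ^ k` are already separated by their values at `2`.
    have h2 := DFunLike.congr_fun hkl (Units.mk0 2 two_ne_zero)
    simp only [χ, MonoidHom.comp_apply, zpowGroupHom_apply, Units.coeHom_apply,
      Units.val_zpow_eq_zpow_val, Units.val_mk0] at h2
    have h3 : ((2 : ℝ) ^ k) = (2 : ℝ) ^ l := by
      rw [show (2 : ℂ) = ((2 : ℝ) : ℂ) by norm_num, ← Complex.ofReal_zpow,
        ← Complex.ofReal_zpow] at h2
      exact_mod_cast h2
    exact zpow_right_injective₀ (by norm_num) (by norm_num) h3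
  -- Independence of characters settles scalar coefficients; linear forms on `A` reduce the general
  -- case to it.
  have hli := (linearIndependent_monoidHom ℂˣ ℂ).comp χ hχ
  intro k hk
  rw [← Module.forall_dual_apply_eq_zero_iff ℂ]
  intro φ
  refine linearIndependent_iff'.mp hli s (fun k => φ (c k)) ?_ k hk
  funext a
  have := congrArg φ (h a)
  rw [map_sum, map_zero] at this
  rw [Finset.sum_apply, Pi.zero_apply, ← this]
  refine Finset.sum_congr rfl fun i _ => ?_
  simp [χ, mul_comm]

end Laurent

/-! ### Laurent polynomial families and their Euler derivatives -/

section Laurent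

variable {A : Type*} [Ring A] [Algebra ℂ A]

/-- `F` is a Laurent polynomial function with Euler derivative `G = a dF/da`. -/
def HasEulerDeriv (F G : ℂˣ → A) : Prop :=
  ∃ (n : ℕ) (d : Fin n → ℤ) (c : Fin n → A), ∀ a : ℂˣ,
    F a = ∑ i, ((a ^ d i : ℂˣ) : ℂ) • c i ∧ G a = ∑ i, ((a ^ d i : ℂˣ) : ℂ) • (d i : ℂ) • c i

theorem HasEulerDeriv.of_fintype {ι : Type*} [Fintype ι] {F G : ℂˣ → A} (d : ι → ℤ) (c : ι → A)
    (h : ∀ a : ℂˣ, F a = ∑ i, ((a ^ d i : ℂˣ) : ℂ) • c i ∧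
      G a = ∑ i, ((a ^ d i : ℂˣ) : ℂ) • (d i : ℂ) • c i) : HasEulerDeriv F G := by
  let e := (Fintype.equivFin ι).symm
  refine ⟨Fintype.card ι, d ∘ e, c ∘ e, fun a => ?_⟩
  rw [(h a).1, (h a).2]
  exact ⟨(e.sum_comp fun i => ((a ^ d i : ℂˣ) : ℂ) • c i).symm,
    (e.sum_comp fun i => ((a ^ d i : ℂˣ) : ℂ) • (d i : ℂ) • c i).symm⟩

theorem HasEulerDeriv.mul {F G F' G' : ℂˣ → A} (h : HasEulerDeriv F G)
    (h' : HasEulerDeriv F' G') :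
    HasEulerDeriv (fun a => F a * F' a) (fun a => G a * F' a + F a * G' a) := by
  obtain ⟨n, d, c, hc⟩ := h
  obtain ⟨n', d', c', hc'⟩ := h'
  refine .of_fintype (ι := Fin n × Fin n') (fun p => d p.1 + d' p.2) (fun p => c p.1 * c' p.2)
    fun a => ⟨?_, ?_⟩
  · rw [(hc a).1, (hc' a).1, Finset.sum_mul_sum, Fintype.sum_prod_type]
    refine Finset.sum_congr rfl fun i _ => Finset.sum_congr rfl fun j _ => ?_
    rw [smul_mul_smul_comm, zpow_add, Units.val_mul]
  · rw [(hc a).1, (hc' a).1, (hc a).2, (hc' a).2, Finset.sum_mul_sum, Finset.sum_mul_sum,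
      Fintype.sum_prod_type, ← Finset.sum_add_distrib]
    refine Finset.sum_congr rfl fun i _ => ?_
    rw [← Finset.sum_add_distrib]
    refine Finset.sum_congr rfl fun j _ => ?_
    simp only [smul_mul_assoc, mul_smul_comm, smul_smul, ← add_smul, zpow_add, Units.val_mul,
      Int.cast_add]
    congr 1
    ring

/-- The chain rule for `exp (a^ε x)`; it is needed for `ε = ±1`. -/
theorem hasEulerDeriv_nexp {x : A} (hx : IsNilpotent x) (ε : ℤ) :
    HasEulerDeriv (fun a => nexp (((a ^ ε : ℂˣ) : ℂ) • x))
      (fun a => (((a ^ ε : ℂˣ) : ℂ) • (ε : ℂ) • x) * nexp (((a ^ ε : ℂˣ) : ℂ) • x)) := by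
  obtain ⟨n, hn⟩ := hx
  have hexp : ∀ z : ℂ, nexp (z • x) = ∑ i ∈ Finset.range (n + 1),
      z ^ i • ((i.factorial : ℂ)⁻¹) • x ^ i := by
    intro z
    rw [nexp_eq_sum (n := n + 1) (by rw [smul_pow, pow_succ x, hn]; simp)]
    refine Finset.sum_congr rfl fun i _ => ?_
    rw [smul_pow, smul_comm]
  refine .of_fintype (ι := Fin (n + 1)) (fun i => ε * i)
    (fun i => (((i : ℕ).factorial : ℂ)⁻¹) • x ^ (i : ℕ)) fun a => ⟨?_, ?_⟩
  · rw [hexp, Finset.sum_range]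
    refine Finset.sum_congr rfl fun i _ => ?_
    rw [zpow_mul, zpow_natCast, Units.val_pow_eq_pow_val]
  · rw [hexp]
    set z : ℂ := ((a ^ ε : ℂˣ) : ℂ) with hz
    have : ∀ i : ℕ, ((a ^ (ε * i) : ℂˣ) : ℂ) = z ^ i := by
      intro i; rw [zpow_mul, zpow_natCast, Units.val_pow_eq_pow_val]
    simp only [this]
    -- Left multiplication by `x` shifts the index by one. The unmatched terms vanish: the top one
    -- because `x ^ n = 0`, the one of degree zero because its exponent is `0`.
    rw [← Finset.sum_range (fun i => z ^ i • ((ε * i : ℤ) : ℂ) • ((i.factorial : ℂ)⁻¹) • x ^ i),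
      Finset.sum_range_succ, Finset.sum_range_succ', mul_add, Finset.mul_sum]
    congr 1
    · refine Finset.sum_congr rfl fun i _ => ?_
      simp only [← pow_succ', smul_smul, smul_mul_assoc, mul_smul_comm]
      congr 1
      rw [Nat.factorial_succ]
      push_cast
      have : (i.factorial : ℂ) ≠ 0 := by exact_mod_cast i.factorial_ne_zero
      field_simp
      ring
    · simp only [smul_mul_assoc, mul_smul_comm, ← pow_succ']
      rw [pow_succ, hn]
      simp

end Laurent

/-! ### The torus of `SL₂` acting in a representation -/

section SlTwo

variable {A : Type*} [Ring A] [Algebra ℂ A] {e f h : A}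

/-- The element `exp(a e) exp(-a⁻¹ f) exp(a e)`. -/
def weylElt (e f : A) (a : ℂˣ) : A :=
  nexp ((a : ℂ) • e) * nexp (((-a⁻¹ : ℂˣ) : ℂ) • f) * nexp ((a : ℂ) • e)

theorem nexp_e_mul_f (he : IsNilpotent e) (hef : e * f - f * e = h)
    (hhe : h * e - e * h = (2 : ℂ) • e) (a : ℂ) :
    nexp (a • e) * f = (f + a • h - (a ^ 2) • e) * nexp (a • e) := by
  have h1 : e * h - h * e = -((2 : ℂ) • e) := by rw [← hhe]; abel
  have := nexp_mul_eq (x := a • e) (y := f) (z := a • h) (w := -(a ^ 2 • e)) (he.smul a)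
    (by rw [← hef]; simp [smul_sub])
    (by rw [smul_mul_smul_comm, smul_mul_smul_comm, ← smul_sub, h1, ← pow_two]
        simp [smul_smul, mul_comm])
    (by simp [smul_smul, mul_comm])
  rw [this, sub_eq_add_neg]

theorem nexp_e_mul_h (he : IsNilpotent e) (hhe : h * e - e * h = (2 : ℂ) • e) (a : ℂ) :
    nexp (a • e) * h = (h - (2 * a) • e) * nexp (a • e) := by
  have h1 : e * h - h * e = -((2 : ℂ) • e) := by rw [← hhe]; abel
  have := nexp_mul_eq (x := a • e) (y := h) (z := -((2 * a) • e)) (w := 0) (he.smul a)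
    (by rw [smul_mul_assoc, mul_smul_comm, ← smul_sub, h1]; simp [smul_smul, mul_comm])
    (by simp [smul_smul, mul_comm])
    (by simp)
  rw [this, sub_eq_add_neg, add_zero]

theorem nexp_mul_self_comm {x : A} (a : ℂ) (hx : IsNilpotent x) :
    nexp (a • x) * x = x * nexp (a • x) := by
  have := nexp_mul_eq (x := a • x) (y := x) (z := 0) (w := 0) (hx.smul a)
    (by simp) (by simp) (by simp)
  simpa using this

/-- In `SL₂` this family is `α^∨(a)` times its value at `1`, so its logarithmic Euler derivative
must be `h`. Only the commutation relations are used: the three factors are differentiated and every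
generator is moved to the left. -/
theorem weylElt_hasEulerDeriv (he : IsNilpotent e) (hf : IsNilpotent f)
    (hef : e * f - f * e = h) (hhe : h * e - e * h = (2 : ℂ) • e)
    (hhf : h * f - f * h = -((2 : ℂ) • f)) :
    HasEulerDeriv (weylElt e f) (fun a => h * weylElt e f a) := by
  have h1 := hasEulerDeriv_nexp he 1
  have h2 := hasEulerDeriv_nexp hf.neg (-1)
  have h3 := (h1.mul h2).mul h1
  have e1 : ∀ a : ℂˣ, ((a ^ (1 : ℤ) : ℂˣ) : ℂ) = a := by simp
  have e2 : ∀ a : ℂˣ, (((a ^ (-1 : ℤ) : ℂˣ) : ℂ) • (-f)) = ((-a⁻¹ : ℂˣ) : ℂ) • f := by simp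
  simp only [e1, e2] at h3
  convert! h3 using 1
  funext a
  have ha : (a : ℂ) ≠ 0 := a.ne_zero
  set X := nexp ((a : ℂ) • e) with hX
  set Y := nexp (((-a⁻¹ : ℂˣ) : ℂ) • f) with hY
  have c1 : X * f = (f + (a : ℂ) • h - ((a : ℂ) ^ 2) • e) * X := nexp_e_mul_f he hef hhe a
  have c2 : X * h = (h - (2 * (a : ℂ)) • e) * X := nexp_e_mul_h he hhe a
  have c3 : X * e = e * X := nexp_mul_self_comm _ he
  have c4 : Y * e = (e + ((a : ℂ)⁻¹) • h - ((a : ℂ)⁻¹ ^ 2) • f) * Y := by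
    have := nexp_e_mul_f (e := f) (f := e) (h := -h) hf (by rw [← hef]; abel)
      (by rw [neg_mul, mul_neg, sub_neg_eq_add, neg_add_eq_sub, ← neg_sub, hhf, neg_neg])
      ((-a⁻¹ : ℂˣ) : ℂ)
    rw [← hY] at this
    rw [this]
    simp
  have c5 : X * Y * e = X * (e + ((a : ℂ)⁻¹) • h - ((a : ℂ)⁻¹ ^ 2) • f) * Y := by
    rw [mul_assoc, c4, mul_assoc]
  -- After conjugation by both factors only a multiple of `f` is left of `e`, as expected of a Weyl
  -- group representative.
  have c6 : X * (e + ((a : ℂ)⁻¹) • h - ((a : ℂ)⁻¹ ^ 2) • f) = -(((a : ℂ)⁻¹ ^ 2) • f) * X := by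
    rw [mul_sub, mul_add, mul_smul_comm, mul_smul_comm, c1, c2, c3]
    simp only [sub_mul, add_mul, smul_mul_assoc, smul_sub, smul_add, smul_smul, neg_mul]
    have s1 : (a : ℂ)⁻¹ * (2 * a) = 2 := by field_simp
    have s2 : (a : ℂ)⁻¹ ^ 2 * a = (a : ℂ)⁻¹ := by field_simp
    have s3 : (a : ℂ)⁻¹ ^ 2 * (a : ℂ) ^ 2 = 1 := by field_simp
    rw [s1, s2, s3, two_smul, one_smul]
    abel
  have c7 : X * (-f) = -(f + (a : ℂ) • h - ((a : ℂ) ^ 2) • e) * X := by rw [mul_neg, c1, neg_mul]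
  have a1 : (((a ^ (-1 : ℤ) : ℂˣ) : ℂ)) = (a : ℂ)⁻¹ := by simp
  simp only [weylElt]
  rw [← hX, ← hY, a1]
  have t1 : (((a : ℂ) • ((1 : ℤ) : ℂ) • e) * X * Y +
      X * ((a : ℂ)⁻¹ • ((-1 : ℤ) : ℂ) • (-f) * Y)) * X +
      X * Y * ((a : ℂ) • ((1 : ℤ) : ℂ) • e * X) = (a : ℂ) • (e * X * Y * X) +
      (a : ℂ)⁻¹ • (X * f * Y * X) + (a : ℂ) • (X * Y * e * X) := by
    simp [add_mul, mul_assoc]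
  rw [t1, c5, c6, c1]
  simp only [sub_mul, add_mul, smul_mul_assoc, smul_sub, smul_add, smul_smul, neg_mul, smul_neg]
  have s1 : (a : ℂ)⁻¹ * a = 1 := by field_simp
  have s2 : (a : ℂ)⁻¹ * a ^ 2 = a := by field_simp
  have s3 : (a : ℂ) * (a : ℂ)⁻¹ ^ 2 = (a : ℂ)⁻¹ := by field_simp
  rw [s1, s2, s3, one_smul]
  simp only [mul_assoc]
  abel

/-- The torus `a ↦ weylElt a * (weylElt 1)⁻¹` acts with integral weights, its weight spaces being
eigenspaces of `h`; in particular `h` is diagonalizable with integral eigenvalues. -/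
theorem exists_weight_projections (he : IsNilpotent e) (hf : IsNilpotent f)
    (hef : e * f - f * e = h) (hhe : h * e - e * h = (2 : ℂ) • e)
    (hhf : h * f - f * h = -((2 : ℂ) • f)) (θ : A) (hθ : weylElt e f 1 * θ = 1) :
    ∃ (s : Finset ℤ) (P : ℤ → A), (∀ k ∈ s, h * P k = (k : ℂ) • P k) ∧ ∑ k ∈ s, P k = 1 ∧
      ∀ a : ℂˣ, weylElt e f a * θ = ∑ k ∈ s, ((a ^ k : ℂˣ) : ℂ) • P k := by
  obtain ⟨n, d, c, hc⟩ := weylElt_hasEulerDeriv he hf hef hhe hhf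
  let s : Finset ℤ := Finset.univ.image d
  -- Coefficients with equal exponents are collected, so that independence of powers applies.
  let Q : ℤ → A := fun k => ∑ i ∈ Finset.univ.filter (fun i => d i = k), c i
  have hmaps : ∀ i ∈ (Finset.univ : Finset (Fin n)), d i ∈ s :=
    fun i _ => Finset.mem_image_of_mem d (Finset.mem_univ i)
  have hF : ∀ a, weylElt e f a = ∑ k ∈ s, ((a ^ k : ℂˣ) : ℂ) • Q k := by
    intro a
    rw [(hc a).1, ← Finset.sum_fiberwise_of_maps_to hmaps]
    refine Finset.sum_congr rfl fun k _ => ?_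
    rw [Finset.smul_sum]
    refine Finset.sum_congr rfl fun i hi => ?_
    rw [(Finset.mem_filter.mp hi).2]
  have hG : ∀ a, h * weylElt e f a = ∑ k ∈ s, ((a ^ k : ℂˣ) : ℂ) • (k : ℂ) • Q k := by
    intro a
    rw [show h * weylElt e f a = _ from (hc a).2, ← Finset.sum_fiberwise_of_maps_to hmaps]
    refine Finset.sum_congr rfl fun k _ => ?_
    rw [Finset.smul_sum, Finset.smul_sum]
    refine Finset.sum_congr rfl fun i hi => ?_
    rw [(Finset.mem_filter.mp hi).2]
  -- Comparison of the coefficients of `a ^ k` in `h F = a dF/da`.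
  have hQ : ∀ k ∈ s, h * Q k - (k : ℂ) • Q k = 0 := by
    refine eq_zero_of_sum_zpow_smul s (fun k => h * Q k - (k : ℂ) • Q k) fun a => ?_
    have := hG a
    rw [hF a, Finset.mul_sum] at this
    simp only [mul_smul_comm] at this
    simp only [smul_sub, Finset.sum_sub_distrib]
    rw [this, sub_self]
  have hP : ∀ a : ℂˣ, weylElt e f a * θ = ∑ k ∈ s, ((a ^ k : ℂˣ) : ℂ) • (Q k * θ) := by
    intro a
    rw [hF a, Finset.sum_mul]
    simp
  refine ⟨s, fun k => Q k * θ, fun k hk => ?_, ?_, hP⟩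
  · rw [← mul_assoc, sub_eq_zero.mp (hQ k hk), smul_mul_assoc]
  · have := hP 1
    rw [hθ] at this
    simp at this
    exact this.symm

end SlTwo

end Pinnings

end

noncomputable section

namespace Pinnings

open scoped Classical

set_option linter.unusedSectionVars false

/-! ### Words in simple reflections: exchange condition and the longest element -/

section Words

variable {ι R M N : Type*} [Field R] [CharZero R] [AddCommGroup M] [Module R M]
  [AddCommGroup N] [Module R N] {P : RootPairing ι R M N} (b : P.Base)

/-- The product of simple reflections along a word. -/
def wordRefl (l : List b.support) : M ≃ₗ[R] M :=
  (l.map fun s => P.reflection s.1).prod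

/-- The permutation of the roots given by a word. -/
def wordPerm (l : List b.support) : Equiv.Perm ι :=
  (l.map fun s => P.reflectionPerm s.1).prod

/-- A word is reduced if no shorter word has the same product. -/
def RedWord (l : List b.support) : Prop :=
  ∀ m : List b.support, wordRefl b m = wordRefl b l → l.length ≤ m.length

/-- A reduced word of maximal length. -/
def LongWord (l : List b.support) : Prop :=
  RedWord b l ∧ ∀ m, RedWord b m → m.length ≤ l.length

variable {b}

@[simp] theorem wordRefl_nil : wordRefl b [] = 1 := rfl

@[simp] theorem wordRefl_cons (s : b.support) (l) :
    wordRefl b (s :: l) = P.reflection s.1 * wordRefl b l := by simp [wordRefl]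

@[simp] theorem wordRefl_append (l m) : wordRefl b (l ++ m) = wordRefl b l * wordRefl b m := by
  simp [wordRefl]

@[simp] theorem wordPerm_nil : wordPerm b [] = 1 := rfl

@[simp] theorem wordPerm_cons (s : b.support) (l) :
    wordPerm b (s :: l) = P.reflectionPerm s.1 * wordPerm b l := by simp [wordPerm]

@[simp] theorem wordPerm_append (l m) : wordPerm b (l ++ m) = wordPerm b l * wordPerm b m := by
  simp [wordPerm]

theorem reflection_mul_self (i : ι) : P.reflection i * P.reflection i = 1 := by
  ext x; simp

theorem reflectionPerm_mul_self (i : ι) : P.reflectionPerm i * P.reflectionPerm i = 1 := by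
  ext x; simp

theorem root_wordPerm (l : List b.support) (i : ι) :
    P.root (wordPerm b l i) = wordRefl b l (P.root i) := by
  induction l with
  | nil => simp
  | cons s l ih => simp [P.root_reflectionPerm, ih]

theorem coroot_wordPerm (l : List b.support) (i : ι) :
    P.coroot (wordPerm b l i) = (l.map fun s => P.coreflection s.1).prod (P.coroot i) := by
  induction l with
  | nil => simp
  | cons s l ih => simp [P.coroot_reflectionPerm, ih]

theorem wordPerm_eq_of_wordRefl_eq {l m : List b.support} (h : wordRefl b l = wordRefl b m) :
    wordPerm b l = wordPerm b m := by
  ext i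
  apply P.root.injective
  rw [root_wordPerm, root_wordPerm, h]

theorem wordRefl_reverse (l : List b.support) : wordRefl b l.reverse = (wordRefl b l)⁻¹ := by
  induction l with
  | nil => simp
  | cons s l ih =>
    rw [List.reverse_cons, wordRefl_append, ih, wordRefl_cons s l, mul_inv_rev, wordRefl_cons,
      wordRefl_nil, mul_one, ← eq_inv_of_mul_eq_one_left (reflection_mul_self s.1)]

theorem wordPerm_reverse (l : List b.support) : wordPerm b l.reverse = (wordPerm b l)⁻¹ := by
  induction l with
  | nil => simp
  | cons s l ih =>
    rw [List.reverse_cons, wordPerm_append, ih, wordPerm_cons s l, mul_inv_rev, wordPerm_cons,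
      wordPerm_nil, mul_one, ← eq_inv_of_mul_eq_one_left (reflectionPerm_mul_self s.1)]

/-- Conjugating the reflection in a root by `w` gives the reflection in its image under `w`. -/
theorem wordRefl_mul_reflection (l : List b.support) (i : ι) :
    wordRefl b l * P.reflection i = P.reflection (wordPerm b l i) * wordRefl b l := by
  induction l with
  | nil => simp
  | cons s l ih =>
    rw [wordRefl_cons, mul_assoc, ih, wordPerm_cons, Equiv.Perm.mul_apply,
      P.reflection_reflectionPerm]
    simp only [← mul_assoc]
    congr 1
    have := reflection_mul_self (P := P) s.1
    change _ = (P.reflection s.1 * P.reflection (wordPerm b l i) * P.reflection s.1) * _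
    rw [mul_assoc _ (P.reflection s.1) (P.reflection s.1), this, mul_one]

theorem RedWord.of_wordRefl_eq {l m : List b.support} (hl : RedWord b l)
    (h : wordRefl b m = wordRefl b l) (hlen : m.length ≤ l.length) : RedWord b m :=
  fun k hk => hlen.trans (hl k (hk.trans h))

theorem RedWord.reverse {l : List b.support} (hl : RedWord b l) : RedWord b l.reverse := by
  intro m hm
  have := hl m.reverse (by rw [wordRefl_reverse, hm, wordRefl_reverse, inv_inv])
  simpa using this

theorem RedWord.infix {l₁ l₂ l₃ : List b.support} (hl : RedWord b (l₁ ++ l₂ ++ l₃)) :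
    RedWord b l₂ := by
  intro m hm
  have := hl (l₁ ++ m ++ l₃) (by simp [hm])
  simp only [List.length_append] at this
  omega

theorem RedWord.left {l₁ l₂ : List b.support} (hl : RedWord b (l₁ ++ l₂)) : RedWord b l₁ :=
  RedWord.infix (l₁ := []) (l₃ := l₂) (by simpa using hl)

theorem RedWord.right {l₁ l₂ : List b.support} (hl : RedWord b (l₁ ++ l₂)) : RedWord b l₂ :=
  RedWord.infix (l₁ := l₁) (l₃ := []) (by simpa using hl)

theorem exists_redWord (l : List b.support) :
    ∃ m, RedWord b m ∧ wordRefl b m = wordRefl b l ∧ m.length ≤ l.length := by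
  have hex : ∃ n, ∃ m : List b.support, wordRefl b m = wordRefl b l ∧ m.length = n :=
    ⟨_, l, rfl, rfl⟩
  obtain ⟨m, hm, hn⟩ := Nat.find_spec hex
  have hmin : ∀ k : List b.support, wordRefl b k = wordRefl b l → m.length ≤ k.length := by
    intro k hk
    rw [hn]
    exact Nat.find_min' hex ⟨k, hk, rfl⟩
  exact ⟨m, fun k hk => hmin k (hk.trans hm), hm, hmin l rfl⟩

/-- The index of the opposite root. -/
theorem root_reflectionPerm_self (i : ι) : P.root (P.reflectionPerm i i) = -P.root i := by
  rw [P.root_reflectionPerm]; simp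

theorem isPos_reflectionPerm_self_iff (i : ι) :
    b.IsPos (P.reflectionPerm i i) ↔ ¬ b.IsPos i :=
  RootPairing.Base.IsPos.neg_iff_not b i

variable [Finite ι] [P.IsCrystallographic] [P.IsReduced]

/-- A simple reflection permutes the positive roots other than its own. -/
theorem eq_of_isPos_of_not_isPos {s : b.support} {i : ι} (hi : b.IsPos i)
    (h : ¬ b.IsPos (P.reflectionPerm s.1 i)) : i = s.1 := by
  by_contra hne
  exact h (hi.reflectionPerm s.2 hne)

/-- Letters act from the right end of the word. Somewhere the sign changes from positive to
negative, and at a letter `t` this can only happen to `α_t`. -/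
theorem exists_split_of_not_isPos (l : List b.support) {i : ι} (hi : b.IsPos i)
    (h : ¬ b.IsPos (wordPerm b l i)) :
    ∃ (l₁ : List b.support) (t : b.support) (l₂ : List b.support),
      l = l₁ ++ t :: l₂ ∧ wordPerm b l₂ i = t.1 := by
  induction l with
  | nil => exact absurd hi h
  | cons t l ih =>
    by_cases hl : b.IsPos (wordPerm b l i)
    · exact ⟨[], t, l, rfl, eq_of_isPos_of_not_isPos hl h⟩
    · obtain ⟨l₁, u, l₂, rfl, h₂⟩ := ih hl
      exact ⟨t :: l₁, u, l₂, rfl, h₂⟩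

theorem wordRefl_concat_of_wordPerm_eq {l : List b.support} {s t : b.support}
    (h : wordPerm b l s.1 = t.1) : wordRefl b (t :: l) = wordRefl b (l ++ [s]) := by
  rw [wordRefl_append, wordRefl_cons s, wordRefl_nil, mul_one, wordRefl_mul_reflection, h,
    wordRefl_cons]

/-- The exchange condition. -/
theorem exists_exchange (l : List b.support) {s : b.support}
    (h : ¬ b.IsPos (wordPerm b l s.1)) :
    ∃ (l₁ : List b.support) (t : b.support) (l₂ : List b.support), l = l₁ ++ t :: l₂ ∧
      wordPerm b l₂ s.1 = t.1 ∧ wordRefl b (l₁ ++ l₂) = wordRefl b (l ++ [s]) := by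
  obtain ⟨l₁, t, l₂, rfl, h₂⟩ := exists_split_of_not_isPos l
    (RootPairing.Base.isPos_of_mem_support s.2) h
  refine ⟨l₁, t, l₂, rfl, h₂, ?_⟩
  rw [List.append_assoc, wordRefl_append, wordRefl_append, List.cons_append, wordRefl_cons,
    ← wordRefl_concat_of_wordPerm_eq h₂, wordRefl_cons, ← mul_assoc (P.reflection t.1),
    reflection_mul_self, one_mul]

/-- Otherwise the exchange condition would delete a letter of `l` and shorten the word. -/
theorem RedWord.isPos {l : List b.support} {s : b.support} (h : RedWord b (l ++ [s])) :
    b.IsPos (wordPerm b l s.1) := by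
  by_contra hn
  obtain ⟨l₁, t, l₂, rfl, -, h₃⟩ := exists_exchange l hn
  have := h _ h₃
  simp only [List.length_append, List.length_cons, List.length_nil] at this
  omega

/-- A reduced word `m` for the longer product sends `α_s` to a negative root. Exchange then removes
a letter from `m` and yields a word for `l`, so `m` is longer than `l`. -/
theorem RedWord.append_of_isPos {l : List b.support} {s : b.support} (hl : RedWord b l)
    (h : b.IsPos (wordPerm b l s.1)) : RedWord b (l ++ [s]) := by
  obtain ⟨m, hm, hml, hlen⟩ := exists_redWord (l ++ [s])
  suffices l.length + 1 ≤ m.length from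
    hm.of_wordRefl_eq hml.symm (by simpa using this)
  have hms : wordRefl b (m ++ [s]) = wordRefl b l := by
    rw [wordRefl_append, hml, ← wordRefl_append, List.append_assoc, wordRefl_append]
    simp [reflection_mul_self]
  have hneg : ¬ b.IsPos (wordPerm b m s.1) := by
    rw [wordPerm_eq_of_wordRefl_eq hml, ← isPos_reflectionPerm_self_iff]
    convert h using 1
    apply P.root.injective
    rw [root_reflectionPerm_self, root_wordPerm, root_wordPerm]
    simp
  obtain ⟨l₁, t, l₂, rfl, -, h₃⟩ := exists_exchange m hneg
  have := hl _ (h₃.trans hms)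
  simp only [List.length_append, List.length_cons] at this ⊢
  omega

/-- The last letter of a nonempty reduced word is a simple root made negative. -/
theorem wordRefl_eq_one_of_isPos {l : List b.support}
    (h : ∀ s : b.support, b.IsPos (wordPerm b l s.1)) : wordRefl b l = 1 := by
  obtain ⟨m, hm, hml, -⟩ := exists_redWord l
  rcases List.eq_nil_or_concat m with rfl | ⟨m', s, rfl⟩
  · exact hml.symm
  · rw [List.concat_eq_append] at hm hml
    have h1 := hm.isPos
    have h2 := h s
    rw [← wordPerm_eq_of_wordRefl_eq hml] at h2
    rw [← not_not (a := b.IsPos (wordPerm b m' s.1)), ← isPos_reflectionPerm_self_iff] at h1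
    refine absurd ?_ h1
    convert h2 using 1
    apply P.root.injective
    rw [root_reflectionPerm_self, root_wordPerm, root_wordPerm]
    simp

/-- A longest word cannot be extended, so it makes every simple root negative; additivity of the
height carries this to all positive roots. -/
theorem LongWord.not_isPos {l : List b.support} (hl : LongWord b l) {i : ι} (hi : b.IsPos i) :
    ¬ b.IsPos (wordPerm b l i) := by
  have hs : ∀ i ∈ b.support, ¬ b.IsPos (wordPerm b l i) := by
    intro s hs hpos
    have := hl.2 _ (hl.1.append_of_isPos (s := ⟨s, hs⟩) hpos)
    simp at this
  refine hi.induction_on_add hs fun i j k hk hi hj => ?_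
  have hh := b.height_add (i := wordPerm b l i) (j := wordPerm b l j) (k := wordPerm b l k)
    (by simp [root_wordPerm, hk])
  have := hs j hj
  rw [RootPairing.Base.isPos_iff] at *
  omega

/-- Two sign reversals preserve the sign of every simple root, so the product is trivial. This gives
both `w₀² = 1` and the uniqueness of `w₀`. -/
theorem not_isPos_trans {l m : List b.support}
    (hl : ∀ i, b.IsPos i → ¬ b.IsPos (wordPerm b l i))
    (hm : ∀ i, b.IsPos i → ¬ b.IsPos (wordPerm b m i)) : wordRefl b (l ++ m) = 1 := by
  refine wordRefl_eq_one_of_isPos fun s => ?_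
  have h1 := hm _ (RootPairing.Base.isPos_of_mem_support s.2)
  rw [← isPos_reflectionPerm_self_iff] at h1
  have h2 := hl _ h1
  rw [← isPos_reflectionPerm_self_iff] at h2
  convert h2 using 1
  apply P.root.injective
  rw [root_reflectionPerm_self, root_wordPerm, root_wordPerm, root_reflectionPerm_self,
    root_wordPerm]
  simp

theorem LongWord.mul_self {l : List b.support} (hl : LongWord b l) :
    wordRefl b l * wordRefl b l = 1 := by
  rw [← wordRefl_append]
  exact not_isPos_trans (fun i hi => hl.not_isPos hi) (fun i hi => hl.not_isPos hi)

theorem LongWord.unique_of_not_isPos {l m : List b.support} (hl : LongWord b l)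
    (hm : ∀ i, b.IsPos i → ¬ b.IsPos (wordPerm b m i)) : wordRefl b l = wordRefl b m := by
  have h1 : wordRefl b l * wordRefl b m = 1 := by
    rw [← wordRefl_append]
    exact not_isPos_trans (fun i hi => hl.not_isPos hi) hm
  exact mul_left_cancel (hl.mul_self.trans h1.symm)

theorem LongWord.wordRefl_eq {l m : List b.support} (hl : LongWord b l) (hm : LongWord b m) :
    wordRefl b l = wordRefl b m :=
  hl.unique_of_not_isPos fun _ hi => hm.not_isPos hi

theorem LongWord.of_length_le {l m : List b.support} (hl : LongWord b l)
    (h : wordRefl b m = wordRefl b l) (hlen : m.length ≤ l.length) : LongWord b m :=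
  ⟨hl.1.of_wordRefl_eq h hlen, fun k hk => (hl.2 k hk).trans (hl.1 m h)⟩

/-- The height as a linear form. -/
def heightForm [P.IsRootSystem] (b : P.Base) : M →ₗ[R] R :=
  b.toWeightBasis.constr R fun _ => (1 : R)

variable [P.IsRootSystem]

theorem heightForm_root (i : ι) : heightForm b (P.root i) = b.height i := by
  obtain ⟨f, -, -, hf⟩ := b.exists_root_eq_sum_int i
  rw [RootPairing.Base.height_eq_sum hf, hf, map_sum]
  push_cast
  refine Finset.sum_congr rfl fun j hj => ?_
  have : heightForm b (P.root j) = 1 := by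
    have := b.toWeightBasis.constr_basis R (fun _ => (1 : R)) ⟨j, hj⟩
    rwa [b.toWeightBasis_apply] at this
  rw [map_zsmul, this]
  simp

/-- Nonnegative integral coefficients with sum `1` consist of a single `1`. -/
theorem exists_mem_support_of_height_one {i : ι} (h : b.height i = 1) : i ∈ b.support := by
  have hpos : b.IsPos i := by rw [RootPairing.Base.isPos_iff, h]; norm_num
  obtain ⟨f, -, hf⟩ := b.exists_root_eq_sum_nat_or_neg i
  rcases hf with hf | hf
  · have hsum : ∑ j ∈ b.support, f j = 1 := by
      have := RootPairing.Base.height_eq_sum (b := b) (i := i) (f := fun j => (f j : ℤ))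
        (by simpa using hf)
      rw [h] at this
      exact_mod_cast this.symm
    obtain ⟨j, hj, hj0⟩ : ∃ j ∈ b.support, f j ≠ 0 := by
      by_contra! hc
      rw [Finset.sum_eq_zero hc] at hsum
      omega
    have hrest := Finset.add_sum_erase b.support f hj
    have hz : ∀ k ∈ b.support.erase j, f k = 0 := by
      rw [← Finset.sum_eq_zero_iff]
      omega
    have h1 : f j = 1 := by
      rw [Finset.sum_eq_zero hz] at hrest
      omega
    rw [← Finset.add_sum_erase b.support _ hj, h1, one_smul, Finset.sum_eq_zero (fun k hk => by
      rw [hz k hk, zero_smul]), add_zero] at hf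
    rwa [P.root.injective hf]
  · have := RootPairing.Base.height_eq_sum (b := b) (i := i) (f := fun j => -(f j : ℤ))
      (by simpa using hf)
    rw [h, Finset.sum_neg_distrib] at this
    have h2 : (0 : ℤ) ≤ ∑ j ∈ b.support, (f j : ℤ) := Finset.sum_nonneg fun _ _ => by positivity
    omega

/-- The involution `σ = -w₀` preserves positive roots. If `σ(α_s) = ∑ f_j α_j`, then `α_s = ∑ f_j
σ(α_j)`, and heights give `1 = ∑ f_j ht σ(α_j) ≥ ∑ f_j = ht σ(α_s)`. So `σ(α_s)` has height one,
hence is simple. -/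
theorem LongWord.exists_star {l : List b.support} (hl : LongWord b l) (s : b.support) :
    ∃ t : b.support, P.root t.1 = -wordRefl b l (P.root s.1) := by
  let σ : ι → ι := fun i => P.reflectionPerm (wordPerm b l i) (wordPerm b l i)
  have hσ : ∀ i, P.root (σ i) = -wordRefl b l (P.root i) := fun i => by
    rw [root_reflectionPerm_self, root_wordPerm]
  have hσpos : ∀ i, b.IsPos i → b.IsPos (σ i) := fun i hi =>
    (isPos_reflectionPerm_self_iff _).mpr (hl.not_isPos hi)
  have hs : b.IsPos s.1 := RootPairing.Base.isPos_of_mem_support s.2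
  obtain ⟨f, -, hf⟩ := b.exists_root_eq_sum_nat_or_neg (σ s.1)
  have hpos := hσpos _ hs
  rw [RootPairing.Base.isPos_iff] at hpos
  have hf' : P.root (σ s.1) = ∑ j ∈ b.support, f j • P.root j := by
    rcases hf with hf | hf
    · exact hf
    · have := RootPairing.Base.height_eq_sum (b := b) (i := σ s.1) (f := fun j => -(f j : ℤ))
        (by simpa using hf)
      rw [Finset.sum_neg_distrib] at this
      have h2 : (0 : ℤ) ≤ ∑ j ∈ b.support, (f j : ℤ) := Finset.sum_nonneg fun _ _ => by positivity
      omega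
  have hsum := RootPairing.Base.height_eq_sum (b := b) (i := σ s.1) (f := fun j => (f j : ℤ))
    (by simpa using hf')
  have hback : P.root s.1 = ∑ j ∈ b.support, f j • P.root (σ j) := by
    have h1 : -wordRefl b l (P.root (σ s.1)) = P.root s.1 := by
      rw [hσ, map_neg, neg_neg, ← LinearEquiv.mul_apply, hl.mul_self]; rfl
    rw [← h1, hf', map_sum, ← Finset.sum_neg_distrib]
    refine Finset.sum_congr rfl fun j _ => ?_
    rw [hσ, map_nsmul, smul_neg]
  have hht : (1 : ℤ) = ∑ j ∈ b.support, (f j : ℤ) * b.height (σ j) := by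
    have h1 := congrArg (heightForm b) hback
    rw [heightForm_root, RootPairing.Base.height_one_of_mem_support s.2, map_sum] at h1
    have h2 : ((1 : ℤ) : R) = ((∑ j ∈ b.support, (f j : ℤ) * b.height (σ j) : ℤ) : R) := by
      rw [h1]
      push_cast
      refine Finset.sum_congr rfl fun j _ => ?_
      rw [map_nsmul, heightForm_root, nsmul_eq_mul]
    exact_mod_cast h2
  have hle : ∑ j ∈ b.support, (f j : ℤ) ≤ ∑ j ∈ b.support, (f j : ℤ) * b.height (σ j) := by
    refine Finset.sum_le_sum fun j hj => ?_
    have := hσpos j (RootPairing.Base.isPos_of_mem_support hj)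
    rw [RootPairing.Base.isPos_iff] at this
    nlinarith [Int.natCast_nonneg (f j)]
  refine ⟨⟨σ s.1, exists_mem_support_of_height_one ?_⟩, hσ s.1⟩
  omega

/-- A word without `s` does not change coordinates along `α_s`, whereas `w₀ α_s = -α_t` has
coordinate `0` or `-1` there instead of `1`. -/
theorem LongWord.mem {l : List b.support} (hl : LongWord b l) (s : b.support) : s ∈ l := by
  by_contra hs
  have key : ∀ m : List b.support, s ∉ m → ∀ x,
      b.toWeightBasis.coord s (wordRefl b m x) = b.toWeightBasis.coord s x := by
    intro m hm x
    induction m with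
    | nil => simp
    | cons t m ih =>
      rw [List.mem_cons, not_or] at hm
      rw [wordRefl_cons, LinearEquiv.mul_apply, P.reflection_apply, map_sub, ih hm.2, map_smul,
        Basis.coord_apply, Basis.coord_apply, b.toWeightBasis_repr_root,
        Finsupp.single_eq_of_ne hm.1]
      simp
  obtain ⟨t, ht⟩ := hl.exists_star s
  have h1 := key l hs (P.root s.1)
  rw [← neg_eq_iff_eq_neg] at ht
  rw [← ht, map_neg, Basis.coord_apply, Basis.coord_apply, b.toWeightBasis_repr_root,
    b.toWeightBasis_repr_root, Finsupp.single_eq_same, Finsupp.single_apply] at h1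
  split_ifs at h1
  · have h2 : (2 : R) = 0 := by linear_combination -h1
    exact two_ne_zero h2
  · simp at h1

/-- Locates the letter at which `w₀` turns `α_s` negative. By `beta_eq_iff` this is the position
that defines the coordinate at `(s, -∞)`. -/
theorem LongWord.exists_split {l : List b.support} (hl : LongWord b l) (s : b.support) :
    ∃ (l₁ : List b.support) (t : b.support) (l₂ : List b.support), l = l₁ ++ t :: l₂ ∧
      wordPerm b l₂.reverse t.1 = s.1 := by
  obtain ⟨l₁, t, l₂, h, h2⟩ := exists_split_of_not_isPos l
    (RootPairing.Base.isPos_of_mem_support s.2)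
    (hl.not_isPos (RootPairing.Base.isPos_of_mem_support s.2))
  exact ⟨l₁, t, l₂, h, by rw [wordPerm_reverse, ← h2, Equiv.Perm.inv_def, Equiv.symm_apply_apply]⟩

/-- Makes the position behind the coordinate at `(s, -∞)` unique. Equality would give `l₂⁻¹ α_t =
r_{t'} α_{t'} = -α_{t'}`, while `l₂⁻¹ r_t` is reduced and so `l₂⁻¹ α_t` is positive. -/
theorem RedWord.split_ne {l₁ l₂ l₃ : List b.support} {t t' : b.support}
    (hl : RedWord b (l₁ ++ t :: (l₂ ++ t' :: l₃))) :
    wordPerm b (l₂ ++ t' :: l₃).reverse t.1 ≠ wordPerm b l₃.reverse t'.1 := by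
  intro h
  simp only [List.reverse_append, List.reverse_cons, wordPerm_append, wordPerm_cons, wordPerm_nil,
    mul_one, Equiv.Perm.mul_apply, EmbeddingLike.apply_eq_iff_eq] at h
  have hred : RedWord b (l₂.reverse ++ [t]) := by
    rw [← List.reverse_cons]
    refine RedWord.reverse (RedWord.infix (l₁ := l₁) (l₃ := t' :: l₃) ?_)
    simpa using hl
  have h1 := hred.isPos
  have h2 := congrArg (P.reflectionPerm t'.1) h
  rw [← Equiv.Perm.mul_apply, reflectionPerm_mul_self, Equiv.Perm.one_apply] at h2
  rw [h2, isPos_reflectionPerm_self_iff] at h1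
  exact h1 (RootPairing.Base.isPos_of_mem_support t'.2)

/-- The sign comes from `r_t α_t = -α_t`. For a word of `w₀` the right side is the root `α_{s*}`. -/
theorem LongWord.root_split {l₁ l₂ : List b.support} {t s : b.support}
    (h : wordPerm b l₂.reverse t.1 = s.1) :
    wordRefl b l₁ (P.root t.1) = -wordRefl b (l₁ ++ t :: l₂) (P.root s.1) := by
  have h1 : wordPerm b l₂ s.1 = t.1 := by
    rw [← h, wordPerm_reverse, Equiv.Perm.inv_def, Equiv.apply_symm_apply]
  rw [wordRefl_append, wordRefl_cons, LinearEquiv.mul_apply, LinearEquiv.mul_apply,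
    ← root_wordPerm l₂, h1]
  simp

end Words

end Pinnings

end

/-! ### The group inside `GL(V)` and the `SL₂`-relations of simple root subgroups -/

noncomputable section

namespace Pinnings

open scoped Classical

set_option linter.unusedSectionVars false

variable {L : Type*} [LieRing L] [LieAlgebra ℂ L] [FiniteDimensional ℂ L] [IsKilling ℂ L]
variable {H : LieSubalgebra ℂ L} [H.IsCartanSubalgebra]
variable (V : Type*) [AddCommGroup V] [Module ℂ V] [FiniteDimensional ℂ V]
  [LieRingModule L V] [LieModule ℂ L V]

/-- The representation `V` as a linear map. -/
def rho : L →ₗ[ℂ] End ℂ V := (LieModule.toEnd ℂ L V : L →ₗ[ℂ] End ℂ V)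

theorem rho_apply (x : L) (v : V) : rho V x v = ⁅x, v⁆ := rfl

theorem rho_lie (x y : L) : rho V ⁅x, y⁆ = rho V x * rho V y - rho V y * rho V x := by
  ext v
  simp [rho_apply]

theorem rho_isNilpotent {χ : H → ℂ} (hχ : χ ≠ 0) {x : L} (hx : x ∈ rootSpace H χ) :
    IsNilpotent (rho V x) :=
  LieModule.isNilpotent_toEnd_of_mem_rootSpace (M := V) H hχ hx

variable {V}

/-- The endomorphism of `V` given by an element of the group. -/
def gv : SCGroup H V →* End ℂ V := (Units.coeHom _).comp (SCGroup H V).subtype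

theorem gv_injective : Function.Injective (gv : SCGroup H V → End ℂ V) :=
  Units.val_injective.comp Subtype.val_injective

theorem gv_mul_inv (g : SCGroup H V) : gv g * gv g⁻¹ = 1 := by
  rw [← map_mul, mul_inv_cancel, map_one]

theorem gv_inv_mul (g : SCGroup H V) : gv g⁻¹ * gv g = 1 := by
  rw [← map_mul, inv_mul_cancel, map_one]

/-- Conjugation by an element of the group. -/
def cj (g : SCGroup H V) : End ℂ V →ₐ[ℂ] End ℂ V :=
  AlgHom.ofLinearMap ((LinearMap.mulLeft ℂ (gv g)).comp (LinearMap.mulRight ℂ (gv g⁻¹)))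
    (by simp [gv_mul_inv]) fun x y => by
      simp only [LinearMap.comp_apply, LinearMap.mulRight_apply, LinearMap.mulLeft_apply]
      calc gv g * (x * y * gv g⁻¹) = gv g * x * (1 * (y * gv g⁻¹)) := by noncomm_ring
        _ = _ := by rw [← gv_inv_mul g]; noncomm_ring

theorem cj_apply (g : SCGroup H V) (X : End ℂ V) : cj g X = gv g * X * gv g⁻¹ := by
  rw [mul_assoc]; rfl

theorem cj_mul (g k : SCGroup H V) (X : End ℂ V) : cj (g * k) X = cj g (cj k X) := by
  rw [cj_apply, cj_apply, cj_apply, mul_inv_rev, map_mul, map_mul]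
  simp only [mul_assoc]

@[simp] theorem cj_one (X : End ℂ V) : cj (1 : SCGroup H V) X = X := by
  simp [cj_apply]

@[simp] theorem cj_inv_cj (g : SCGroup H V) (X : End ℂ V) : cj g⁻¹ (cj g X) = X := by
  rw [← cj_mul, inv_mul_cancel, cj_one]

@[simp] theorem cj_cj_inv (g : SCGroup H V) (X : End ℂ V) : cj g (cj g⁻¹ X) = X := by
  rw [← cj_mul, mul_inv_cancel, cj_one]

theorem cj_injective (g : SCGroup H V) : Function.Injective (cj g) := fun X Y h => by
  rw [← cj_inv_cj g X, h, cj_inv_cj]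

theorem cj_eq_iff (g : SCGroup H V) {X Y : End ℂ V} : cj g X = Y ↔ gv g * X = Y * gv g := by
  rw [cj_apply]
  constructor
  · rintro rfl
    rw [mul_assoc, gv_inv_mul, mul_one]
  · intro h
    rw [h, mul_assoc, gv_mul_inv, mul_one]

theorem cj_gv (g k : SCGroup H V) : cj g (gv k) = gv (g * k * g⁻¹) := by
  simp [cj_apply]

theorem isNilpotent_cj (g : SCGroup H V) {X : End ℂ V} (h : IsNilpotent X) :
    IsNilpotent (cj g X) := h.map (cj g)

theorem cj_nexp (g : SCGroup H V) {X : End ℂ V} (h : IsNilpotent X) :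
    cj g (nexp X) = nexp (cj g X) := map_nexp (cj g) h

/-- Root elements in the group. -/
def rexp {χ : H → ℂ} (hχ : χ ≠ 0) {x : L} (hx : x ∈ rootSpace H χ) : SCGroup H V :=
  ⟨rootExp V χ hχ x hx, Subgroup.subset_closure ⟨_, _, _, _, rfl⟩⟩

theorem gv_rexp {χ : H → ℂ} (hχ : χ ≠ 0) {x : L} (hx : x ∈ rootSpace H χ) :
    gv (rexp hχ hx : SCGroup H V) = nexp (rho V x) := rfl

/-- Conjugation by a root element preserves the image of the Lie algebra. -/
theorem cj_rexp_mem {χ : H → ℂ} (hχ : χ ≠ 0) {x : L} (hx : x ∈ rootSpace H χ) (y : L) :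
    cj (rexp hχ hx : SCGroup H V) (rho V y) ∈ LinearMap.range (rho (L := L) V) := by
  have hn := rho_isNilpotent V hχ hx
  obtain ⟨N, hN⟩ := nexp_mul_mul_nexp_neg hn
  have hinv : gv (rexp hχ hx : SCGroup H V)⁻¹ = nexp (-rho V x) := rfl
  rw [cj_apply, gv_rexp, hinv, hN N le_rfl]
  refine Submodule.sum_mem _ fun i hi => Submodule.smul_mem _ _ ?_
  clear hi
  induction i with
  | zero => exact ⟨y, rfl⟩
  | succ i ih =>
    obtain ⟨z, hz⟩ := ih
    rw [pow_succ', Module.End.mul_apply, ← hz, comm_apply, ← rho_lie]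
    exact ⟨_, rfl⟩

/-- It suffices to treat the generators, for which conjugation is a sum of iterated brackets. This
is how the adjoint action of the group on `L` is available. -/
theorem cj_mem (g : SCGroup H V) (y : L) : cj g (rho V y) ∈ LinearMap.range (rho (L := L) V) := by
  obtain ⟨g, hg⟩ := g
  induction hg using Subgroup.closure_induction'' generalizing y with
  | mem g hg =>
    obtain ⟨χ, hχ, x, hx, rfl⟩ := hg
    exact cj_rexp_mem hχ hx y
  | inv_mem g hg =>
    obtain ⟨χ, hχ, x, hx, rfl⟩ := hg
    have h : (⟨(rootExp V χ hχ x hx)⁻¹, inv_mem (Subgroup.subset_closure ⟨_, _, _, _, rfl⟩)⟩ :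
        SCGroup H V) = rexp hχ (Submodule.neg_mem _ hx : -x ∈ rootSpace H χ) := by
      apply gv_injective
      change nexp (-rho V x) = nexp (rho V (-x))
      rw [map_neg]
    rw [h]
    exact cj_rexp_mem hχ _ y
  | one => exact ⟨y, (cj_one (rho V y)).symm⟩
  | mul g k hg hk ihg ihk =>
    have : (⟨g * k, mul_mem hg hk⟩ : SCGroup H V) = ⟨g, hg⟩ * ⟨k, hk⟩ := rfl
    rw [this, cj_mul]
    obtain ⟨z, hz⟩ := ihk y
    rw [← hz]
    exact ihg z

namespace Splitting

variable (D : Splitting H)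

/-- The simple coroot as an element of the Lie algebra. -/
def hc (s : D.S) : L := ((coroot s.1.1 : H) : L)

/-- The integers `⟨α, α_s^∨⟩`. -/
def rn (α : H.root) (s : D.S) : ℤ := (rootSystem H).pairingIn ℤ α s.1

theorem rn_cast (α : H.root) (s : D.S) : (D.rn α s : ℂ) = α.1 (coroot s.1.1) := by
  rw [← rootSystem_pairing_apply]
  exact (rootSystem H).algebraMap_pairingIn ℤ α s.1

theorem rn_self (s : D.S) : D.rn s.1 s = 2 := by
  simp [rn]

theorem lie_hc_of_mem {α : H.root} {x : L} (hx : x ∈ rootSpace H (α.1 : H → ℂ)) (s : D.S) :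
    ⁅D.hc s, x⁆ = (D.rn α s : ℂ) • x := by
  rw [rn_cast]
  exact lie_eq_smul_of_mem_rootSpace hx (coroot s.1.1)

theorem lie_hc_f (s t : D.S) : ⁅D.hc t, D.f s⁆ = (-(D.rn s.1 t) : ℂ) • D.f s := by
  rw [rn_cast]
  exact lie_eq_smul_of_mem_rootSpace (D.f_mem s) (coroot t.1.1)

theorem lie_hc_e (s t : D.S) : ⁅D.hc t, D.e s⁆ = (D.rn s.1 t : ℂ) • D.e s :=
  D.lie_hc_of_mem (D.e_mem s) t

variable (V)

/-- The images of the raising generators in the endomorphisms of `V`. -/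
def re (s : D.S) : End ℂ V := rho V (D.e s)

/-- The images of the lowering generators in the endomorphisms of `V`. -/
def rf (s : D.S) : End ℂ V := rho V (D.f s)

/-- The images of the simple coroots in the endomorphisms of `V`. -/
def rh (s : D.S) : End ℂ V := rho V (D.hc s)

theorem re_isNilpotent (s : D.S) : IsNilpotent (D.re V s) :=
  rho_isNilpotent V (root_ne_zero s.1) (D.e_mem s)

theorem rf_isNilpotent (s : D.S) : IsNilpotent (D.rf V s) :=
  rho_isNilpotent V (neg_ne_zero.mpr (root_ne_zero s.1)) (D.f_mem s)

theorem re_rf (s : D.S) : D.re V s * D.rf V s - D.rf V s * D.re V s = D.rh V s := by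
  rw [re, rf, ← rho_lie, D.lie_e_f]; rfl

theorem rh_re (s t : D.S) :
    D.rh V t * D.re V s - D.re V s * D.rh V t = (D.rn s.1 t : ℂ) • D.re V s := by
  rw [re, rh, ← rho_lie, lie_hc_e, map_smul]

theorem rh_rf (s t : D.S) :
    D.rh V t * D.rf V s - D.rf V s * D.rh V t = (-(D.rn s.1 t) : ℂ) • D.rf V s := by
  rw [rf, rh, ← rho_lie, lie_hc_f, map_smul]

theorem rh_re_self (s : D.S) :
    D.rh V s * D.re V s - D.re V s * D.rh V s = (2 : ℂ) • D.re V s := by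
  rw [rh_re, rn_self]; norm_num

theorem rh_rf_self (s : D.S) :
    D.rh V s * D.rf V s - D.rf V s * D.rh V s = -((2 : ℂ) • D.rf V s) := by
  rw [rh_rf, rn_self]; norm_num

theorem gv_scx (s : D.S) (a : ℂ) : gv (D.scx V s a) = nexp (a • D.re V s) := by
  rw [re, ← map_smul]; rfl

theorem gv_scy (s : D.S) (a : ℂ) : gv (D.scy V s a) = nexp (a • D.rf V s) := by
  rw [rf, ← map_smul]; rfl

theorem scx_add (s : D.S) (a b : ℂ) : D.scx V s (a + b) = D.scx V s a * D.scx V s b := by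
  apply gv_injective
  rw [map_mul, gv_scx, gv_scx, gv_scx, nexp_smul_add (D.re_isNilpotent V s)]

theorem scy_add (s : D.S) (a b : ℂ) : D.scy V s (a + b) = D.scy V s a * D.scy V s b := by
  apply gv_injective
  rw [map_mul, gv_scy, gv_scy, gv_scy, nexp_smul_add (D.rf_isNilpotent V s)]

@[simp] theorem scx_zero (s : D.S) : D.scx V s 0 = 1 := by
  apply gv_injective
  rw [gv_scx, zero_smul, nexp_zero, map_one]

@[simp] theorem scy_zero (s : D.S) : D.scy V s 0 = 1 := by
  apply gv_injective
  rw [gv_scy, zero_smul, nexp_zero, map_one]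

theorem scx_neg (s : D.S) (a : ℂ) : D.scx V s (-a) = (D.scx V s a)⁻¹ := by
  rw [eq_inv_iff_mul_eq_one, ← scx_add, neg_add_cancel, scx_zero]

theorem scy_neg (s : D.S) (a : ℂ) : D.scy V s (-a) = (D.scy V s a)⁻¹ := by
  rw [eq_inv_iff_mul_eq_one, ← scy_add, neg_add_cancel, scy_zero]

@[simp] theorem cj_scx_re (s : D.S) (a : ℂ) : cj (D.scx V s a) (D.re V s) = D.re V s := by
  rw [cj_eq_iff, gv_scx, nexp_mul_self_comm a (D.re_isNilpotent V s)]

@[simp] theorem cj_scy_rf (s : D.S) (a : ℂ) : cj (D.scy V s a) (D.rf V s) = D.rf V s := by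
  rw [cj_eq_iff, gv_scy, nexp_mul_self_comm a (D.rf_isNilpotent V s)]

theorem cj_scx_rf (s : D.S) (a : ℂ) : cj (D.scx V s a) (D.rf V s) =
    D.rf V s + a • D.rh V s - (a ^ 2) • D.re V s := by
  rw [cj_eq_iff, gv_scx,
    nexp_e_mul_f (D.re_isNilpotent V s) (D.re_rf V s) (D.rh_re_self V s)]

theorem cj_scy_re (s : D.S) (a : ℂ) : cj (D.scy V s a) (D.re V s) =
    D.re V s - a • D.rh V s - (a ^ 2) • D.rf V s := by
  have h1 : D.rf V s * D.re V s - D.re V s * D.rf V s = -D.rh V s := by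
    rw [← re_rf]; abel
  have h2 : -D.rh V s * D.rf V s - D.rf V s * (-D.rh V s) = (2 : ℂ) • D.rf V s := by
    have := D.rh_rf_self V s
    rw [← neg_eq_iff_eq_neg] at this
    rw [← this]; noncomm_ring
  rw [cj_eq_iff, gv_scy, nexp_e_mul_f (D.rf_isNilpotent V s) h1 h2, smul_neg, ← sub_eq_add_neg]

theorem cj_scx_rh (s t : D.S) (a : ℂ) : cj (D.scx V s a) (D.rh V t) =
    D.rh V t - (a * D.rn s.1 t) • D.re V s := by
  have h := D.rh_re V s t
  rw [cj_eq_iff, gv_scx, nexp_mul_eq (z := -((a * D.rn s.1 t) • D.re V s)) (w := 0)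
    ((D.re_isNilpotent V s).smul a), add_zero, sub_eq_add_neg]
  · rw [smul_mul_assoc, mul_smul_comm, ← smul_sub, ← neg_sub, h, smul_neg, smul_smul]
  · rw [mul_neg, neg_mul, smul_mul_smul_comm, smul_mul_smul_comm, mul_comm a]; simp
  · simp

theorem cj_scy_rh (s t : D.S) (a : ℂ) : cj (D.scy V s a) (D.rh V t) =
    D.rh V t + (a * D.rn s.1 t) • D.rf V s := by
  have h := D.rh_rf V s t
  rw [cj_eq_iff, gv_scy, nexp_mul_eq (z := ((a * D.rn s.1 t) • D.rf V s)) (w := 0)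
    ((D.rf_isNilpotent V s).smul a), add_zero]
  · rw [smul_mul_assoc, mul_smul_comm, ← smul_sub, ← neg_sub, h, smul_neg, smul_smul, ← neg_smul]
    congr 1; ring
  · rw [smul_mul_smul_comm, smul_mul_smul_comm, mul_comm a]; simp
  · simp

/-- `φ_s` of the antidiagonal matrix with entries `a, -a⁻¹`. -/
def scth (s : D.S) (a : ℂˣ) : SCGroup H V :=
  D.scx V s a * D.scy V s (-(a⁻¹ : ℂˣ)) * D.scx V s a

theorem cj_scth_re (s : D.S) (a : ℂˣ) :
    cj (D.scth V s a) (D.re V s) = (-((a : ℂ)⁻¹ ^ 2)) • D.rf V s := by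
  have ha := a.ne_zero
  simp only [scth, cj_mul, cj_scx_re, cj_scy_re, map_sub, map_smul, cj_scx_rh, cj_scx_rf, rn_self,
    Units.val_inv_eq_inv_val]
  match_scalars <;> field_simp <;> norm_num

theorem cj_scth_rf (s : D.S) (a : ℂˣ) :
    cj (D.scth V s a) (D.rf V s) = (-((a : ℂ) ^ 2)) • D.re V s := by
  have ha := a.ne_zero
  simp only [scth, cj_mul, cj_scx_re, cj_scy_re, map_sub, map_add, map_smul, cj_scx_rh, cj_scx_rf,
    cj_scy_rf, cj_scy_rh, rn_self, Units.val_inv_eq_inv_val]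
  match_scalars <;> field_simp <;> norm_num

theorem cj_scth_rh (s t : D.S) (a : ℂˣ) :
    cj (D.scth V s a) (D.rh V t) = D.rh V t - (D.rn s.1 t : ℂ) • D.rh V s := by
  have ha := a.ne_zero
  simp only [scth, cj_mul, cj_scx_re, cj_scy_re, map_sub, map_add, map_smul, cj_scx_rh, cj_scx_rf,
    cj_scy_rh, rn_self, Units.val_inv_eq_inv_val]
  match_scalars <;> field_simp <;> ring

/-- A conjugation formula for one-parameter groups from its infinitesimal version. -/
theorem scth_mul_scx (s : D.S) (a : ℂˣ) (b : ℂ) : D.scth V s a * D.scx V s b =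
    D.scy V s (-((a : ℂ)⁻¹ ^ 2) * b) * D.scth V s a := by
  rw [← mul_inv_eq_iff_eq_mul]
  apply gv_injective
  rw [← cj_gv, gv_scx, gv_scy, cj_nexp _ ((D.re_isNilpotent V s).smul b), map_smul, cj_scth_re,
    smul_smul, mul_comm]

theorem scth_mul_scy (s : D.S) (a : ℂˣ) (b : ℂ) : D.scth V s a * D.scy V s b =
    D.scx V s (-((a : ℂ) ^ 2) * b) * D.scth V s a := by
  rw [← mul_inv_eq_iff_eq_mul]
  apply gv_injective
  rw [← cj_gv, gv_scx, gv_scy, cj_nexp _ ((D.rf_isNilpotent V s).smul b), map_smul, cj_scth_rf,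
    smul_smul, mul_comm]

/-- The relation `x y x = y x y`: by `scth_mul_scx` with `b = a`, the last factor `x_s(a)` can be
traded for a factor `y_s(-a⁻¹)` in front. -/
theorem scth_eq (s : D.S) (a : ℂˣ) : D.scth V s a =
    D.scy V s (-(a⁻¹ : ℂˣ)) * D.scx V s a * D.scy V s (-(a⁻¹ : ℂˣ)) := by
  have h := D.scth_mul_scx V s a a
  have h2 : -((a : ℂ)⁻¹ ^ 2) * a = -(a⁻¹ : ℂˣ) := by
    have ha := a.ne_zero
    rw [Units.val_inv_eq_inv_val]; field_simp
  rw [h2] at h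
  conv_rhs at h => rw [scth, ← mul_assoc, ← mul_assoc]
  exact mul_right_cancel h

theorem scth_neg (s : D.S) (a : ℂˣ) : D.scth V s (-a) = (D.scth V s a)⁻¹ := by
  simp only [scth, mul_inv_rev, ← scx_neg, ← scy_neg, Units.val_neg, inv_neg, neg_neg, mul_assoc]

theorem scr_eq (s : D.S) : D.scr V s = D.scth V s (-1) := by
  simp [scr, scth]

theorem scr_eq_inv (s : D.S) : D.scr V s = (D.scth V s 1)⁻¹ := by
  rw [scr_eq, scth_neg]

/-- The factor `x(1) y(-1) x(1)` in the definition of the coroot is the inverse of `r̄_s`. -/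
theorem scCoroot_eq (s : D.S) (a : ℂˣ) :
    D.scCoroot V s a = D.scth V s a * D.scr V s := by
  rw [scr_eq_inv]
  simp [scCoroot, scth]

theorem cj_scr_re (s : D.S) : cj (D.scr V s) (D.re V s) = -D.rf V s := by
  rw [scr_eq, cj_scth_re]; simp

theorem cj_scr_rf (s : D.S) : cj (D.scr V s) (D.rf V s) = -D.re V s := by
  rw [scr_eq, cj_scth_rf]; simp

theorem cj_scr_rh (s t : D.S) :
    cj (D.scr V s) (D.rh V t) = D.rh V t - (D.rn s.1 t : ℂ) • D.rh V s := by
  rw [scr_eq, cj_scth_rh]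

theorem scr_mul_scx (s : D.S) (b : ℂ) :
    D.scr V s * D.scx V s b = D.scy V s (-b) * D.scr V s := by
  rw [scr_eq, scth_mul_scx]; simp

theorem scr_mul_scy (s : D.S) (b : ℂ) :
    D.scr V s * D.scy V s b = D.scx V s (-b) * D.scr V s := by
  rw [scr_eq, scth_mul_scy]; simp

end Splitting

end Pinnings

end

/-! ### Weights of `V` and faithfulness of the representation -/

noncomputable section

namespace Pinnings

open scoped Classical

set_option linter.unusedSectionVars false

variable {L : Type*} [LieRing L] [LieAlgebra ℂ L] [FiniteDimensional ℂ L] [IsKilling ℂ L]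
variable {H : LieSubalgebra ℂ L} [H.IsCartanSubalgebra]
variable {V : Type*} [AddCommGroup V] [Module ℂ V] [FiniteDimensional ℂ V]
  [LieRingModule L V] [LieModule ℂ L V]

namespace Splitting

variable (D : Splitting H)

/-- Weight vectors of `V`, the weight being recorded by its values on the simple coroots. -/
def IsWt (n : D.S → ℤ) (v : V) : Prop := ∀ s, D.rh V s v = (n s : ℂ) • v

theorem exists_projections (s : D.S) : ∃ (σ : Finset ℤ) (P : ℤ → End ℂ V),
    (∀ k ∈ σ, D.rh V s * P k = (k : ℂ) • P k) ∧ ∑ k ∈ σ, P k = 1 ∧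
      ∀ a : ℂˣ, gv (D.scCoroot V s a) = ∑ k ∈ σ, ((a ^ k : ℂˣ) : ℂ) • P k := by
  have h1 : ∀ a : ℂˣ, gv (D.scth V s a) = weylElt (D.re V s) (D.rf V s) a := by
    intro a
    simp [scth, weylElt, gv_scx, gv_scy]
  obtain ⟨σ, P, h⟩ := exists_weight_projections (D.re_isNilpotent V s) (D.rf_isNilpotent V s)
    (D.re_rf V s) (D.rh_re_self V s) (D.rh_rf_self V s) (gv (D.scr V s)) (by
      rw [← h1, ← map_mul, scr_eq_inv, mul_inv_cancel, map_one])
  refine ⟨σ, P, h.1, h.2.1, fun a => ?_⟩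
  rw [scCoroot_eq, map_mul, h1, h.2.2]

/-- The vectors `P k v` are eigenvectors of `h` for distinct eigenvalues, and `∑ (k - z) P k v = (h
- z) v = 0`, so each summand vanishes. -/
theorem projection_apply {s : D.S} {σ : Finset ℤ} {P : ℤ → End ℂ V}
    (hP : ∀ k ∈ σ, D.rh V s * P k = (k : ℂ) • P k) (h1 : ∑ k ∈ σ, P k = 1) {z : ℂ} {v : V}
    (hv : D.rh V s v = z • v) : ∀ k ∈ σ, ((k : ℂ) - z) • P k v = 0 := by
  have hind := Module.End.eigenspaces_iSupIndep (D.rh V s)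
  have hinj : Function.Injective (fun k : ℤ => (k : ℂ)) := Int.cast_injective
  have hind' := hind.comp hinj
  rw [iSupIndep_iff_finsetSum_eq_zero_imp_eq_zero] at hind'
  refine hind' σ _ (fun k hk => ?_) ?_
  · refine Submodule.smul_mem _ _ ?_
    rw [Function.comp_apply, Module.End.mem_eigenspace_iff, ← Module.End.mul_apply, hP k hk]
    rfl
  · have hvs : ∑ k ∈ σ, P k v = v := by
      rw [← LinearMap.sum_apply, h1]; rfl
    have h2 : D.rh V s v = ∑ k ∈ σ, (k : ℂ) • P k v := by
      conv_lhs => rw [← hvs, map_sum]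
      refine Finset.sum_congr rfl fun k hk => ?_
      rw [← Module.End.mul_apply, hP k hk]
      rfl
    simp only [sub_smul, Finset.sum_sub_distrib, ← h2, ← Finset.smul_sum, hvs, hv, sub_self]

theorem exists_int_of_eigen {s : D.S} {z : ℂ} {v : V} (hv : D.rh V s v = z • v) (h0 : v ≠ 0) :
    ∃ k : ℤ, z = k := by
  obtain ⟨σ, P, hP, h1, -⟩ := D.exists_projections (V := V) s
  by_contra! hne
  apply h0
  have hvs : ∑ k ∈ σ, P k v = v := by
    rw [← LinearMap.sum_apply, h1]; rfl
  rw [← hvs]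
  refine Finset.sum_eq_zero fun k hk => ?_
  have := D.projection_apply hP h1 hv k hk
  rcases smul_eq_zero.mp this with h | h
  · exact absurd (sub_eq_zero.mp h).symm (hne k)
  · exact h

theorem gv_scCoroot_apply (s : D.S) (a : ℂˣ) {n : ℤ} {v : V} (hv : D.rh V s v = (n : ℂ) • v) :
    gv (D.scCoroot V s a) v = ((a ^ n : ℂˣ) : ℂ) • v := by
  obtain ⟨σ, P, hP, h1, h2⟩ := D.exists_projections (V := V) s
  have hvs : ∑ k ∈ σ, P k v = v := by
    rw [← LinearMap.sum_apply, h1]; rfl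
  rw [h2, LinearMap.sum_apply]
  conv_rhs => rw [← hvs, Finset.smul_sum]
  refine Finset.sum_congr rfl fun k hk => ?_
  rw [LinearMap.smul_apply]
  rcases smul_eq_zero.mp (D.projection_apply hP h1 hv k hk) with h | h
  · rw [Int.cast_inj.mp (sub_eq_zero.mp h)]
  · rw [h, smul_zero, smul_zero]

/-- The projections show that `h` is annihilated by the separable polynomial `∏ (X - k)`. -/
theorem rh_isSemisimple (s : D.S) : (D.rh V s).IsSemisimple := by
  obtain ⟨σ, P, hP, h1, -⟩ := D.exists_projections (V := V) s
  refine Module.End.isSemisimple_of_squarefree_aeval_eq_zero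
    (p := ∏ k ∈ σ, (Polynomial.X - Polynomial.C (k : ℂ))) ?_ ?_
  · apply Polynomial.Separable.squarefree
    refine Polynomial.separable_prod_X_sub_C_iff'.mpr fun x _ y _ h => Int.cast_inj.mp h
  · rw [← mul_one (Polynomial.aeval _ _), ← h1, Finset.mul_sum]
    refine Finset.sum_eq_zero fun k hk => ?_
    rw [← Finset.prod_erase_mul σ _ hk, map_mul, mul_assoc]
    have : Polynomial.aeval (D.rh V s) (Polynomial.X - Polynomial.C (k : ℂ)) * P k = 0 := by
      rw [map_sub, Polynomial.aeval_X, Polynomial.aeval_C, sub_mul, hP k hk,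
        Algebra.algebraMap_eq_smul_one, smul_mul_assoc, one_mul, sub_self]
    rw [this, mul_zero]

/-- A semisimple operator acts on its generalized eigenspaces by scalars; this turns generalized
weight vectors into weight vectors. -/
theorem rh_apply_of_mem_genWeightSpace {χ : LieModule.Weight ℂ H V} {v : V}
    (hv : v ∈ LieModule.genWeightSpace V (χ : H → ℂ)) (s : D.S) :
    D.rh V s v = χ (coroot s.1.1) • v := by
  have h := (D.rh_isSemisimple (V := V) s).isFinitelySemisimple.maxGenEigenspace_eq_eigenspace
    (χ (coroot s.1.1))
  rw [← Module.End.mem_eigenspace_iff, ← h, Module.End.mem_maxGenEigenspace]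
  exact (LieModule.mem_genWeightSpace V _ v).mp hv (coroot s.1.1)

theorem exists_isWt_of_mem_genWeightSpace {χ : LieModule.Weight ℂ H V} {v : V}
    (hv : v ∈ LieModule.genWeightSpace V (χ : H → ℂ)) (h0 : v ≠ 0) :
    ∃ n : D.S → ℤ, D.IsWt n v ∧ ∀ s, χ (coroot s.1.1) = n s := by
  choose n hn using fun s =>
    D.exists_int_of_eigen (D.rh_apply_of_mem_genWeightSpace hv s) h0
  exact ⟨n, fun s => by rw [D.rh_apply_of_mem_genWeightSpace hv s, hn], hn⟩

variable (V)

theorem span_isWt : Submodule.span ℂ {v : V | ∃ n, D.IsWt n v} = ⊤ := by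
  have h := LieModule.iSup_genWeightSpace_eq_top' ℂ H V
  rw [eq_top_iff, ← LieSubmodule.top_toSubmodule (R := ℂ) (L := H), ← h,
    LieSubmodule.iSup_toSubmodule, iSup_le_iff]
  intro χ v hv
  by_cases h0 : v = 0
  · rw [h0]; exact zero_mem _
  · obtain ⟨n, hn, -⟩ := D.exists_isWt_of_mem_genWeightSpace hv h0
    exact Submodule.subset_span ⟨n, hn⟩

variable {V}

theorem end_ext {X Y : End ℂ V} (h : ∀ n v, D.IsWt n v → X v = Y v) : X = Y := by
  apply LinearMap.ext_on (D.span_isWt V)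
  rintro v ⟨n, hn⟩
  exact h n v hn

theorem sc_ext {g k : SCGroup H V} (h : ∀ n v, D.IsWt n v → gv g v = gv k v) : g = k :=
  gv_injective (D.end_ext h)

variable (V)

/-- The subgroup of the weight lattice generated by the weights of `V` is everything. -/
theorem mem_closure_wt (hV : GeneratesWeightLattice H V) (n : D.S → ℤ) :
    n ∈ AddSubgroup.closure {m : D.S → ℤ | ∃ v : V, v ≠ 0 ∧ D.IsWt m v} := by
  let b := D.base.toCoweightBasis
  -- The form with the prescribed integral values on simple coroots. It is integral on all coroots,
  -- because up to sign these are sums of simple ones, so the hypothesis on `V` applies to it.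
  let μ : Dual ℂ H := b.constr ℂ fun s => (n s : ℂ)
  have hμ : ∀ s : D.S, μ (coroot s.1.1) = n s := by
    intro s
    have h1 : (coroot s.1.1 : H) = b s := by
      rw [RootPairing.Base.toCoweightBasis_apply, rootSystem_coroot_apply]
    rw [h1]
    exact b.constr_basis ℂ _ s
  have hμ' : ∀ α : H.root, ∃ k : ℤ, μ (coroot α.1) = k := by
    intro α
    have key : ∀ y ∈ AddSubmonoid.closure ((rootSystem H).coroot '' D.base.support),
        ∃ k : ℤ, μ y = k := by
      intro y hy
      induction hy using AddSubmonoid.closure_induction with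
      | mem y hy =>
        obtain ⟨s, hs, rfl⟩ := hy
        exact ⟨n ⟨s, hs⟩, hμ ⟨s, hs⟩⟩
      | zero => exact ⟨0, by simp⟩
      | add y z _ _ ihy ihz =>
        obtain ⟨k, hk⟩ := ihy
        obtain ⟨m, hm⟩ := ihz
        exact ⟨k + m, by rw [map_add, hk, hm]; push_cast; rfl⟩
    rcases D.base.coroot_mem_or_neg_mem α with h | h
    · exact key _ h
    · obtain ⟨k, hk⟩ := key _ h
      refine ⟨-k, ?_⟩
      rw [map_neg, rootSystem_coroot_apply] at hk
      push_cast
      rw [← hk, neg_neg]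
  have h := hV μ hμ'
  have key : ∀ ν ∈ AddSubgroup.closure (Set.range (LieModule.Weight.toLinear ℂ H V)),
      ∃ m ∈ AddSubgroup.closure {m : D.S → ℤ | ∃ v : V, v ≠ 0 ∧ D.IsWt m v},
        ∀ s, ν (coroot s.1.1) = (m s : ℂ) := by
    intro ν hν
    induction hν using AddSubgroup.closure_induction with
    | mem ν hν =>
      obtain ⟨χ, rfl⟩ := hν
      obtain ⟨v, hv, h0⟩ := χ.exists_ne_zero
      obtain ⟨m, hm, hm'⟩ := D.exists_isWt_of_mem_genWeightSpace hv h0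
      exact ⟨m, AddSubgroup.subset_closure ⟨v, h0, hm⟩, hm'⟩
    | zero => exact ⟨0, zero_mem _, fun s => by simp⟩
    | add x y _ _ ihx ihy =>
      obtain ⟨m, hm, hm'⟩ := ihx
      obtain ⟨k, hk, hk'⟩ := ihy
      exact ⟨m + k, add_mem hm hk, fun s => by
        rw [LinearMap.add_apply, hm', hk', Pi.add_apply]; push_cast; rfl⟩
    | neg x _ ihx =>
      obtain ⟨m, hm, hm'⟩ := ihx
      exact ⟨-m, neg_mem hm, fun s => by
        rw [LinearMap.neg_apply, hm', Pi.neg_apply]; push_cast; rfl⟩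
  obtain ⟨m, hm, hm'⟩ := key μ h
  have : n = m := by
    funext s
    have := hm' s
    rw [hμ] at this
    exact Int.cast_inj.mp this
  rwa [this]

theorem eq_of_forall_apply_coroot {h k : H}
    (hh : ∀ α : H.root, α.1 h = α.1 k) : h = k := by
  have h0 : ∀ χ : LieModule.Weight ℂ H L, χ (h - k) = 0 := by
    intro χ
    by_cases hχ : χ.IsZero
    · have : (χ : H → ℂ) = 0 := hχ
      rw [this]; rfl
    · have := hh ⟨χ, by simpa using hχ⟩
      have h2 : LieModule.Weight.toLinear ℂ H L χ h = LieModule.Weight.toLinear ℂ H L χ k := this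
      have h3 : LieModule.Weight.toLinear ℂ H L χ (h - k) = 0 := by rw [map_sub, h2, sub_self]
      exact h3
  have h1 := iInf_ker_weight_eq_bot (K := ℂ) (L := L) (H := H)
  rw [← sub_eq_zero, ← Submodule.mem_bot ℂ, ← h1, Submodule.mem_iInf]
  exact h0

/-- An element of `H` acting by zero is killed by all weights of `V`, hence by the lattice they
generate. This lattice contains the roots, and the roots separate points of `H`. -/
theorem rho_coe_injective (hV : GeneratesWeightLattice H V) {h : H} (hh : rho V (h : L) = 0) :
    h = 0 := by
  apply eq_of_forall_apply_coroot
  intro α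
  have h1 : ∀ χ : LieModule.Weight ℂ H V, χ h = 0 := by
    intro χ
    obtain ⟨v, hv, h0⟩ := χ.exists_ne_zero
    obtain ⟨k, hk⟩ := (LieModule.mem_genWeightSpace V _ v).mp hv h
    have h2 : (LieModule.toEnd ℂ H V h) = 0 := hh
    rw [h2, zero_sub] at hk
    by_contra hne
    apply h0
    -- On a generalized weight vector a power of `0 - χ h` vanishes, which forces the scalar `χ h`
    -- to be zero.
    have h3 : (-(χ h • (1 : End ℂ V))) ^ k = ((-χ h) ^ k) • (1 : End ℂ V) := by
      rw [← neg_smul, smul_pow, one_pow]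
    rw [h3, LinearMap.smul_apply] at hk
    exact (smul_eq_zero.mp hk).resolve_left (pow_ne_zero _ (neg_ne_zero.mpr hne))
  have h2 := hV (LieModule.Weight.toLinear ℂ H L α.1) fun β => by
    refine ⟨(rootSystem H).pairingIn ℤ α β, ?_⟩
    have := (rootSystem H).algebraMap_pairingIn ℤ α β
    rw [rootSystem_pairing_apply] at this
    exact this.symm
  have h3 : ∀ ν ∈ AddSubgroup.closure (Set.range (LieModule.Weight.toLinear ℂ H V)), ν h = 0 := by
    intro ν hν
    induction hν using AddSubgroup.closure_induction with
    | mem ν hν =>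
      obtain ⟨χ, rfl⟩ := hν
      exact h1 χ
    | zero => rfl
    | add x y _ _ ihx ihy => rw [LinearMap.add_apply, ihx, ihy, add_zero]
    | neg x _ ih => rw [LinearMap.neg_apply, ih, neg_zero]
  have h4 : α.1 h = 0 := h3 _ h2
  rw [h4]
  exact (map_zero (LieModule.Weight.toLinear ℂ H L α.1)).symm

/-- The kernel is an ideal, so it is the sum of its intersection with `H` and of root spaces. A root
space in the kernel would bring the corresponding coroot along, contrary to faithfulness on `H`. -/
theorem rho_injective (hV : GeneratesWeightLattice H V) :
    Function.Injective (rho V : L → End ℂ V) := by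
  let I : LieIdeal ℂ L := LieModule.ker ℂ L V
  have hI : ∀ x, x ∈ I ↔ rho V x = 0 := fun x => by
    rw [LieModule.mem_ker]
    exact ⟨fun h => LinearMap.ext h, fun h m => LinearMap.congr_fun h m⟩
  have hroot : ∀ α : H.root, ¬ rootSpace H (α.1 : H → ℂ) ≤ I.restr H := by
    intro α hα
    obtain ⟨h, e, f, ht, he, hf⟩ := exists_isSl2Triple_of_weight_isNonZero
      (show α.1.IsNonZero from H.isNonZero_coe_root α)
    have hh := ht.h_eq_coroot (H.isNonZero_coe_root α) he hf
    have heI : e ∈ I := hα he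
    have : h ∈ I := by
      rw [← ht.lie_e_f]
      rw [← lie_skew]
      exact neg_mem (lie_mem_right ℂ L I f e heI)
    rw [hI, hh] at this
    have h0 := rho_coe_injective V hV this
    exact H.isNonZero_coe_root α (coroot_eq_zero_iff.mp h0)
  have hbot : I = ⊥ := by
    have h1 := lieIdeal_eq_inf_cartan_sup_biSup_rootSpace (H := H) I
    rw [eq_bot_iff]
    intro x hx
    have hx' : x ∈ I.restr H := hx
    have h2 : ⨆ (α : H.root) (_ : rootSpace H α.val ≤ I.restr H), rootSpace H α.val = ⊥ := by
      simp only [iSup_eq_bot]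
      intro α hα
      exact absurd hα (hroot α)
    rw [h1, h2, sup_bot_eq] at hx'
    have hxH : x ∈ H := hx'.2
    have := rho_coe_injective V hV (h := ⟨x, hxH⟩) ((hI x).mp hx)
    have h3 : x = 0 := congrArg Subtype.val this
    rw [h3]; exact zero_mem _
  rw [injective_iff_map_eq_zero]
  intro x hx
  have : x ∈ I := (hI x).mpr hx
  rw [hbot] at this
  exact (LieSubmodule.mem_bot x).mp this

end Splitting

end Pinnings

end

/-! ### The maximal torus and its characters -/

noncomputable section

namespace Pinnings

open scoped Classical

set_option linter.unusedSectionVars false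

variable {L : Type*} [LieRing L] [LieAlgebra ℂ L] [FiniteDimensional ℂ L] [IsKilling ℂ L]
variable {H : LieSubalgebra ℂ L} [H.IsCartanSubalgebra]
variable {V : Type*} [AddCommGroup V] [Module ℂ V] [FiniteDimensional ℂ V]
  [LieRingModule L V] [LieModule ℂ L V]

/-- The monomial character of a torus. -/
def chr {S : Type*} [Fintype S] (n : S → ℤ) : (S → ℂˣ) →* ℂˣ where
  toFun c := ∏ s, c s ^ n s
  map_one' := by simp
  map_mul' c d := by simp [mul_zpow, Finset.prod_mul_distrib]

section chr

variable {S : Type*} [Fintype S]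

theorem prod_zpow_eq (a : ℂˣ) (f : S → ℤ) (σ : Finset S) :
    ∏ s ∈ σ, a ^ f s = a ^ ∑ s ∈ σ, f s := by
  induction σ using Finset.induction_on with
  | empty => simp
  | insert s σ hs ih => rw [Finset.prod_insert hs, Finset.sum_insert hs, ih, zpow_add]

theorem chr_apply (n : S → ℤ) (c : S → ℂˣ) : chr n c = ∏ s, c s ^ n s := rfl

theorem chr_add (n m : S → ℤ) (c : S → ℂˣ) : chr (n + m) c = chr n c * chr m c := by
  simp [chr_apply, zpow_add, Finset.prod_mul_distrib]

theorem chr_neg (n : S → ℤ) (c : S → ℂˣ) : chr (-n) c = (chr n c)⁻¹ := by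
  simp [chr_apply]

@[simp] theorem chr_zero (c : S → ℂˣ) : chr 0 c = 1 := by
  simp [chr_apply]

theorem chr_sub (n m : S → ℤ) (c : S → ℂˣ) : chr (n - m) c = chr n c * (chr m c)⁻¹ := by
  rw [sub_eq_add_neg, chr_add, chr_neg]

theorem chr_zsmul (k : ℤ) (n : S → ℤ) (c : S → ℂˣ) : chr (k • n) c = chr n c ^ k := by
  simp [chr_apply, mul_comm k, zpow_mul, Finset.prod_zpow]

theorem chr_single [DecidableEq S] (s : S) (c : S → ℂˣ) : chr (Pi.single s 1) c = c s := by
  rw [chr_apply, Finset.prod_eq_single s]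
  · simp
  · intro t _ ht
    simp [Pi.single_eq_of_ne ht]
  · simp

theorem chr_mulSingle [DecidableEq S] (n : S → ℤ) (s : S) (a : ℂˣ) : chr n (Pi.mulSingle s a) = a ^ n s := by
  rw [chr_apply, Finset.prod_eq_single s]
  · simp
  · intro t _ ht
    simp [Pi.mulSingle_eq_of_ne ht]
  · simp

theorem chr_zpow (n m : S → ℤ) (a : ℂˣ) : chr n (fun s => a ^ m s) = a ^ (∑ s, n s * m s) := by
  rw [chr_apply, ← prod_zpow_eq]
  exact Finset.prod_congr rfl fun s _ => by rw [← zpow_mul, mul_comm]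

end chr

namespace Splitting

variable (D : Splitting H)

/-- Weight vectors for the conjugation action on endomorphisms. -/
def EWt (n : D.S → ℤ) (X : End ℂ V) : Prop :=
  ∀ s, D.rh V s * X - X * D.rh V s = (n s : ℂ) • X

variable {D}

theorem EWt.apply {m n : D.S → ℤ} {X : End ℂ V} {v : V} (hX : D.EWt m X) (hv : D.IsWt n v) :
    D.IsWt (m + n) (X v) := by
  intro s
  have h := LinearMap.congr_fun (hX s) v
  simp only [LinearMap.sub_apply, Module.End.mul_apply, LinearMap.smul_apply, hv s,
    map_smul] at h
  rw [sub_eq_iff_eq_add] at h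
  rw [h, Pi.add_apply, Int.cast_add, add_smul]

variable (D)

theorem ewt_of_mem {α : H.root} {x : L} (hx : x ∈ rootSpace H (α.1 : H → ℂ)) :
    D.EWt (D.rn α) (rho V x) := by
  intro s
  rw [rh, ← rho_lie, D.lie_hc_of_mem hx, map_smul]

theorem ewt_re (s : D.S) : D.EWt (D.rn s.1) (D.re V s) := fun t => D.rh_re V s t

theorem ewt_rf (s : D.S) : D.EWt (-D.rn s.1) (D.rf V s) := fun t => by
  rw [D.rh_rf V s t]; simp

theorem gv_list_scCoroot_apply (c : D.S → ℂˣ) (l : List D.S) {n : D.S → ℤ} {v : V}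
    (hv : D.IsWt n v) : gv ((l.map fun s => D.scCoroot V s (c s)).prod) v =
      (((l.map fun s => c s ^ n s).prod : ℂˣ) : ℂ) • v := by
  induction l with
  | nil => simp
  | cons s l ih =>
    rw [List.map_cons, List.prod_cons, map_mul, Module.End.mul_apply, ih, map_smul,
      D.gv_scCoroot_apply s _ (hv s), List.map_cons, List.prod_cons, Units.val_mul, smul_smul,
      mul_comm]

theorem gv_prod_scCoroot_apply (c : D.S → ℂˣ) {n : D.S → ℤ} {v : V}
    (hv : D.IsWt n v) : gv ((Finset.univ.toList.map fun s => D.scCoroot V s (c s)).prod) v =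
      ((chr n c : ℂˣ) : ℂ) • v := by
  rw [D.gv_list_scCoroot_apply c _ hv, chr_apply, Finset.prod_map_toList]

variable (V)

/-- The maximal torus, parametrized by the simple coroots. -/
def tor : (D.S → ℂˣ) →* SCGroup H V where
  toFun c := (Finset.univ.toList.map fun s => D.scCoroot V s (c s)).prod
  -- Identities between torus elements are checked on weight vectors, which span `V`.
  map_one' := D.sc_ext fun n v hv => by
    rw [D.gv_prod_scCoroot_apply 1 hv, map_one, map_one, Units.val_one, one_smul]; rfl
  map_mul' c d := D.sc_ext fun n v hv => by
    rw [D.gv_prod_scCoroot_apply _ hv, map_mul gv, Module.End.mul_apply,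
      D.gv_prod_scCoroot_apply d hv, map_smul, D.gv_prod_scCoroot_apply c hv, map_mul (chr n),
      Units.val_mul, smul_smul, mul_comm]

variable {V}

theorem gv_tor_apply (c : D.S → ℂˣ) {n : D.S → ℤ} {v : V} (hv : D.IsWt n v) :
    gv (D.tor V c) v = ((chr n c : ℂˣ) : ℂ) • v :=
  D.gv_prod_scCoroot_apply c hv

theorem cj_tor (c : D.S → ℂˣ) {n : D.S → ℤ} {X : End ℂ V} (hX : D.EWt n X) :
    cj (D.tor V c) X = ((chr n c : ℂˣ) : ℂ) • X := by
  rw [cj_eq_iff]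
  refine D.end_ext fun m v hv => ?_
  rw [Module.End.mul_apply, D.gv_tor_apply c (hX.apply hv), Module.End.mul_apply,
    D.gv_tor_apply c hv, map_smul, LinearMap.smul_apply, smul_smul, chr_add, Units.val_mul,
    mul_comm]

variable (V)

theorem scCoroot_eq_tor (s : D.S) (a : ℂˣ) : D.scCoroot V s a = D.tor V (Pi.mulSingle s a) :=
  D.sc_ext fun n v hv => by
    rw [D.gv_tor_apply _ hv, chr_mulSingle, D.gv_scCoroot_apply s a (hv s)]

theorem tor_mem_scT (c : D.S → ℂˣ) : D.tor V c ∈ D.scT V := by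
  refine list_prod_mem fun g hg => ?_
  obtain ⟨s, -, rfl⟩ := List.mem_map.mp hg
  exact Subgroup.subset_closure ⟨s, c s, rfl⟩

theorem scT_eq_range : D.scT V = (D.tor V).range := by
  apply le_antisymm
  · rw [scT, Subgroup.closure_le]
    rintro _ ⟨s, a, rfl⟩
    exact ⟨_, (D.scCoroot_eq_tor V s a).symm⟩
  · rintro _ ⟨c, rfl⟩
    exact D.tor_mem_scT V c

/-- Here simple connectedness enters: the weights of `V` generate the full weight lattice, so every
coordinate `c s`, being the value of a fundamental weight, is determined by the action on `V`. -/
theorem tor_injective (hV : GeneratesWeightLattice H V) : Function.Injective (D.tor V) := by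
  intro c d hcd
  have h : ∀ n ∈ AddSubgroup.closure {m : D.S → ℤ | ∃ v : V, v ≠ 0 ∧ D.IsWt m v},
      chr n c = chr n d := by
    intro n hn
    induction hn using AddSubgroup.closure_induction with
    | mem n hn =>
      obtain ⟨v, h0, hv⟩ := hn
      have h1 := D.gv_tor_apply c hv
      rw [hcd, D.gv_tor_apply d hv] at h1
      exact (Units.ext (smul_left_injective ℂ h0 h1)).symm
    | zero => simp
    | add x y _ _ ihx ihy => rw [chr_add, chr_add, ihx, ihy]
    | neg x _ ih => rw [chr_neg, chr_neg, ih]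
  funext s
  have := h _ (D.mem_closure_wt V hV (Pi.single s 1))
  rwa [chr_single, chr_single] at this

/-- The inverse of `tor` provides a character with the defining property, and the coroot subgroups
generate the torus, so the chosen character is that one. -/
theorem fundWeight_tor (hV : GeneratesWeightLattice H V) (s : D.S) (c : D.S → ℂˣ)
    (h : D.tor V c ∈ D.scT V) : D.fundWeight V s ⟨D.tor V c, h⟩ = c s := by
  let φ := MonoidHom.ofInjective (D.tor_injective V hV)
  have hex : ∃ χ : D.scT V →* ℂˣ, ∀ (t : D.S) (a : ℂˣ),
      χ ⟨D.scCoroot V t a, Subgroup.subset_closure ⟨t, a, rfl⟩⟩ = if s = t then a else 1 := by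
    refine ⟨(Pi.evalMonoidHom _ s).comp (φ.symm.toMonoidHom.comp
      (Subgroup.inclusion (D.scT_eq_range V).le)), fun t a => ?_⟩
    have : (Subgroup.inclusion (D.scT_eq_range V).le
        ⟨D.scCoroot V t a, Subgroup.subset_closure ⟨t, a, rfl⟩⟩) = φ (Pi.mulSingle t a) :=
      Subtype.ext (D.scCoroot_eq_tor V t a)
    simp only [MonoidHom.comp_apply, this]
    change (φ.symm (φ (Pi.mulSingle t a))) s = _
    rw [MulEquiv.symm_apply_apply, Pi.mulSingle_apply]
  have hspec := Classical.epsilon_spec hex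
  have h1 : (D.fundWeight V s).comp ((D.tor V).codRestrict (D.scT V) (D.tor_mem_scT V)) =
      Pi.evalMonoidHom _ s := by
    refine MonoidHom.functions_ext _ _ _ fun t a => ?_
    have h2 := hspec t a
    have h3 : (D.tor V).codRestrict (D.scT V) (D.tor_mem_scT V) (Pi.mulSingle t a) =
        ⟨D.scCoroot V t a, Subgroup.subset_closure ⟨t, a, rfl⟩⟩ :=
      Subtype.ext (D.scCoroot_eq_tor V t a).symm
    rw [MonoidHom.comp_apply, h3]
    refine h2.trans ?_
    rw [Pi.evalMonoidHom_apply, Pi.mulSingle_apply]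
  exact DFunLike.congr_fun h1 c

theorem scCoroot_mul (s : D.S) (a b : ℂˣ) :
    D.scCoroot V s (a * b) = D.scCoroot V s a * D.scCoroot V s b := by
  simp only [scCoroot_eq_tor, Pi.mulSingle_mul, map_mul]

theorem scr_mul_self (s : D.S) : D.scr V s * D.scr V s = D.scCoroot V s (-1) := by
  rw [scCoroot_eq, scr_eq]

theorem scth_eq_scCoroot (s : D.S) (a : ℂˣ) :
    D.scth V s a = D.scCoroot V s (-a) * D.scr V s := by
  have h : D.scCoroot V s (-a) = D.scCoroot V s a * D.scCoroot V s (-1) := by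
    rw [← scCoroot_mul, mul_neg_one]
  have h1 : D.scCoroot V s (-1) * D.scCoroot V s (-1) = 1 := by
    rw [← scCoroot_mul, scCoroot_eq_tor]; simp
  rw [← scr_mul_self] at h1
  rw [h, scCoroot_eq, ← scr_mul_self]
  simp only [mul_assoc] at h1 ⊢
  rw [h1, mul_one]

theorem scx_mul_scr (s : D.S) (b : ℂ) :
    D.scx V s b * D.scr V s = D.scr V s * D.scy V s (-b) := by
  rw [scr_mul_scy, neg_neg]

/-- The Gauss decomposition of `y(c) r̄` in `SL₂`. It governs both the multiplication of Bruhat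
cells and the flags at simple distance from `B⁻`. -/
theorem scy_mul_scr_eq (s : D.S) (c : ℂˣ) : D.scy V s c * D.scr V s =
    D.scx V s (c⁻¹ : ℂˣ) * D.scCoroot V s (-c⁻¹) * D.scy V s (-(c⁻¹ : ℂˣ)) := by
  have h : D.scy V s c =
      D.scx V s (c⁻¹ : ℂˣ) * D.scth V s (-c⁻¹) * D.scx V s (c⁻¹ : ℂˣ) := by
    rw [scth]
    have h1 : -((-c⁻¹)⁻¹ : ℂˣ) = c := by simp
    simp only [← Units.val_neg, h1]
    rw [← mul_assoc, ← mul_assoc, ← scx_add, mul_assoc, ← scx_add]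
    simp
  rw [h, mul_assoc, scx_mul_scr, ← mul_assoc, scCoroot_eq, mul_assoc (D.scx V s _)]

variable {V}

/-- The action of a simple reflection on torus coordinates. -/
def sact (s : D.S) (c : D.S → ℂˣ) : D.S → ℂˣ := c * Pi.mulSingle s (chr (D.rn s.1) c)⁻¹

theorem chr_sact (s : D.S) (c : D.S → ℂˣ) (n : D.S → ℤ) :
    chr n (D.sact s c) = chr (n - n s • D.rn s.1) c := by
  rw [sact, map_mul, chr_mulSingle, chr_sub, chr_zsmul, inv_zpow]

theorem apply_gv_eq {g : SCGroup H V} {v : V} {X : End ℂ V} {m : ℤ}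
    (h : cj g⁻¹ X v = (m : ℂ) • v) : X (gv g v) = (m : ℂ) • gv g v := by
  rw [← map_smul, ← h, cj_apply, inv_inv, ← Module.End.mul_apply, ← Module.End.mul_apply,
    ← mul_assoc, ← mul_assoc, gv_mul_inv, one_mul]

theorem cj_scr_inv_rh (s t : D.S) :
    cj (D.scr V s)⁻¹ (D.rh V t) = D.rh V t - (D.rn s.1 t : ℂ) • D.rh V s := by
  apply cj_injective (D.scr V s)
  rw [cj_cj_inv, map_sub, map_smul, cj_scr_rh, cj_scr_rh, rn_self]
  match_scalars <;> ring

/-- The lift `r̄_s` acts on weights through the simple reflection. -/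
theorem IsWt.scr {s : D.S} {n : D.S → ℤ} {v : V} (hv : D.IsWt n v) :
    D.IsWt (n - n s • D.rn s.1) (gv (D.scr V s) v) := by
  intro t
  apply apply_gv_eq
  rw [cj_scr_inv_rh, LinearMap.sub_apply, LinearMap.smul_apply, hv t, hv s, smul_smul,
    ← sub_smul]
  simp [mul_comm]

variable (V)

/-- Compared on weight vectors, where both sides act by the same monomial in `c`. -/
theorem scr_mul_tor (s : D.S) (c : D.S → ℂˣ) :
    D.scr V s * D.tor V c = D.tor V (D.sact s c) * D.scr V s := by
  refine D.sc_ext fun n v hv => ?_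
  rw [map_mul, Module.End.mul_apply, D.gv_tor_apply c hv, map_smul, map_mul,
    Module.End.mul_apply, D.gv_tor_apply _ hv.scr, chr_sact]
  congr 3
  have : (n - n s • D.rn s.1) s = - n s := by
    simp [rn_self]; ring
  rw [this, neg_smul, sub_neg_eq_add, sub_add_cancel]

theorem sact_sact (s : D.S) (c : D.S → ℂˣ) : D.sact s (D.sact s c) = c := by
  funext t
  rw [← chr_single t c, ← chr_single t (D.sact s (D.sact s c)), chr_sact, chr_sact]
  congr 1
  have : ((Pi.single t 1 : D.S → ℤ) - (Pi.single t 1 : D.S → ℤ) s • D.rn s.1) s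
      = - (Pi.single t 1 : D.S → ℤ) s := by
    rw [Pi.sub_apply, Pi.smul_apply, rn_self, smul_eq_mul]; ring
  rw [this, neg_smul, sub_neg_eq_add, sub_add_cancel]

theorem tor_mul_scx (c : D.S → ℂˣ) (s : D.S) (a : ℂ) : D.tor V c * D.scx V s a =
    D.scx V s ((chr (D.rn s.1) c : ℂˣ) * a) * D.tor V c := by
  rw [← mul_inv_eq_iff_eq_mul]
  apply gv_injective
  rw [← cj_gv, gv_scx, cj_nexp _ ((D.re_isNilpotent V s).smul a), map_smul, D.cj_tor c (D.ewt_re s),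
    smul_smul, mul_comm, gv_scx]

theorem tor_mul_scy (c : D.S → ℂˣ) (s : D.S) (a : ℂ) : D.tor V c * D.scy V s a =
    D.scy V s (((chr (D.rn s.1) c)⁻¹ : ℂˣ) * a) * D.tor V c := by
  rw [← mul_inv_eq_iff_eq_mul]
  apply gv_injective
  rw [← cj_gv, gv_scy, cj_nexp _ ((D.rf_isNilpotent V s).smul a), map_smul, D.cj_tor c (D.ewt_rf s),
    smul_smul, mul_comm, gv_scy, chr_neg]

/-- The Cartan matrix. -/
def cm : Matrix D.S D.S ℤ := Matrix.of fun s t => D.rn s.1 t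

theorem det_cm_ne_zero : D.cm.det ≠ 0 := by
  have h := D.base.cartanMatrix_nondegenerate
  have : D.cm = D.base.cartanMatrix := by
    ext s t
    rfl
  rw [this]
  exact Matrix.nondegenerate_iff_det_ne_zero.mp h

theorem exists_zpow_eq {k : ℤ} (hk : k ≠ 0) (z : ℂˣ) : ∃ w : ℂˣ, w ^ k = z := by
  obtain ⟨w, hw⟩ := IsAlgClosed.exists_pow_nat_eq (z : ℂ) (Int.natAbs_pos.mpr hk)
  have hw0 : w ≠ 0 := by
    rintro rfl
    rw [zero_pow (Int.natAbs_ne_zero.mpr hk)] at hw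
    exact z.ne_zero hw.symm
  have h : (Units.mk0 w hw0) ^ k.natAbs = z := Units.ext (by simpa using hw)
  rcases Int.natAbs_eq k with h1 | h1
  · exact ⟨Units.mk0 w hw0, by rw [h1, zpow_natCast, h]⟩
  · exact ⟨(Units.mk0 w hw0)⁻¹, by rw [h1, zpow_neg, zpow_natCast, inv_pow, inv_inv, h]⟩

/-- Composition of monomial maps corresponds to multiplication of their exponent matrices. -/
theorem chr_chr (n : D.S → ℤ) (A : D.S → D.S → ℤ) (w : D.S → ℂˣ) :
    chr n (fun s => chr (A s) w) = chr (fun u => ∑ s, n s * A s u) w := by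
  simp only [chr_apply, ← Finset.prod_zpow]
  rw [Finset.prod_comm]
  refine Finset.prod_congr rfl fun u _ => ?_
  rw [← prod_zpow_eq]
  exact Finset.prod_congr rfl fun s _ => by rw [← zpow_mul, mul_comm]

/-- The simple roots are independent characters of the torus. -/
theorem exists_chr_eq (z : D.S → ℂˣ) : ∃ c : D.S → ℂˣ, ∀ t, chr (D.rn t.1) c = z t := by
  -- The adjugate inverts the Cartan matrix up to its determinant; this factor is removed by
  -- extracting roots of that order in `ℂˣ`.
  choose w hw using fun s => exists_zpow_eq D.det_cm_ne_zero (z s)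
  refine ⟨fun s => chr (fun u => D.cm.adjugate s u) w, fun t => ?_⟩
  have h : (fun u => ∑ s, D.rn t.1 s * D.cm.adjugate s u) = D.cm.det • Pi.single t 1 := by
    funext u
    have := congrFun (congrFun (Matrix.mul_adjugate D.cm) t) u
    rw [Matrix.mul_apply] at this
    refine this.trans ?_
    simp [Matrix.one_apply, Pi.single_apply, eq_comm]
  rw [chr_chr, h, chr_zsmul, chr_single, hw]

/-- A multiple of `ρ^∨`. The row sums of the adjugate pair with every simple root to `det`, and a
second factor `det` makes the common value the positive number `det²`. A root then pairs to its
height times this number. -/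
theorem exists_height_cochar : ∃ (n : D.S → ℤ) (N : ℕ), 0 < N ∧
    ∀ α : H.root, ∑ s, D.rn α s * n s = N * D.base.height α := by
  let n : D.S → ℤ := fun s => D.cm.det * ∑ u, D.cm.adjugate s u
  have hN : ((D.cm.det.natAbs ^ 2 : ℕ) : ℤ) = D.cm.det ^ 2 := by simp
  have hsimple : ∀ t : D.S, ∑ s, D.rn t.1 s * n s = D.cm.det ^ 2 := by
    intro t
    have h : ∀ u, ∑ s, D.cm t s * D.cm.adjugate s u = D.cm.det * (1 : Matrix D.S D.S ℤ) t u := by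
      intro u
      have := congrFun (congrFun (Matrix.mul_adjugate D.cm) t) u
      rwa [Matrix.mul_apply] at this
    calc ∑ s, D.rn t.1 s * n s = ∑ s, ∑ u, D.cm.det * (D.cm t s * D.cm.adjugate s u) := by
          refine Finset.sum_congr rfl fun s _ => ?_
          simp only [n, Finset.mul_sum]
          refine Finset.sum_congr rfl fun u _ => ?_
          change D.cm t s * _ = _
          ring
      _ = D.cm.det ^ 2 := by
          rw [Finset.sum_comm]
          simp only [← Finset.mul_sum, h]
          simp [Matrix.one_apply]; ring
  refine ⟨n, D.cm.det.natAbs ^ 2, pow_pos (Int.natAbs_pos.mpr D.det_cm_ne_zero) 2, fun α => ?_⟩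
  rw [hN]
  let φ : Dual ℂ H →ₗ[ℂ] ℂ := ∑ s, (n s : ℂ) • Dual.eval ℂ H (coroot s.1.1)
  have hφ : ∀ β : H.root, φ ((rootSystem H).root β) = ((∑ s, D.rn β s * n s : ℤ) : ℂ) := by
    intro β
    simp only [φ, LinearMap.sum_apply, LinearMap.smul_apply, Dual.eval_apply,
      rootSystem_root_apply, Int.cast_sum, Int.cast_mul, rn_cast, smul_eq_mul]
    exact Finset.sum_congr rfl fun s _ => mul_comm _ _
  have hh : φ = (D.cm.det ^ 2 : ℂ) • heightForm D.base := by
    apply D.base.toWeightBasis.ext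
    intro t
    rw [RootPairing.Base.toWeightBasis_apply, hφ, hsimple, LinearMap.smul_apply, heightForm_root,
      D.base.height_one_of_mem_support t.2]
    simp
  have := hφ α
  rw [hh, LinearMap.smul_apply, heightForm_root, smul_eq_mul] at this
  exact_mod_cast this.symm

end Splitting

end Pinnings

end

/-! ### Families polynomial in a power of a parameter -/

noncomputable section

namespace Pinnings

open scoped Classical

set_option linter.unusedSectionVars false

section IsPol

variable {A : Type*} [Ring A] [Algebra ℂ A]

/-- `F a` is a polynomial in `a ^ N` with constant term `c`. -/
def IsPol (N : ℕ) (F : ℂˣ → A) (c : A) : Prop :=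
  ∃ p : Polynomial A, p.coeff 0 = c ∧ ∀ a : ℂˣ, F a = p.eval (algebraMap ℂ A ((a : ℂ) ^ N))

/-- Over a noncommutative ring, evaluation is multiplicative at central points. -/
theorem eval_algebraMap_mul (p q : Polynomial A) (z : ℂ) : (p * q).eval (algebraMap ℂ A z) =
    p.eval (algebraMap ℂ A z) * q.eval (algebraMap ℂ A z) :=
  Polynomial.eval₂_mul_noncomm (RingHom.id A) _ fun _ => (Algebra.commutes z _).symm

theorem IsPol.const (N : ℕ) (c : A) : IsPol N (fun _ => c) c :=
  ⟨Polynomial.C c, by simp, fun a => by simp⟩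

theorem IsPol.mul {N : ℕ} {F G : ℂˣ → A} {c d : A} (hF : IsPol N F c) (hG : IsPol N G d) :
    IsPol N (fun a => F a * G a) (c * d) := by
  obtain ⟨p, hp, hp'⟩ := hF
  obtain ⟨q, hq, hq'⟩ := hG
  exact ⟨p * q, by rw [Polynomial.mul_coeff_zero, hp, hq], fun a => by
    rw [eval_algebraMap_mul, ← hp', ← hq']⟩

theorem IsPol.add {N : ℕ} {F G : ℂˣ → A} {c d : A} (hF : IsPol N F c) (hG : IsPol N G d) :
    IsPol N (fun a => F a + G a) (c + d) := by
  obtain ⟨p, hp, hp'⟩ := hF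
  obtain ⟨q, hq, hq'⟩ := hG
  exact ⟨p + q, by rw [Polynomial.coeff_add, hp, hq], fun a => by
    rw [Polynomial.eval_add, ← hp', ← hq']⟩

theorem IsPol.smul {N : ℕ} {F : ℂˣ → A} {c : A} (hF : IsPol N F c) (z : ℂ) :
    IsPol N (fun a => z • F a) (z • c) := by
  have := (IsPol.const N (algebraMap ℂ A z)).mul hF
  simpa only [← Algebra.smul_def] using this

theorem IsPol.sum {ι : Type*} (σ : Finset ι) {N : ℕ} {F : ι → ℂˣ → A} {c : ι → A}
    (h : ∀ i ∈ σ, IsPol N (F i) (c i)) : IsPol N (fun a => ∑ i ∈ σ, F i a) (∑ i ∈ σ, c i) := by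
  induction σ using Finset.induction_on with
  | empty => simpa using IsPol.const N (0 : A)
  | insert i σ hi ih =>
    simp only [Finset.sum_insert hi]
    exact (h i (Finset.mem_insert_self i σ)).add
      (ih fun j hj => h j (Finset.mem_insert_of_mem hj))

theorem IsPol.pow {N : ℕ} {F : ℂˣ → A} {c : A} (hF : IsPol N F c) (k : ℕ) :
    IsPol N (fun a => F a ^ k) (c ^ k) := by
  induction k with
  | zero => simpa using IsPol.const N (1 : A)
  | succ k ih =>
    simp only [pow_succ]
    exact ih.mul hF

theorem IsPol.monomial {N k : ℕ} (hk : 0 < k) (c : A) :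
    IsPol N (fun a => ((a : ℂ) ^ (N * k)) • c) 0 := by
  refine ⟨Polynomial.monomial k c, ?_, fun a => ?_⟩
  · rw [Polynomial.coeff_monomial, if_neg hk.ne']
  · rw [Polynomial.eval_monomial, ← map_pow, ← Algebra.commutes, ← Algebra.smul_def, ← pow_mul]

/-- A common bound on the order of nilpotency makes the exponential one fixed polynomial in `F a`;
its constant term only sees the summand of degree zero. -/
theorem IsPol.nexp {N : ℕ} {F : ℂˣ → A} (hF : IsPol N F 0) {n : ℕ} (hn : ∀ a, F a ^ n = 0) :
    IsPol N (fun a => nexp (F a)) 1 := by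
  have hn' : ∀ a, F a ^ (n + 1) = 0 := fun a => by rw [pow_succ, hn, zero_mul]
  have h := IsPol.sum (Finset.range (n + 1)) fun i _ => (hF.pow i).smul ((i.factorial : ℂ)⁻¹)
  have h1 : ∑ i ∈ Finset.range (n + 1), ((i.factorial : ℂ)⁻¹) • (0 : A) ^ i = 1 := by
    rw [Finset.sum_eq_single 0]
    · simp
    · intro i _ hi
      rw [zero_pow hi, smul_zero]
    · simp
  rw [h1] at h
  convert h using 2 with a
  exact nexp_eq_sum (hn' a)

theorem eval_units_eq_sum (p : Polynomial A) {M : ℕ} (hM : p.natDegree < M) (z : ℂˣ) :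
    p.eval (algebraMap ℂ A (z : ℂ)) =
      ∑ k ∈ Finset.range M, ((z ^ (k : ℤ) : ℂˣ) : ℂ) • p.coeff k := by
  rw [Polynomial.eval_eq_sum_range' hM]
  refine Finset.sum_congr rfl fun k _ => ?_
  rw [← map_pow, ← Algebra.commutes, ← Algebra.smul_def, zpow_natCast, Units.val_pow_eq_pow_val]

theorem exists_units_pow_eq {N : ℕ} (hN : 0 < N) (z : ℂˣ) : ∃ w : ℂˣ, w ^ N = z := by
  obtain ⟨w, hw⟩ := IsAlgClosed.exists_pow_nat_eq (z : ℂ) hN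
  have hw0 : w ≠ 0 := by
    rintro rfl
    rw [zero_pow hN.ne'] at hw
    exact z.ne_zero hw.symm
  exact ⟨Units.mk0 w hw0, Units.ext (by simpa using hw)⟩

/-- A family that is polynomial both in `a` and in `a⁻¹` is constant. -/
theorem coeff_eq_zero_of_eval_eq_eval_inv {p q : Polynomial A}
    (h : ∀ z : ℂˣ, p.eval (algebraMap ℂ A (z : ℂ)) = q.eval (algebraMap ℂ A ((z⁻¹ : ℂˣ) : ℂ)))
    {k : ℕ} (hk : 0 < k) : p.coeff k = 0 := by
  let M := max p.natDegree (max q.natDegree k) + 1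
  have hp : p.natDegree < M := Nat.lt_succ_of_le (le_max_left _ _)
  have hq : q.natDegree < M := Nat.lt_succ_of_le ((le_max_left _ _).trans (le_max_right _ _))
  have hkM : k < M := Nat.lt_succ_of_le ((le_max_right _ _).trans (le_max_right _ _))
  -- The coefficients of the Laurent polynomial `p(z) - q(z⁻¹)`, which vanishes identically.
  let f : ℤ → A := fun j => (if 0 ≤ j then p.coeff j.toNat else 0) -
    (if j ≤ 0 then q.coeff (-j).toNat else 0)
  have hsum : ∀ z : ℂˣ, ∑ j ∈ Finset.Ioo (-(M : ℤ)) M, ((z ^ j : ℂˣ) : ℂ) • f j = 0 := by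
    intro z
    have h1 : ∑ j ∈ Finset.Ioo (-(M : ℤ)) M,
        ((z ^ j : ℂˣ) : ℂ) • (if 0 ≤ j then p.coeff j.toNat else 0) =
        p.eval (algebraMap ℂ A (z : ℂ)) := by
      rw [eval_units_eq_sum p hp]
      symm
      refine Finset.sum_of_injOn (fun k : ℕ => (k : ℤ)) (fun a _ b _ hab => by simpa using hab)
        (fun a ha => ?_) (fun j hj hj' => ?_) (fun a ha => by simp)
      · simp only [Finset.coe_range, Set.mem_Iio, Finset.coe_Ioo, Set.mem_Ioo] at ha ⊢
        omega
      · rw [if_neg, smul_zero]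
        intro h0
        apply hj'
        refine ⟨j.toNat, ?_, Int.toNat_of_nonneg h0⟩
        simp only [Finset.mem_Ioo] at hj
        simp only [Finset.coe_range, Set.mem_Iio]
        omega
    have h2 : ∑ j ∈ Finset.Ioo (-(M : ℤ)) M,
        ((z ^ j : ℂˣ) : ℂ) • (if j ≤ 0 then q.coeff (-j).toNat else 0) =
        q.eval (algebraMap ℂ A ((z⁻¹ : ℂˣ) : ℂ)) := by
      rw [eval_units_eq_sum q hq]
      symm
      refine Finset.sum_of_injOn (fun k : ℕ => -(k : ℤ)) (fun a _ b _ hab => by simpa using hab)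
        (fun a ha => ?_) (fun j hj hj' => ?_) (fun a ha => by simp)
      · simp only [Finset.coe_range, Set.mem_Iio, Finset.coe_Ioo, Set.mem_Ioo] at ha ⊢
        omega
      · rw [if_neg, smul_zero]
        intro h0
        apply hj'
        refine ⟨(-j).toNat, ?_, by simp only [Int.toNat_of_nonneg (neg_nonneg.mpr h0)]; omega⟩
        simp only [Finset.mem_Ioo] at hj
        simp only [Finset.coe_range, Set.mem_Iio]
        omega
    simp only [f, smul_sub, Finset.sum_sub_distrib, h1, h2, h z, sub_self]
  have := eq_zero_of_sum_zpow_smul _ f hsum (k : ℤ) (by simp only [Finset.mem_Ioo]; omega)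
  simpa [f, hk.ne'] using this

/-- Polynomial in `a^N` and in `a^{-N}` at once leaves only the constant term. This stands in for
the triviality of `U⁺ ∩ T U⁻`; every nonzero number is some `a^N`, so the exponent `N` does no harm.
-/
theorem IsPol.eq_const {N : ℕ} (hN : 0 < N) {F : ℂˣ → A} {c d : A} (hF : IsPol N F c)
    (hG : IsPol N (fun a => F a⁻¹) d) (a : ℂˣ) : F a = c := by
  obtain ⟨p, hp, hp'⟩ := hF
  obtain ⟨q, hq, hq'⟩ := hG
  have h : ∀ z : ℂˣ,
      p.eval (algebraMap ℂ A (z : ℂ)) = q.eval (algebraMap ℂ A ((z⁻¹ : ℂˣ) : ℂ)) := by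
    intro z
    obtain ⟨w, rfl⟩ := exists_units_pow_eq hN z
    have h1 := hp' w
    have h2 := hq' w⁻¹
    simp only [inv_inv] at h2
    rw [← inv_pow, Units.val_pow_eq_pow_val, Units.val_pow_eq_pow_val, ← h1, ← h2]
  have h0 : p = Polynomial.C c := by
    ext k
    rcases Nat.eq_zero_or_pos k with rfl | hk
    · rw [hp, Polynomial.coeff_C_zero]
    · rw [coeff_eq_zero_of_eval_eq_eval_inv h hk, Polynomial.coeff_C_of_ne_zero hk.ne']
  rw [hp', h0, Polynomial.eval_C]

/-- The values `a^N` exhaust `ℂˣ`, so they determine a polynomial. -/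
theorem eq_of_forall_eval_eq {N : ℕ} (hN : 0 < N) {p q : Polynomial A}
    (h : ∀ a : ℂˣ, p.eval (algebraMap ℂ A ((a : ℂ) ^ N)) =
      q.eval (algebraMap ℂ A ((a : ℂ) ^ N))) : p = q := by
  let M := max p.natDegree q.natDegree + 1
  have hp : p.natDegree < M := Nat.lt_succ_of_le (le_max_left _ _)
  have hq : q.natDegree < M := Nat.lt_succ_of_le (le_max_right _ _)
  have hs : ∀ z : ℂˣ, ∑ j ∈ (Finset.range M).map Nat.castEmbedding,
      ((z ^ j : ℂˣ) : ℂ) • (p - q).coeff (j : ℤ).toNat = 0 := by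
    intro z
    obtain ⟨w, rfl⟩ := exists_units_pow_eq hN z
    have h1 := h w
    rw [← Units.val_pow_eq_pow_val, eval_units_eq_sum p hp, eval_units_eq_sum q hq, ← sub_eq_zero,
      ← Finset.sum_sub_distrib] at h1
    rw [Finset.sum_map, ← h1]
    refine Finset.sum_congr rfl fun k _ => ?_
    rw [← smul_sub, ← Polynomial.coeff_sub]
    rfl
  ext k
  by_cases hk : k < M
  · have := eq_zero_of_sum_zpow_smul _ (fun j => (p - q).coeff (j : ℤ).toNat) hs (k : ℤ)
      (Finset.mem_map.mpr ⟨k, Finset.mem_range.mpr hk, rfl⟩)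
    rw [Int.toNat_natCast, Polynomial.coeff_sub, sub_eq_zero] at this
    exact this
  · rw [Polynomial.coeff_eq_zero_of_natDegree_lt (hp.trans_le (not_lt.mp hk)),
      Polynomial.coeff_eq_zero_of_natDegree_lt (hq.trans_le (not_lt.mp hk))]

end IsPol

end Pinnings

end

/-! ### The unipotent radical and its contraction by a regular cocharacter -/

noncomputable section

namespace Pinnings

open scoped Classical

set_option linter.unusedSectionVars false

variable {L : Type*} [LieRing L] [LieAlgebra ℂ L] [FiniteDimensional ℂ L] [IsKilling ℂ L]
variable {H : LieSubalgebra ℂ L} [H.IsCartanSubalgebra]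
variable {V : Type*} [AddCommGroup V] [Module ℂ V] [FiniteDimensional ℂ V]
  [LieRingModule L V] [LieModule ℂ L V]

theorem mul_rexp_mul_inv {g : SCGroup H V} {χ ψ : H → ℂ} (hχ : χ ≠ 0) (hψ : ψ ≠ 0) {x y : L}
    (hx : x ∈ rootSpace H χ) (hy : y ∈ rootSpace H ψ) (h : cj g (rho V x) = rho V y) :
    g * rexp hχ hx * g⁻¹ = rexp hψ hy := by
  apply gv_injective
  rw [← cj_gv, gv_rexp, cj_nexp g (rho_isNilpotent V hχ hx), h, gv_rexp]

theorem rexp_inv {χ : H → ℂ} (hχ : χ ≠ 0) {x : L} (hx : x ∈ rootSpace H χ) :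
    (rexp hχ hx : SCGroup H V)⁻¹ = rexp hχ (Submodule.neg_mem _ hx : -x ∈ rootSpace H χ) := by
  apply gv_injective
  change nexp (-rho V x) = nexp (rho V (-x))
  rw [map_neg]

/-- Conjugation by an exponential preserves any subspace stable under the bracket. -/
theorem nexp_conj_mem {x : L} (hx : IsNilpotent (rho V x)) {N : Submodule ℂ L} {y : L}
    (hy : ⁅x, y⁆ ∈ N) (hN : ∀ z ∈ N, ⁅x, z⁆ ∈ N) :
    ∃ z ∈ N, nexp (rho V x) * rho V y * nexp (-rho V x) = rho V (y + z) := by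
  obtain ⟨n, hn⟩ := nexp_mul_mul_nexp_neg hx
  have h : ∀ i : ℕ, ∃ z ∈ N, ((comm (End ℂ V) (rho V x) : End ℂ (End ℂ V)) ^ (i + 1)) (rho V y) =
      rho V z := by
    intro i
    induction i with
    | zero => exact ⟨_, hy, by rw [zero_add, pow_one, comm_apply, rho_lie]⟩
    | succ i ih =>
      obtain ⟨z, hz, hz'⟩ := ih
      exact ⟨_, hN z hz, by rw [pow_succ', Module.End.mul_apply, hz', comm_apply, rho_lie]⟩
  choose z hz hz' using h
  refine ⟨∑ i ∈ Finset.range n, (((i + 1).factorial : ℂ)⁻¹) • z i,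
    Submodule.sum_mem _ fun i _ => Submodule.smul_mem _ _ (hz i), ?_⟩
  rw [hn (n + 1) (Nat.le_succ n), Finset.sum_range_succ', map_add, map_sum, add_comm]
  congr 1
  · simp
  · refine Finset.sum_congr rfl fun i _ => ?_
    rw [map_smul, hz']

namespace Splitting

variable (D : Splitting H)

/-- Simple coroots form a basis of `H`, so the weight condition need only be tested on them. -/
theorem mem_rootSpace_of_hc {α : H.root} {y : L} (h : ∀ s, ⁅D.hc s, y⁆ = (D.rn α s : ℂ) • y) :
    y ∈ rootSpace H (α.1 : H → ℂ) := by
  apply LieModule.weightSpace_le_genWeightSpace L (α.1 : H → ℂ)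
  rw [LieModule.mem_weightSpace]
  let f : H →ₗ[ℂ] L := (LieModule.toEnd ℂ L L : L →ₗ[ℂ] End ℂ L).flip y ∘ₗ H.subtype -
    (LieModule.Weight.toLinear ℂ H L α.1).smulRight y
  have hf : f = 0 := by
    apply D.base.toCoweightBasis.ext
    intro s
    rw [RootPairing.Base.toCoweightBasis_apply, rootSystem_coroot_apply]
    have := h s
    rw [rn_cast, ← sub_eq_zero] at this
    exact this
  intro k
  have := LinearMap.congr_fun hf k
  exact sub_eq_zero.mp this

theorem mem_rootSpace_of_ewt (hV : GeneratesWeightLattice H V) {α : H.root} {y : L}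
    (h : D.EWt (D.rn α) (rho V y)) : y ∈ rootSpace H (α.1 : H → ℂ) := by
  apply D.mem_rootSpace_of_hc
  intro s
  apply rho_injective V hV
  rw [rho_lie, map_smul]
  exact h s

theorem EWt.cj_scr {s : D.S} {n : D.S → ℤ} {X : End ℂ V} (hX : D.EWt n X) :
    D.EWt (n - n s • D.rn s.1) (cj (D.scr V s) X) := by
  intro t
  apply cj_injective (D.scr V s)⁻¹
  rw [map_sub, map_mul, map_mul, map_smul, cj_inv_cj, cj_scr_inv_rh]
  have h1 := hX t
  have h2 := hX s
  calc (D.rh V t - (D.rn s.1 t : ℂ) • D.rh V s) * X - X * (D.rh V t - (D.rn s.1 t : ℂ) • D.rh V s)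
      = (D.rh V t * X - X * D.rh V t) - (D.rn s.1 t : ℂ) • (D.rh V s * X - X * D.rh V s) := by
        rw [sub_mul, mul_sub, smul_mul_assoc, mul_smul_comm, smul_sub]; abel
    _ = _ := by
        rw [h1, h2, smul_smul, ← sub_smul]
        simp [mul_comm]

theorem rn_reflectionPerm (s : D.S) (α : H.root) :
    D.rn ((rootSystem H).reflectionPerm s.1 α) = D.rn α - D.rn α s • D.rn s.1 := by
  funext t
  have h : (rootSystem H).root ((rootSystem H).reflectionPerm s.1 α) =
      (rootSystem H).root α - (rootSystem H).pairing α s.1 • (rootSystem H).root s.1 := by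
    rw [RootPairing.root_reflectionPerm, RootPairing.reflection_apply_root]
  have h2 := LinearMap.congr_fun h (coroot t.1.1)
  rw [LinearMap.sub_apply, LinearMap.smul_apply, rootSystem_pairing_apply, ← rn_cast] at h2
  have h3 : ∀ β : H.root, (rootSystem H).root β (coroot t.1.1) = D.rn β t := fun β => by
    rw [rn_cast]; rfl
  rw [h3, h3, h3, smul_eq_mul] at h2
  rw [Pi.sub_apply, Pi.smul_apply, smul_eq_mul]
  exact_mod_cast h2

theorem exists_cj_scr (hV : GeneratesWeightLattice H V) (s : D.S) {α : H.root} {x : L}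
    (hx : x ∈ rootSpace H (α.1 : H → ℂ)) :
    ∃ y ∈ rootSpace H (((rootSystem H).reflectionPerm s.1 α).1 : H → ℂ),
      cj (D.scr V s) (rho V x) = rho V y := by
  obtain ⟨y, hy⟩ := cj_mem (D.scr V s) x
  refine ⟨y, D.mem_rootSpace_of_ewt hV ?_, hy.symm⟩
  rw [hy, rn_reflectionPerm]
  exact (D.ewt_of_mem hx).cj_scr

variable (V)

/-- The product of the lifts of the simple reflections along a word. -/
def scrw (l : List D.S) : SCGroup H V := (l.map (D.scr V)).prod

@[simp] theorem scrw_nil : D.scrw V [] = 1 := rfl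

@[simp] theorem scrw_cons (s : D.S) (l : List D.S) :
    D.scrw V (s :: l) = D.scr V s * D.scrw V l := by
  simp [scrw]

@[simp] theorem scrw_append (l m : List D.S) :
    D.scrw V (l ++ m) = D.scrw V l * D.scrw V m := by
  simp [scrw]

variable {V}

theorem exists_cj_scrw (hV : GeneratesWeightLattice H V) (l : List D.S) {α : H.root} {x : L}
    (hx : x ∈ rootSpace H (α.1 : H → ℂ)) :
    ∃ y ∈ rootSpace H ((wordPerm D.base l α).1 : H → ℂ),
      cj (D.scrw V l) (rho V x) = rho V y := by
  induction l with
  | nil => exact ⟨x, hx, cj_one _⟩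
  | cons s l ih =>
    obtain ⟨y, hy, hy'⟩ := ih
    obtain ⟨z, hz, hz'⟩ := D.exists_cj_scr (V := V) hV s hy
    refine ⟨z, ?_, ?_⟩
    · rwa [wordPerm_cons]
    · rw [scrw_cons, cj_mul, hy', hz']

/-- The coefficients of a dominant regular cocharacter. -/
def hn : D.S → ℤ := D.exists_height_cochar.choose

/-- The value of the dominant regular cocharacter on simple roots. -/
def hN : ℕ := D.exists_height_cochar.choose_spec.choose

theorem hN_pos : 0 < D.hN := D.exists_height_cochar.choose_spec.choose_spec.1

theorem sum_rn_hn (α : H.root) : ∑ s, D.rn α s * D.hn s = D.hN * D.base.height α :=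
  D.exists_height_cochar.choose_spec.choose_spec.2 α

variable (V)

/-- A dominant regular cocharacter. -/
def lam (a : ℂˣ) : SCGroup H V := D.tor V fun s => a ^ D.hn s

variable {V}

theorem cj_lam (a : ℂˣ) {n : D.S → ℤ} {X : End ℂ V} (hX : D.EWt n X) :
    cj (D.lam V a) X = ((a ^ (∑ s, n s * D.hn s) : ℂˣ) : ℂ) • X := by
  rw [lam, D.cj_tor _ hX, chr_zpow]

theorem cj_lam_rho (a : ℂˣ) {α : H.root} {x : L} (hx : x ∈ rootSpace H (α.1 : H → ℂ)) :
    cj (D.lam V a) (rho V x) = ((a ^ (D.hN * D.base.height α) : ℂˣ) : ℂ) • rho V x := by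
  rw [D.cj_lam a (D.ewt_of_mem hx), sum_rn_hn]

/-- Elements that contract to the identity under the regular cocharacter. -/
def Up (g : SCGroup H V) : Prop := IsPol D.hN (fun a => cj (D.lam V a) (gv g)) 1

/-- Elements that contract to the identity under the inverse of the regular cocharacter. -/
def Lo (g : SCGroup H V) : Prop := IsPol D.hN (fun a => cj (D.lam V a⁻¹) (gv g)) 1

variable {D}

theorem Up.mul {g k : SCGroup H V} (hg : D.Up g) (hk : D.Up k) : D.Up (g * k) := by
  have := IsPol.mul hg hk
  simpa only [Up, map_mul, mul_one] using this

theorem Lo.mul {g k : SCGroup H V} (hg : D.Lo g) (hk : D.Lo k) : D.Lo (g * k) := by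
  have := IsPol.mul hg hk
  simpa only [Lo, map_mul, mul_one] using this

variable (D) in
theorem Up.one : D.Up (1 : SCGroup H V) := by
  simpa only [Up, map_one] using IsPol.const D.hN (1 : End ℂ V)

variable (D) in
theorem Lo.one : D.Lo (1 : SCGroup H V) := by
  simpa only [Lo, map_one] using IsPol.const D.hN (1 : End ℂ V)

/-- Uniqueness in the Gauss decomposition. -/
theorem Up.eq_of_eq_mul {g k : SCGroup H V} (hg : D.Up g) (hk : D.Lo k) {c : D.S → ℂˣ}
    (h : g = D.tor V c * k) : g = 1 ∧ D.tor V c = 1 ∧ k = 1 := by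
  have hc : ∀ a, cj (D.lam V a) (gv (D.tor V c)) = gv (D.tor V c) := by
    intro a
    rw [cj_gv, lam, ← map_inv, ← map_mul, ← map_mul, mul_comm, inv_mul_cancel_left]
  -- The cocharacter commutes with the torus part, so through the right side the same family is
  -- polynomial in the inverse parameter.
  have hk' : IsPol D.hN (fun a => cj (D.lam V a⁻¹) (gv g)) (gv (D.tor V c)) := by
    have := (IsPol.const D.hN (gv (D.tor V c))).mul hk
    simpa only [h, map_mul, hc, mul_one] using this
  have h1 : g = 1 := by
    apply gv_injective
    apply cj_injective (D.lam V 1)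
    rw [map_one, map_one]
    exact IsPol.eq_const D.hN_pos hg hk' 1
  have hk1 : k = 1 := by
    have hk2 : k = D.tor V c⁻¹ := by
      rw [map_inv]
      exact eq_inv_of_mul_eq_one_right (h.symm.trans h1)
    have hc' : ∀ a, cj (D.lam V a) (gv (D.tor V c⁻¹)) = gv (D.tor V c⁻¹) := by
      intro a
      rw [cj_gv, lam, ← map_inv, ← map_mul, ← map_mul, mul_comm, inv_mul_cancel_left]
    have hk3 : IsPol D.hN (fun a => cj (D.lam V (a⁻¹)⁻¹) (gv k)) (gv k) := by
      simp only [hk2, hc']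
      exact IsPol.const _ _
    apply gv_injective
    apply cj_injective (D.lam V 1⁻¹)
    rw [map_one, map_one]
    exact IsPol.eq_const D.hN_pos hk hk3 1
  refine ⟨h1, ?_, hk1⟩
  rw [h1, hk1, mul_one] at h
  exact h.symm

variable (D)

/-- The sum of the root spaces of a set of roots. -/
def rsum (σ : Finset H.root) : Submodule ℂ L :=
  σ.sup fun α => (rootSpace H (α.1 : H → ℂ)).toSubmodule

theorem le_rsum {σ : Finset H.root} {α : H.root} (h : α ∈ σ) {x : L}
    (hx : x ∈ rootSpace H (α.1 : H → ℂ)) : x ∈ rsum σ :=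
  Finset.le_sup (f := fun α : H.root => (rootSpace H (α.1 : H → ℂ)).toSubmodule) h hx

theorem rsum_induction {σ : Finset H.root} {p : L → Prop} (h0 : p 0)
    (hadd : ∀ x y, p x → p y → p (x + y))
    (h : ∀ α ∈ σ, ∀ x ∈ rootSpace H (α.1 : H → ℂ), p x) {x : L} (hx : x ∈ rsum σ) : p x := by
  rw [rsum, Finset.sup_eq_iSup] at hx
  refine Submodule.iSup_induction _ (motive := p) hx (fun α x hx => ?_) h0 hadd
  by_cases hα : α ∈ σ
  · rw [iSup_pos hα] at hx
    exact h α hα x hx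
  · rw [iSup_neg hα] at hx
    rw [(Submodule.mem_bot ℂ).mp hx]
    exact h0

/-- The positive roots. -/
def posRoots : Finset H.root := Finset.univ.filter D.base.IsPos

theorem mem_posRoots {α : H.root} : α ∈ D.posRoots ↔ D.base.IsPos α := by
  simp [posRoots]

/-- A bracket of root vectors has weight `α + β`; if nonzero, that weight is a root, which the
closure hypothesis puts in `σ`. -/
theorem lie_mem_rsum_of_add_ne_zero {σ : Finset H.root} {α : H.root}
    (hσ : ∀ β ∈ σ, (rootSystem H).root α + (rootSystem H).root β ≠ 0)
    (h : ∀ β ∈ σ, ∀ γ : H.root, (rootSystem H).root γ = (rootSystem H).root α +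
      (rootSystem H).root β → γ ∈ σ) {x y : L} (hx : x ∈ rootSpace H (α.1 : H → ℂ))
    (hy : y ∈ rsum σ) : ⁅x, y⁆ ∈ rsum σ := by
  refine rsum_induction (p := fun y => ⁅x, y⁆ ∈ rsum σ) ?_ (fun y z hy hz => ?_) ?_ hy
  · rw [lie_zero]; exact zero_mem _
  · rw [lie_add]; exact add_mem hy hz
  intro β hβ y hy
  have h1 := LieAlgebra.lie_mem_genWeightSpace_of_mem_genWeightSpace hx hy
  by_cases h0 : ⁅x, y⁆ = 0
  · rw [h0]; exact zero_mem _
  have hne : rootSpace H ((α.1 : H → ℂ) + (β.1 : H → ℂ)) ≠ ⊥ := by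
    intro hb
    have h2 : ⁅x, y⁆ ∈ rootSpace H ((α.1 : H → ℂ) + (β.1 : H → ℂ)) := h1
    rw [hb] at h2
    exact h0 ((LieSubmodule.mem_bot _).mp h2)
  let χ : LieModule.Weight ℂ H L := ⟨(α.1 : H → ℂ) + (β.1 : H → ℂ), hne⟩
  have hχ : χ.toLinear = (rootSystem H).root α + (rootSystem H).root β := by
    ext k
    rfl
  have hχ0 : χ.IsNonZero := by
    intro hz
    have hz' : (χ : H → ℂ) = 0 := hz
    apply hσ β hβ
    rw [← hχ]
    ext k
    exact congrFun hz' k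
  let γ : H.root := ⟨χ, by simpa using hχ0⟩
  exact le_rsum (h β hβ γ hχ) h1

theorem lie_mem_rsum {σ : Finset H.root} {α : H.root} (hα : D.base.IsPos α)
    (hσ : ∀ β ∈ σ, D.base.IsPos β)
    (h : ∀ β ∈ σ, ∀ γ : H.root, (rootSystem H).root γ = (rootSystem H).root α +
      (rootSystem H).root β → γ ∈ σ) {x y : L} (hx : x ∈ rootSpace H (α.1 : H → ℂ))
    (hy : y ∈ rsum σ) : ⁅x, y⁆ ∈ rsum σ := by
  refine lie_mem_rsum_of_add_ne_zero (fun β hβ h2 => ?_) h hx hy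
  have h3 := congrArg (heightForm D.base) h2
  rw [map_add, heightForm_root, heightForm_root, map_zero] at h3
  have h4 : D.base.height α + D.base.height β = 0 := by exact_mod_cast h3
  have h5 := hσ β hβ
  rw [RootPairing.Base.isPos_iff] at hα h5
  omega

theorem height_add' {α β γ : H.root} (h : (rootSystem H).root γ = (rootSystem H).root α +
    (rootSystem H).root β) : D.base.height γ = D.base.height α + D.base.height β := by
  have h3 := congrArg (heightForm D.base) h
  rw [map_add, heightForm_root, heightForm_root, heightForm_root] at h3
  exact_mod_cast h3

theorem lie_mem_rsum_posRoots {x y : L} (hx : x ∈ rsum D.posRoots) (hy : y ∈ rsum D.posRoots) :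
    ⁅x, y⁆ ∈ rsum D.posRoots := by
  refine rsum_induction (p := fun x => ⁅x, y⁆ ∈ rsum D.posRoots) ?_ (fun y z hy hz => ?_) ?_ hx
  · rw [zero_lie]; exact zero_mem _
  · rw [add_lie]; exact add_mem hy hz
  intro α hα x hx
  rw [mem_posRoots] at hα
  refine D.lie_mem_rsum hα (fun β hβ => D.mem_posRoots.mp hβ) (fun β hβ γ hγ => ?_) hx hy
  rw [mem_posRoots, RootPairing.Base.isPos_iff] at *
  have := D.height_add' hγ
  omega

/-- A regular element of the Cartan subalgebra. -/
def hreg : L := ∑ s, (D.hn s : ℂ) • D.hc s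

theorem lie_hreg {α : H.root} {x : L} (hx : x ∈ rootSpace H (α.1 : H → ℂ)) :
    ⁅D.hreg, x⁆ = ((D.hN * D.base.height α : ℤ) : ℂ) • x := by
  have h : ∀ s, ⁅(D.hn s : ℂ) • D.hc s, x⁆ = ((D.rn α s * D.hn s : ℤ) : ℂ) • x := fun s => by
    rw [smul_lie, D.lie_hc_of_mem hx, smul_smul]
    push_cast
    rw [mul_comm]
  rw [hreg, sum_lie]
  simp only [h]
  rw [← Finset.sum_smul, ← sum_rn_hn]
  push_cast
  rfl

theorem cj_rexp_self {χ : H → ℂ} (hχ : χ ≠ 0) {x : L} (hx : x ∈ rootSpace H χ) :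
    cj (rexp hχ hx : SCGroup H V) (rho V x) = rho V x := by
  rw [cj_eq_iff, gv_rexp]
  have := nexp_mul_self_comm 1 (rho_isNilpotent V hχ hx)
  rwa [one_smul] at this

theorem gv_inv_of_eq_nexp {g : SCGroup H V} {x : L} (hx : IsNilpotent (rho V x))
    (h : gv g = nexp (rho V x)) : gv g⁻¹ = nexp (-rho V x) := by
  rw [← mul_one (gv g⁻¹), ← nexp_mul_nexp_neg hx, ← h, ← mul_assoc, gv_inv_mul, one_mul]

theorem rexp_mem_scU {α : H.root} (hα : D.base.IsPos α) {x : L}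
    (hx : x ∈ rootSpace H (α.1 : H → ℂ)) : rexp (root_ne_zero α) hx ∈ D.scU V :=
  Subgroup.subset_closure ⟨α, hα, x, hx, rfl⟩

theorem rsum_insert (σ : Finset H.root) (α : H.root) :
    rsum (insert α σ) = (rootSpace H (α.1 : H → ℂ)).toSubmodule ⊔ rsum σ := Finset.sup_insert

/-- The unipotent group acts transitively on the translates of the regular element. -/
theorem exists_cj_hreg (c : ℕ) : ∀ σ : Finset H.root, σ.card = c →
    (∀ β ∈ σ, D.base.IsPos β) →
    (∀ β ∈ σ, ∀ α γ : H.root, D.base.IsPos α → (rootSystem H).root γ = (rootSystem H).root α +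
      (rootSystem H).root β → γ ∈ σ) → ∀ m ∈ rsum σ,
    ∃ u ∈ D.scU V, cj u (rho V (D.hreg + m)) = rho V D.hreg := by
  induction c with
  | zero =>
    intro σ hσ _ _ m hm
    rw [Finset.card_eq_zero.mp hσ] at hm
    have : m = 0 := (Submodule.mem_bot ℂ).mp hm
    exact ⟨1, one_mem _, by rw [this, add_zero, cj_one]⟩
  | succ c ih =>
    intro σ hσ hpos hcl m hm
    have hne : σ.Nonempty := Finset.card_pos.mp (by omega)
    -- Removing a root of minimal height keeps the set closed under adding positive roots, because
    -- such sums have larger height.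
    obtain ⟨β, hβ, hmin⟩ := Finset.exists_min_image σ D.base.height hne
    have hcl' : ∀ δ ∈ σ.erase β, ∀ α γ : H.root, D.base.IsPos α →
        (rootSystem H).root γ = (rootSystem H).root α + (rootSystem H).root δ →
          γ ∈ σ.erase β := by
      intro δ hδ α γ hα hγ
      refine Finset.mem_erase.mpr ⟨?_, hcl δ (Finset.mem_of_mem_erase hδ) α γ hα hγ⟩
      rintro rfl
      have h1 := D.height_add' hγ
      have h2 := hmin δ (Finset.mem_of_mem_erase hδ)
      rw [RootPairing.Base.isPos_iff] at hα
      omega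
    have hpos' : ∀ δ ∈ σ.erase β, D.base.IsPos δ := fun δ hδ => hpos δ (Finset.mem_of_mem_erase hδ)
    rw [← Finset.insert_erase hβ, rsum_insert, Submodule.mem_sup] at hm
    obtain ⟨x, hx, m', hm', rfl⟩ := hm
    -- The regular element acts on the root space of `β` by `N ht β`. With this scalar, `exp (z x)`
    -- sends it to itself minus `x` modulo nothing else, which cancels the component along `β`.
    let z : ℂ := (((D.hN * D.base.height β : ℤ) : ℂ))⁻¹
    have hz : z * ((D.hN * D.base.height β : ℤ) : ℂ) = 1 := by
      refine inv_mul_cancel₀ (Int.cast_ne_zero.mpr (mul_ne_zero ?_ ?_))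
      · exact_mod_cast D.hN_pos.ne'
      · have := hpos β hβ
        rw [RootPairing.Base.isPos_iff] at this
        exact this.ne'
    have hzx : z • x ∈ rootSpace H (β.1 : H → ℂ) := Submodule.smul_mem _ z hx
    let g : SCGroup H V := rexp (root_ne_zero β) hzx
    have hnil := rho_isNilpotent V (root_ne_zero β) hzx
    have hgi : gv g⁻¹ = nexp (-rho V (z • x)) := rfl
    have h1 : cj g (rho V D.hreg) = rho V (D.hreg - x) := by
      have hl : ⁅z • x, D.hreg⁆ = -x := by
        rw [smul_lie, ← lie_skew, D.lie_hreg hx, smul_neg, smul_smul, hz, one_smul]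
      obtain ⟨n, hn⟩ := nexp_mul_mul_nexp_neg hnil
      rw [cj_eq_iff, gv_rexp, nexp_mul_eq (z := rho V (-x)) (w := 0) hnil, add_zero, ← map_add,
        sub_eq_add_neg]
      · rw [← rho_lie, hl]
      · rw [← sub_eq_zero, ← rho_lie, smul_lie, lie_neg, lie_self]; simp
      · simp
    have h2 : cj g (rho V x) = rho V x := by
      have h := cj_rexp_self (V := V) (root_ne_zero β) hzx
      have hx2 : ((D.hN * D.base.height β : ℤ) : ℂ) • (z • x) = x := by
        rw [smul_smul, mul_comm, hz, one_smul]
      conv_lhs => rw [← hx2, map_smul, map_smul]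
      change _ • cj (rexp (root_ne_zero β) hzx) _ = _
      rw [h, ← map_smul, hx2]
    obtain ⟨m'', hm'', h3⟩ : ∃ m'' ∈ rsum (σ.erase β), cj g (rho V m') = rho V m'' := by
      have hst : ∀ w ∈ rsum (σ.erase β), ⁅z • x, w⁆ ∈ rsum (σ.erase β) := fun w hw =>
        D.lie_mem_rsum (hpos β hβ) hpos' (fun δ hδ γ hγ => hcl' δ hδ β γ (hpos β hβ) hγ) hzx hw
      obtain ⟨w, hw, hw'⟩ := nexp_conj_mem hnil (hst m' hm') hst
      exact ⟨m' + w, add_mem hm' hw, by rw [cj_apply, hgi, gv_rexp]; exact hw'⟩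
    obtain ⟨u, hu, hu'⟩ := ih (σ.erase β) (by rw [Finset.card_erase_of_mem hβ]; omega) hpos' hcl'
      m'' hm''
    refine ⟨u * g, mul_mem hu (D.rexp_mem_scU (hpos β hβ) hzx), ?_⟩
    have h4 : cj g (rho V (D.hreg + (x + m'))) = rho V (D.hreg + m'') := by
      rw [map_add, map_add (cj g), map_add, map_add (cj g), h1, h2, h3, ← map_add, ← map_add]
      congr 1
      abel
    rw [cj_mul, h4, hu']

theorem isPol_cj_lam_rho {n : L} (hn : n ∈ rsum D.posRoots) :
    IsPol D.hN (fun a => cj (D.lam V a) (rho V n)) 0 := by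
  refine rsum_induction (p := fun n => IsPol D.hN (fun a => cj (D.lam V a) (rho V n)) 0)
    ?_ (fun x y hx hy => ?_) (fun α hα x hx => ?_) hn
  · simpa using IsPol.const D.hN (0 : End ℂ V)
  · simpa using hx.add hy
  · rw [mem_posRoots, RootPairing.Base.isPos_iff] at hα
    obtain ⟨k, hk⟩ := Int.eq_ofNat_of_zero_le hα.le
    simp only [D.cj_lam_rho _ hx]
    have := IsPol.monomial (N := D.hN) (k := k) (by omega) (rho V x)
    convert this using 3 with a
    rw [hk, ← Int.natCast_mul, zpow_natCast, Units.val_pow_eq_pow_val]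

theorem up_of_eq_nexp {g : SCGroup H V} {n : L} (hn : n ∈ rsum D.posRoots)
    (hnil : IsNilpotent (rho V n)) (h : gv g = nexp (rho V n)) : D.Up g := by
  obtain ⟨k, hk⟩ := hnil
  have := (D.isPol_cj_lam_rho (V := V) hn).nexp (n := k) fun a => by
    rw [← map_pow, hk, map_zero]
  simp only [← cj_nexp _ (⟨k, hk⟩ : IsNilpotent (rho V n)), ← h] at this
  exact this

theorem lo_rexp {α : H.root} (hα : ¬ D.base.IsPos α) {x : L}
    (hx : x ∈ rootSpace H (α.1 : H → ℂ)) : D.Lo (rexp (root_ne_zero α) hx : SCGroup H V) := by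
  rw [RootPairing.Base.isPos_iff] at hα
  have hα0 := D.base.height_ne_zero α
  obtain ⟨k, hk⟩ := Int.eq_ofNat_of_zero_le (a := -D.base.height α) (by omega)
  obtain ⟨m, hm⟩ := rho_isNilpotent V (root_ne_zero α) hx
  have h1 : IsPol D.hN (fun a => cj (D.lam V a⁻¹) (rho V x)) 0 := by
    simp only [D.cj_lam_rho _ hx]
    have := IsPol.monomial (N := D.hN) (k := k) (by omega) (rho V x)
    convert this using 3 with a
    rw [inv_zpow, ← zpow_neg, ← mul_neg, hk, ← Int.natCast_mul, zpow_natCast,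
      Units.val_pow_eq_pow_val]
  have := h1.nexp (n := m) fun a => by rw [← map_pow, hm, map_zero]
  simp only [← cj_nexp _ (⟨m, hm⟩ : IsNilpotent (rho V x))] at this
  exact this

theorem up_of_mem {u : SCGroup H V} (hu : u ∈ D.scU V) : D.Up u := by
  have h : ∀ (α : H.root) (_ : D.base.IsPos α) (x : L) (hx : x ∈ rootSpace H (α.1 : H → ℂ)),
      D.Up (rexp (root_ne_zero α) hx : SCGroup H V) := fun α hα x hx =>
    D.up_of_eq_nexp (le_rsum (D.mem_posRoots.mpr hα) hx)
      (rho_isNilpotent V (root_ne_zero α) hx) rfl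
  rw [scU] at hu
  induction hu using Subgroup.closure_induction'' with
  | mem u hu =>
    obtain ⟨α, hα, x, hx, hu⟩ := hu
    have : u = rexp (root_ne_zero α) hx := Subtype.ext hu
    rw [this]
    exact h α hα x hx
  | inv_mem u hu =>
    obtain ⟨α, hα, x, hx, hu⟩ := hu
    have : u = rexp (root_ne_zero α) hx := Subtype.ext hu
    rw [this, rexp_inv]
    exact h α hα _ _
  | one => exact Up.one D
  | mul g k _ _ ihg ihk => exact ihg.mul ihk

theorem rho_hreg_apply {n : D.S → ℤ} {v : V} (hv : D.IsWt n v) :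
    rho V D.hreg v = ((∑ s, n s * D.hn s : ℤ) : ℂ) • v := by
  rw [hreg, map_sum, LinearMap.sum_apply]
  push_cast
  rw [Finset.sum_smul]
  refine Finset.sum_congr rfl fun s _ => ?_
  have := hv s
  rw [rh] at this
  rw [map_smul, LinearMap.smul_apply, this, smul_smul, mul_comm]

theorem gv_lam_apply (a : ℂˣ) {n : D.S → ℤ} {v : V} (hv : D.IsWt n v) :
    gv (D.lam V a) v = ((a ^ (∑ s, n s * D.hn s) : ℂˣ) : ℂ) • v := by
  rw [lam, D.gv_tor_apply _ hv, chr_zpow]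

/-- Weight vectors span `V`, and on a weight vector the cocharacter acts by the power of `a` whose
exponent is the eigenvalue of `hreg`. -/
theorem exists_hreg_decomp (v : V) : ∃ f : ℤ →₀ V, (f.sum fun _ x => x) = v ∧
    ∀ k, rho V D.hreg (f k) = (k : ℂ) • f k ∧
      ∀ a, gv (D.lam V a) (f k) = ((a ^ k : ℂˣ) : ℂ) • f k := by
  have hv : v ∈ Submodule.span ℂ {v : V | ∃ n, D.IsWt n v} := by rw [span_isWt]; trivial
  induction hv using Submodule.span_induction with
  | mem v hv =>
    obtain ⟨n, hn⟩ := hv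
    refine ⟨Finsupp.single (∑ s, n s * D.hn s) v, Finsupp.sum_single_index rfl, fun k => ?_⟩
    by_cases hk : ∑ s, n s * D.hn s = k
    · subst hk
      rw [Finsupp.single_eq_same]
      exact ⟨D.rho_hreg_apply hn, fun a => D.gv_lam_apply a hn⟩
    · rw [Finsupp.single_apply, if_neg hk]
      simp
  | zero => exact ⟨0, rfl, by simp⟩
  | add x y _ _ ihx ihy =>
    obtain ⟨f, hf, hf'⟩ := ihx
    obtain ⟨g, hg, hg'⟩ := ihy
    refine ⟨f + g, ?_, fun k => ⟨?_, fun a => ?_⟩⟩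
    · rw [Finsupp.sum_add_index' (fun _ => rfl) (fun _ _ _ => rfl), hf, hg]
    · rw [Finsupp.add_apply, map_add, smul_add, (hf' k).1, (hg' k).1]
    · rw [Finsupp.add_apply, map_add, smul_add, (hf' k).2, (hg' k).2]
  | smul z x _ ih =>
    obtain ⟨f, hf, hf'⟩ := ih
    refine ⟨z • f, ?_, fun k => ⟨?_, fun a => ?_⟩⟩
    · rw [Finsupp.sum_smul_index' (fun _ => rfl), ← hf, Finsupp.smul_sum]
    · rw [Finsupp.smul_apply, map_smul, (hf' k).1, smul_comm]
    · rw [Finsupp.smul_apply, map_smul, (hf' k).2, smul_comm]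

/-- Eigenvectors of `hreg` for distinct eigenvalues are independent, so in the decomposition of `v`
only the component with eigenvalue `k` is nonzero. -/
theorem gv_lam_apply_of_hreg (a : ℂˣ) {k : ℤ} {v : V} (hv : rho V D.hreg v = (k : ℂ) • v) :
    gv (D.lam V a) v = ((a ^ k : ℂˣ) : ℂ) • v := by
  obtain ⟨f, hf, hf'⟩ := D.exists_hreg_decomp v
  have hind := Module.End.eigenspaces_iSupIndep (rho V D.hreg)
  have hind' := hind.comp (show Function.Injective (fun k : ℤ => (k : ℂ)) from Int.cast_injective)
  rw [iSupIndep_iff_finsetSum_eq_zero_imp_eq_zero] at hind'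
  have h0 := hind' f.support (fun j => ((j : ℂ) - k) • f j) (fun j _ => by
    refine Submodule.smul_mem _ _ ?_
    rw [Function.comp_apply, Module.End.mem_eigenspace_iff]
    exact (hf' j).1) (by
    have h2 : rho V D.hreg v = ∑ j ∈ f.support, (j : ℂ) • f j := by
      conv_lhs => rw [← hf, Finsupp.sum, map_sum]
      exact Finset.sum_congr rfl fun j _ => (hf' j).1
    rw [Finsupp.sum] at hf
    simp only [sub_smul, Finset.sum_sub_distrib, ← h2, ← Finset.smul_sum, hf, hv, sub_self])
  rw [← hf, Finsupp.sum, map_sum, Finset.smul_sum]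
  refine Finset.sum_congr rfl fun j hj => ?_
  rw [(hf' j).2]
  rcases smul_eq_zero.mp (h0 j hj) with h | h
  · rw [Int.cast_inj.mp (sub_eq_zero.mp h)]
  · rw [h, smul_zero, smul_zero]

/-- The contraction of such an element is constant in `a`, hence equal to its limit `1`. -/
theorem Up.eq_one_of_comm {g : SCGroup H V} (hg : D.Up g)
    (h : ∀ a, D.lam V a * g = g * D.lam V a) : g = 1 := by
  have hc : ∀ a, cj (D.lam V a) (gv g) = gv g := fun a => by
    rw [cj_gv, h, mul_inv_cancel_right]
  apply gv_injective
  rw [map_one, ← hc 1]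
  refine IsPol.eq_const D.hN_pos hg (d := gv g) ?_ 1
  simp only [hc]
  exact IsPol.const _ _

/-- Commuting with `hreg` preserves its eigenspaces, and `lam` is determined by these; so the
element commutes with `lam`. -/
theorem Up.eq_one_of_hreg {g : SCGroup H V} (hg : D.Up g)
    (h : cj g (rho V D.hreg) = rho V D.hreg) : g = 1 := by
  refine Up.eq_one_of_comm D hg fun a => D.sc_ext fun n v hv => ?_
  rw [cj_eq_iff] at h
  have h1 : rho V D.hreg (gv g v) = ((∑ s, n s * D.hn s : ℤ) : ℂ) • gv g v := by
    rw [← Module.End.mul_apply, ← h, Module.End.mul_apply, D.rho_hreg_apply hv, map_smul]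
  rw [map_mul, map_mul, Module.End.mul_apply, Module.End.mul_apply,
    D.gv_lam_apply_of_hreg a h1, D.gv_lam_apply a hv, map_smul]

/-- The exponential of any sum of positive root vectors lies in the unipotent radical. -/
theorem mem_scU_of_eq_nexp {g : SCGroup H V} {n : L} (hn : n ∈ rsum D.posRoots)
    (hnil : IsNilpotent (rho V n)) (h : gv g = nexp (rho V n)) : g ∈ D.scU V := by
  have hh : ⁅n, D.hreg⁆ ∈ rsum D.posRoots := by
    refine rsum_induction (p := fun n => ⁅n, D.hreg⁆ ∈ rsum D.posRoots)
      ?_ (fun x y hx hy => ?_) (fun α hα x hx => ?_) hn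
    · rw [zero_lie]; exact zero_mem _
    · rw [add_lie]; exact add_mem hx hy
    · rw [← lie_skew, D.lie_hreg hx]
      exact neg_mem (Submodule.smul_mem _ _ (le_rsum hα hx))
  obtain ⟨z, hz, hz'⟩ := nexp_conj_mem hnil hh fun w hw => D.lie_mem_rsum_posRoots hn hw
  rw [← h, ← gv_inv_of_eq_nexp hnil h, ← cj_apply] at hz'
  -- The element `g` moves `hreg` by a sum of positive root vectors, and some `u` in the radical
  -- moves it back. Then `u g` contracts to `1` and fixes `hreg`, so `g = u⁻¹`.
  obtain ⟨u, hu, hu'⟩ := D.exists_cj_hreg (V := V) _ D.posRoots rfl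
    (fun β hβ => D.mem_posRoots.mp hβ) (fun β hβ α γ hα hγ => by
      rw [mem_posRoots, RootPairing.Base.isPos_iff] at *
      have := D.height_add' hγ
      omega) z hz
  rw [← hz', ← cj_mul] at hu'
  have h1 := Up.eq_one_of_hreg D ((D.up_of_mem hu).mul (D.up_of_eq_nexp hn hnil h)) hu'
  rw [eq_inv_of_mul_eq_one_right h1]
  exact inv_mem hu

end Splitting

end Pinnings

end

/-! ### Additive characters of the unipotent radical and the Borel subgroup -/

noncomputable section

namespace Pinnings

open scoped Classical

set_option linter.unusedSectionVars false

variable {L : Type*} [LieRing L] [LieAlgebra ℂ L] [FiniteDimensional ℂ L] [IsKilling ℂ L]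
variable {H : LieSubalgebra ℂ L} [H.IsCartanSubalgebra]
variable {V : Type*} [AddCommGroup V] [Module ℂ V] [FiniteDimensional ℂ V]
  [LieRingModule L V] [LieModule ℂ L V]

namespace Splitting

variable (D : Splitting H)

theorem e_ne_zero (s : D.S) : D.e s ≠ 0 := by
  intro h
  have h1 := D.lie_e_f s
  rw [h, zero_lie] at h1
  have h2 : (coroot s.1.1 : H) = 0 := Subtype.ext h1.symm
  exact H.isNonZero_coe_root s.1 (coroot_eq_zero_iff.mp h2)

theorem linearIndependent_e : LinearIndependent ℂ D.e := by
  have h := LieModule.iSupIndep_genWeightSpace ℂ H L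
  have h1 : Function.Injective fun s : D.S => (s.1.1 : H → ℂ) := fun s t hst =>
    Subtype.ext (Subtype.ext (DFunLike.coe_injective hst))
  have h2 := h.comp h1
  rw [← LieSubmodule.iSupIndep_toSubmodule] at h2
  exact h2.linearIndependent _ D.e_mem D.e_ne_zero

variable (V)

theorem exists_dual_re (hV : GeneratesWeightLattice H V) (s : D.S) :
    ∃ φ : End ℂ V →ₗ[ℂ] ℂ, ∀ t, φ (D.re V t) = if s = t then 1 else 0 := by
  have hli : LinearIndependent ℂ (D.re V) :=
    D.linearIndependent_e.map' (rho V) (LinearMap.ker_eq_bot.mpr (rho_injective V hV))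
  obtain ⟨φ, hφ⟩ := LinearMap.exists_extend ((Finsupp.lapply s).comp hli.repr)
  refine ⟨φ, fun t => ?_⟩
  have h := LinearMap.congr_fun hφ ⟨D.re V t, Submodule.subset_span ⟨t, rfl⟩⟩
  have h2 := hli.repr_eq_single t ⟨D.re V t, Submodule.subset_span ⟨t, rfl⟩⟩ rfl
  have h3 : φ (D.re V t) = hli.repr ⟨D.re V t, Submodule.subset_span ⟨t, rfl⟩⟩ s := h
  rw [h3, h2, Finsupp.single_apply]
  simp only [eq_comm]

variable {V}

/-- The part of degree one of an element of the unipotent radical. -/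
def linPart (g : SCGroup H V) : End ℂ V := if h : D.Up g then h.choose.coeff 1 else 0

/-- The polynomial that describes the contraction is determined by its values, so the choice in the
definition of `linPart` does not matter. -/
theorem linPart_eq {g : SCGroup H V} {p : Polynomial (End ℂ V)} (h0 : p.coeff 0 = 1)
    (hp : ∀ a : ℂˣ, cj (D.lam V a) (gv g) = p.eval (algebraMap ℂ _ ((a : ℂ) ^ D.hN))) :
    D.linPart g = p.coeff 1 := by
  have h : D.Up g := ⟨p, h0, hp⟩
  rw [linPart, dif_pos h]
  congr 1
  refine eq_of_forall_eval_eq D.hN_pos fun a => ?_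
  rw [← hp]
  exact (h.choose_spec.2 a).symm

/-- Both constant terms are `1`, so the coefficients of degree one add. -/
theorem linPart_mul {g k : SCGroup H V} (hg : D.Up g) (hk : D.Up k) :
    D.linPart (g * k) = D.linPart g + D.linPart k := by
  obtain ⟨p, hp, hp'⟩ := hg
  obtain ⟨q, hq, hq'⟩ := hk
  have hp2 : ∀ a : ℂˣ,
    cj (D.lam V a) (gv g) = p.eval (algebraMap ℂ _ ((a : ℂ) ^ D.hN)) := hp'
  have hq2 : ∀ a : ℂˣ,
    cj (D.lam V a) (gv k) = q.eval (algebraMap ℂ _ ((a : ℂ) ^ D.hN)) := hq'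
  rw [D.linPart_eq hp hp', D.linPart_eq hq hq', D.linPart_eq (p := p * q)]
  · rw [Polynomial.mul_coeff_one, hp, hq, one_mul, mul_one, add_comm]
  · rw [Polynomial.mul_coeff_zero, hp, hq, one_mul]
  · intro a
    rw [eval_algebraMap_mul, map_mul, map_mul, hp2, hq2]

/-- A simple root has height one, so the cocharacter multiplies `e_s` by `a^N`, and the degree-one
part is the linear term of the exponential. The range `n + 2` is large enough to contain the index
`1`. -/
theorem linPart_scx (s : D.S) (b : ℂ) : D.linPart (D.scx V s b) = b • D.re V s := by
  obtain ⟨n, hn⟩ := D.re_isNilpotent V s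
  have hn2 : ∀ z : ℂ, (z • D.re V s) ^ (n + 2) = 0 := fun z => by
    rw [smul_pow, pow_add (D.re V s), hn, zero_mul, smul_zero]
  have h := D.linPart_eq (g := D.scx V s b) (p := ∑ i ∈ Finset.range (n + 2),
    Polynomial.monomial i (((i.factorial : ℂ)⁻¹) • (b • D.re V s) ^ i)) ?_ ?_
  · rw [h, Polynomial.finsetSum_coeff, Finset.sum_eq_single 1]
    · simp
    · intro i _ hi
      rw [Polynomial.coeff_monomial, if_neg hi]
    · simp
  · rw [Polynomial.finsetSum_coeff, Finset.sum_eq_single 0]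
    · simp
    · intro i _ hi
      rw [Polynomial.coeff_monomial, if_neg hi]
    · simp
  · intro a
    have h1 : cj (D.lam V a) (b • D.re V s) = ((a : ℂ) ^ D.hN * b) • D.re V s := by
      rw [map_smul, re, D.cj_lam_rho a (D.e_mem s), D.base.height_one_of_mem_support s.2, mul_one,
        zpow_natCast, Units.val_pow_eq_pow_val, smul_smul, mul_comm]
    rw [gv_scx, cj_nexp _ ((D.re_isNilpotent V s).smul b), h1, nexp_eq_sum (hn2 _),
      Polynomial.eval_finsetSum]
    refine Finset.sum_congr rfl fun i _ => ?_
    rw [Polynomial.eval_monomial, ← map_pow, ← Algebra.commutes, ← Algebra.smul_def, mul_smul,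
      smul_pow ((a : ℂ) ^ D.hN), smul_comm]

theorem scx_injective (hV : GeneratesWeightLattice H V) (s : D.S) :
    Function.Injective (D.scx V s) := by
  intro a b hab
  have h := congrArg D.linPart hab
  rw [linPart_scx, linPart_scx] at h
  refine smul_left_injective ℂ ?_ h
  intro h0
  apply D.e_ne_zero s
  apply rho_injective V hV
  rw [map_zero]
  exact h0

/-- A central element is unchanged by the contraction. Consequently `U⁺` maps isomorphically to the
adjoint group. -/
theorem Up.eq_one_of_mem_center {u : SCGroup H V} (hu : D.Up u)
    (hz : u ∈ Subgroup.center (SCGroup H V)) : u = 1 :=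
  Up.eq_one_of_comm D hu fun _ => Subgroup.mem_center_iff.mp hz _

theorem proj_eq_iff {g k : SCGroup H V} :
    proj H V g = proj H V k ↔ g⁻¹ * k ∈ Subgroup.center (SCGroup H V) := QuotientGroup.eq

theorem proj_injOn {u v : SCGroup H V} (hu : u ∈ D.scU V) (hv : v ∈ D.scU V)
    (h : proj H V u = proj H V v) : u = v := by
  rw [proj_eq_iff] at h
  have := Up.eq_one_of_mem_center D (D.up_of_mem (mul_mem (inv_mem hu) hv)) h
  exact (inv_mul_eq_one.mp this)

variable (V)

/-- The coordinate along `e_s` of the degree-one part of the unique lift to `G̃` is a character with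
the required values, so the chosen `χ_s` has the defining properties. -/
theorem chi_spec (hV : GeneratesWeightLattice H V) (s : D.S) :
    (∀ u v, D.chi V s (u * v) = D.chi V s u + D.chi V s v) ∧
      ∀ (t : D.S) (a : ℂ), D.chi V s ⟨D.x V t a, D.x_mem_U V t a⟩ = if s = t then a else 0 := by
  obtain ⟨φ, hφ⟩ := D.exists_dual_re V hV s
  have hex : ∀ u : D.U V, ∃ v ∈ D.scU V, proj H V v = u := fun u => u.2
  choose f hf hf' using hex
  refine Classical.epsilon_spec (p := fun χ : D.U V → ℂ => (∀ u v, χ (u * v) = χ u + χ v) ∧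
    ∀ (t : D.S) (a : ℂ), χ ⟨D.x V t a, D.x_mem_U V t a⟩ = if s = t then a else 0)
    ⟨fun u => φ (D.linPart (f u)), fun u v => ?_, fun t a => ?_⟩
  · have : f (u * v) = f u * f v :=
      D.proj_injOn (hf _) (mul_mem (hf u) (hf v)) (by rw [map_mul, hf', hf', hf']; rfl)
    dsimp only
    rw [this, D.linPart_mul (D.up_of_mem (hf u)) (D.up_of_mem (hf v)), map_add]
  · have : f ⟨D.x V t a, D.x_mem_U V t a⟩ = D.scx V t a :=
      D.proj_injOn (hf _) (D.rexp_mem_scU (D.simple_isPos t)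
        (Submodule.smul_mem _ a (D.e_mem t))) (by rw [hf']; rfl)
    dsimp only
    rw [this, linPart_scx, map_smul, hφ]
    simp

theorem scx_mem_scU (s : D.S) (a : ℂ) : D.scx V s a ∈ D.scU V :=
  D.rexp_mem_scU (D.simple_isPos s) (Submodule.smul_mem _ a (D.e_mem s))

variable {V}

theorem exists_smul_e (s : D.S) {x : L} (hx : x ∈ rootSpace H (s.1.1 : H → ℂ)) :
    ∃ c : ℂ, x = c • D.e s := by
  have h := finrank_rootSpace_eq_one s.1.1 (H.isNonZero_coe_root s.1)
  obtain ⟨c, hc⟩ := (finrank_eq_one_iff_of_nonzero' (⟨D.e s, D.e_mem s⟩ :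
    rootSpace H (s.1.1 : H → ℂ)) (fun h0 => D.e_ne_zero s (congrArg Subtype.val h0))).mp h ⟨x, hx⟩
  exact ⟨c, (congrArg Subtype.val hc).symm⟩

theorem rexp_simple (s : D.S) {x : L} (hx : x ∈ rootSpace H (s.1.1 : H → ℂ)) :
    ∃ c : ℂ, (rexp (root_ne_zero s.1) hx : SCGroup H V) = D.scx V s c := by
  obtain ⟨c, rfl⟩ := D.exists_smul_e s hx
  exact ⟨c, rfl⟩

/-- Inverses of root elements are root elements, so no separate case for inverses is needed. -/
theorem scU_induction {p : SCGroup H V → Prop} (h1 : p 1) (hmul : ∀ g k, p g → p k → p (g * k))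
    (h : ∀ (α : H.root) (_ : D.base.IsPos α) (x : L) (hx : x ∈ rootSpace H (α.1 : H → ℂ)),
      p (rexp (root_ne_zero α) hx)) {u : SCGroup H V} (hu : u ∈ D.scU V) : p u := by
  rw [scU] at hu
  induction hu using Subgroup.closure_induction'' with
  | mem u hu =>
    obtain ⟨α, hα, x, hx, hu⟩ := hu
    have : u = rexp (root_ne_zero α) hx := Subtype.ext hu
    rw [this]
    exact h α hα x hx
  | inv_mem u hu =>
    obtain ⟨α, hα, x, hx, hu⟩ := hu
    have : u = rexp (root_ne_zero α) hx := Subtype.ext hu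
    rw [this, rexp_inv]
    exact h α hα _ _
  | one => exact h1
  | mul g k _ _ ihg ihk => exact hmul g k ihg ihk

theorem f_mem' (s : D.S) : D.f s ∈ rootSpace H
    (((rootSystem H).reflectionPerm s.1 s.1).1 : H → ℂ) := by
  have h : (rootSystem H).root ((rootSystem H).reflectionPerm s.1 s.1) =
      -(rootSystem H).root s.1 := root_reflectionPerm_self s.1
  have h2 : (((rootSystem H).reflectionPerm s.1 s.1).1 : H → ℂ) = -(s.1.1 : H → ℂ) := by
    funext k
    exact LinearMap.congr_fun h k
  rw [h2]
  exact D.f_mem s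

/-- Root elements for positive roots other than `α_s` are conjugated into the unipotent radical
by the parabolic subgroup of `s`. -/
theorem scy_conj_rexp_mem (s : D.S) (b : ℂ) {α : H.root} (hα : D.base.IsPos α) (hs : α ≠ s.1)
    {x : L} (hx : x ∈ rootSpace H (α.1 : H → ℂ)) :
    D.scy V s b * rexp (root_ne_zero α) hx * (D.scy V s b)⁻¹ ∈ D.scU V := by
  have hfs : b • D.f s ∈ rootSpace H (((rootSystem H).reflectionPerm s.1 s.1).1 : H → ℂ) :=
    Submodule.smul_mem _ b (D.f_mem' s)
  -- Adding `-α_s` to a positive root `β ≠ α_s` gives neither `0` nor, since `2 α_s` is not a root,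
  -- `α_s`. If it gives a root, the height `ht β - 1` is nonnegative and nonzero, so the root is
  -- positive.
  have hst : ∀ w ∈ rsum (D.posRoots.erase s.1), ⁅b • D.f s, w⁆ ∈ rsum (D.posRoots.erase s.1) := by
    intro w hw
    refine lie_mem_rsum_of_add_ne_zero (fun β hβ h0 => ?_) (fun β hβ γ hγ => ?_) hfs hw
    · rw [root_reflectionPerm_self, neg_add_eq_zero] at h0
      exact Finset.ne_of_mem_erase hβ ((rootSystem H).root.injective h0.symm)
    · have hβ2 := Finset.mem_of_mem_erase hβ
      rw [root_reflectionPerm_self] at hγ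
      refine Finset.mem_erase.mpr ⟨?_, ?_⟩
      · rintro rfl
        have : IsAddTorsionFree (Dual ℂ H) := .of_isTorsionFree ℂ _
        apply RootPairing.nsmul_notMem_range_root (P := rootSystem H) (n := 2) (i := s.1)
        refine ⟨β, ?_⟩
        rw [two_nsmul]
        nth_rewrite 1 [hγ]
        abel
      · have h3 := congrArg (heightForm D.base) hγ
        rw [map_add, map_neg, heightForm_root, heightForm_root, heightForm_root,
          D.base.height_one_of_mem_support s.2] at h3
        have h4 : D.base.height γ = -1 + D.base.height β := by exact_mod_cast h3
        have h5 := D.base.height_ne_zero γ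
        rw [mem_posRoots, RootPairing.Base.isPos_iff] at *
        omega
  have hxs : x ∈ rsum (D.posRoots.erase s.1) :=
    le_rsum (Finset.mem_erase.mpr ⟨hs, D.mem_posRoots.mpr hα⟩) hx
  have hnil : IsNilpotent (rho V (b • D.f s)) := by
    rw [map_smul]; exact (D.rf_isNilpotent V s).smul b
  obtain ⟨z, hz, hz'⟩ := nexp_conj_mem hnil (hst x hxs) hst
  have hgv : gv (D.scy V s b) = nexp (rho V (b • D.f s)) := rfl
  rw [← hgv, ← gv_inv_of_eq_nexp hnil hgv, ← cj_apply] at hz'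
  have hle : rsum (D.posRoots.erase s.1) ≤ rsum D.posRoots :=
    Finset.sup_mono (Finset.erase_subset _ _)
  refine D.mem_scU_of_eq_nexp (n := x + z) (hle (add_mem hxs hz)) ?_ ?_
  · rw [← hz']
    exact isNilpotent_cj _ (rho_isNilpotent V (root_ne_zero α) hx)
  · rw [← cj_gv, gv_rexp, cj_nexp _ (rho_isNilpotent V (root_ne_zero α) hx), hz']

/-- The unipotent radical is the product of a simple root subgroup and of a subgroup
normalized by the corresponding reflection. -/
theorem exists_scU_split (hV : GeneratesWeightLattice H V) (s : D.S) {u : SCGroup H V}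
    (hu : u ∈ D.scU V) : ∃ (a : ℂ) (k : SCGroup H V), u = k * D.scx V s a ∧ k ∈ D.scU V ∧
      D.scr V s * k * (D.scr V s)⁻¹ ∈ D.scU V := by
  -- The condition is imposed for all `b`, so that `K` is normalized by `x_s` and the two factors of
  -- a product can be rearranged.
  let K : Subgroup (SCGroup H V) :=
    { carrier := {k | k ∈ D.scU V ∧ ∀ b, D.scr V s * (D.scx V s b * k * (D.scx V s b)⁻¹) *
        (D.scr V s)⁻¹ ∈ D.scU V}
      one_mem' := ⟨one_mem _, fun b => by simp [one_mem]⟩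
      mul_mem' := fun {g k} hg hk => ⟨mul_mem hg.1 hk.1, fun b => by
        have := mul_mem (hg.2 b) (hk.2 b)
        convert this using 1
        group⟩
      inv_mem' := fun {g} hg => ⟨inv_mem hg.1, fun b => by
        have := inv_mem (hg.2 b)
        convert this using 1
        group⟩ }
  have hK : ∀ (b : ℂ) (k : SCGroup H V), k ∈ K → D.scx V s b * k * (D.scx V s b)⁻¹ ∈ K := by
    intro b k hk
    refine ⟨mul_mem (mul_mem (D.scx_mem_scU V s b) hk.1) (inv_mem (D.scx_mem_scU V s b)),
      fun c => ?_⟩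
    have := hk.2 (c + b)
    rw [scx_add] at this
    convert this using 1
    group
  suffices h : ∃ (a : ℂ) (k : SCGroup H V), u = k * D.scx V s a ∧ k ∈ K by
    obtain ⟨a, k, rfl, hk⟩ := h
    refine ⟨a, k, rfl, hk.1, ?_⟩
    have := hk.2 0
    simpa using this
  refine D.scU_induction (p := fun u => ∃ (a : ℂ) (k : SCGroup H V),
    u = k * D.scx V s a ∧ k ∈ K) ⟨0, 1, by simp, one_mem _⟩ ?_ ?_ hu
  · rintro _ _ ⟨a, k, rfl, hk⟩ ⟨b, m, rfl, hm⟩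
    refine ⟨a + b, k * (D.scx V s a * m * (D.scx V s a)⁻¹), ?_, mul_mem hk (hK a m hm)⟩
    rw [scx_add]
    group
  · intro α hα x hx
    by_cases hs : α = s.1
    · subst hs
      obtain ⟨c, hc⟩ := D.rexp_simple (V := V) s hx
      exact ⟨c, 1, by rw [hc, one_mul], one_mem _⟩
    · refine ⟨0, rexp (root_ne_zero α) hx, by simp, D.rexp_mem_scU hα hx, fun b => ?_⟩
      obtain ⟨y, hy, hy'⟩ := D.exists_cj_scr (V := V) hV s hx
      have h1 := mul_rexp_mul_inv (root_ne_zero α) (root_ne_zero _) hx hy hy'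
      have hpos : D.base.IsPos ((rootSystem H).reflectionPerm s.1 α) := by
        by_contra hn
        exact hs (eq_of_isPos_of_not_isPos hα hn)
      have hne : (rootSystem H).reflectionPerm s.1 α ≠ s.1 := by
        intro he
        have h2 : α = (rootSystem H).reflectionPerm s.1 s.1 := by
          have h3 : ((rootSystem H).reflectionPerm s.1 * (rootSystem H).reflectionPerm s.1) α =
              α := by rw [reflectionPerm_mul_self]; rfl
          rw [Equiv.Perm.mul_apply, he] at h3
          exact h3.symm
        rw [h2, isPos_reflectionPerm_self_iff] at hα
        exact hα (D.simple_isPos s)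
      -- Since `r̄_s x_s(b) = y_s(-b) r̄_s`, the condition for `K` becomes conjugation of another
      -- positive root element by `y_s`.
      have h3 := D.scy_conj_rexp_mem (V := V) s (-b) hpos hne hy
      rw [← h1] at h3
      have h4 := D.scr_mul_scx V s b
      have h5 : D.scr V s * (D.scx V s b * rexp (root_ne_zero α) hx * (D.scx V s b)⁻¹) *
          (D.scr V s)⁻¹ = (D.scr V s * D.scx V s b) * rexp (root_ne_zero α) hx *
            (D.scr V s * D.scx V s b)⁻¹ := by group
      rw [h5, h4]
      convert h3 using 1
      group

theorem tor_conj_mem_scU (c : D.S → ℂˣ) {u : SCGroup H V} (hu : u ∈ D.scU V) :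
    D.tor V c * u * (D.tor V c)⁻¹ ∈ D.scU V := by
  refine D.scU_induction (p := fun u => D.tor V c * u * (D.tor V c)⁻¹ ∈ D.scU V) ?_ ?_ ?_ hu
  · simp [one_mem]
  · intro g k hg hk
    have := mul_mem hg hk
    convert this using 1
    group
  · intro α hα x hx
    have h := D.cj_tor c (D.ewt_of_mem (V := V) hx)
    rw [← map_smul] at h
    rw [mul_rexp_mul_inv (root_ne_zero α) (root_ne_zero α) hx (Submodule.smul_mem _ _ hx) h]
    exact D.rexp_mem_scU hα _

theorem tor_conj_mem_scU' (c : D.S → ℂˣ) {u : SCGroup H V} (hu : u ∈ D.scU V) :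
    (D.tor V c)⁻¹ * u * D.tor V c ∈ D.scU V := by
  have := D.tor_conj_mem_scU c⁻¹ hu
  rwa [map_inv, inv_inv] at this

variable (V)

/-- The Borel subgroup of the simply connected group. -/
def scB : Subgroup (SCGroup H V) where
  carrier := {g | ∃ (c : D.S → ℂˣ) (u : SCGroup H V), u ∈ D.scU V ∧ g = D.tor V c * u}
  one_mem' := ⟨1, 1, one_mem _, by simp⟩
  mul_mem' := by
    rintro _ _ ⟨c, u, hu, rfl⟩ ⟨d, v, hv, rfl⟩
    refine ⟨c * d, ((D.tor V d)⁻¹ * u * D.tor V d) * v, mul_mem (D.tor_conj_mem_scU' d hu) hv, ?_⟩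
    rw [map_mul]
    group
  inv_mem' := by
    rintro _ ⟨c, u, hu, rfl⟩
    refine ⟨c⁻¹, D.tor V c * u⁻¹ * (D.tor V c)⁻¹, D.tor_conj_mem_scU c (inv_mem hu), ?_⟩
    rw [map_inv]
    group

variable {V}

theorem mem_scB' {g : SCGroup H V} :
    g ∈ D.scB V ↔ ∃ (c : D.S → ℂˣ) (u : SCGroup H V), u ∈ D.scU V ∧ g = u * D.tor V c := by
  constructor
  · rintro ⟨c, u, hu, rfl⟩
    exact ⟨c, _, D.tor_conj_mem_scU c hu, by group⟩
  · rintro ⟨c, u, hu, rfl⟩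
    exact ⟨c, _, D.tor_conj_mem_scU' c hu, by group⟩

theorem scU_le_scB : D.scU V ≤ D.scB V := fun u hu => ⟨1, u, hu, by simp⟩

theorem tor_mem_scB (c : D.S → ℂˣ) : D.tor V c ∈ D.scB V := ⟨c, 1, one_mem _, by simp⟩

variable (V)

theorem B_eq_map : D.B V = (D.scB V).map (proj H V) := by
  have h : D.scB V = D.scT V ⊔ D.scU V := by
    apply le_antisymm
    · rintro _ ⟨c, u, hu, rfl⟩
      exact mul_mem (Subgroup.mem_sup_left (D.tor_mem_scT V c)) (Subgroup.mem_sup_right hu)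
    · refine sup_le ?_ D.scU_le_scB
      rw [scT_eq_range]
      rintro _ ⟨c, rfl⟩
      exact D.tor_mem_scB c
  rw [h, Subgroup.map_sup]
  rfl

end Splitting

end Pinnings

end

/-! ### Bruhat cells, the centre and the big cell -/

noncomputable section

namespace Pinnings

open scoped Classical

set_option linter.unusedSectionVars false

/-- If `x ^ (k + 2) = 0`, multiplying `exp x = 1` by `x ^ k` gives `x ^ (k + 1) = 0`; the order of
nilpotency descends to one. -/
theorem nexp_eq_one {A : Type*} [Ring A] [Algebra ℂ A] {x : A} (h : IsNilpotent x)
    (h1 : nexp x = 1) : x = 0 := by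
  obtain ⟨n, hn⟩ := h
  have key : ∀ k, x ^ (k + 1) = 0 → x = 0 := by
    intro k
    induction k with
    | zero => intro h; simpa using h
    | succ k ih =>
      intro h
      apply ih
      have h2 := congrArg (x ^ k * ·) (nexp_eq_sum h)
      simp only [h1, mul_one, Finset.mul_sum, mul_smul_comm, ← pow_add] at h2
      rw [Finset.sum_range_succ', Finset.sum_range_succ', Finset.sum_eq_zero] at h2
      · simpa using h2.symm
      · intro i _
        have : k + (i + 1 + 1) = (k + 1 + 1) + i := by ring
        rw [this, pow_add, h, zero_mul, smul_zero]
  cases n with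
  | zero =>
    rw [pow_zero] at hn
    rw [← mul_one x, hn, mul_zero]
  | succ n => exact key n hn

theorem wordPerm_neg {ι R M N : Type*} [Field R] [CharZero R] [AddCommGroup M] [Module R M]
    [AddCommGroup N] [Module R N] {P : RootPairing ι R M N} {b : P.Base} (l : List b.support)
    (i : ι) : wordPerm b l (P.reflectionPerm i i) =
      P.reflectionPerm (wordPerm b l i) (wordPerm b l i) := by
  apply P.root.injective
  rw [root_wordPerm, root_reflectionPerm_self, root_reflectionPerm_self, root_wordPerm, map_neg]

variable {L : Type*} [LieRing L] [LieAlgebra ℂ L] [FiniteDimensional ℂ L] [IsKilling ℂ L]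
variable {H : LieSubalgebra ℂ L} [H.IsCartanSubalgebra]
variable {V : Type*} [AddCommGroup V] [Module ℂ V] [FiniteDimensional ℂ V]
  [LieRingModule L V] [LieModule ℂ L V]

namespace Splitting

variable (D : Splitting H)

theorem EWt.cj_scr_inv {s : D.S} {n : D.S → ℤ} {X : End ℂ V} (hX : D.EWt n X) :
    D.EWt (n - n s • D.rn s.1) (cj (D.scr V s)⁻¹ X) := by
  intro t
  apply cj_injective (D.scr V s)
  rw [map_sub, map_mul, map_mul, map_smul, cj_cj_inv, cj_scr_rh]
  have h1 := hX t
  have h2 := hX s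
  calc (D.rh V t - (D.rn s.1 t : ℂ) • D.rh V s) * X - X * (D.rh V t - (D.rn s.1 t : ℂ) • D.rh V s)
      = (D.rh V t * X - X * D.rh V t) - (D.rn s.1 t : ℂ) • (D.rh V s * X - X * D.rh V s) := by
        rw [sub_mul, mul_sub, smul_mul_assoc, mul_smul_comm, smul_sub]; abel
    _ = _ := by
        rw [h1, h2, smul_smul, ← sub_smul]
        simp [mul_comm]

variable {D}

theorem exists_cj_scr_inv (hV : GeneratesWeightLattice H V) (s : D.S) {α : H.root} {x : L}
    (hx : x ∈ rootSpace H (α.1 : H → ℂ)) :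
    ∃ y ∈ rootSpace H (((rootSystem H).reflectionPerm s.1 α).1 : H → ℂ),
      cj (D.scr V s)⁻¹ (rho V x) = rho V y := by
  obtain ⟨y, hy⟩ := cj_mem (D.scr V s)⁻¹ x
  refine ⟨y, D.mem_rootSpace_of_ewt hV ?_, hy.symm⟩
  rw [hy, rn_reflectionPerm]
  exact (D.ewt_of_mem hx).cj_scr_inv

theorem exists_cj_scrw_inv (hV : GeneratesWeightLattice H V) (l : List D.S) {α : H.root} {x : L}
    (hx : x ∈ rootSpace H (α.1 : H → ℂ)) :
    ∃ y ∈ rootSpace H ((wordPerm D.base l.reverse α).1 : H → ℂ),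
      cj (D.scrw V l)⁻¹ (rho V x) = rho V y := by
  induction l generalizing α x with
  | nil => exact ⟨x, hx, by simp⟩
  | cons s l ih =>
    obtain ⟨y, hy, hy'⟩ := exists_cj_scr_inv (V := V) hV s hx
    obtain ⟨z, hz, hz'⟩ := ih hy
    refine ⟨z, ?_, ?_⟩
    · rw [List.reverse_cons, wordPerm_append, wordPerm_cons, wordPerm_nil, mul_one]
      exact hz
    · rw [scrw_cons, mul_inv_rev, cj_mul, hy', hz']

theorem scrw_conj_rexp (hV : GeneratesWeightLattice H V) (l : List D.S) {α : H.root} {x : L}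
    (hx : x ∈ rootSpace H (α.1 : H → ℂ)) :
    ∃ (y : L) (hy : y ∈ rootSpace H ((wordPerm D.base l α).1 : H → ℂ)),
      D.scrw V l * rexp (root_ne_zero α) hx * (D.scrw V l)⁻¹ = rexp (root_ne_zero _) hy := by
  obtain ⟨y, hy, h⟩ := D.exists_cj_scrw (V := V) hV l hx
  exact ⟨y, hy, mul_rexp_mul_inv _ _ hx hy h⟩

theorem scrw_inv_conj_rexp (hV : GeneratesWeightLattice H V) (l : List D.S) {α : H.root} {x : L}
    (hx : x ∈ rootSpace H (α.1 : H → ℂ)) :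
    ∃ (y : L) (hy : y ∈ rootSpace H ((wordPerm D.base l.reverse α).1 : H → ℂ)),
      (D.scrw V l)⁻¹ * rexp (root_ne_zero α) hx * D.scrw V l = rexp (root_ne_zero _) hy := by
  obtain ⟨y, hy, h⟩ := exists_cj_scrw_inv (V := V) hV l hx
  have := mul_rexp_mul_inv (root_ne_zero _) (root_ne_zero _) hx hy h
  rw [inv_inv] at this
  exact ⟨y, hy, this⟩

variable (V) in
theorem exists_scrw_mul_tor (l : List D.S) (c : D.S → ℂˣ) :
    ∃ d, D.scrw V l * D.tor V c = D.tor V d * D.scrw V l := by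
  induction l with
  | nil => exact ⟨c, by simp⟩
  | cons s l ih =>
    obtain ⟨d, hd⟩ := ih
    exact ⟨D.sact s d, by
      rw [scrw_cons, mul_assoc, hd, ← mul_assoc, scr_mul_tor, mul_assoc]⟩

/-- The Bruhat double coset of a word. -/
def Cell (l : List D.S) (g : SCGroup H V) : Prop :=
  ∃ b ∈ D.scB V, ∃ b' ∈ D.scB V, g = b * D.scrw V l * b'

theorem Cell.mul_left {l : List D.S} {g b : SCGroup H V} (h : Cell l g) (hb : b ∈ D.scB V) :
    Cell l (b * g) := by
  obtain ⟨c, hc, c', hc', rfl⟩ := h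
  exact ⟨b * c, mul_mem hb hc, c', hc', by group⟩

theorem Cell.mul_right {l : List D.S} {g b : SCGroup H V} (h : Cell l g) (hb : b ∈ D.scB V) :
    Cell l (g * b) := by
  obtain ⟨c, hc, c', hc', rfl⟩ := h
  exact ⟨c, hc, c' * b, mul_mem hc' hb, by group⟩

variable (V) in
theorem cell_scrw (l : List D.S) : Cell l (D.scrw V l) :=
  ⟨1, one_mem _, 1, one_mem _, by simp⟩

theorem scU_mul_scrw_cell {l : List D.S} {u : SCGroup H V}
    (hu : (D.scrw V l)⁻¹ * u * D.scrw V l ∈ D.scU V) : Cell l (u * D.scrw V l) :=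
  ⟨1, one_mem _, _, D.scU_le_scB hu, by group⟩

/-- When `w⁻¹ α_s` is positive, `x_s(a)` can be moved to the right of `w̄` and stays in `U⁺`. -/
theorem scr_mul_scx_mul_scrw_cell (hV : GeneratesWeightLattice H V) {l : List D.S} {s : D.S}
    (hs : D.base.IsPos (wordPerm D.base l.reverse s.1)) (a : ℂ) :
    Cell (s :: l) (D.scr V s * D.scx V s a * D.scrw V l) := by
  obtain ⟨y, hy, h⟩ := scrw_inv_conj_rexp (V := V) hV l (Submodule.smul_mem _ a (D.e_mem s))
  have h2 : (D.scrw V l)⁻¹ * D.scx V s a * D.scrw V l = rexp (root_ne_zero _) hy := h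
  refine ⟨1, one_mem _, _, D.scU_le_scB (D.rexp_mem_scU hs hy), ?_⟩
  rw [← h2, scrw_cons]
  group

/-- When `w⁻¹ α_s` is negative, it is `y_s(a)` that becomes an element of `U⁺` on the right of `w̄`.
-/
theorem scy_mul_scrw_cell (hV : GeneratesWeightLattice H V) {l : List D.S} {s : D.S}
    (hs : ¬ D.base.IsPos (wordPerm D.base l.reverse s.1)) (a : ℂ) :
    Cell l (D.scy V s a * D.scrw V l) := by
  have hf : a • D.f s ∈ rootSpace H (((rootSystem H).reflectionPerm s.1 s.1).1 : H → ℂ) :=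
    Submodule.smul_mem _ a (D.f_mem' s)
  obtain ⟨y, hy, h⟩ := scrw_inv_conj_rexp (V := V) hV l hf
  apply scU_mul_scrw_cell
  have h2 : D.scy V s a = rexp (root_ne_zero _) hf := by
    apply gv_injective
    rw [gv_rexp, gv_scy, rf, ← map_smul]
  rw [h2, h]
  refine D.rexp_mem_scU ?_ hy
  rwa [wordPerm_neg, isPos_reflectionPerm_self_iff]

/-- The multiplication rule of cells. The part of `U⁺` normalized by `r̄_s` passes to the left, so
only `r̄_s x_s(a) w̄` matters. If `w⁻¹ α_s` is negative and `a ≠ 0`, this is `y_s(-a) r̄_s w̄`, and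
the Gauss decomposition in `SL₂` leaves a factor `y_s` that is absorbed on the right. -/
theorem scr_mul_cell (hV : GeneratesWeightLattice H V) {l : List D.S} (s : D.S)
    {g : SCGroup H V} (hg : Cell l g) :
    (D.base.IsPos (wordPerm D.base l.reverse s.1) → Cell (s :: l) (D.scr V s * g)) ∧
      (Cell (s :: l) (D.scr V s * g) ∨ Cell l (D.scr V s * g)) := by
  obtain ⟨b, hb, b', hb', rfl⟩ := hg
  obtain ⟨c, u, hu, rfl⟩ := hb
  obtain ⟨a, k, rfl, hk, hk'⟩ := D.exists_scU_split hV s hu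
  have h : D.scr V s * (D.tor V c * (k * D.scx V s a) * D.scrw V l * b') =
      D.tor V (D.sact s c) * (D.scr V s * k * (D.scr V s)⁻¹) *
        (D.scr V s * D.scx V s a * D.scrw V l) * b' := by
    calc _ = (D.scr V s * D.tor V c) * (k * D.scx V s a) * D.scrw V l * b' := by group
      _ = _ := by rw [scr_mul_tor]; group
  have hb2 : D.tor V (D.sact s c) * (D.scr V s * k * (D.scr V s)⁻¹) ∈ D.scB V :=
    ⟨_, _, hk', rfl⟩
  have hpos : D.base.IsPos (wordPerm D.base l.reverse s.1) →
      Cell (s :: l) (D.scr V s * (D.tor V c * (k * D.scx V s a) * D.scrw V l * b')) := by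
    intro hs
    rw [h]
    exact ((scr_mul_scx_mul_scrw_cell hV hs a).mul_left hb2).mul_right hb'
  refine ⟨hpos, ?_⟩
  by_cases hs : D.base.IsPos (wordPerm D.base l.reverse s.1)
  · exact Or.inl (hpos hs)
  · rw [h]
    by_cases ha : a = 0
    · left
      subst ha
      rw [scx_zero, mul_one, ← scrw_cons]
      exact ((cell_scrw V (s :: l)).mul_left hb2).mul_right hb'
    · right
      refine Cell.mul_right (Cell.mul_left ?_ hb2) hb'
      let z : ℂˣ := Units.mk0 (-a) (neg_ne_zero.mpr ha)
      have h3 := D.scy_mul_scr_eq V s z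
      have h4 : D.scr V s * D.scx V s a = D.scy V s z * D.scr V s := D.scr_mul_scx V s a
      rw [h4, h3, mul_assoc, scCoroot_eq_tor]
      exact (scy_mul_scrw_cell hV hs _).mul_left
        (mul_mem (D.scU_le_scB (D.scx_mem_scU V s _)) (D.tor_mem_scB _))

theorem cell_singleton_mul (hV : GeneratesWeightLattice H V) {l : List D.S} {s : D.S}
    {g k : SCGroup H V} (hg : Cell [s] g) (hk : Cell l k) :
    (D.base.IsPos (wordPerm D.base l.reverse s.1) → Cell (s :: l) (g * k)) ∧
      (Cell (s :: l) (g * k) ∨ Cell l (g * k)) := by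
  obtain ⟨b, hb, b', hb', rfl⟩ := hg
  have h := scr_mul_cell hV s (hk.mul_left hb')
  have h2 : b * D.scrw V [s] * b' * k = b * (D.scr V s * (b' * k)) := by
    rw [scrw_cons, scrw_nil]; group
  rw [h2]
  exact ⟨fun hs => (h.1 hs).mul_left hb, h.2.imp (fun h => h.mul_left hb) fun h => h.mul_left hb⟩

/-- Each multiplication by an element of a simple cell adds at most one letter. This upper bound is
compared with `cell_prod`, where a reduced word loses nothing. -/
theorem exists_cell_prod (hV : GeneratesWeightLattice H V) {l : List D.S}
    {gs : List (SCGroup H V)} (h : List.Forall₂ (fun s g => Cell [s] g) l gs) :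
    ∃ m : List D.S, m.length ≤ l.length ∧ Cell m gs.prod := by
  induction h with
  | nil => exact ⟨[], le_rfl, cell_scrw V []⟩
  | cons hg _ ih =>
    obtain ⟨m, hm, hm'⟩ := ih
    rw [List.prod_cons]
    rcases (cell_singleton_mul hV hg hm').2 with h | h
    · exact ⟨_, by simpa using hm, h⟩
    · exact ⟨m, hm.trans (by simp), h⟩

/-- For a reduced word the positivity condition holds at every step, so each letter is kept. -/
theorem cell_prod (hV : GeneratesWeightLattice H V) {l : List D.S}
    {gs : List (SCGroup H V)} (h : List.Forall₂ (fun s g => Cell [s] g) l gs)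
    (hl : RedWord D.base l) : Cell l gs.prod := by
  induction h with
  | nil => exact cell_scrw V []
  | @cons s g l gs hg _ ih =>
    rw [List.prod_cons]
    have h1 := ih (RedWord.right (l₁ := [s]) hl)
    refine (cell_singleton_mul hV hg h1).1 ?_
    have := hl.reverse
    rw [List.reverse_cons] at this
    exact this.isPos

variable (V) in
-- The Bruhat decomposition of a nontrivial lower triangular matrix in `SL₂`.
theorem cell_scy (s : D.S) {c : ℂ} (hc : c ≠ 0) : Cell [s] (D.scy V s c) := by
  have h := D.scy_mul_scr_eq V s (Units.mk0 c hc)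
  have h2 : D.scy V s c = D.scx V s ((Units.mk0 c hc)⁻¹ : ℂˣ) *
      D.scCoroot V s (-(Units.mk0 c hc)⁻¹) * (D.scy V s (-((Units.mk0 c hc)⁻¹ : ℂˣ)) *
        (D.scr V s)⁻¹) := by
    rw [← mul_assoc, ← h]
    simp
  have h3 : ∀ z, D.scy V s z * (D.scr V s)⁻¹ = (D.scr V s)⁻¹ * D.scx V s (-z) := by
    intro z
    rw [mul_inv_eq_iff_eq_mul, mul_assoc, scx_mul_scr, neg_neg, inv_mul_cancel_left]
  have h4 : (D.scr V s)⁻¹ = D.scCoroot V s (-1) * D.scr V s := by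
    rw [← scth_eq_scCoroot, scr_eq_inv, inv_inv]
  rw [h3, h4, scCoroot_eq_tor, scCoroot_eq_tor] at h2
  refine ⟨D.scx V s ((Units.mk0 c hc)⁻¹ : ℂˣ) * D.tor V (Pi.mulSingle s (-(Units.mk0 c hc)⁻¹)) *
    D.tor V (Pi.mulSingle s (-1)), ?_, D.scx V s (- -((Units.mk0 c hc)⁻¹ : ℂˣ)), ?_, ?_⟩
  · exact mul_mem (mul_mem (D.scU_le_scB (D.scx_mem_scU V s _)) (D.tor_mem_scB _))
      (D.tor_mem_scB _)
  · exact D.scU_le_scB (D.scx_mem_scU V s _)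
  · rw [h2, scrw_cons, scrw_nil]
    group

/-- The Bruhat decomposition (without disjointness). -/
theorem exists_cell (hV : GeneratesWeightLattice H V) {w : List D.S} (hw : LongWord D.base w)
    (g : SCGroup H V) : ∃ l : List D.S, Cell l g := by
  -- The elements whose left multiplication preserves the union of the cells. All root elements are
  -- shown to lie in `Q`.
  let Q : Set (SCGroup H V) := {k | ∀ g, (∃ l : List D.S, Cell l g) → ∃ l : List D.S, Cell l (k * g)}
  have hone : (1 : SCGroup H V) ∈ Q := fun g hg => by rwa [one_mul]
  have hmul : ∀ k m, k ∈ Q → m ∈ Q → k * m ∈ Q := fun k m hk hm g hg => by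
    rw [mul_assoc]; exact hk _ (hm _ hg)
  have hB : ∀ b ∈ D.scB V, b ∈ Q := fun b hb g ⟨l, hl⟩ => ⟨l, hl.mul_left hb⟩
  have hr : ∀ s, D.scr V s ∈ Q := fun s g ⟨l, hl⟩ =>
    (scr_mul_cell hV s hl).2.elim (fun h => ⟨_, h⟩) fun h => ⟨_, h⟩
  have hr' : ∀ s, (D.scr V s)⁻¹ ∈ Q := fun s => by
    have h4 : (D.scr V s)⁻¹ = D.scCoroot V s (-1) * D.scr V s := by
      rw [← scth_eq_scCoroot, scr_eq_inv, inv_inv]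
    rw [h4, scCoroot_eq_tor]
    exact hmul _ _ (hB _ (D.tor_mem_scB _)) (hr s)
  have hw' : ∀ l : List D.S, D.scrw V l ∈ Q ∧ (D.scrw V l)⁻¹ ∈ Q := by
    intro l
    induction l with
    | nil => simpa using hone
    | cons s l ih =>
      rw [scrw_cons, mul_inv_rev]
      exact ⟨hmul _ _ (hr s) ih.1, hmul _ _ ih.2 (hr' s)⟩
  have hroot : ∀ (α : H.root) (x : L) (hx : x ∈ rootSpace H (α.1 : H → ℂ)),
      (rexp (root_ne_zero α) hx : SCGroup H V) ∈ Q := by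
    intro α x hx
    by_cases hα : D.base.IsPos α
    · exact hB _ (D.scU_le_scB (D.rexp_mem_scU hα hx))
    -- Negative root elements are conjugated into `U⁺` by the lift of `w₀`.
    · obtain ⟨y, hy, hy'⟩ := scrw_conj_rexp (V := V) hV w hx
      have hpos : D.base.IsPos (wordPerm D.base w α) := by
        rw [← isPos_reflectionPerm_self_iff] at hα
        have := hw.not_isPos hα
        rwa [wordPerm_neg, isPos_reflectionPerm_self_iff, not_not] at this
      have h2 : rexp (root_ne_zero α) hx =
          (D.scrw V w)⁻¹ * (rexp (root_ne_zero _) hy * D.scrw V w) := by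
        rw [← hy']; group
      rw [h2]
      exact hmul _ _ (hw' w).2 (hmul _ _ (hB _ (D.scU_le_scB (D.rexp_mem_scU hpos hy))) (hw' w).1)
  have hgen : ∀ (χ : H → ℂ) (hχ : χ ≠ 0) (x : L) (hx : x ∈ rootSpace H χ),
      (rexp hχ hx : SCGroup H V) ∈ Q := by
    intro χ hχ x hx
    by_cases hx0 : x = 0
    · have : (rexp hχ hx : SCGroup H V) = 1 := by
        apply gv_injective
        rw [gv_rexp, hx0, map_zero, nexp_zero, map_one]
      rw [this]
      exact hone
    · have hne : rootSpace H χ ≠ ⊥ := by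
        intro hb
        rw [hb] at hx
        exact hx0 ((LieSubmodule.mem_bot _).mp hx)
      let ω : LieModule.Weight ℂ H L := ⟨χ, hne⟩
      have hω : ω.IsNonZero := hχ
      exact hroot ⟨ω, by simpa using hω⟩ x hx
  have hall : g ∈ Q := by
    obtain ⟨g, hg⟩ := g
    induction hg using Subgroup.closure_induction'' with
    | mem g hg =>
      obtain ⟨χ, hχ, x, hx, rfl⟩ := hg
      exact hgen χ hχ x hx
    | inv_mem g hg =>
      obtain ⟨χ, hχ, x, hx, rfl⟩ := hg
      have := hgen χ hχ (-x) (Submodule.neg_mem _ hx)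
      rw [← rexp_inv hχ hx] at this
      exact this
    | one => exact hone
    | mul g k hg hk ihg ihk => exact hmul ⟨g, hg⟩ ⟨k, hk⟩ ihg ihk
  have := hall 1 ⟨[], cell_scrw V []⟩
  rwa [mul_one] at this

theorem f_ne_zero (s : D.S) : D.f s ≠ 0 := by
  intro h
  have h1 := D.lie_e_f s
  rw [h, lie_zero] at h1
  have h2 : (coroot s.1.1 : H) = 0 := Subtype.ext h1.symm
  exact H.isNonZero_coe_root s.1 (coroot_eq_zero_iff.mp h2)

theorem exists_smul_f (s : D.S) {x : L}
    (hx : x ∈ rootSpace H (((rootSystem H).reflectionPerm s.1 s.1).1 : H → ℂ)) :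
    ∃ c : ℂ, x = c • D.f s := by
  have h := finrank_rootSpace_eq_one _ (H.isNonZero_coe_root ((rootSystem H).reflectionPerm s.1 s.1))
  obtain ⟨c, hc⟩ := (finrank_eq_one_iff_of_nonzero' (⟨D.f s, D.f_mem' s⟩ :
    rootSpace H (((rootSystem H).reflectionPerm s.1 s.1).1 : H → ℂ))
      (fun h0 => f_ne_zero s (congrArg Subtype.val h0))).mp h ⟨x, hx⟩
  exact ⟨c, (congrArg Subtype.val hc).symm⟩

theorem re_ne_zero (hV : GeneratesWeightLattice H V) (s : D.S) : D.re V s ≠ 0 := by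
  intro h0
  apply D.e_ne_zero s
  apply rho_injective V hV
  rw [map_zero]
  exact h0

/-- A word sending one simple root to another conjugates the Chevalley generators up to scalars. -/
theorem exists_scrw_conj (hV : GeneratesWeightLattice H V) {l : List D.S} {s t : D.S}
    (h : wordPerm D.base l s.1 = t.1) : ∃ a : ℂˣ,
      cj (D.scrw V l) (D.re V s) = (a : ℂ) • D.re V t ∧
      cj (D.scrw V l) (D.rf V s) = ((a⁻¹ : ℂˣ) : ℂ) • D.rf V t := by
  obtain ⟨y, hy, hy'⟩ := D.exists_cj_scrw (V := V) hV l (D.e_mem s)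
  obtain ⟨z, hz, hz'⟩ := D.exists_cj_scrw (V := V) hV l (D.f_mem' s)
  rw [h] at hy
  rw [wordPerm_neg, h] at hz
  obtain ⟨a, rfl⟩ := D.exists_smul_e t hy
  obtain ⟨b, rfl⟩ := exists_smul_f t hz
  rw [map_smul] at hy' hz'
  change cj (D.scrw V l) (D.re V s) = a • D.re V t at hy'
  change cj (D.scrw V l) (D.rf V s) = b • D.rf V t at hz'
  have hh : cj (D.scrw V l) (D.rh V s) = (a * b) • D.rh V t := by
    rw [← re_rf, map_sub, map_mul, map_mul, hy', hz', smul_mul_smul_comm, smul_mul_smul_comm,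
      mul_comm b, ← smul_sub, re_rf]
  have ha : a ≠ 0 := by
    rintro rfl
    rw [zero_smul, ← map_zero (cj (D.scrw V l))] at hy'
    exact re_ne_zero hV s (cj_injective _ hy')
  -- Conjugation sends `h_s` to `a b h_t`; comparing with the relation `[h, e] = 2 e` forces `a b =
  -- 1`.
  have h2 : (a * b * a * 2) • D.re V t = (a * 2) • D.re V t := by
    have h3 := congrArg (cj (D.scrw V l)) (D.rh_re_self V s)
    rw [map_sub, map_mul, map_mul, map_smul, hh, hy', smul_mul_smul_comm, smul_mul_smul_comm,
      mul_comm a (a * b), ← smul_sub, rh_re_self, smul_smul, smul_smul] at h3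
    rw [mul_comm a 2, ← h3]
  have h3 : a * b * a * 2 = a * 2 := smul_left_injective ℂ (re_ne_zero hV t) h2
  have hab : a * b = 1 := by
    have h4 : a * 2 ≠ 0 := mul_ne_zero ha two_ne_zero
    apply mul_right_cancel₀ h4
    linear_combination h3
  refine ⟨Units.mk0 a ha, hy', ?_⟩
  rw [hz', Units.val_inv_eq_inv_val, Units.val_mk0, eq_inv_of_mul_eq_one_right hab]

theorem mul_scx_of_cj {g : SCGroup H V} {s t : D.S} {a : ℂ}
    (h : cj g (D.re V s) = a • D.re V t) (c : ℂ) :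
    g * D.scx V s c = D.scx V t (a * c) * g := by
  rw [← mul_inv_eq_iff_eq_mul]
  apply gv_injective
  rw [← cj_gv, gv_scx, gv_scx, cj_nexp _ ((D.re_isNilpotent V s).smul c), map_smul, h, smul_smul,
    mul_comm]

theorem mul_scy_of_cj {g : SCGroup H V} {s t : D.S} {a : ℂ}
    (h : cj g (D.rf V s) = a • D.rf V t) (c : ℂ) :
    g * D.scy V s c = D.scy V t (a * c) * g := by
  rw [← mul_inv_eq_iff_eq_mul]
  apply gv_injective
  rw [← cj_gv, gv_scy, gv_scy, cj_nexp _ ((D.rf_isNilpotent V s).smul c), map_smul, h, smul_smul,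
    mul_comm]

theorem mul_scth_of_cj {g : SCGroup H V} {s t : D.S} {a : ℂˣ}
    (h : cj g (D.re V s) = (a : ℂ) • D.re V t)
    (h' : cj g (D.rf V s) = ((a⁻¹ : ℂˣ) : ℂ) • D.rf V t) (z : ℂˣ) :
    g * D.scth V s z = D.scth V t (a * z) * g := by
  have hi : ((a⁻¹ : ℂˣ) : ℂ) * -((z⁻¹ : ℂˣ) : ℂ) = -(((a * z)⁻¹ : ℂˣ) : ℂ) := by
    rw [mul_inv, Units.val_mul, mul_neg]
  rw [scth, scth, ← mul_assoc, ← mul_assoc, mul_scx_of_cj h, mul_assoc (D.scx V t _),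
    mul_scy_of_cj h', hi, ← mul_assoc, mul_assoc _ g, mul_scx_of_cj h, ← mul_assoc]
  rfl

theorem exists_scrw_mul_scr (hV : GeneratesWeightLattice H V) {l : List D.S} {s t : D.S}
    (h : wordPerm D.base l s.1 = t.1) : ∃ c : D.S → ℂˣ,
      D.scrw V l * D.scr V s = D.tor V c * D.scr V t * D.scrw V l := by
  obtain ⟨a, ha, ha'⟩ := exists_scrw_conj hV h
  refine ⟨Pi.mulSingle t (-(a * -1)), ?_⟩
  rw [scr_eq, mul_scth_of_cj ha ha', scth_eq_scCoroot, scCoroot_eq_tor]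

/-- By exchange the last letter cancels an earlier one, up to torus elements, and two letters
disappear. Torus elements move freely past lifts of reflections. -/
theorem exists_scrw_eq_tor (hV : GeneratesWeightLattice H V) (n : ℕ) :
    ∀ l : List D.S, l.length = n → wordRefl D.base l = 1 → ∃ c, D.scrw V l = D.tor V c := by
  induction n using Nat.strong_induction_on with
  | _ n ih =>
    intro l hn hl
    rcases List.eq_nil_or_concat l with rfl | ⟨l', s, rfl⟩
    · exact ⟨1, by simp⟩
    rw [List.concat_eq_append] at hl hn ⊢
    have hneg : ¬ D.base.IsPos (wordPerm D.base l' s.1) := by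
      have h1 : wordPerm D.base (l' ++ [s]) = 1 :=
        wordPerm_eq_of_wordRefl_eq (m := []) (by simpa using hl)
      intro hp
      rw [← not_not (a := D.base.IsPos _), ← isPos_reflectionPerm_self_iff, ← wordPerm_neg] at hp
      apply hp
      have h2 : wordPerm D.base l' ((rootSystem H).reflectionPerm s.1 s.1) =
        wordPerm D.base (l' ++ [s]) s.1 := by simp
      rw [h2, h1]
      exact D.simple_isPos s
    obtain ⟨l₁, t, l₂, rfl, ht, hl'⟩ := exists_exchange l' hneg
    obtain ⟨c, hc⟩ := exists_scrw_mul_scr hV ht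
    obtain ⟨d, hd⟩ := ih (l₁ ++ l₂).length (by rw [← hn]; simp) (l₁ ++ l₂) rfl (hl'.trans hl)
    have h1 : D.scr V t * D.tor V c * D.scr V t =
        D.tor V (D.sact t c * Pi.mulSingle t (-1)) := by
      rw [scr_mul_tor, mul_assoc, scr_mul_self, scCoroot_eq_tor, map_mul]
    obtain ⟨c', hc'⟩ := exists_scrw_mul_tor V l₁ (D.sact t c * Pi.mulSingle t (-1))
    refine ⟨c' * d, ?_⟩
    calc D.scrw V (l₁ ++ t :: l₂ ++ [s])
        = D.scrw V l₁ * D.scr V t * (D.scrw V l₂ * D.scr V s) := by simp; group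
      _ = D.scrw V l₁ * (D.scr V t * D.tor V c * D.scr V t) * D.scrw V l₂ := by
          rw [hc]; group
      _ = D.tor V c' * D.scrw V (l₁ ++ l₂) := by
          rw [h1, hc', scrw_append]; group
      _ = _ := by rw [hd, map_mul]

/-- Let the central element lie in the cell of `l`. Then `l̄` differs from an element of the Borel
subgroup by a central factor. If `l` made some `α_s` negative, conjugating `x_s` by `l̄` would land
both in `U⁺` and in its opposite, so it would be trivial. Hence `l` represents the identity and the
element lies in the Borel subgroup; its unipotent part commutes with the cocharacter, so it is `1`.
-/
theorem center_le (hV : GeneratesWeightLattice H V) {w : List D.S} (hw : LongWord D.base w)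
    {z : SCGroup H V} (hz : z ∈ Subgroup.center (SCGroup H V)) : ∃ c, z = D.tor V c := by
  obtain ⟨l, b, hb, b', hb', hzl⟩ := exists_cell hV hw z
  have hcomm := fun g => Subgroup.mem_center_iff.mp hz g
  have hone : wordRefl D.base l = 1 := by
    refine wordRefl_eq_one_of_isPos fun s => ?_
    by_contra hneg
    obtain ⟨y, hy, hy'⟩ := scrw_conj_rexp (V := V) hV l (D.e_mem s)
    have h1 : D.scrw V l = b⁻¹ * z * b'⁻¹ := by rw [hzl]; group
    have h2 : ∃ u ∈ D.scU V, rexp (root_ne_zero _) hy = u := by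
      refine ⟨_, ?_, hy'.symm⟩
      obtain ⟨c, u, hu, huc⟩ := inv_mem hb
      obtain ⟨c', u', hu', huc'⟩ := inv_mem hb'
      have hx : rexp (root_ne_zero s.1) (D.e_mem s) ∈ D.scU V :=
        D.rexp_mem_scU (D.simple_isPos s) (D.e_mem s)
      have h3 : D.scrw V l * rexp (root_ne_zero s.1) (D.e_mem s) * (D.scrw V l)⁻¹ =
          (b⁻¹ * b'⁻¹) * rexp (root_ne_zero s.1) (D.e_mem s) * (b⁻¹ * b'⁻¹)⁻¹ := by
        have h4 : D.scrw V l = z * (b⁻¹ * b'⁻¹) := by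
          rw [h1, hcomm b⁻¹, mul_assoc]
        rw [h4, mul_inv_rev, mul_assoc z, mul_assoc z, ← mul_assoc (_ * rexp _ _), ← mul_assoc z,
          ← hcomm]
        group
      rw [h3]
      obtain ⟨d, v, hv, hdv⟩ := mul_mem (inv_mem hb) (inv_mem hb')
      rw [hdv]
      have := D.tor_conj_mem_scU d (mul_mem (mul_mem hv hx) (inv_mem hv))
      convert this using 1
      group
    obtain ⟨u, hu, hyu⟩ := h2
    have hlo := D.lo_rexp (V := V) hneg hy
    have h5 := (D.up_of_mem hu).eq_of_eq_mul hlo (c := 1) (by rw [map_one, one_mul, hyu])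
    have h6 := congrArg gv h5.2.2
    rw [gv_rexp, map_one] at h6
    have h7 := nexp_eq_one (rho_isNilpotent V (root_ne_zero _) hy) h6
    have h8 : rexp (root_ne_zero s.1) (D.e_mem s) = (1 : SCGroup H V) := by
      have := hy'
      rw [h5.2.2, mul_inv_eq_one] at this
      exact mul_eq_left.mp this
    have h9 := congrArg gv h8
    rw [gv_rexp, map_one] at h9
    exact re_ne_zero hV s (nexp_eq_one (rho_isNilpotent V (root_ne_zero s.1) (D.e_mem s)) h9)
  obtain ⟨c, hc⟩ := exists_scrw_eq_tor hV _ l rfl hone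
  have hzB : z ∈ D.scB V := by
    rw [hzl, hc]
    exact mul_mem (mul_mem hb (D.tor_mem_scB c)) hb'
  obtain ⟨d, u, hu, rfl⟩ := hzB
  refine ⟨d, ?_⟩
  have h1 : u = 1 := by
    refine Up.eq_one_of_comm D (D.up_of_mem hu) fun a => ?_
    have h2 := hcomm (D.lam V a)
    have h3 : D.lam V a * D.tor V d = D.tor V d * D.lam V a := by
      rw [lam, ← map_mul, ← map_mul, mul_comm]
    rw [← mul_assoc, h3, mul_assoc, mul_assoc] at h2
    exact mul_left_cancel h2
  rw [h1, mul_one]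

/-- Since `w₀` makes all positive roots negative, it carries `U⁺` to elements that contract under
the inverse cocharacter. -/
theorem lo_conj (hV : GeneratesWeightLattice H V) {w : List D.S} (hw : LongWord D.base w)
    {u : SCGroup H V} (hu : u ∈ D.scU V) : D.Lo (D.scrw V w * u * (D.scrw V w)⁻¹) := by
  refine D.scU_induction (p := fun u => D.Lo (D.scrw V w * u * (D.scrw V w)⁻¹)) ?_ ?_ ?_ hu
  · simpa using Lo.one D
  · intro g k hg hk
    have := hg.mul hk
    convert this using 1
    group
  · intro α hα x hx
    obtain ⟨y, hy, hy'⟩ := scrw_conj_rexp (V := V) hV w hx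
    rw [hy']
    exact D.lo_rexp (hw.not_isPos hα) hy

/-- An element of the big cell cannot raise heights. -/
theorem height_le_of_big_cell {α β : H.root} {x y : L} (hx : x ∈ rootSpace H (α.1 : H → ℂ))
    (hy : y ∈ rootSpace H (β.1 : H → ℂ)) (hV : GeneratesWeightLattice H V) (hx0 : x ≠ 0)
    {u v : SCGroup H V} (hu : D.Up u) (hu' : D.Up u⁻¹) (hv : D.Lo v) (hv' : D.Lo v⁻¹)
    (c : D.S → ℂˣ) (h : cj (u * D.tor V c * v) (rho V x) = rho V y) :
    D.base.height β ≤ D.base.height α := by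
  by_contra! hlt
  obtain ⟨k, hk⟩ := Int.eq_ofNat_of_zero_le (a := D.base.height β - D.base.height α) (by omega)
  have hk0 : 0 < k := by omega
  have hβ : D.base.height β = D.base.height α + k := by omega
  -- Computed from `y`, the family is polynomial in `a^N` without constant term, because `β` has the
  -- larger height. Computed from `x`, it is polynomial in `a^{-N}`. So it vanishes, which
  -- contradicts `x ≠ 0`.
  let F : ℂˣ → End ℂ V := fun a =>
    ((a ^ (-(D.hN * D.base.height α)) : ℂˣ) : ℂ) • cj (D.lam V a) (cj u⁻¹ (rho V y))
  have hF1 : IsPol D.hN F 0 := by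
    have h1 : IsPol D.hN (fun a => cj (D.lam V a) (gv u⁻¹) *
        ((((a : ℂ) ^ (D.hN * k)) • rho V y) * cj (D.lam V a) (gv u))) (1 * (0 * 1)) :=
      IsPol.mul hu' ((IsPol.monomial hk0 _).mul hu)
    rw [zero_mul, mul_zero] at h1
    convert h1 using 2 with a
    simp only [F]
    rw [cj_apply u⁻¹, inv_inv, map_mul, map_mul, D.cj_lam_rho a hy, hβ, mul_smul_comm,
      smul_mul_assoc, smul_smul, ← Units.val_mul, ← zpow_add, smul_mul_assoc, mul_smul_comm,
      mul_assoc]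
    congr 1
    rw [← Units.val_pow_eq_pow_val, ← zpow_natCast]
    congr 2
    push_cast
    ring
  have hF2 : IsPol D.hN (fun a => F a⁻¹) (gv (D.tor V c) * rho V x * gv (D.tor V c)⁻¹) := by
    have h1 : IsPol D.hN (fun a => gv (D.tor V c) * (cj (D.lam V a⁻¹) (gv v) *
        (rho V x * cj (D.lam V a⁻¹) (gv v⁻¹))) * gv (D.tor V c)⁻¹) _ :=
      (((IsPol.const _ (gv (D.tor V c))).mul (IsPol.mul hv ((IsPol.const _ (rho V x)).mul hv'))).mul
        (IsPol.const _ (gv (D.tor V c)⁻¹)))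
    rw [one_mul, mul_one] at h1
    convert h1 using 2 with a
    have hy2 : cj u⁻¹ (rho V y) = cj (D.tor V c) (cj v (rho V x)) := by
      rw [← h, mul_assoc, cj_mul, cj_inv_cj, cj_mul]
    have hlt : D.lam V a⁻¹ * D.tor V c = D.tor V c * D.lam V a⁻¹ := by
      rw [lam, ← map_mul, ← map_mul, mul_comm]
    have hvx : cj (D.lam V a⁻¹) (gv v * rho V x * gv v⁻¹) =
        ((a⁻¹ ^ (D.hN * D.base.height α) : ℂˣ) : ℂ) •
          (cj (D.lam V a⁻¹) (gv v) * (rho V x * cj (D.lam V a⁻¹) (gv v⁻¹))) := by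
      rw [map_mul, map_mul, D.cj_lam_rho _ hx, mul_smul_comm, smul_mul_assoc, mul_assoc]
    simp only [F]
    rw [hy2, ← cj_mul, hlt, cj_mul, cj_apply v, hvx, map_smul, smul_smul, ← Units.val_mul,
      ← zpow_add, neg_add_cancel, zpow_zero, Units.val_one, one_smul, cj_apply (D.tor V c)]
  have h0 := IsPol.eq_const D.hN_pos hF1 hF2 1
  simp only [F, one_zpow, Units.val_one, one_smul] at h0
  rw [← map_zero (cj (D.lam V 1))] at h0
  have h1 := cj_injective _ h0
  rw [← map_zero (cj u⁻¹)] at h1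
  have h2 := cj_injective _ h1
  rw [h2, ← map_zero (cj (u * D.tor V c * v))] at h
  have h3 := cj_injective _ h
  rw [← map_zero (rho (L := L) V)] at h3
  exact hx0 (rho_injective V hV h3)

theorem exists_ne_zero_mem_rootSpace (α : H.root) : ∃ x ∈ rootSpace H (α.1 : H → ℂ), x ≠ 0 := by
  obtain ⟨x, hx, h0⟩ := α.1.exists_ne_zero
  exact ⟨x, hx, h0⟩

/-- The big cell determines the longest element. -/
theorem Cell.wordRefl_eq (hV : GeneratesWeightLattice H V) {w l : List D.S}
    (hw : LongWord D.base w) (h : Cell w (D.scrw V l)) :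
    wordRefl D.base l = wordRefl D.base w := by
  obtain ⟨b, hb, b', hb', hl⟩ := h
  obtain ⟨c, u, hu, rfl⟩ := D.mem_scB'.mp hb
  obtain ⟨d, v, hv, rfl⟩ := hb'
  obtain ⟨d', hd'⟩ := exists_scrw_mul_tor V w d
  -- The quotient of the two lifts lies in `U⁺ T U⁻`, where heights of roots cannot increase.
  have hq : D.scrw V l * (D.scrw V w)⁻¹ =
      u * D.tor V (c * d') * (D.scrw V w * v * (D.scrw V w)⁻¹) := by
    calc _ = u * D.tor V c * (D.scrw V w * D.tor V d) * v * (D.scrw V w)⁻¹ := by rw [hl]; group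
      _ = _ := by rw [hd', map_mul]; group
  have hle : ∀ α, D.base.height (wordPerm D.base (l ++ w.reverse) α) ≤ D.base.height α := by
    intro α
    obtain ⟨x, hx, hx0⟩ := exists_ne_zero_mem_rootSpace α
    obtain ⟨y, hy, hy'⟩ := exists_cj_scrw_inv (V := V) hV w hx
    obtain ⟨z, hz, hz'⟩ := D.exists_cj_scrw (V := V) hV l hy
    rw [wordPerm_append]
    refine height_le_of_big_cell hx hz hV hx0 (D.up_of_mem hu) (D.up_of_mem (inv_mem hu))
      (lo_conj hV hw hv) ?_ (c * d') ?_
    · have := lo_conj hV hw (inv_mem hv)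
      convert this using 1
      group
    · rw [← hq, cj_mul, hy', hz']
  have hone : wordRefl D.base (l ++ w.reverse) = 1 := by
    refine wordRefl_eq_one_of_isPos fun s => ?_
    -- Since the height of `-α_s` does not increase, the image of `α_s` has height at least one.
    have h1 := hle ((rootSystem H).reflectionPerm s.1 s.1)
    have hneg : ∀ α : H.root, D.base.height ((rootSystem H).reflectionPerm α α) =
        -D.base.height α := by
      intro α
      have h3 := congrArg (heightForm D.base) (root_reflectionPerm_self (P := rootSystem H) α)
      rw [map_neg, heightForm_root, heightForm_root] at h3
      exact_mod_cast h3
    rw [wordPerm_neg, hneg, hneg, D.base.height_one_of_mem_support s.2] at h1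
    rw [RootPairing.Base.isPos_iff]
    omega
  rw [wordRefl_append, wordRefl_reverse, mul_inv_eq_one] at hone
  exact hone

end Splitting

end Pinnings

end

noncomputable section

namespace Pinnings

open scoped Classical

set_option linter.unusedSectionVars false

/-! ### Alternating words and Matsumoto's theorem -/

section Matsumoto

/-- The alternating word of length `k` in `s` and `u` that ends with `s`. -/
def alt {S : Type*} (s u : S) : ℕ → List S
  | 0 => []
  | k + 1 => alt u s k ++ [s]

theorem length_alt {S : Type*} (s u : S) (k : ℕ) : (alt s u k).length = k := by
  induction k generalizing s u with
  | zero => rfl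
  | succ k ih => simp [alt, ih]

/-- An alternating word is named after its last letter; which letter stands first depends on the
parity of the length. -/
theorem alt_succ_and_reverse {S : Type*} (k : ℕ) :
    (k % 2 = 0 → ∀ s u : S, alt s u (k + 1) = s :: alt s u k ∧ (alt s u k).reverse = alt u s k) ∧
    (k % 2 = 1 → ∀ s u : S, alt s u (k + 1) = u :: alt s u k ∧
      (alt s u k).reverse = alt s u k) := by
  induction k with
  | zero => simp [alt]
  | succ k ih =>
    refine ⟨fun hk s u => ?_, fun hk s u => ?_⟩
    · have h := ih.2 (by omega)
      refine ⟨?_, ?_⟩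
      · conv_lhs => rw [alt, (h u s).1]
        rw [List.cons_append]; rfl
      · rw [(h s u).1, List.reverse_cons, (h s u).2]; rfl
    · have h := ih.1 (by omega)
      refine ⟨?_, ?_⟩
      · conv_lhs => rw [alt, (h u s).1]
        rw [List.cons_append]; rfl
      · rw [(h s u).1, List.reverse_cons, (h s u).2, ← (h s u).1]; rfl

variable {ι R M N : Type*} [Field R] [CharZero R] [AddCommGroup M] [Module R M]
  [AddCommGroup N] [Module R N] {P : RootPairing ι R M N} {b : P.Base}

/-- The Weyl group elements given by alternating words shorter than `m` send the next
simple root to a nonnegative combination. -/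
def AltNonneg (b : P.Base) (s u : b.support) (m : ℕ) : Prop :=
  ∀ k < m, ∃ x y : ℕ, P.root (wordPerm b (alt s u k) u.1) = x • P.root s.1 + y • P.root u.1

variable [Finite ι] [P.IsCrystallographic] [P.IsReduced] [P.IsRootSystem]

theorem height_nonpos_of_comb {l : List b.support} {s u : b.support}
    (hs : ¬ b.IsPos (wordPerm b l s.1)) (hu : ¬ b.IsPos (wordPerm b l u.1)) {i : ι} {x y : ℕ}
    (h : P.root i = x • P.root s.1 + y • P.root u.1) : ¬ b.IsPos (wordPerm b l i) := by
  rw [RootPairing.Base.isPos_iff, not_lt] at hs hu ⊢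
  have h2 : (b.height (wordPerm b l i) : R) =
      ((x * b.height (wordPerm b l s.1) + y * b.height (wordPerm b l u.1) : ℤ) : R) := by
    rw [← heightForm_root, root_wordPerm, h]
    push_cast
    rw [← heightForm_root, ← heightForm_root, root_wordPerm, root_wordPerm, map_add, map_nsmul,
      map_nsmul, map_add, map_nsmul, map_nsmul, nsmul_eq_mul, nsmul_eq_mul]
  rw [Int.cast_injective h2]
  nlinarith [mul_nonneg (Int.natCast_nonneg x) (neg_nonneg.mpr hs),
    mul_nonneg (Int.natCast_nonneg y) (neg_nonneg.mpr hu)]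

/-- An element that makes `α_s` and `α_u` negative has a factorization ending in either alternating
word, with lengths adding up. The prefix found so far sends the next simple root to the image under
`l` of a nonnegative combination of `α_s` and `α_u`, which is negative, so exchange removes one more
letter. -/
theorem exists_strip {l : List b.support} {s u : b.support} {m : ℕ}
    (hsu : AltNonneg b s u m) (hus : AltNonneg b u s m)
    (hs : ¬ b.IsPos (wordPerm b l s.1)) (hu : ¬ b.IsPos (wordPerm b l u.1)) :
    ∀ k ≤ m, ∃ n : List b.support, n.length + k = l.length ∧
      wordRefl b (n ++ alt s u k) = wordRefl b l := by
  intro k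
  induction k with
  | zero => exact fun _ => ⟨l, rfl, by simp [alt]⟩
  | succ k ih =>
    intro hk
    obtain ⟨n, hn, hnl⟩ := ih (by omega)
    have key : ∃ x : b.support, alt s u (k + 1) = x :: alt s u k ∧
        ¬ b.IsPos (wordPerm b n x.1) := by
      have hn2 : ∀ i, wordPerm b n i = wordPerm b l (wordPerm b (alt s u k).reverse i) := by
        intro i
        rw [← wordPerm_eq_of_wordRefl_eq hnl, wordPerm_append, wordPerm_reverse]
        simp
      rcases Nat.mod_two_eq_zero_or_one k with h | h
      · obtain ⟨h1, h2⟩ := (alt_succ_and_reverse k).1 h s u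
        obtain ⟨x, y, hxy⟩ := hus k (by omega)
        refine ⟨s, h1, ?_⟩
        rw [hn2, h2]
        exact height_nonpos_of_comb hu hs hxy
      · obtain ⟨h1, h2⟩ := (alt_succ_and_reverse k).2 h s u
        obtain ⟨x, y, hxy⟩ := hsu k (by omega)
        refine ⟨u, h1, ?_⟩
        rw [hn2, h2]
        exact height_nonpos_of_comb hs hu hxy
    obtain ⟨x, hx, hneg⟩ := key
    obtain ⟨l₁, t, l₂, rfl, -, h₃⟩ := exists_exchange n hneg
    refine ⟨l₁ ++ l₂, ?_, ?_⟩
    · simp only [List.length_append, List.length_cons] at hn ⊢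
      omega
    · rw [hx, wordRefl_append, h₃, wordRefl_append, ← hnl, wordRefl_append _ (alt s u k),
        wordRefl_cons x, wordRefl_cons x, wordRefl_nil, mul_one, mul_assoc,
        ← mul_assoc (P.reflection x.1), reflection_mul_self, one_mul]

/-- Matsumoto's theorem. -/
theorem matsumoto {A : Type*} [Monoid A] (g : b.support → A)
    (hg : ∀ s u : b.support, s ≠ u → ∃ m, 0 < m ∧ AltNonneg b s u m ∧ AltNonneg b u s m ∧
      wordRefl b (alt s u m) = wordRefl b (alt u s m) ∧
      ((alt s u m).map g).prod = ((alt u s m).map g).prod) (n : ℕ) :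
    ∀ l l' : List b.support, l.length = n → RedWord b l → RedWord b l' →
      wordRefl b l = wordRefl b l' → (l.map g).prod = (l'.map g).prod := by
  induction n with
  | zero =>
    intro l l' hn hl hl' h
    have h1 := hl' _ h
    rw [List.length_eq_zero_iff.mp hn] at h1 ⊢
    rw [List.length_eq_zero_iff.mp (Nat.le_zero.mp h1)]
  | succ n ih =>
    intro l l' hn hl hl' h
    have hn' : l'.length = n + 1 := le_antisymm (hn ▸ hl' _ h) (hn ▸ hl _ h.symm)
    have hneg : ∀ (k : List b.support) (s : b.support), RedWord b (k ++ [s]) →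
        ¬ b.IsPos (wordPerm b (k ++ [s]) s.1) := by
      intro k s hk
      rw [wordPerm_append, wordPerm_cons, wordPerm_nil, mul_one, Equiv.Perm.mul_apply, wordPerm_neg,
        isPos_reflectionPerm_self_iff, not_not]
      exact hk.isPos
    rcases List.eq_nil_or_concat l with rfl | ⟨l₁, s, rfl⟩
    · simp at hn
    rcases List.eq_nil_or_concat l' with rfl | ⟨l₁', u, rfl⟩
    · simp at hn'
    rw [List.concat_eq_append] at *
    rw [List.concat_eq_append] at *
    simp only [List.length_append, List.length_singleton, Nat.add_right_cancel_iff] at hn hn'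
    have hcancel : ∀ (k k' : List b.support) (x : b.support),
        wordRefl b (k ++ [x]) = wordRefl b (k' ++ [x]) → wordRefl b k = wordRefl b k' := by
      intro k k' x hk
      rw [wordRefl_append, wordRefl_append] at hk
      exact mul_right_cancel hk
    by_cases hsu : s = u
    · subst hsu
      rw [List.map_append, List.prod_append, List.map_append, List.prod_append,
        ih l₁ l₁' hn hl.left hl'.left (hcancel _ _ _ h)]
    · obtain ⟨m, hm, h1, h2, h3, h4⟩ := hg s u hsu
      have hs := hneg _ _ hl
      have hu := hneg _ _ hl'
      rw [← wordPerm_eq_of_wordRefl_eq h] at hu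
      -- Both `α_s` and `α_u` are made negative, so there are reduced words that end in the two
      -- alternating words with the same prefix. The induction compares each given word with the one
      -- sharing its last letter, and the braid relation compares these two.
      obtain ⟨k, hk, hkl⟩ := exists_strip h1 h2 hs hu m le_rfl
      obtain ⟨m, rfl⟩ : ∃ m', m = m' + 1 := ⟨m - 1, by omega⟩
      have hkl' : wordRefl b (k ++ alt u s (m + 1)) = wordRefl b (l₁' ++ [u]) := by
        rw [← h, ← hkl, wordRefl_append, wordRefl_append, h3]
      have e1 : k ++ alt s u (m + 1) = (k ++ alt u s m) ++ [s] := by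
        rw [List.append_assoc]; rfl
      have e2 : k ++ alt u s (m + 1) = (k ++ alt s u m) ++ [u] := by
        rw [List.append_assoc]; rfl
      have r1 : RedWord b (k ++ alt s u (m + 1)) :=
        hl.of_wordRefl_eq hkl (by simp [length_alt] at hk ⊢; omega)
      have r2 : RedWord b (k ++ alt u s (m + 1)) :=
        hl'.of_wordRefl_eq hkl' (by simp [length_alt] at hk ⊢; omega)
      rw [e1] at r1 hkl
      rw [e2] at r2 hkl'
      have i1 := ih l₁ _ hn hl.left r1.left (hcancel _ _ _ hkl).symm
      have i2 := ih l₁' _ hn' hl'.left r2.left (hcancel _ _ _ hkl').symm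
      calc ((l₁ ++ [s]).map g).prod = ((k ++ alt s u (m + 1)).map g).prod := by
            rw [e1, List.map_append, List.prod_append, i1, ← List.prod_append, ← List.map_append]
        _ = ((k ++ alt u s (m + 1)).map g).prod := by
            rw [List.map_append, List.prod_append, h4, ← List.prod_append, ← List.map_append]
        _ = _ := by
            rw [e2, List.map_append, List.prod_append, ← i2, ← List.prod_append, ← List.map_append]

end Matsumoto

end Pinnings

end

/-! ### Braid relations for the lifts of simple reflections -/

noncomputable section

namespace Pinnings

open scoped Classical

set_option linter.unusedSectionVars false

variable {L : Type*} [LieRing L] [LieAlgebra ℂ L] [FiniteDimensional ℂ L] [IsKilling ℂ L]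
variable {H : LieSubalgebra ℂ L} [H.IsCartanSubalgebra]
variable {V : Type*} [AddCommGroup V] [Module ℂ V] [FiniteDimensional ℂ V]
  [LieRingModule L V] [LieModule ℂ L V]

theorem lie_eq_zero_of_not_root {γ δ : H.root} {x y : L} (hx : x ∈ rootSpace H (γ.1 : H → ℂ))
    (hy : y ∈ rootSpace H (δ.1 : H → ℂ))
    (h0 : (rootSystem H).root γ + (rootSystem H).root δ ≠ 0)
    (h : (rootSystem H).root γ + (rootSystem H).root δ ∉ Set.range (rootSystem H).root) :
    ⁅x, y⁆ = 0 := by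
  by_contra hne
  have hxy := lie_mem_genWeightSpace_of_mem_genWeightSpace hx hy
  have hbot : rootSpace H ((γ.1 : H → ℂ) + δ.1) ≠ ⊥ := by
    intro hb
    have hxy' : ⁅x, y⁆ ∈ rootSpace H ((γ.1 : H → ℂ) + δ.1) := hxy
    rw [hb] at hxy'
    replace hxy := hxy'
    exact hne ((LieSubmodule.mem_bot _).mp hxy)
  let ω : LieModule.Weight ℂ H L := ⟨_, hbot⟩
  have hω : ω.IsNonZero := by
    intro hz
    apply h0
    ext z
    exact congrFun hz z
  refine h ⟨⟨ω, by simpa using hω⟩, ?_⟩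
  ext z
  rfl

namespace Splitting

variable {D : Splitting H}

theorem root_reflectionPerm_eq (s : D.S) (α : H.root) :
    (rootSystem H).root ((rootSystem H).reflectionPerm s.1 α) =
      (rootSystem H).root α - D.rn α s • (rootSystem H).root s.1 := by
  rw [RootPairing.root_reflectionPerm, RootPairing.reflection_apply_root, ← Int.cast_smul_eq_zsmul ℂ,
    rn, ← (rootSystem H).algebraMap_pairingIn ℤ]
  rfl

theorem cj_scr_of_comm {t : D.S} {X : End ℂ V} (he : D.re V t * X = X * D.re V t)
    (hf : D.rf V t * X = X * D.rf V t) : cj (D.scr V t) X = X := by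
  have h1 : ∀ a, cj (D.scx V t a) X = X := by
    intro a
    rw [cj_eq_iff, gv_scx, nexp_mul_eq (z := 0) (w := 0) ((D.re_isNilpotent V t).smul a)]
    · simp
    · rw [smul_mul_assoc, mul_smul_comm, he, sub_self]
    · simp
    · simp
  have h2 : ∀ a, cj (D.scy V t a) X = X := by
    intro a
    rw [cj_eq_iff, gv_scy, nexp_mul_eq (z := 0) (w := 0) ((D.rf_isNilpotent V t).smul a)]
    · simp
    · rw [smul_mul_assoc, mul_smul_comm, hf, sub_self]
    · simp
    · simp
  rw [scr, cj_mul, cj_mul, h1, h2, h1]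

/-- The reflection fixes `γ`, so with `γ - α_t` also `γ + α_t` is not a root. The root vector thus
commutes with `e_t` and `f_t`, and with everything built from them. -/
theorem cj_scr_of_rn_eq_zero {t : D.S} {γ : H.root} {y : L}
    (hy : y ∈ rootSpace H (γ.1 : H → ℂ)) (h0 : D.rn γ t = 0)
    (h : (rootSystem H).root γ - (rootSystem H).root t.1 ∉ Set.range (rootSystem H).root) :
    cj (D.scr V t) (rho V y) = rho V y := by
  have hrefl := root_reflectionPerm_eq t γ
  have hneg := root_reflectionPerm_self (P := rootSystem H) t.1
  have hne1 : (rootSystem H).root γ ≠ (rootSystem H).root t.1 := by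
    intro he
    rw [(rootSystem H).root.injective he, rn_self] at h0
    norm_num at h0
  have hne2 : (rootSystem H).root γ ≠ -(rootSystem H).root t.1 := by
    intro he
    rw [← hneg] at he
    rw [(rootSystem H).root.injective he, rn_reflectionPerm] at h0
    simp [rn_self] at h0
  have h' : (rootSystem H).root γ + (rootSystem H).root t.1 ∉ Set.range (rootSystem H).root := by
    rintro ⟨δ, hδ⟩
    apply h
    refine ⟨(rootSystem H).reflectionPerm t.1 δ, ?_⟩
    rw [RootPairing.root_reflectionPerm, hδ, map_add, ← RootPairing.root_reflectionPerm, hrefl, h0,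
      zero_smul, sub_zero, ← RootPairing.root_reflectionPerm, hneg, sub_eq_add_neg]
  have hcomm : ∀ z : L, ⁅z, y⁆ = 0 → rho V z * rho V y = rho V y * rho V z := by
    intro z hz
    have := rho_lie (V := V) z y
    rw [hz, map_zero] at this
    exact (sub_eq_zero.mp this.symm)
  apply cj_scr_of_comm
  · apply hcomm
    rw [← lie_skew, neg_eq_zero]
    exact lie_eq_zero_of_not_root hy (D.e_mem t) (fun h => hne2 (eq_neg_of_add_eq_zero_left h)) h'
  · apply hcomm
    rw [← lie_skew, neg_eq_zero]
    refine lie_eq_zero_of_not_root hy (D.f_mem' t) ?_ ?_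
    · rw [hneg, ← sub_eq_add_neg, sub_ne_zero]; exact hne1
    · rw [hneg, ← sub_eq_add_neg]; exact h

/-- The square of `r̄_s` is `α_s^∨(-1)`. -/
theorem cj_scr_scr (s : D.S) {γ : H.root} {y : L} (hy : y ∈ rootSpace H (γ.1 : H → ℂ)) :
    cj (D.scr V s) (cj (D.scr V s) (rho V y)) = ((-1 : ℂ) ^ D.rn γ s) • rho V y := by
  rw [← cj_mul, scr_mul_self, scCoroot_eq_tor, D.cj_tor _ (D.ewt_of_mem hy), chr_mulSingle]
  simp

theorem cj_scrw_two {s u : D.S} (h : D.rn u.1 s = 0) :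
    cj (D.scrw V [s]) (D.re V u) = D.re V u := by
  rw [scrw_cons, scrw_nil, mul_one]
  exact cj_scr_of_rn_eq_zero (D.e_mem u) h (D.base.sub_notMem_range_root u.2 s.2)

theorem lie_f_e {s u : D.S} (hsu : s ≠ u) :
    D.rf V s * D.re V u = D.re V u * D.rf V s := by
  have h := lie_eq_zero_of_not_root (D.e_mem u) (D.f_mem' s)
    (by rw [root_reflectionPerm_self, ← sub_eq_add_neg, sub_ne_zero]
        exact fun h => hsu (Subtype.ext ((rootSystem H).root.injective h)).symm)
    (by rw [root_reflectionPerm_self, ← sub_eq_add_neg]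
        exact D.base.sub_notMem_range_root u.2 s.2)
  have h2 := rho_lie (V := V) (D.e u) (D.f s)
  rw [h, map_zero] at h2
  exact (sub_eq_zero.mp h2.symm).symm

/-- The root string consists of `α_u` and `α_u + α_s`, so all exponentials stop at the linear term
and the sign can be computed directly. -/
theorem cj_scr_re_of_rn_neg_one {s u : D.S} (hsu : s ≠ u) (h : D.rn u.1 s = -1) :
    cj (D.scr V s) (D.re V u) = -(D.re V s * D.re V u - D.re V u * D.re V s) := by
  have hroot : (rootSystem H).root ((rootSystem H).reflectionPerm s.1 u.1) =
      (rootSystem H).root u.1 + (rootSystem H).root s.1 := by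
    rw [root_reflectionPerm_eq, h]; module
  have hmem : ⁅D.e s, D.e u⁆ ∈
      rootSpace H (((rootSystem H).reflectionPerm s.1 u.1).1 : H → ℂ) := by
    have h1 := lie_mem_genWeightSpace_of_mem_genWeightSpace (D.e_mem s) (D.e_mem u)
    convert h1 using 2
    funext z
    have h2 := LinearMap.congr_fun hroot z
    rw [LinearMap.add_apply, add_comm] at h2
    exact h2
  have hneg := root_reflectionPerm_self (P := rootSystem H) s.1
  have hzero : ⁅⁅D.e s, D.e u⁆, D.e s⁆ = 0 := by
    refine lie_eq_zero_of_not_root hmem (D.e_mem s) ?_ ?_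
    · rw [hroot, add_assoc, ← two_nsmul]
      intro h0
      have : IsAddTorsionFree (Dual ℂ H) := .of_isTorsionFree ℂ _
      refine (rootSystem H).nsmul_notMem_range_root (n := 2) (i := s.1)
        ⟨(rootSystem H).reflectionPerm u.1 u.1, ?_⟩
      rw [root_reflectionPerm_self]
      exact neg_eq_of_add_eq_zero_right h0
    · rintro ⟨δ, hδ⟩
      refine D.base.sub_notMem_range_root u.2 s.2 ⟨(rootSystem H).reflectionPerm s.1 δ, ?_⟩
      rw [RootPairing.root_reflectionPerm, hδ, map_add, ← RootPairing.root_reflectionPerm,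
        ← RootPairing.root_reflectionPerm, hneg, ← Equiv.Perm.mul_apply,
        reflectionPerm_mul_self, Equiv.Perm.one_apply, sub_eq_add_neg]
  have hfu := lie_f_e (V := V) hsu
  set Z := D.re V s * D.re V u - D.re V u * D.re V s with hZ
  have heZ : D.re V s * Z = Z * D.re V s := by
    have h1 := rho_lie (V := V) ⁅D.e s, D.e u⁆ (D.e s)
    rw [hzero, map_zero, rho_lie] at h1
    exact (sub_eq_zero.mp h1.symm).symm
  have hfZ : D.rf V s * Z - Z * D.rf V s = D.re V u := by
    have h1 := D.rh_re V u s
    rw [h, ← re_rf] at h1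
    have h2 : D.re V u = -((D.re V s * D.rf V s - D.rf V s * D.re V s) * D.re V u -
        D.re V u * (D.re V s * D.rf V s - D.rf V s * D.re V s)) := by
      rw [h1]; simp
    conv_rhs => rw [h2]
    have h4 : D.re V s * D.rf V s * D.re V u = D.re V s * D.re V u * D.rf V s := by
      rw [mul_assoc, hfu, mul_assoc]
    have h5 : D.re V u * D.rf V s * D.re V s = D.rf V s * D.re V u * D.re V s := by rw [hfu]
    simp only [hZ, sub_mul, mul_sub, ← mul_assoc]
    rw [h4, h5]
    abel
  have c1 : ∀ a, cj (D.scx V s a) (D.re V u) = D.re V u + a • Z := by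
    intro a
    rw [cj_eq_iff, gv_scx, nexp_mul_eq (z := a • Z) (w := 0) ((D.re_isNilpotent V s).smul a),
      add_zero]
    · rw [smul_mul_assoc, mul_smul_comm, ← smul_sub]
    · rw [smul_mul_smul_comm, smul_mul_smul_comm, heZ, sub_self, smul_zero]
    · simp
  have c2 : ∀ a, cj (D.scx V s a) Z = Z := by
    intro a
    rw [cj_eq_iff, gv_scx, nexp_mul_eq (z := 0) (w := 0) ((D.re_isNilpotent V s).smul a)]
    · simp
    · rw [smul_mul_assoc, mul_smul_comm, heZ, sub_self]
    · simp
    · simp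
  have c3 : ∀ a, cj (D.scy V s a) (D.re V u) = D.re V u := by
    intro a
    rw [cj_eq_iff, gv_scy, nexp_mul_eq (z := 0) (w := 0) ((D.rf_isNilpotent V s).smul a)]
    · simp
    · rw [smul_mul_assoc, mul_smul_comm, hfu, sub_self]
    · simp
    · simp
  have c4 : ∀ a, cj (D.scy V s a) Z = Z + a • D.re V u := by
    intro a
    rw [cj_eq_iff, gv_scy, nexp_mul_eq (z := a • D.re V u) (w := 0)
      ((D.rf_isNilpotent V s).smul a), add_zero]
    · rw [smul_mul_assoc, mul_smul_comm, ← smul_sub, hfZ]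
    · rw [smul_mul_smul_comm, smul_mul_smul_comm, hfu, sub_self, smul_zero]
    · simp
  rw [scr, cj_mul, cj_mul, c1, map_add, map_smul, c3, c4, map_add, map_smul, map_add, map_smul,
    c1, c2]
  module

/-- The case of type `A₂`. The coefficient is exactly `1`, which is what makes the braid relation
hold without a torus factor. -/
theorem cj_scrw_three {s u : D.S} (hsu : s ≠ u) (hq : D.rn u.1 s = -1) (hp : D.rn s.1 u = -1) :
    cj (D.scrw V [u, s]) (D.re V u) = D.re V s := by
  rw [scrw_cons, scrw_cons, scrw_nil, mul_one, cj_mul, cj_scr_re_of_rn_neg_one hsu hq, map_neg,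
    map_sub, map_mul, map_mul, cj_scr_re_of_rn_neg_one hsu.symm hp, cj_scr_re]
  have h1 := lie_f_e (V := V) hsu.symm
  have h2 := D.rh_re V s u
  rw [hp, ← re_rf] at h2
  have h3 : D.re V s = -((D.re V u * D.rf V u - D.rf V u * D.re V u) * D.re V s -
      D.re V s * (D.re V u * D.rf V u - D.rf V u * D.re V u)) := by
    rw [h2]; simp
  conv_rhs => rw [h3]
  have h4 : D.re V u * D.rf V u * D.re V s = D.re V u * D.re V s * D.rf V u := by
    rw [mul_assoc, h1, mul_assoc]
  have h5 : D.re V s * D.rf V u * D.re V u = D.rf V u * D.re V s * D.re V u := by rw [h1]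
  simp only [sub_mul, mul_sub, neg_mul, mul_neg, ← mul_assoc]
  rw [h4, h5]
  abel

/-- The case of type `B₂`: `r_s α_u` is orthogonal to `α_u`, so `r̄_u` fixes its root vector and the
square of `r̄_s` acts with sign `(-1)^{-2} = 1`. -/
theorem cj_scrw_four (hV : GeneratesWeightLattice H V) {s u : D.S} (hq : D.rn u.1 s = -2)
    (hp : D.rn s.1 u = -1) : cj (D.scrw V [s, u, s]) (D.re V u) = D.re V u := by
  obtain ⟨y, hy, hy'⟩ := D.exists_cj_scr (V := V) hV s (D.e_mem u)
  simp only [scrw_cons, scrw_nil, mul_one, cj_mul]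
  change cj (D.scr V s) (D.re V u) = rho V y at hy'
  rw [hy', cj_scr_of_rn_eq_zero hy, ← hy']
  · have := D.cj_scr_scr (V := V) s (D.e_mem u)
    rw [hq] at this
    change cj (D.scr V s) (cj (D.scr V s) (D.re V u)) = (-1 : ℂ) ^ (-2 : ℤ) • D.re V u at this
    rw [this]
    norm_num
  · rw [rn_reflectionPerm]
    simp [rn_self, hq, hp]
  · rw [root_reflectionPerm_eq, hq]
    have : IsAddTorsionFree (Dual ℂ H) := .of_isTorsionFree ℂ _
    convert (rootSystem H).nsmul_notMem_range_root (n := 2) (i := s.1) using 2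
    module

/-- The case of type `G₂`: `r_u r_s α_u` is orthogonal to `α_s`, so the middle reflection acts
trivially. The squares of `r̄_u` and `r̄_s` each contribute a sign, and the two signs cancel. -/
theorem cj_scrw_six (hV : GeneratesWeightLattice H V) {s u : D.S} (hq : D.rn u.1 s = -1)
    (hp : D.rn s.1 u = -3) : cj (D.scrw V [s, u, s, u, s]) (D.re V u) = D.re V u := by
  obtain ⟨y, hy, hy'⟩ := D.exists_cj_scr (V := V) hV s (D.e_mem u)
  obtain ⟨z, hz, hz'⟩ := D.exists_cj_scr (V := V) hV u hy
  simp only [scrw_cons, scrw_nil, mul_one, cj_mul]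
  change cj (D.scr V s) (D.re V u) = rho V y at hy'
  rw [hy', hz', cj_scr_of_rn_eq_zero hz, ← hz']
  · have h1 := D.cj_scr_scr (V := V) u hy
    have h2 := D.cj_scr_scr (V := V) s (D.e_mem u)
    rw [rn_reflectionPerm] at h1
    simp [hq, hp, rn_self] at h1
    rw [hq] at h2
    rw [h1, map_neg, ← hy']
    change cj (D.scr V s) (cj (D.scr V s) (D.re V u)) = _ at h2
    rw [h2]
    change -((-1 : ℂ) ^ (-1 : ℤ) • D.re V u) = _
    simp
  · rw [rn_reflectionPerm, rn_reflectionPerm]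
    simp [rn_self, hq, hp]
  · rw [root_reflectionPerm_eq, root_reflectionPerm_eq, rn_reflectionPerm, hq]
    have : IsAddTorsionFree (Dual ℂ H) := .of_isTorsionFree ℂ _
    convert (rootSystem H).nsmul_notMem_range_root (n := 2) (i := u.1) using 2
    simp [hp, rn_self]
    module

/-- The coordinates of a root in the span of two simple roots. -/
def Comb (s u : D.S) (i : H.root) (x y : ℤ) : Prop :=
  (rootSystem H).root i = x • (rootSystem H).root s.1 + y • (rootSystem H).root u.1

theorem Comb.symm {s u : D.S} {i : H.root} {x y : ℤ} (h : Comb s u i x y) : Comb u s i y x := by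
  rw [Comb, add_comm]; exact h

theorem comb_right (s u : D.S) : Comb s u u.1 0 1 := by simp [Comb]

theorem Comb.refl_left {s u : D.S} {i : H.root} {x y : ℤ} (h : Comb s u i x y) (z : ℤ)
    (hz : -x - y * D.rn u.1 s = z) : Comb s u ((rootSystem H).reflectionPerm s.1 i) z y := by
  rw [Comb, RootPairing.root_reflectionPerm, h, map_add, map_zsmul, map_zsmul,
    ← RootPairing.root_reflectionPerm, ← RootPairing.root_reflectionPerm,
    root_reflectionPerm_eq, root_reflectionPerm_eq, rn_self, ← hz]
  module

theorem Comb.refl_right {s u : D.S} {i : H.root} {x y : ℤ} (h : Comb s u i x y) (z : ℤ)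
    (hz : -y - x * D.rn s.1 u = z) : Comb s u ((rootSystem H).reflectionPerm u.1 i) x z :=
  (h.symm.refl_left z hz).symm

theorem Comb.exists_nat {s u : D.S} {i : H.root} {x y : ℤ} (h : Comb s u i x y) (hx : 0 ≤ x)
    (hy : 0 ≤ y) : ∃ m n : ℕ, (rootSystem H).root i =
      m • (rootSystem H).root s.1 + n • (rootSystem H).root u.1 := by
  lift x to ℕ using hx
  lift y to ℕ using hy
  exact ⟨x, y, by rw [h, natCast_zsmul, natCast_zsmul]⟩

theorem Comb.eq_right {s u : D.S} {i : H.root} (h : Comb s u i 0 1) : i = u.1 := by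
  apply (rootSystem H).root.injective
  rw [h]; simp

/-- The data of a braid relation. -/
def BraidRel (V : Type*) [AddCommGroup V] [Module ℂ V] [FiniteDimensional ℂ V]
    [LieRingModule L V] [LieModule ℂ L V] (s u : D.S) : Prop :=
  ∃ m, 0 < m ∧ AltNonneg D.base s u m ∧ AltNonneg D.base u s m ∧
      wordRefl D.base (alt s u m) = wordRefl D.base (alt u s m) ∧
      D.scrw V (alt s u m) = D.scrw V (alt u s m)

theorem BraidRel.symm {s u : D.S} (h : BraidRel V s u) : BraidRel V u s := by
  obtain ⟨m, h0, h1, h2, h3, h4⟩ := h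
  exact ⟨m, h0, h2, h1, h3.symm, h4.symm⟩

/-- If the lift carries `e_s` to exactly `e_t`, it carries `f_s` to `f_t` as well, hence `r̄_s` to
`r̄_t`. -/
theorem scrw_mul_scr_of_cj (hV : GeneratesWeightLattice H V) {l : List D.S} {s t : D.S}
    (h : wordPerm D.base l s.1 = t.1) (h' : cj (D.scrw V l) (D.re V s) = D.re V t) :
    D.scrw V (t :: l) = D.scrw V (l ++ [s]) := by
  obtain ⟨a, ha, ha'⟩ := exists_scrw_conj hV h
  have h1 : (a : ℂ) = 1 := by
    rw [h'] at ha
    refine smul_left_injective ℂ (re_ne_zero hV t) ?_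
    simpa using ha.symm
  have h2 := mul_scth_of_cj ha ha' (-1)
  rw [Units.val_eq_one.mp h1, one_mul, ← scr_eq, ← scr_eq] at h2
  rw [scrw_cons, scrw_append, scrw_cons, scrw_nil, mul_one, h2]

/-- The cases are `A₁ × A₁`, `A₂`, `B₂` and `G₂`, each with one ordering of the two letters. -/
theorem BraidRel.of_rn (hV : GeneratesWeightLattice H V) {s u : D.S} (hsu : s ≠ u)
    (h : (D.rn u.1 s = 0 ∧ D.rn s.1 u = 0) ∨ (D.rn u.1 s = -1 ∧ D.rn s.1 u = -1) ∨
      (D.rn u.1 s = -2 ∧ D.rn s.1 u = -1) ∨ (D.rn u.1 s = -1 ∧ D.rn s.1 u = -3)) :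
    BraidRel V s u := by
  -- The families `c`, `c1`, … and `d`, `d1`, … record the coordinates of the images of `α_u` and
  -- `α_s` under alternating words of growing length. All are nonnegative, and the last `c` is again
  -- a simple root, which gives the relation.
  have c := comb_right s u
  have d := (comb_right u s).symm
  rcases h with ⟨hq, hp⟩ | ⟨hq, hp⟩ | ⟨hq, hp⟩ | ⟨hq, hp⟩
  · have c1 := c.refl_left 0 (by rw [hq]; norm_num)
    have d1 := d.refl_right 0 (by rw [hp]; norm_num)
    refine ⟨2, by norm_num, ?_, ?_, ?_, ?_⟩
    · intro k hk
      interval_cases k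
      · exact c.exists_nat (by norm_num) (by norm_num)
      · exact c1.exists_nat (by norm_num) (by norm_num)
    · intro k hk
      interval_cases k
      · exact d.symm.exists_nat (by norm_num) (by norm_num)
      · exact d1.symm.exists_nat (by norm_num) (by norm_num)
    · exact wordRefl_concat_of_wordPerm_eq (l := [s]) c1.eq_right
    · exact scrw_mul_scr_of_cj hV (l := [s]) c1.eq_right (cj_scrw_two hq)
  · have c1 := c.refl_left 1 (by rw [hq]; norm_num)
    have c2 := c1.refl_right 0 (by rw [hp]; norm_num)
    have d1 := d.refl_right 1 (by rw [hp]; norm_num)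
    have d2 := d1.refl_left 0 (by rw [hq]; norm_num)
    refine ⟨3, by norm_num, ?_, ?_, ?_, ?_⟩
    · intro k hk
      interval_cases k
      · exact c.exists_nat (by norm_num) (by norm_num)
      · exact c1.exists_nat (by norm_num) (by norm_num)
      · exact c2.exists_nat (by norm_num) (by norm_num)
    · intro k hk
      interval_cases k
      · exact d.symm.exists_nat (by norm_num) (by norm_num)
      · exact d1.symm.exists_nat (by norm_num) (by norm_num)
      · exact d2.symm.exists_nat (by norm_num) (by norm_num)
    · exact wordRefl_concat_of_wordPerm_eq (l := [u, s]) c2.symm.eq_right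
    · exact scrw_mul_scr_of_cj hV (l := [u, s]) c2.symm.eq_right (cj_scrw_three hsu hq hp)
  · have c1 := c.refl_left 2 (by rw [hq]; norm_num)
    have c2 := c1.refl_right 1 (by rw [hp]; norm_num)
    have c3 := c2.refl_left 0 (by rw [hq]; norm_num)
    have d1 := d.refl_right 1 (by rw [hp]; norm_num)
    have d2 := d1.refl_left 1 (by rw [hq]; norm_num)
    have d3 := d2.refl_right 0 (by rw [hp]; norm_num)
    refine ⟨4, by norm_num, ?_, ?_, ?_, ?_⟩
    · intro k hk
      interval_cases k
      · exact c.exists_nat (by norm_num) (by norm_num)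
      · exact c1.exists_nat (by norm_num) (by norm_num)
      · exact c2.exists_nat (by norm_num) (by norm_num)
      · exact c3.exists_nat (by norm_num) (by norm_num)
    · intro k hk
      interval_cases k
      · exact d.symm.exists_nat (by norm_num) (by norm_num)
      · exact d1.symm.exists_nat (by norm_num) (by norm_num)
      · exact d2.symm.exists_nat (by norm_num) (by norm_num)
      · exact d3.symm.exists_nat (by norm_num) (by norm_num)
    · exact wordRefl_concat_of_wordPerm_eq (l := [s, u, s]) c3.eq_right
    · exact scrw_mul_scr_of_cj hV (l := [s, u, s]) c3.eq_right (cj_scrw_four hV hq hp)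
  · have c1 := c.refl_left 1 (by rw [hq]; norm_num)
    have c2 := c1.refl_right 2 (by rw [hp]; norm_num)
    have c3 := c2.refl_left 1 (by rw [hq]; norm_num)
    have c4 := c3.refl_right 1 (by rw [hp]; norm_num)
    have c5 := c4.refl_left 0 (by rw [hq]; norm_num)
    have d1 := d.refl_right 3 (by rw [hp]; norm_num)
    have d2 := d1.refl_left 2 (by rw [hq]; norm_num)
    have d3 := d2.refl_right 3 (by rw [hp]; norm_num)
    have d4 := d3.refl_left 1 (by rw [hq]; norm_num)
    have d5 := d4.refl_right 0 (by rw [hp]; norm_num)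
    refine ⟨6, by norm_num, ?_, ?_, ?_, ?_⟩
    · intro k hk
      interval_cases k
      · exact c.exists_nat (by norm_num) (by norm_num)
      · exact c1.exists_nat (by norm_num) (by norm_num)
      · exact c2.exists_nat (by norm_num) (by norm_num)
      · exact c3.exists_nat (by norm_num) (by norm_num)
      · exact c4.exists_nat (by norm_num) (by norm_num)
      · exact c5.exists_nat (by norm_num) (by norm_num)
    · intro k hk
      interval_cases k
      · exact d.symm.exists_nat (by norm_num) (by norm_num)
      · exact d1.symm.exists_nat (by norm_num) (by norm_num)
      · exact d2.symm.exists_nat (by norm_num) (by norm_num)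
      · exact d3.symm.exists_nat (by norm_num) (by norm_num)
      · exact d4.symm.exists_nat (by norm_num) (by norm_num)
      · exact d5.symm.exists_nat (by norm_num) (by norm_num)
    · exact wordRefl_concat_of_wordPerm_eq (l := [s, u, s, u, s]) c5.eq_right
    · exact scrw_mul_scr_of_cj hV (l := [s, u, s, u, s]) c5.eq_right (cj_scrw_six hV hq hp)

/-- The finite list of Cartan integers of two roots, restricted to nonpositive values, leaves the
rank two cases and their transposes. -/
theorem braidRel (hV : GeneratesWeightLattice H V) {s u : D.S} (hsu : s ≠ u) :
    BraidRel V s u := by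
  have hne : s.1 ≠ u.1 := fun h => hsu (Subtype.ext h)
  have h0 : D.rn s.1 u ≤ 0 := D.base.pairingIn_le_zero_of_ne hne s.2 u.2
  have h := (rootSystem H).pairingIn_pairingIn_mem_set_of_isCrystal_of_isRed' s.1 u.1
    (fun h => hne ((rootSystem H).root.injective h)) (fun h => by
      have h1 := D.base.height_one_of_mem_support s.2
      have h2 := D.base.height_one_of_mem_support u.2
      have h3 := heightForm_root (b := D.base) s.1
      rw [h, map_neg, heightForm_root, h1, h2] at h3
      norm_num at h3)
  change (D.rn s.1 u, D.rn u.1 s) ∈ _ at h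
  simp only [Set.mem_insert_iff, Set.mem_singleton_iff, Prod.mk.injEq] at h
  rcases h with h | h | h | h | h | h | h | h | h | h | h
  all_goals first
    | (exfalso; omega)
    | exact BraidRel.of_rn hV hsu (by omega)
    | exact (BraidRel.of_rn hV hsu.symm (by omega)).symm

theorem scrw_eq_of_wordRefl_eq (hV : GeneratesWeightLattice H V) {l l' : List D.S}
    (hl : RedWord D.base l) (hl' : RedWord D.base l') (h : wordRefl D.base l = wordRefl D.base l') :
    D.scrw V l = D.scrw V l' :=
  matsumoto (D.scr V) (fun _ _ hsu => braidRel hV hsu) _ l l' rfl hl hl' h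

end Splitting

end Pinnings

end

/-! ### The lift of `w₀` and the torus of the adjoint group -/

noncomputable section

namespace Pinnings

open scoped Classical

set_option linter.unusedSectionVars false

variable {L : Type*} [LieRing L] [LieAlgebra ℂ L] [FiniteDimensional ℂ L] [IsKilling ℂ L]
variable {H : LieSubalgebra ℂ L} [H.IsCartanSubalgebra]
variable {V : Type*} [AddCommGroup V] [Module ℂ V] [FiniteDimensional ℂ V]
  [LieRingModule L V] [LieModule ℂ L V]

namespace Splitting

variable {D : Splitting H}

/-- A reduced word sending one simple root to another respects the Chevalley generators. -/
theorem cj_scrw_of_wordPerm (hV : GeneratesWeightLattice H V) {l : List D.S} {s t : D.S}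
    (hl : RedWord D.base l) (h : wordPerm D.base l s.1 = t.1) :
    cj (D.scrw V l) (D.re V s) = D.re V t ∧ cj (D.scrw V l) (D.rf V s) = D.rf V t := by
  obtain ⟨a, ha, ha'⟩ := exists_scrw_conj (V := V) hV h
  have hr := wordRefl_concat_of_wordPerm_eq h
  have h1 : RedWord D.base (l ++ [s]) :=
    hl.append_of_isPos (by rw [h]; exact D.simple_isPos t)
  -- The words `t :: l` and `l ++ [s]` are reduced for the same element, so their lifts agree. This
  -- removes the torus factor in the conjugation formula and forces the scalar `a` to be `1`.
  have h2 := scrw_eq_of_wordRefl_eq (V := V) hV (h1.of_wordRefl_eq hr (by simp)) h1 hr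
  have h3 := mul_scth_of_cj ha ha' (-1)
  rw [scrw_cons, scrw_append, scrw_cons, scrw_nil, mul_one] at h2
  rw [← scr_eq, ← h2] at h3
  have h4 := mul_right_cancel h3
  rw [scr_eq, scth_eq_scCoroot, scth_eq_scCoroot, mul_left_inj, scCoroot_eq_tor,
    scCoroot_eq_tor] at h4
  have h5 := Pi.mulSingle_injective t (D.tor_injective V hV h4)
  have h6 : a = 1 := by simpa using h5.symm
  rw [h6] at ha ha'
  exact ⟨by simpa using ha, by simpa using ha'⟩

theorem w0Word_spec {l : List D.S} (hl : D.IsLongestWord l) : LongWord D.base D.w0Word :=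
  Classical.epsilon_spec (p := D.IsLongestWord) ⟨l, hl⟩

theorem scw0_eq_scrw (hV : GeneratesWeightLattice H V) {l : List D.S} (hl : LongWord D.base l) :
    D.scw0 V = D.scrw V l :=
  have hw := w0Word_spec hl
  scrw_eq_of_wordRefl_eq hV hw.1 hl.1 (hw.wordRefl_eq hl)

section Star

variable (hw : LongWord D.base D.w0Word)

include hw

theorem root_star (s : D.S) : (rootSystem H).root (D.star s).1 =
    -wordRefl D.base D.w0Word ((rootSystem H).root s.1) :=
  Classical.epsilon_spec (hw.exists_star s)

theorem star_star (s : D.S) : D.star (D.star s) = s := by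
  apply Subtype.ext
  apply (rootSystem H).root.injective
  rw [root_star hw, root_star hw, map_neg, neg_neg, ← LinearEquiv.mul_apply, hw.mul_self]
  rfl

theorem star_injective : Function.Injective D.star :=
  fun s t h => by rw [← star_star hw s, h, star_star hw]

/-- By exchange `w₀` has a reduced word that ends in `s`; its remaining part sends `α_s` to `-w₀ α_s
= α_{s*}`. -/
theorem exists_redWord_star (s : D.S) : ∃ l : List D.S, LongWord D.base (l ++ [s]) ∧
    wordPerm D.base l s.1 = (D.star s).1 := by
  obtain ⟨l₁, t, l₂, hl, -, h⟩ := exists_exchange D.w0Word (hw.not_isPos (D.simple_isPos s))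
  have h1 : wordRefl D.base (l₁ ++ l₂ ++ [s]) = wordRefl D.base D.w0Word := by
    rw [wordRefl_append, h, wordRefl_append, mul_assoc, wordRefl_cons, wordRefl_nil, mul_one,
      reflection_mul_self, mul_one]
  refine ⟨l₁ ++ l₂, LongWord.of_length_le hw h1 ?_, ?_⟩
  · rw [hl]; simp
  · apply (rootSystem H).root.injective
    rw [root_wordPerm, root_star hw, h, wordRefl_append, LinearEquiv.mul_apply, wordRefl_cons,
      wordRefl_nil, mul_one, RootPairing.reflection_apply_self, map_neg]

/-- With `w₀ = l s` as in `exists_redWord_star`, `r̄_s` exchanges `e_s` and `f_s` up to sign and the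
lift of `l` carries the generators of `s` to those of `s*` without scalars. -/
theorem cj_scw0 (hV : GeneratesWeightLattice H V) (s : D.S) :
    cj (D.scw0 V) (D.re V s) = -D.rf V (D.star s) ∧
      cj (D.scw0 V) (D.rf V s) = -D.re V (D.star s) := by
  obtain ⟨l, hl, hs⟩ := exists_redWord_star hw s
  obtain ⟨h1, h2⟩ := cj_scrw_of_wordPerm (V := V) hV hl.1.left hs
  rw [scw0_eq_scrw hV hl, scrw_append, scrw_cons, scrw_nil, mul_one, cj_mul, cj_mul, cj_scr_re,
    cj_scr_rf, map_neg, map_neg, h1, h2]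
  exact ⟨rfl, rfl⟩

theorem scw0_mul_scx (hV : GeneratesWeightLattice H V) (s : D.S) (c : ℂ) :
    D.scw0 V * D.scx V s c = D.scy V (D.star s) (-c) * D.scw0 V := by
  rw [← mul_inv_eq_iff_eq_mul]
  apply gv_injective
  rw [← cj_gv, gv_scx, gv_scy, cj_nexp _ ((D.re_isNilpotent V s).smul c), map_smul,
    (cj_scw0 hw hV s).1, smul_neg, neg_smul]

theorem scw0_mul_scy (hV : GeneratesWeightLattice H V) (s : D.S) (c : ℂ) :
    D.scw0 V * D.scy V s c = D.scx V (D.star s) (-c) * D.scw0 V := by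
  rw [← mul_inv_eq_iff_eq_mul]
  apply gv_injective
  rw [← cj_gv, gv_scx, gv_scy, cj_nexp _ ((D.rf_isNilpotent V s).smul c), map_smul,
    (cj_scw0 hw hV s).2, smul_neg, neg_smul]

/-- Conjugation by `w̄₀` exchanges `x` and `y`, so one side uses the form `x y x` and the other the
form `y x y`. -/
theorem scw0_mul_scth (hV : GeneratesWeightLattice H V) (s : D.S) (a : ℂˣ) :
    D.scw0 V * D.scth V s a = D.scth V (D.star s) a⁻¹ * D.scw0 V := by
  rw [scth, scth_eq, ← mul_assoc, ← mul_assoc, scw0_mul_scx hw hV, mul_assoc (D.scy V _ _),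
    scw0_mul_scy hw hV, ← mul_assoc, mul_assoc _ (D.scw0 V), scw0_mul_scx hw hV, ← mul_assoc,
    inv_inv, neg_neg]

theorem scw0_mul_scr (hV : GeneratesWeightLattice H V) (s : D.S) :
    D.scw0 V * D.scr V s = D.scr V (D.star s) * D.scw0 V := by
  rw [scr_eq, scr_eq, scw0_mul_scth hw hV, inv_neg, inv_one]

theorem scw0_mul_scCoroot (hV : GeneratesWeightLattice H V) (s : D.S) (a : ℂˣ) :
    D.scw0 V * D.scCoroot V s a = D.scCoroot V (D.star s) a⁻¹ * D.scw0 V := by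
  rw [scCoroot_eq, scCoroot_eq, ← mul_assoc, scw0_mul_scth hw hV, mul_assoc, scw0_mul_scr hw hV,
    ← mul_assoc]

omit hw in
variable (D) in
/-- The action of `w₀` on the maximal torus. -/
def starAct : (D.S → ℂˣ) →* (D.S → ℂˣ) where
  toFun c t := (c (D.star t))⁻¹
  map_one' := by funext; simp
  map_mul' c d := by funext; simp [mul_comm]

theorem starAct_mulSingle (s : D.S) (a : ℂˣ) :
    D.starAct (Pi.mulSingle s a) = Pi.mulSingle (D.star s) a⁻¹ := by
  funext t
  change ((Pi.mulSingle s a : D.S → ℂˣ) (D.star t))⁻¹ = _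
  by_cases h : t = D.star s
  · rw [h, star_star hw, Pi.mulSingle_eq_same, Pi.mulSingle_eq_same]
  · rw [Pi.mulSingle_eq_of_ne h, Pi.mulSingle_eq_of_ne, inv_one]
    rintro rfl
    exact h (star_star hw t).symm

theorem scw0_mul_tor (hV : GeneratesWeightLattice H V) (c : D.S → ℂˣ) :
    D.scw0 V * D.tor V c = D.tor V (D.starAct c) * D.scw0 V := by
  induction c using Pi.mulSingle_induction with
  | one => simp
  | mul c d hc hd => rw [map_mul, map_mul, map_mul, ← mul_assoc, hc, mul_assoc, hd, ← mul_assoc]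
  | mulSingle s a =>
    rw [← scCoroot_eq_tor, scw0_mul_scCoroot hw hV, starAct_mulSingle hw, scCoroot_eq_tor]

omit hw in
theorem rf_ne_zero (hV : GeneratesWeightLattice H V) (s : D.S) : D.rf V s ≠ 0 := by
  intro h0
  apply f_ne_zero s
  apply rho_injective V hV
  rw [map_zero]
  exact h0

theorem chr_starAct (hV : GeneratesWeightLattice H V) (t : D.S) (c : D.S → ℂˣ) :
    chr (D.rn t.1) (D.starAct c) = (chr (D.rn (D.star t).1) c)⁻¹ := by
  have h := congrArg (fun g => cj g (D.re V (D.star t))) (scw0_mul_tor hw hV c)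
  simp only [cj_mul] at h
  rw [D.cj_tor c (D.ewt_re _), map_smul, (cj_scw0 hw hV _).1, star_star hw, map_neg,
    D.cj_tor _ (D.ewt_rf t), chr_neg, smul_neg, neg_inj] at h
  have h1 := smul_left_injective ℂ (rf_ne_zero hV t) h
  rw [← inv_inj, inv_inv, Units.ext h1]

end Star

/-- The characters trivial on `c` form a subgroup, and every root is an integral combination of
simple ones. -/
theorem chr_rn_eq_one {c : D.S → ℂˣ} (h : ∀ t : D.S, chr (D.rn t.1) c = 1) (α : H.root) :
    chr (D.rn α) c = 1 := by
  let K : AddSubgroup (D.S → ℤ) :=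
    { carrier := {n | chr n c = 1}
      zero_mem' := chr_zero c
      add_mem' := fun {n m} hn hm => by
        change chr (n + m) c = 1
        rw [chr_add, hn, hm, mul_one]
      neg_mem' := fun {n} hn => by
        change chr (-n) c = 1
        rw [chr_neg, hn, inv_one] }
  obtain ⟨f, -, -, hf⟩ := D.base.exists_root_eq_sum_int α
  have h1 : D.rn α = ∑ j : D.S, f j.1 • D.rn j.1 := by
    funext t
    have h2 := LinearMap.congr_fun hf (coroot t.1.1)
    have h3 : ((D.rn α t : ℤ) : ℂ) = ((∑ j : D.S, f j.1 • D.rn j.1) t : ℤ) := by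
      rw [rn_cast]
      refine h2.trans ?_
      rw [← Finset.sum_coe_sort, LinearMap.sum_apply, Finset.sum_apply, Int.cast_sum]
      refine Finset.sum_congr rfl fun j _ => ?_
      rw [LinearMap.smul_apply, Pi.smul_apply, zsmul_eq_mul, smul_eq_mul, Int.cast_mul, rn_cast]
      rfl
    exact_mod_cast h3
  change D.rn α ∈ K
  rw [h1]
  exact sum_mem fun j _ => K.zsmul_mem (h j) _

/-- A nonzero vector in the space of a nonzero weight of `L` is a root vector, so root elements
generate the group. -/
theorem mem_center_of_comm_rexp {z : SCGroup H V}
    (h : ∀ (α : H.root) (x : L) (hx : x ∈ rootSpace H (α.1 : H → ℂ)),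
      rexp (root_ne_zero α) hx * z = z * rexp (root_ne_zero α) hx) :
    z ∈ Subgroup.center (SCGroup H V) := by
  have hgen : ∀ (χ : H → ℂ) (hχ : χ ≠ 0) (x : L) (hx : x ∈ rootSpace H χ),
      (rexp hχ hx : SCGroup H V) * z = z * rexp hχ hx := by
    intro χ hχ x hx
    by_cases hx0 : x = 0
    · have : (rexp hχ hx : SCGroup H V) = 1 := by
        apply gv_injective
        rw [gv_rexp, hx0, map_zero, nexp_zero, map_one]
      rw [this, one_mul, mul_one]
    · have hne : rootSpace H χ ≠ ⊥ := by
        intro hb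
        rw [hb] at hx
        exact hx0 ((LieSubmodule.mem_bot _).mp hx)
      let ω : LieModule.Weight ℂ H L := ⟨χ, hne⟩
      have hω : ω.IsNonZero := hχ
      exact h ⟨ω, by simpa using hω⟩ x hx
  rw [Subgroup.mem_center_iff]
  rintro ⟨g, hg⟩
  let Q : Subgroup (SCGroup H V) := Subgroup.centralizer {z}
  have hQ : ∀ k : SCGroup H V, k * z = z * k → k ∈ Q := fun k hk => by
    rw [Subgroup.mem_centralizer_singleton_iff]
    exact hk
  have : (⟨g, hg⟩ : SCGroup H V) ∈ Q := by
    induction hg using Subgroup.closure_induction with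
    | mem g hg =>
      obtain ⟨χ, hχ, x, hx, rfl⟩ := hg
      exact hQ _ (hgen χ hχ x hx)
    | one => exact one_mem Q
    | mul g k hg hk ihg ihk => exact mul_mem (a := (⟨g, hg⟩ : SCGroup H V)) ihg ihk
    | inv g hg ih => exact inv_mem (x := (⟨g, hg⟩ : SCGroup H V)) ih
  exact (Subgroup.mem_centralizer_singleton_iff.mp this)

theorem tor_mem_center {c : D.S → ℂˣ} (h : ∀ t : D.S, chr (D.rn t.1) c = 1) :
    D.tor V c ∈ Subgroup.center (SCGroup H V) := by
  refine mem_center_of_comm_rexp fun α x hx => ?_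
  have h1 := mul_rexp_mul_inv (V := V) (g := D.tor V c) (root_ne_zero α) (root_ne_zero α) hx hx
    (by rw [D.cj_tor c (D.ewt_of_mem hx), chr_rn_eq_one h, Units.val_one, one_smul])
  rw [mul_inv_eq_iff_eq_mul] at h1
  exact h1.symm

theorem chr_rn_of_mem_center (hV : GeneratesWeightLattice H V) {c : D.S → ℂˣ}
    (h : D.tor V c ∈ Subgroup.center (SCGroup H V)) (t : D.S) : chr (D.rn t.1) c = 1 := by
  have h1 := (Subgroup.mem_center_iff.mp h (D.scx V t 1)).symm
  rw [tor_mul_scx] at h1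
  have h2 := D.scx_injective hV t (mul_right_cancel h1)
  rw [mul_one] at h2
  exact Units.ext h2

/-- The square lies in the torus because `w₀² = 1`, and it fixes every `e_t`, since the two signs
cancel. -/
theorem scw0_mul_self_mem_center (hV : GeneratesWeightLattice H V)
    (hw : LongWord D.base D.w0Word) :
    D.scw0 V * D.scw0 V ∈ Subgroup.center (SCGroup H V) := by
  obtain ⟨c, hc⟩ := exists_scrw_eq_tor (V := V) hV _ (D.w0Word ++ D.w0Word) rfl
    (by rw [wordRefl_append, hw.mul_self])
  rw [scrw_append] at hc
  change D.scw0 V * D.scw0 V = _ at hc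
  rw [hc]
  refine tor_mem_center fun t => ?_
  have h1 := D.cj_tor (V := V) c (D.ewt_re t)
  rw [← hc, cj_mul, (cj_scw0 hw hV t).1, map_neg, (cj_scw0 hw hV _).2, star_star hw, neg_neg] at h1
  have h2 : ((1 : ℂˣ) : ℂ) • D.re V t = ((chr (D.rn t.1) c : ℂˣ) : ℂ) • D.re V t := by
    rw [← h1, Units.val_one, one_smul]
  exact (Units.ext (smul_left_injective ℂ (re_ne_zero hV t) h2)).symm

/-! ### The torus of the adjoint group -/

variable (D V) in
/-- The element `h` of the Cartan subgroup of the adjoint group with `h^{α_t} = z t`. -/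
def adt : (D.S → ℂˣ) →* AdjGroup H V where
  -- Two solutions of `c^{α_t} = z t` differ by an element on which all roots are trivial. It is
  -- central, so the choice disappears in the adjoint group.
  toFun z := proj H V (D.tor V (D.exists_chr_eq z).choose)
  map_one' := by
    rw [← map_one (proj H V), proj_eq_iff]
    exact (mul_one (D.tor V _)⁻¹).symm ▸ inv_mem (tor_mem_center (D.exists_chr_eq 1).choose_spec)
  map_mul' z z' := by
    rw [← map_mul, proj_eq_iff, ← map_mul, ← map_inv, ← map_mul]
    refine tor_mem_center fun t => ?_
    rw [map_mul, map_inv, map_mul, (D.exists_chr_eq (z * z')).choose_spec,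
      (D.exists_chr_eq z).choose_spec, (D.exists_chr_eq z').choose_spec]
    simp

theorem proj_tor {c z : D.S → ℂˣ} (h : ∀ t : D.S, chr (D.rn t.1) c = z t) :
    proj H V (D.tor V c) = D.adt V z := by
  change _ = proj H V (D.tor V (D.exists_chr_eq z).choose)
  rw [proj_eq_iff, ← map_inv, ← map_mul]
  refine tor_mem_center fun t => ?_
  rw [map_mul, map_inv, h, (D.exists_chr_eq z).choose_spec, inv_mul_cancel]

variable (D V) in
theorem exists_adt_eq (z : D.S → ℂˣ) : ∃ c, (∀ t : D.S, chr (D.rn t.1) c = z t) ∧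
    D.adt V z = proj H V (D.tor V c) :=
  ⟨_, (D.exists_chr_eq z).choose_spec, rfl⟩

theorem adt_injective (hV : GeneratesWeightLattice H V) : Function.Injective (D.adt V) := by
  rw [injective_iff_map_eq_one]
  intro z hz
  obtain ⟨c, hc, h⟩ := D.exists_adt_eq V z
  rw [h, ← map_one (proj H V), proj_eq_iff, mul_one] at hz
  funext t
  rw [← hc, chr_rn_of_mem_center hV (inv_mem_iff.mp hz)]
  rfl

theorem adt_mul_x (z : D.S → ℂˣ) (s : D.S) (a : ℂ) :
    D.adt V z * D.x V s a = D.x V s (z s * a) * D.adt V z := by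
  obtain ⟨c, hc, h⟩ := D.exists_adt_eq V z
  rw [h, x, x, ← map_mul, ← map_mul, tor_mul_scx, hc]

theorem adt_mul_y (z : D.S → ℂˣ) (s : D.S) (a : ℂ) :
    D.adt V z * D.y V s a = D.y V s ((z s)⁻¹ * a) * D.adt V z := by
  obtain ⟨c, hc, h⟩ := D.exists_adt_eq V z
  rw [h, y, y, ← map_mul, ← map_mul, tor_mul_scy, hc, Units.val_inv_eq_inv_val]

theorem T_eq_range : D.T V = (D.adt V).range := by
  rw [T, scT_eq_range]
  ext g
  constructor
  · rintro ⟨_, ⟨c, rfl⟩, rfl⟩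
    exact ⟨_, (proj_tor fun t => rfl).symm⟩
  · rintro ⟨z, rfl⟩
    obtain ⟨c, -, h⟩ := D.exists_adt_eq V z
    exact ⟨_, ⟨c, rfl⟩, h.symm⟩

theorem x_injective (hV : GeneratesWeightLattice H V) (s : D.S) :
    Function.Injective (D.x V s) := fun a b h =>
  D.scx_injective hV s (D.proj_injOn (D.scx_mem_scU V s a) (D.scx_mem_scU V s b) h)

/-- The conjugation rule determines the element among those of the Cartan subgroup, because `x_t` is
injective. -/
theorem coweight_eq (hV : GeneratesWeightLattice H V) (s : D.S) (a : ℂˣ) :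
    D.coweight V s a = D.adt V (Pi.mulSingle s a) := by
  have hval : ∀ t, ((Pi.mulSingle s a : D.S → ℂˣ) t : ℂ) = if s = t then (a : ℂ) else 1 := by
    intro t
    rw [Pi.mulSingle_apply]
    simp only [eq_comm (a := t)]
    split_ifs <;> rfl
  have hex : ∃ h : AdjGroup H V, h ∈ D.T V ∧ ∀ (t : D.S) (b : ℂ),
      h * D.x V t b * h⁻¹ = D.x V t ((if s = t then (a : ℂ) else 1) * b) := by
    refine ⟨D.adt V (Pi.mulSingle s a), ?_, fun t b => ?_⟩
    · rw [T_eq_range]; exact ⟨_, rfl⟩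
    · rw [adt_mul_x, mul_inv_cancel_right, hval]
  obtain ⟨h1, h2⟩ := Classical.epsilon_spec hex
  change D.coweight V s a ∈ D.T V at h1
  rw [T_eq_range] at h1
  obtain ⟨z, hz⟩ := h1
  rw [← hz]
  congr 1
  funext t
  apply Units.ext
  have h3 := h2 t 1
  change D.coweight V s a * _ * (D.coweight V s a)⁻¹ = _ at h3
  rw [← hz, adt_mul_x, mul_inv_cancel_right] at h3
  have h4 := x_injective hV t h3
  rw [mul_one, mul_one] at h4
  rw [h4, hval]

section W0

variable (hV : GeneratesWeightLattice H V) (hw : LongWord D.base D.w0Word)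

include hV hw

theorem w0_mul_self : D.w0 V * D.w0 V = 1 := by
  rw [w0, ← map_mul, ← map_one (proj H V), proj_eq_iff, mul_one]
  exact inv_mem (scw0_mul_self_mem_center hV hw)

theorem w0_inv : (D.w0 V)⁻¹ = D.w0 V := inv_eq_of_mul_eq_one_left (w0_mul_self hV hw)

theorem w0_mul_x (s : D.S) (a : ℂ) : D.w0 V * D.x V s a = D.y V (D.star s) (-a) * D.w0 V := by
  rw [w0, x, y, ← map_mul, ← map_mul, scw0_mul_scx hw hV]

theorem w0_mul_adt (z : D.S → ℂˣ) :
    D.w0 V * D.adt V z = D.adt V (D.starAct z) * D.w0 V := by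
  obtain ⟨c, hc, h⟩ := D.exists_adt_eq V z
  rw [h, w0, ← map_mul, scw0_mul_tor hw hV, map_mul]
  congr 1
  refine proj_tor fun t => ?_
  rw [chr_starAct hw hV, hc]
  rfl

end W0

end Splitting

end Pinnings

end

/-! ### Uniqueness of factors, generic flags and flags at simple distance -/

noncomputable section

namespace Pinnings

open scoped Classical

set_option linter.unusedSectionVars false

variable {L : Type*} [LieRing L] [LieAlgebra ℂ L] [FiniteDimensional ℂ L] [IsKilling ℂ L]
variable {H : LieSubalgebra ℂ L} [H.IsCartanSubalgebra]
variable {V : Type*} [AddCommGroup V] [Module ℂ V] [FiniteDimensional ℂ V]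
  [LieRingModule L V] [LieModule ℂ L V]

namespace Splitting

variable {D : Splitting H}

/-! ### Shortcut instances -/

instance : MulAction (AdjGroup H V) (D.Flag V) := inferInstance

instance : SMul (AdjGroup H V) (D.Flag V) := inferInstance

instance : MulAction (AdjGroup H V) (D.DecFlag V) := inferInstance

instance : SMul (AdjGroup H V) (D.DecFlag V) := inferInstance

instance : MulAction (SCGroup H V) (D.SCDecFlag V) := inferInstance

instance : SMul (SCGroup H V) (D.SCDecFlag V) := inferInstance

variable (D V) in
/-- The product of the `x_s(a_k)` along a word. -/
def xprod : List D.S → (ℕ → ℂˣ) → SCGroup H V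
  | [], _ => 1
  | s :: l, a => D.scx V s (a 0) * xprod l fun n => a (n + 1)

@[simp] theorem xprod_nil (a : ℕ → ℂˣ) : D.xprod V [] a = 1 := rfl

theorem xprod_cons (s : D.S) (l : List D.S) (a : ℕ → ℂˣ) :
    D.xprod V (s :: l) a = D.scx V s (a 0) * D.xprod V l fun n => a (n + 1) := rfl

theorem xprod_concat (l : List D.S) (s : D.S) (a : ℕ → ℂˣ) :
    D.xprod V (l ++ [s]) a = D.xprod V l a * D.scx V s (a l.length) := by
  induction l generalizing a with
  | nil => simp [xprod_cons]
  | cons t l ih => rw [List.cons_append, xprod_cons, ih, xprod_cons, mul_assoc]; rfl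

theorem xprod_take_succ (l : List D.S) (a : ℕ → ℂˣ) (k : Fin l.length) :
    D.xprod V (l.take (k + 1)) a = D.xprod V (l.take k) a * D.scx V l[k] (a k) := by
  rw [List.take_succ_eq_append_getElem k.2, xprod_concat, List.length_take,
    min_eq_left k.2.le]
  rfl

theorem xprod_mem_scU (l : List D.S) (a : ℕ → ℂˣ) : D.xprod V l a ∈ D.scU V := by
  induction l generalizing a with
  | nil => exact one_mem _
  | cons s l ih => exact mul_mem (D.scx_mem_scU V s _) (ih _)

theorem xprod_congr {l : List D.S} {a b : ℕ → ℂˣ} (h : ∀ k < l.length, a k = b k) :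
    D.xprod V l a = D.xprod V l b := by
  induction l generalizing a b with
  | nil => rfl
  | cons s l ih =>
    rw [xprod_cons, xprod_cons, h 0 (by simp), ih fun k hk => h (k + 1) (by simpa using hk)]

theorem gauss_unique {u v : SCGroup H V} {w : List D.S} (hV : GeneratesWeightLattice H V)
    (hw : LongWord D.base w) (hu : u ∈ D.scU V) (hv : v ∈ D.scU V) {c : D.S → ℂˣ}
    (h : u = D.tor V c * (D.scrw V w * v * (D.scrw V w)⁻¹)) : u = 1 ∧ c = 1 ∧ v = 1 := by
  obtain ⟨h1, h2, h3⟩ := (D.up_of_mem hu).eq_of_eq_mul (lo_conj hV hw hv) h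
  refine ⟨h1, D.tor_injective V hV (h2.trans (map_one _).symm), ?_⟩
  rwa [mul_inv_eq_one, mul_eq_left] at h3

section Longest

variable (hV : GeneratesWeightLattice H V) (hw : LongWord D.base D.w0Word)

include hw

theorem wordRefl_map_star (l : List D.S) : wordRefl D.base (l.map D.star) =
    wordRefl D.base D.w0Word * wordRefl D.base l * wordRefl D.base D.w0Word := by
  induction l with
  | nil => rw [List.map_nil, wordRefl_nil, mul_one, hw.mul_self]
  | cons s l ih =>
    have h1 := wordRefl_mul_reflection (b := D.base) D.w0Word s.1
    have h2 : (rootSystem H).reflection (wordPerm D.base D.w0Word s.1) =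
        (rootSystem H).reflection (D.star s).1 := by
      have h3 : wordPerm D.base D.w0Word s.1 =
          (rootSystem H).reflectionPerm (D.star s).1 (D.star s).1 := by
        apply (rootSystem H).root.injective
        rw [root_wordPerm, root_reflectionPerm_self, root_star hw, neg_neg]
      rw [h3, RootPairing.reflection_reflectionPerm]
      ext x
      simp [LinearEquiv.mul_apply]
    rw [List.map_cons, wordRefl_cons, ih, wordRefl_cons, ← h2, ← mul_assoc, ← mul_assoc, ← h1,
      mul_assoc (wordRefl D.base D.w0Word)]

theorem RedWord.map_star {l : List D.S} (hl : RedWord D.base l) :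
    RedWord D.base (l.map D.star) := by
  intro m hm
  rw [wordRefl_map_star hw] at hm
  have h1 : wordRefl D.base (m.map D.star) = wordRefl D.base l := by
    rw [wordRefl_map_star hw, hm]
    simp only [mul_assoc, hw.mul_self, mul_one]
    rw [← mul_assoc, hw.mul_self, one_mul]
  simpa using hl _ h1

theorem LongWord.map_star {l : List D.S} (hl : LongWord D.base l) :
    LongWord D.base (l.map D.star) :=
  ⟨RedWord.map_star hw hl.1, by simpa using hl.2⟩

include hV

/-- Conjugation by `w̄₀` turns each `x_s(a_k)` into `y_{s*}(-a_k)`, which lies in the cell of `s*`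
as `a_k ≠ 0`. -/
theorem exists_forall₂_cell (l : List D.S) (a : ℕ → ℂˣ) : ∃ gs : List (SCGroup H V),
    List.Forall₂ (fun s g => Cell [s] g) (l.map D.star) gs ∧
      gs.prod = D.scw0 V * D.xprod V l a * (D.scw0 V)⁻¹ := by
  induction l generalizing a with
  | nil => exact ⟨[], List.Forall₂.nil, by simp⟩
  | cons s l ih =>
    obtain ⟨gs, h1, h2⟩ := ih fun n => a (n + 1)
    refine ⟨D.scy V (D.star s) (-a 0) :: gs, List.Forall₂.cons ?_ h1, ?_⟩
    · exact cell_scy V _ (neg_ne_zero.mpr (a 0).ne_zero)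
    · rw [List.prod_cons, h2, xprod_cons, ← mul_assoc (D.scw0 V), scw0_mul_scx hw hV]
      group

/-- For a word of `w₀` this is the big cell, and it yields the genericity of the pair `(B₂, B₃)`. -/
theorem cell_conj_xprod {l : List D.S} (hl : RedWord D.base l) (a : ℕ → ℂˣ) :
    Cell (l.map D.star) (D.scw0 V * D.xprod V l a * (D.scw0 V)⁻¹) := by
  obtain ⟨gs, h1, h2⟩ := exists_forall₂_cell hV hw l a
  rw [← h2]
  exact cell_prod hV h1 (RedWord.map_star hw hl)

omit hw in
theorem Cell.length_le {w m : List D.S} (hw : LongWord D.base w) {g : SCGroup H V}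
    (h : Cell w g) (h' : Cell m g) : w.length ≤ m.length := by
  obtain ⟨b, hb, b', hb', rfl⟩ := h'
  have h1 : Cell w (D.scrw V m) := by
    have := (h.mul_left (inv_mem hb)).mul_right (inv_mem hb')
    convert this using 1
    group
  exact hw.1 m (h1.wordRefl_eq hV hw)

/-- The factors of a product along a suffix of a reduced word of `w₀` are unique. -/
theorem xprod_suffix_injective (l₂ : List D.S) : ∀ (l₁ : List D.S) (_ : LongWord D.base (l₁ ++ l₂))
    (a b : ℕ → ℂˣ), D.xprod V l₂ a = D.xprod V l₂ b → ∀ k < l₂.length, a k = b k := by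
  induction l₂ with
  | nil => intro l₁ _ a b _ k hk; simp at hk
  | cons s l₂ ih =>
    intro l₁ hl a b hab
    -- If the first parameters differ, the letter `s` can be kept on one side and dropped on the
    -- other. Completed by arbitrary factors along `l₁`, the same element then lies in the big cell
    -- and in the cell of a word with at least one letter less.
    have h0 : a 0 = b 0 := by
      by_contra hne
      have hc : (a 0 : ℂ) - b 0 ≠ 0 := sub_ne_zero.mpr fun h => hne (Units.ext h)
      have h1 : D.scx V s (a 0 - b 0) * D.xprod V l₂ (fun n => a (n + 1)) =
          D.xprod V l₂ fun n => b (n + 1) := by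
        rw [sub_eq_neg_add, scx_add, mul_assoc, ← xprod_cons s l₂ a, hab, xprod_cons, scx_neg,
          inv_mul_cancel_left]
      obtain ⟨gs, hgs, hgs'⟩ := exists_forall₂_cell hV hw l₂ fun n => a (n + 1)
      obtain ⟨ks, hks, hks'⟩ := exists_forall₂_cell hV hw l₂ fun n => b (n + 1)
      obtain ⟨ps, hps, -⟩ := exists_forall₂_cell hV hw l₁ 1
      have h2 : D.scy V (D.star s) (-(a 0 - b 0)) * gs.prod = ks.prod := by
        rw [hgs', hks', ← h1, ← mul_assoc (D.scw0 V) (D.scx V s _), scw0_mul_scx hw hV]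
        group
      have h3 : Cell ((l₁ ++ s :: l₂).map D.star)
          (ps ++ D.scy V (D.star s) (-(a 0 - b 0)) :: gs).prod := by
        refine cell_prod hV ?_ (RedWord.map_star hw hl.1)
        rw [List.map_append]
        exact List.rel_append hps (List.Forall₂.cons (cell_scy V _ (neg_ne_zero.mpr hc)) hgs)
      obtain ⟨m, hm, hm'⟩ := exists_cell_prod hV (l := (l₁ ++ l₂).map D.star) (gs := ps ++ ks)
        (by rw [List.map_append]; exact List.rel_append hps hks)
      rw [List.prod_append, List.prod_cons, h2, ← List.prod_append] at h3
      have h4 := Cell.length_le hV (LongWord.map_star hw hl) h3 hm'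
      simp at h4 hm
      omega
    intro k hk
    cases k with
    | zero => exact h0
    | succ k =>
      rw [xprod_cons, xprod_cons, h0] at hab
      refine ih (l₁ ++ [s]) (by simpa using hl) _ _ (mul_left_cancel hab) k ?_
      simpa using hk

theorem xprod_injective {l : List D.S} (hl : LongWord D.base l) {a b : ℕ → ℂˣ}
    (h : D.xprod V l a = D.xprod V l b) : ∀ k < l.length, a k = b k :=
  xprod_suffix_injective hV hw l [] hl a b h

/-! ### Cosets -/

theorem center_le_scB : Subgroup.center (SCGroup H V) ≤ D.scB V := fun z hz => by
  obtain ⟨c, rfl⟩ := center_le hV hw hz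
  exact D.tor_mem_scB c

theorem proj_mem_B {g : SCGroup H V} : proj H V g ∈ D.B V ↔ g ∈ D.scB V := by
  rw [B_eq_map]
  constructor
  · rintro ⟨k, hk, hkg⟩
    rw [proj_eq_iff] at hkg
    have := mul_mem hk (center_le_scB hV hw hkg)
    rwa [mul_inv_cancel_left] at this
  · exact fun h => ⟨g, h, rfl⟩

theorem flag_eq_iff {g k : SCGroup H V} :
    proj H V g • D.flagPlus V = proj H V k • D.flagPlus V ↔ g⁻¹ * k ∈ D.scB V := by
  rw [← proj_mem_B hV hw, map_mul, map_inv]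
  change ((proj H V g * 1 : AdjGroup H V) : D.Flag V) = ((proj H V k * 1 : AdjGroup H V) : D.Flag V)
    ↔ _
  rw [mul_one, mul_one]
  exact QuotientGroup.eq

omit hV hw in
theorem proj_smul_flagMinus (g : SCGroup H V) :
    proj H V g • D.flagMinus V = proj H V (g * D.scw0 V) • D.flagPlus V := by
  rw [flagMinus, w0, map_mul, mul_smul]

theorem scw0_inv_conj_tor (c : D.S → ℂˣ) :
    (D.scw0 V)⁻¹ * D.tor V c * D.scw0 V = D.tor V (D.starAct c) := by
  have h1 : D.starAct (D.starAct c) = c := by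
    funext t
    change ((c (D.star (D.star t)))⁻¹)⁻¹ = _
    rw [star_star hw, inv_inv]
  have h2 := scw0_mul_tor hw hV (D.starAct c)
  rw [h1] at h2
  rw [mul_assoc, ← h2, inv_mul_cancel_left]

theorem scw0_inv_conj_scy (s : D.S) (c : ℂ) :
    (D.scw0 V)⁻¹ * D.scy V s c * D.scw0 V = D.scx V (D.star s) (-c) := by
  have h := scw0_mul_scx hw hV (D.star s) (-c)
  rw [star_star hw, neg_neg] at h
  rw [mul_assoc, ← h, inv_mul_cancel_left]

theorem scw0_inv_conj_scx (s : D.S) (c : ℂ) :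
    (D.scw0 V)⁻¹ * D.scx V s c * D.scw0 V = D.scy V (D.star s) (-c) := by
  have h := scw0_mul_scy hw hV (D.star s) (-c)
  rw [star_star hw, neg_neg] at h
  rw [mul_assoc, ← h, inv_mul_cancel_left]

/-- The unipotent radical meets its opposite Borel subgroup trivially. -/
theorem eq_one_of_conj_mem_scB {u : SCGroup H V} (hu : u ∈ D.scU V)
    (h : (D.scw0 V)⁻¹ * u * D.scw0 V ∈ D.scB V) : u = 1 := by
  obtain ⟨c, v, hv, h1⟩ := h
  refine (gauss_unique hV hw hu hv (c := D.starAct c) ?_).1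
  have h2 : u = D.scw0 V * (D.tor V c * v) * (D.scw0 V)⁻¹ := by rw [← h1]; group
  rw [h2, ← mul_assoc, scw0_mul_tor hw hV]
  change _ = _ * (D.scw0 V * v * (D.scw0 V)⁻¹)
  group

theorem flagMinus_eq_iff {u v : SCGroup H V} (hu : u ∈ D.scU V) (hv : v ∈ D.scU V) :
    proj H V u • D.flagMinus V = proj H V v • D.flagMinus V ↔ u = v := by
  refine ⟨fun h => ?_, fun h => by rw [h]⟩
  rw [proj_smul_flagMinus, proj_smul_flagMinus, flag_eq_iff hV hw] at h
  refine (inv_mul_eq_one.mp (eq_one_of_conj_mem_scB hV hw (mul_mem (inv_mem hu) hv) ?_))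
  convert h using 1
  group

theorem tor_smul_flagMinus (c : D.S → ℂˣ) :
    proj H V (D.tor V c) • D.flagMinus V = D.flagMinus V := by
  rw [proj_smul_flagMinus, flagMinus, w0, flag_eq_iff hV hw, mul_inv_rev, mul_assoc, ← map_inv,
    ← mul_assoc, scw0_inv_conj_tor hV hw]
  exact D.tor_mem_scB _

omit hV hw in
theorem smul_flagPlus_of_mem {g : SCGroup H V} (hg : g ∈ D.scB V) :
    proj H V g • D.flagPlus V = D.flagPlus V := by
  have h1 : proj H V g ∈ D.B V := by rw [B_eq_map]; exact ⟨g, hg, rfl⟩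
  change ((proj H V g * 1 : AdjGroup H V) : D.Flag V) = ((1 : AdjGroup H V) : D.Flag V)
  rw [mul_one]
  exact QuotientGroup.eq.mpr (by rw [mul_one]; exact inv_mem h1)

/-- An element fixing `B⁺` lies in the Borel subgroup, and its torus part fixes `B⁻`. -/
theorem generic_flagPlus_iff {F : D.Flag V} :
    D.Generic (D.flagPlus V) F ↔ ∃ u ∈ D.scU V, F = proj H V u • D.flagMinus V := by
  constructor
  · rintro ⟨g, h1, h2⟩
    obtain ⟨g, rfl⟩ := QuotientGroup.mk_surjective g
    change proj H V g • _ = _ at h1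
    change proj H V g • _ = _ at h2
    have h3 : g ∈ D.scB V := by
      have h4 : proj H V g • D.flagPlus V = proj H V 1 • D.flagPlus V := by
        rw [h1, map_one, one_smul]
      rw [flag_eq_iff hV hw, mul_one] at h4
      exact inv_mem_iff.mp h4
    obtain ⟨c, u, hu, h5⟩ := D.mem_scB'.mp (inv_mem h3)
    refine ⟨u, hu, ?_⟩
    have h6 : F = (proj H V g)⁻¹ • D.flagMinus V := by rw [← h2, inv_smul_smul]
    rw [h6, ← map_inv, h5, map_mul, mul_smul, tor_smul_flagMinus hV hw]
  · rintro ⟨u, hu, rfl⟩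
    refine ⟨proj H V u⁻¹, smul_flagPlus_of_mem (D.scU_le_scB (inv_mem hu)), ?_⟩
    rw [smul_smul, ← map_mul, inv_mul_cancel, map_one, one_smul]

omit hV hw in
theorem scr_inv_conj_tor (s : D.S) (c : D.S → ℂˣ) :
    (D.scr V s)⁻¹ * D.tor V c * D.scr V s = D.tor V (D.sact s c) := by
  have h := D.scr_mul_tor V s (D.sact s c)
  rw [sact_sact] at h
  rw [mul_assoc, ← h, inv_mul_cancel_left]

omit hV hw in
theorem scr_inv_eq (s : D.S) : (D.scr V s)⁻¹ = D.scCoroot V s (-1) * D.scr V s := by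
  rw [← scth_eq_scCoroot, scr_eq_inv, inv_inv]

-- Obtained from `exists_scU_split` by inversion, as `r̄_s` and its inverse differ by a torus
-- element.
omit hw in
theorem exists_scU_split_inv (s : D.S) {u : SCGroup H V} (hu : u ∈ D.scU V) :
    ∃ (a : ℂ) (k : SCGroup H V), u = D.scx V s a * k ∧
      (D.scr V s)⁻¹ * k * D.scr V s ∈ D.scU V := by
  obtain ⟨a, k, h1, -, h2⟩ := D.exists_scU_split hV s (inv_mem hu)
  refine ⟨-a, k⁻¹, by rw [scx_neg, ← mul_inv_rev, ← h1, inv_inv], ?_⟩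
  have h3 := D.tor_conj_mem_scU (Pi.mulSingle s (-1)) (inv_mem h2)
  rw [← scCoroot_eq_tor] at h3
  convert h3 using 1
  have h4 : D.scCoroot V s (-1) = (D.scr V s)⁻¹ * (D.scr V s)⁻¹ :=
    eq_mul_inv_of_mul_eq (scr_inv_eq s).symm
  rw [h4]
  group

/-- Genericity would put the lift of `r_s w₀` in the big cell, hence `r_s w₀ = w₀`. This excludes
the zero parameter among the flags at simple distance. -/
theorem scr_smul_flagMinus_not_generic (s : D.S) {u : SCGroup H V} (hu : u ∈ D.scU V) :
    proj H V (D.scr V s) • D.flagMinus V ≠ proj H V u • D.flagMinus V := by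
  intro h
  rw [eq_comm, proj_smul_flagMinus, proj_smul_flagMinus, flag_eq_iff hV hw] at h
  have h1 : Cell D.w0Word (D.scrw V (s :: D.w0Word)) :=
    ⟨u, D.scU_le_scB hu, _, h, by
      rw [scrw_cons]
      change D.scr V s * D.scw0 V = u * D.scw0 V * _
      group⟩
  have h2 := h1.wordRefl_eq hV hw
  rw [wordRefl_cons, mul_eq_right] at h2
  have h3 := LinearEquiv.congr_fun h2 ((rootSystem H).root s.1)
  rw [RootPairing.reflection_apply_self] at h3
  have : IsAddTorsionFree (Dual ℂ H) := .of_isTorsionFree ℂ _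
  exact (rootSystem H).ne_zero s.1 (self_eq_neg.mp h3.symm)

/-- In the Gauss decomposition of `y_s(c) r̄_s` the torus and lower unipotent factors fix `B⁻`. -/
theorem scy_mul_scr_smul_flagMinus (s : D.S) (c : ℂˣ) :
    proj H V (D.scy V s c * D.scr V s) • D.flagMinus V =
      proj H V (D.scx V s (c⁻¹ : ℂˣ)) • D.flagMinus V := by
  rw [proj_smul_flagMinus, proj_smul_flagMinus, flag_eq_iff hV hw, scy_mul_scr_eq,
    scCoroot_eq_tor]
  have h1 := scw0_inv_conj_tor (V := V) hV hw (Pi.mulSingle s (-c⁻¹))⁻¹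
  have h2 := scw0_inv_conj_scy (V := V) hV hw s (-(-(c⁻¹ : ℂˣ)))
  have h3 := mul_mem (D.scU_le_scB (D.scx_mem_scU V (D.star s) (-(-(-((c⁻¹ : ℂˣ) : ℂ))))))
    (D.tor_mem_scB (V := V) (D.starAct (Pi.mulSingle s (-c⁻¹))⁻¹))
  rw [← h1, ← h2, scy_neg] at h3
  convert h3 using 1
  rw [map_inv]
  group

/-- Flags at simple distance from a generic flag which are again generic. -/
theorem hasDist_and_generic_iff (s : D.S) {u : SCGroup H V} (hu : u ∈ D.scU V) {F : D.Flag V} :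
    D.HasDist (D.star s) (proj H V u • D.flagMinus V) F ∧ D.Generic (D.flagPlus V) F ↔
      ∃ a : ℂˣ, F = proj H V (u * D.scx V s a) • D.flagMinus V := by
  -- Conjugation by `w̄₀` turns the cell of `s*` at `B⁺` into translates `y_s(-c) r̄_s.B⁻`, with
  -- `s** = s`.
  have key : ∀ c : ℂ, proj H V (D.scw0 V * (D.scx V (D.star s) c * D.scr V (D.star s))) •
      D.flagPlus V = proj H V (D.scy V s (-c) * D.scr V s) • D.flagMinus V := by
    intro c
    rw [proj_smul_flagMinus, ← mul_assoc, scw0_mul_scx hw hV, star_star hw, mul_assoc,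
      scw0_mul_scr hw hV, star_star hw, mul_assoc]
  constructor
  · rintro ⟨⟨g, h1, h2⟩, h3⟩
    obtain ⟨g, rfl⟩ := QuotientGroup.mk_surjective g
    change _ = proj H V g • _ at h1
    change _ = proj H V g • _ at h2
    rw [proj_smul_flagMinus, flag_eq_iff hV hw] at h1
    obtain ⟨c, v, hv, h4⟩ := D.mem_scB'.mp h1
    obtain ⟨a, k, rfl, hk⟩ := exists_scU_split_inv hV (D.star s) hv
    have h5 : F = proj H V u • proj H V (D.scy V s (-a) * D.scr V s) • D.flagMinus V := by
      rw [← key, h2, r, smul_smul, smul_smul, ← map_mul, ← map_mul, eq_comm, flag_eq_iff hV hw]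
      have h6 : g = u * D.scw0 V * (D.scx V (D.star s) a * k * D.tor V c) := by rw [← h4]; group
      have h7 := mul_mem (D.scU_le_scB hk)
        (D.tor_mem_scB (V := V) (D.sact (D.star s) c))
      rw [← scr_inv_conj_tor] at h7
      rw [h6]
      convert h7 using 1
      group
    obtain ⟨v', hv', h6⟩ := (generic_flagPlus_iff hV hw).mp h3
    -- The flags at distance `s*` from `u.B⁻` are parametrized by `a ∈ ℂ`. The value `0` is not
    -- generic, and the others give `x_s` with parameter `-a⁻¹`.
    by_cases ha : a = 0
    · exfalso
      rw [ha, neg_zero, scy_zero, one_mul] at h5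
      refine scr_smul_flagMinus_not_generic hV hw s (mul_mem (inv_mem hu) hv') ?_
      rw [map_mul, mul_smul, ← h6, h5, smul_smul, ← map_mul, inv_mul_cancel, map_one, one_smul]
    · refine ⟨(Units.mk0 (-a) (neg_ne_zero.mpr ha))⁻¹, ?_⟩
      rw [h5, map_mul _ u, mul_smul, ← scy_mul_scr_smul_flagMinus hV hw]
      rfl
  · rintro ⟨a, rfl⟩
    refine ⟨⟨proj H V (u * D.scw0 V * D.scx V (D.star s) (-(a⁻¹ : ℂˣ))), ?_, ?_⟩,
      (generic_flagPlus_iff hV hw).mpr ⟨_, mul_mem hu (D.scx_mem_scU V s _), rfl⟩⟩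
    · rw [proj_smul_flagMinus, map_mul, map_mul _ _ (D.scx V _ _), mul_smul _ (proj H V (D.scx V _ _)),
        smul_flagPlus_of_mem (D.scU_le_scB (D.scx_mem_scU V _ _)), map_mul]
    · rw [r, smul_smul, ← map_mul, mul_assoc, mul_assoc, map_mul _ u, mul_smul, map_mul _ u,
        mul_smul, key, neg_neg, scy_mul_scr_smul_flagMinus hV hw, inv_inv]

end Longest

end Splitting

end Pinnings

end

/-! ### Pinnings, potentials and `h`-invariants in terms of representatives -/

noncomputable section

namespace Pinnings

open scoped Classical

set_option linter.unusedSectionVars false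

variable {L : Type*} [LieRing L] [LieAlgebra ℂ L] [FiniteDimensional ℂ L] [IsKilling ℂ L]
variable {H : LieSubalgebra ℂ L} [H.IsCartanSubalgebra]
variable {V : Type*} [AddCommGroup V] [Module ℂ V] [FiniteDimensional ℂ V]
  [LieRingModule L V] [LieModule ℂ L V]

namespace Splitting

variable {D : Splitting H}

theorem xprod_append (l m : List D.S) (a : ℕ → ℂˣ) :
    D.xprod V (l ++ m) a = D.xprod V l a * D.xprod V m fun n => a (l.length + n) := by
  induction l generalizing a with
  | nil => simp
  | cons s l ih =>
    rw [List.cons_append, xprod_cons, ih, xprod_cons, mul_assoc]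
    simp only [List.length_cons, add_right_comm]

theorem proj_mem_U {u : SCGroup H V} (hu : u ∈ D.scU V) : proj H V u ∈ D.U V := ⟨u, hu, rfl⟩

theorem exists_proj_eq (g : AdjGroup H V) : ∃ k : SCGroup H V, g = proj H V k := by
  obtain ⟨k, rfl⟩ := QuotientGroup.mk_surjective g
  exact ⟨k, rfl⟩

theorem tor_inv_mul_xprod (c : D.S → ℂˣ) (l : List D.S) (a : ℕ → ℂˣ) :
    ∃ b, (D.tor V c)⁻¹ * D.xprod V l a * D.tor V c = D.xprod V l b := by
  induction l generalizing a with
  | nil => exact ⟨a, by simp⟩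
  | cons s l ih =>
    obtain ⟨b, hb⟩ := ih fun n => a (n + 1)
    refine ⟨fun n => n.casesOn ((chr (D.rn s.1) c)⁻¹ * a 0) b, ?_⟩
    rw [xprod_cons, xprod_cons]
    have h := D.tor_mul_scx (V := V) c⁻¹ s (a 0)
    rw [map_inv, map_inv] at h
    rw [← mul_assoc, h]
    change _ = D.scx V s (((chr (D.rn s.1) c)⁻¹ * a 0 : ℂˣ) : ℂ) * D.xprod V l b
    rw [← hb, Units.val_mul]
    group

/-- The potentials, in terms of representatives in the simply connected group. -/
def chisc (s : D.S) (u : SCGroup H V) : ℂ :=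
  if hu : u ∈ D.scU V then D.chi V s ⟨proj H V u, proj_mem_U hu⟩ else 0

theorem chisc_mul (hV : GeneratesWeightLattice H V) (s : D.S) {u v : SCGroup H V}
    (hu : u ∈ D.scU V) (hv : v ∈ D.scU V) : chisc s (u * v) = chisc s u + chisc s v := by
  rw [chisc, chisc, chisc, dif_pos hu, dif_pos hv, dif_pos (mul_mem hu hv),
    ← (D.chi_spec V hV s).1]
  rfl

theorem chisc_scx (hV : GeneratesWeightLattice H V) (s t : D.S) (a : ℂ) :
    chisc s (D.scx V t a) = if s = t then a else 0 := by
  rw [chisc, dif_pos (D.scx_mem_scU V t a)]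
  exact (D.chi_spec V hV s).2 t a

theorem chisc_one (hV : GeneratesWeightLattice H V) (s : D.S) :
    chisc s (1 : SCGroup H V) = 0 := by
  have := chisc_mul hV s (one_mem (D.scU V)) (one_mem (D.scU V))
  rwa [mul_one, left_eq_add] at this

theorem chisc_xprod_of_notMem (hV : GeneratesWeightLattice H V) {s : D.S} {l : List D.S}
    (hs : s ∉ l) (a : ℕ → ℂˣ) : chisc s (D.xprod V l a) = 0 := by
  induction l generalizing a with
  | nil => exact chisc_one hV s
  | cons t l ih =>
    rw [List.mem_cons, not_or] at hs
    rw [xprod_cons, chisc_mul hV s (D.scx_mem_scU V t _) (xprod_mem_scU l _), ih hs.2,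
      chisc_scx hV, if_neg hs.1, add_zero]

section Longest

variable (hV : GeneratesWeightLattice H V) (hw : LongWord D.base D.w0Word)

omit hV hw in
theorem dec_eq_iff {g k : AdjGroup H V} :
    g • D.decBase V = k • D.decBase V ↔ g⁻¹ * k ∈ D.U V := by
  change ((g * 1 : AdjGroup H V) : D.DecFlag V) = ((k * 1 : AdjGroup H V) : D.DecFlag V) ↔ _
  rw [mul_one, mul_one]
  exact QuotientGroup.eq

theorem scdec_eq_iff {g k : SCGroup H V} :
    g • D.scBase V = k • D.scBase V ↔ g⁻¹ * k ∈ D.scU V := by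
  change ((g * 1 : SCGroup H V) : D.SCDecFlag V) = ((k * 1 : SCGroup H V) : D.SCDecFlag V) ↔ _
  rw [mul_one, mul_one]
  exact QuotientGroup.eq

theorem exists_smul_scBase (A : D.SCDecFlag V) : ∃ g : SCGroup H V, A = g • D.scBase V := by
  obtain ⟨g, rfl⟩ := QuotientGroup.mk_surjective A
  refine ⟨g, ?_⟩
  change _ = ((g * 1 : SCGroup H V) : D.SCDecFlag V)
  rw [mul_one]

theorem exists_smul_decBase (A : D.DecFlag V) : ∃ g : AdjGroup H V, A = g • D.decBase V := by
  obtain ⟨g, rfl⟩ := QuotientGroup.mk_surjective A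
  refine ⟨g, ?_⟩
  change _ = ((g * 1 : AdjGroup H V) : D.DecFlag V)
  rw [mul_one]

theorem toFlag_smul_decBase (g : AdjGroup H V) :
    D.toFlag (g • D.decBase V) = g • D.flagPlus V := D.toFlag_smul g _

theorem smul_decBase_of_mem {u : SCGroup H V} (hu : u ∈ D.scU V) :
    proj H V u • D.decBase V = D.decBase V := by
  have h : (proj H V u)⁻¹ * 1 ∈ D.U V := by
    rw [mul_one]; exact inv_mem (proj_mem_U hu)
  rw [dec_eq_iff.mpr h, one_smul]

theorem lifts_smul_scBase_iff {g : SCGroup H V} {A : D.DecFlag V} :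
    D.Lifts (g • D.scBase V) A ↔ A = proj H V g • D.decBase V := by
  have h1 : ∀ k : SCGroup H V, (k : D.SCDecFlag V) = k • D.scBase V := fun k => by
    change _ = ((k * 1 : SCGroup H V) : D.SCDecFlag V)
    rw [mul_one]
  have h2 : ∀ k : AdjGroup H V, (k : D.DecFlag V) = k • D.decBase V := fun k => by
    change _ = ((k * 1 : AdjGroup H V) : D.DecFlag V)
    rw [mul_one]
  constructor
  · rintro ⟨k, hk, rfl⟩
    rw [h1, scdec_eq_iff] at hk
    rw [h2, eq_comm, dec_eq_iff, ← map_inv, ← map_mul]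
    exact proj_mem_U hk
  · rintro rfl
    exact ⟨g, (h1 g).symm, (h2 _).symm⟩

include hV hw

/-- The stabilizer of the decorated flag is `U⁺`, which meets the stabilizer of `B⁻` trivially. -/
theorem smul_pstd_injective {g k : AdjGroup H V} (h : g • D.pstd V = k • D.pstd V) : g = k := by
  have h1 : g • D.decBase V = k • D.decBase V := congrArg Pinning.dec h
  have h2 : g • D.flagMinus V = k • D.flagMinus V := congrArg Pinning.flag h
  rw [dec_eq_iff] at h1
  obtain ⟨u, hu, hu'⟩ := h1
  have h3 : proj H V u • D.flagMinus V = proj H V 1 • D.flagMinus V := by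
    rw [hu', mul_smul, ← h2, inv_smul_smul, map_one, one_smul]
  rw [flagMinus_eq_iff hV hw hu (one_mem _)] at h3
  rw [h3, map_one] at hu'
  exact inv_mul_eq_one.mp hu'.symm

/-- After the pair of flags is made standard, the decoration is a torus translate of the base point,
and the torus fixes `B⁻`. -/
theorem exists_smul_pstd (p : D.Pinning V) : ∃ g : AdjGroup H V, p = g • D.pstd V := by
  obtain ⟨h, h1, h2⟩ := p.generic
  obtain ⟨k, hk⟩ := exists_smul_decBase p.dec
  obtain ⟨q, hq⟩ := exists_proj_eq (h * k)
  rw [hk, toFlag_smul_decBase, smul_smul, hq] at h1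
  have h3 : q ∈ D.scB V := by
    have h4 : proj H V q • D.flagPlus V = proj H V 1 • D.flagPlus V := by
      rw [h1, map_one, one_smul]
    rw [flag_eq_iff hV hw, mul_one] at h4
    exact inv_mem_iff.mp h4
  obtain ⟨c, u, hu, rfl⟩ := h3
  refine ⟨h⁻¹ * proj H V (D.tor V c), ?_⟩
  rw [mul_smul, eq_inv_smul_iff]
  apply Pinning.ext
  · change h • p.dec = proj H V (D.tor V c) • D.decBase V
    rw [hk, smul_smul, hq, map_mul, mul_smul, smul_decBase_of_mem hu]
  · change h • p.flag = proj H V (D.tor V c) • D.flagMinus V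
    rw [h2, tor_smul_flagMinus hV hw]

theorem elt_smul_pstd (g : AdjGroup H V) : (g • D.pstd V).elt = g :=
  (smul_pstd_injective hV hw (Classical.epsilon_spec
    (p := fun k : AdjGroup H V => g • D.pstd V = k • D.pstd V) ⟨g, rfl⟩)).symm

theorem opp_smul_pstd (g : AdjGroup H V) : (g • D.pstd V).opp = (g * D.w0 V) • D.pstd V := by
  rw [Pinning.opp, elt_smul_pstd hV hw]

theorem opp_smul (g : AdjGroup H V) (p : D.Pinning V) : (g • p).opp = g • p.opp := by
  obtain ⟨k, rfl⟩ := exists_smul_pstd hV hw p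
  rw [smul_smul, opp_smul_pstd hV hw, opp_smul_pstd hV hw, smul_smul, mul_assoc]

theorem W_eq (s : D.S) (h : AdjGroup H V) {u v : SCGroup H V} (hu : u ∈ D.scU V)
    (hv : v ∈ D.scU V) : D.W s (h • D.decBase V) (h • proj H V u • D.flagMinus V)
      (h • proj H V (u * v) • D.flagMinus V) = chisc s v := by
  have hex : ∃ z : ℂ, ∃ (g : AdjGroup H V) (q : D.U V), g • h • D.decBase V = D.decBase V ∧
      g • h • proj H V u • D.flagMinus V = D.flagMinus V ∧
      g • h • proj H V (u * v) • D.flagMinus V = (q : AdjGroup H V) • D.flagMinus V ∧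
      z = D.chi V s q := by
    refine ⟨_, (h * proj H V u)⁻¹, ⟨proj H V v, proj_mem_U hv⟩, ?_, ?_, ?_, rfl⟩
    · rw [smul_smul, mul_inv_rev, inv_mul_cancel_right, ← map_inv, smul_decBase_of_mem (inv_mem hu)]
    · rw [smul_smul h, inv_smul_smul]
    · rw [map_mul, mul_smul (proj H V u), smul_smul h, inv_smul_smul]
  obtain ⟨g, q, h1, h2, h3, h4⟩ := Classical.epsilon_spec hex
  change D.W s _ _ _ = _ at h4
  rw [h4, chisc, dif_pos hv]
  congr 1
  -- Any translation that makes the first two entries standard fixes the standard pinning after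
  -- composition, so it is unique and the chosen value agrees.
  have h5 : (g * h * proj H V u) • D.pstd V = (1 : AdjGroup H V) • D.pstd V := by
    apply Pinning.ext
    · change (g * h * proj H V u) • D.decBase V = (1 : AdjGroup H V) • D.decBase V
      rw [mul_smul, smul_decBase_of_mem hu, mul_smul, h1, one_smul]
    · change (g * h * proj H V u) • D.flagMinus V = (1 : AdjGroup H V) • D.flagMinus V
      rw [mul_smul, mul_smul, h2, one_smul]
  have h6 := smul_pstd_injective hV hw h5
  obtain ⟨q, q', hq', rfl⟩ := q
  apply Subtype.ext
  change proj H V q' = proj H V v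
  rw [map_mul, mul_smul (proj H V u), smul_smul h, smul_smul, ← mul_assoc, h6, one_smul] at h3
  change _ = proj H V q' • _ at h3
  rw [flagMinus_eq_iff hV hw hv hq'] at h3
  rw [h3]

/-- The potential along a segment of a chain ending with the only occurrence of a letter. -/
theorem W_segment (s : D.S) (h : SCGroup H V) {u : SCGroup H V} (hu : u ∈ D.scU V)
    (c : D.S → ℂˣ) {m : List D.S} (hm : s ∉ m) (a : ℕ → ℂˣ) :
    D.W s (proj H V (h * D.tor V c) • D.decBase V) (proj H V (h * u) • D.flagMinus V)
      (proj H V (h * (u * D.xprod V (m ++ [s]) a)) • D.flagMinus V) =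
      (((chr (D.rn s.1) c)⁻¹ * a m.length : ℂˣ) : ℂ) := by
  -- The torus part of the decoration may be moved past `v`, because the torus fixes `B⁻`. This
  -- conjugates `v` and rescales the last parameter by `α_s(c)⁻¹`.
  have key : ∀ v, proj H V (h * D.tor V c) • proj H V ((D.tor V c)⁻¹ * v * D.tor V c) •
      D.flagMinus V = proj H V (h * v) • D.flagMinus V := by
    intro v
    have h1 : h * D.tor V c * ((D.tor V c)⁻¹ * v * D.tor V c) = h * v * D.tor V c := by group
    rw [smul_smul, ← map_mul, h1, map_mul, mul_smul, tor_smul_flagMinus hV hw]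
  obtain ⟨b, hb⟩ := tor_inv_mul_xprod (V := V) c m a
  have h2 : (D.tor V c)⁻¹ * D.xprod V (m ++ [s]) a * D.tor V c =
      D.xprod V m b * D.scx V s (((chr (D.rn s.1) c)⁻¹ * a m.length : ℂˣ) : ℂ) := by
    have h3 := D.tor_mul_scx (V := V) c⁻¹ s (a m.length)
    rw [map_inv, map_inv] at h3
    rw [xprod_concat, ← hb, Units.val_mul, ← mul_assoc (D.tor V c)⁻¹, ← mul_inv_eq_iff_eq_mul.mpr h3]
    group
  have h4 : (D.tor V c)⁻¹ * (u * D.xprod V (m ++ [s]) a) * D.tor V c =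
      ((D.tor V c)⁻¹ * u * D.tor V c) *
        (D.xprod V m b * D.scx V s (((chr (D.rn s.1) c)⁻¹ * a m.length : ℂˣ) : ℂ)) := by
    rw [← h2]; group
  rw [← key, ← key, h4, W_eq hV hw s _ (D.tor_conj_mem_scU' c hu)
    (mul_mem (xprod_mem_scU m b) (D.scx_mem_scU V s _)),
    chisc_mul hV s (xprod_mem_scU m b) (D.scx_mem_scU V s _), chisc_xprod_of_notMem hV hm,
    chisc_scx hV, if_pos rfl, zero_add]

/-- Translating by `(u t(h))⁻¹` makes the second flag standard and leaves `h⁻¹ ζ` in the first.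
Uniqueness of the Gauss decomposition shows that any other translation gives the same torus element.
-/
theorem Lam_eq (t : D.S) (ζ h : D.S → ℂˣ) {u : SCGroup H V} (hu : u ∈ D.scU V) :
    D.Lam t (D.tor V ζ • D.scBase V) ((u * D.tor V h * D.scw0 V) • D.scBase V) =
      ζ t * (h t)⁻¹ := by
  have hex : ∃ z : ℂˣ, ∃ (g : SCGroup H V) (k : D.scT V),
      D.tor V ζ • D.scBase V = g • (k : SCGroup H V) • D.scBase V ∧
      (u * D.tor V h * D.scw0 V) • D.scBase V = g • D.scw0 V • D.scBase V ∧
      z = D.fundWeight V t k := by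
    refine ⟨_, u * D.tor V h, ⟨D.tor V (h⁻¹ * ζ), D.tor_mem_scT V _⟩, ?_, ?_, rfl⟩
    · rw [smul_smul, mul_assoc, ← map_mul, mul_inv_cancel_left, scdec_eq_iff, ← mul_assoc]
      exact D.tor_conj_mem_scU' ζ hu
    · rw [smul_smul]
  obtain ⟨g, k, h1, h2, h3⟩ := Classical.epsilon_spec hex
  change D.Lam t _ _ = _ at h3
  rw [h3]
  obtain ⟨k, hk⟩ := k
  have hk' := hk
  rw [scT_eq_range] at hk'
  obtain ⟨κ, rfl⟩ := hk'
  rw [D.fundWeight_tor V hV]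
  rw [smul_smul, scdec_eq_iff] at h1 h2
  change (D.tor V ζ)⁻¹ * (g * D.tor V κ) ∈ _ at h1
  have h4 : (u * D.tor V h)⁻¹ * g = D.tor V (h⁻¹ * ζ * κ⁻¹) * (D.tor V κ *
      (((D.tor V ζ)⁻¹ * u * D.tor V ζ)⁻¹ * ((D.tor V ζ)⁻¹ * (g * D.tor V κ))) *
        (D.tor V κ)⁻¹) := by
    rw [map_mul, map_mul, map_inv, map_inv]
    group
  have h5 := D.tor_conj_mem_scU κ (mul_mem (inv_mem (D.tor_conj_mem_scU' ζ hu)) h1)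
  have h6 : (u * D.tor V h)⁻¹ * g = D.scrw V D.w0Word * ((u * D.tor V h * D.scw0 V)⁻¹ *
      (g * D.scw0 V)) * (D.scrw V D.w0Word)⁻¹ := by
    change _ = D.scw0 V * _ * (D.scw0 V)⁻¹
    group
  rw [h6, ← inv_mul_eq_iff_eq_mul, ← map_inv] at h4
  have h7 := (gauss_unique hV hw h5 h2 h4.symm).2.1
  have h8 := congrFun h7 t
  simp only [Pi.inv_apply, Pi.mul_apply, Pi.one_apply, mul_inv_rev, inv_inv] at h8
  rw [mul_comm (ζ t)⁻¹, ← mul_assoc] at h8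
  exact eq_mul_inv_of_mul_eq (mul_inv_eq_one.mp h8)

end Longest

omit [FiniteDimensional ℂ V] in
theorem sact_mul (s : D.S) (c d : D.S → ℂˣ) : D.sact s (c * d) = D.sact s c * D.sact s d := by
  rw [sact, sact, sact, map_mul, mul_inv, Pi.mulSingle_mul, mul_mul_mul_comm]

theorem sact_mulSingle (s : D.S) (a : ℂˣ) :
    D.sact s (Pi.mulSingle s a) = Pi.mulSingle s a⁻¹ := by
  rw [sact, chr_mulSingle, rn_self, ← Pi.mulSingle_mul]
  congr 1
  rw [zpow_two, mul_inv_rev, mul_inv_cancel_left]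

theorem hasUnitDist_iff {t : D.S} {g k : SCGroup H V} :
    D.HasUnitDist t (g • D.scBase V) (k • D.scBase V) ↔
      ∃ u ∈ D.scU V, ∃ v ∈ D.scU V, g⁻¹ * k = u * D.scr V t * v := by
  constructor
  · rintro ⟨q, h1, h2⟩
    rw [scdec_eq_iff] at h1
    rw [smul_smul, scdec_eq_iff] at h2
    exact ⟨_, h1, _, inv_mem h2, by group⟩
  · rintro ⟨u, hu, v, hv, h⟩
    refine ⟨g * u, ?_, ?_⟩
    · rw [scdec_eq_iff, inv_mul_cancel_left]; exact hu
    · rw [smul_smul, scdec_eq_iff]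
      have h1 : k⁻¹ * (g * u * D.scr V t) = v⁻¹ := by
        rw [← inv_inj, mul_inv_rev, inv_inv, inv_inv, mul_assoc g, mul_inv_rev, mul_assoc, h]
        group
      rw [h1]
      exact inv_mem hv

/-- The torus part of an element of `U⁺ t r̄ U⁺` is well defined: after splitting off the factor
`x_t`, the equation takes the form of a Gauss decomposition. -/
theorem tor_mul_scr_double_coset (hV : GeneratesWeightLattice H V) {t : D.S} {E : D.S → ℂˣ}
    {u v u' v' : SCGroup H V} (hu : u ∈ D.scU V) (hv : v ∈ D.scU V) (hu' : u' ∈ D.scU V)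
    (hv' : v' ∈ D.scU V) (h : u * D.tor V E * D.scr V t * v = u' * D.scr V t * v') : E = 1 := by
  obtain ⟨b, k, hk, -, hk'⟩ := D.exists_scU_split hV t (mul_mem hv' (inv_mem hv))
  have h1 : D.scr V t * D.scx V t b * (D.scr V t)⁻¹ = D.scy V t (-b) := by
    rw [scr_mul_scx, mul_inv_cancel_right]
  have h2 : D.tor V E = (u⁻¹ * u' * (D.scr V t * k * (D.scr V t)⁻¹)) * D.scy V t (-b) := by
    have h3 : D.tor V E = u⁻¹ * (u' * D.scr V t * v') * v⁻¹ * (D.scr V t)⁻¹ := by rw [← h]; group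
    calc D.tor V E = u⁻¹ * u' * D.scr V t * (v' * v⁻¹) * (D.scr V t)⁻¹ := by rw [h3]; group
      _ = _ := by rw [hk, ← h1]; group
  have hlo : D.Lo (D.scy V t b) := by
    have hf : b • D.f t ∈ rootSpace H (((rootSystem H).reflectionPerm t.1 t.1).1 : H → ℂ) :=
      Submodule.smul_mem _ b (D.f_mem' t)
    have h4 : D.scy V t b = rexp (root_ne_zero _) hf := by
      apply gv_injective
      rw [gv_rexp, gv_scy, rf, ← map_smul]
    rw [h4]
    refine D.lo_rexp ?_ hf
    rw [isPos_reflectionPerm_self_iff, not_not]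
    exact D.simple_isPos t
  have hup := D.up_of_mem (mul_mem (mul_mem (inv_mem hu) hu') hk')
  have h5 : u⁻¹ * u' * (D.scr V t * k * (D.scr V t)⁻¹) = D.tor V E * D.scy V t b := by
    rw [h2, scy_neg, inv_mul_cancel_right]
  exact D.tor_injective V hV ((hup.eq_of_eq_mul hlo h5).2.1.trans (map_one _).symm)

/-- The Bruhat decomposition of `y(c)` in `SL₂` with its torus part explicit. -/
theorem scy_eq_big_cell (t : D.S) (c : ℂˣ) : D.scy V t c =
    D.scx V t (c⁻¹ : ℂˣ) * D.tor V (Pi.mulSingle t c⁻¹) * D.scr V t * D.scx V t (c⁻¹ : ℂˣ) := by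
  have h := D.scy_mul_scr_eq V t c
  have h3 : D.scy V t (-(c⁻¹ : ℂˣ)) * (D.scr V t)⁻¹ = (D.scr V t)⁻¹ * D.scx V t (c⁻¹ : ℂˣ) := by
    rw [mul_inv_eq_iff_eq_mul, mul_assoc, scx_mul_scr, inv_mul_cancel_left]
  have h4 : D.scy V t c = D.scx V t (c⁻¹ : ℂˣ) * D.scCoroot V t (-c⁻¹) *
      (D.scy V t (-(c⁻¹ : ℂˣ)) * (D.scr V t)⁻¹) := by
    rw [← mul_assoc, ← h, mul_inv_cancel_right]
  have h5 : D.scCoroot V t (-c⁻¹) * D.scCoroot V t (-1) = D.scCoroot V t c⁻¹ := by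
    rw [← scCoroot_mul]; simp
  rw [h4, h3, scr_inv_eq, ← scCoroot_eq_tor, ← h5]
  group

/-- Compatibility of decorations along a chain. -/
theorem hasUnitDist_star_iff (hV : GeneratesWeightLattice H V) (hw : LongWord D.base D.w0Word)
    (s : D.S) (u : SCGroup H V) (a : ℂˣ) (h h' : D.S → ℂˣ) :
    D.HasUnitDist (D.star s) ((u * D.scx V s a * D.tor V h' * D.scw0 V) • D.scBase V)
      ((u * D.tor V h * D.scw0 V) • D.scBase V) ↔ h' = Pi.mulSingle s a * D.sact s h := by
  set γ : ℂˣ := (chr (D.rn s.1) h')⁻¹ * a with hγ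
  set τ := D.starAct (h'⁻¹ * h) with hτ
  -- The relative position is independent of `u`; conjugation by `w̄₀⁻¹` turns it into `y_{s*}(γ)`
  -- times a torus element `τ`.
  have h1 : (u * D.scx V s a * D.tor V h' * D.scw0 V)⁻¹ * (u * D.tor V h * D.scw0 V) =
      D.scy V (D.star s) γ * D.tor V τ := by
    have h2 := D.tor_mul_scx (V := V) h'⁻¹ s (-a)
    rw [map_inv, map_inv] at h2
    have h3 := scw0_inv_conj_scx (V := V) hV hw s (((chr (D.rn s.1) h')⁻¹ : ℂˣ) * -a)
    have h4 := scw0_inv_conj_tor (V := V) hV hw (h'⁻¹ * h)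
    have h5 : (γ : ℂ) = -(((chr (D.rn s.1) h')⁻¹ : ℂˣ) * -(a : ℂ)) := by
      rw [hγ, Units.val_mul]; ring
    rw [h5, ← h3, hτ, ← h4, map_mul, map_inv, ← mul_inv_eq_iff_eq_mul.mpr h2, scx_neg]
    group
  obtain ⟨ρ, hρ⟩ : ∃ ρ, D.scx V (D.star s) (γ⁻¹ : ℂˣ) * D.tor V τ =
      D.tor V τ * D.scx V (D.star s) ρ := by
    have h2 := D.tor_mul_scx (V := V) τ (D.star s)
      (((chr (D.rn (D.star s).1) τ)⁻¹ : ℂˣ) * (γ⁻¹ : ℂˣ))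
    rw [← mul_assoc, Units.mul_inv, one_mul] at h2
    exact ⟨_, h2.symm⟩
  have h2 : D.scy V (D.star s) γ * D.tor V τ = D.scx V (D.star s) (γ⁻¹ : ℂˣ) *
      D.tor V (Pi.mulSingle (D.star s) γ⁻¹ * D.sact (D.star s) τ) * D.scr V (D.star s) *
        D.scx V (D.star s) ρ := by
    rw [scy_eq_big_cell, mul_assoc, hρ, ← mul_assoc, mul_assoc _ (D.scr V _), scr_mul_tor, map_mul]
    group
  -- The torus part of the relative position is trivial exactly when `τ` is the coroot value
  -- `α_{s*}^∨(γ⁻¹)`; transported back through `w₀`, this is the recursion for `h'`.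
  have h3 : Pi.mulSingle (D.star s) γ⁻¹ * D.sact (D.star s) τ = 1 ↔
      h' = Pi.mulSingle s a * D.sact s h := by
    have e1 : Pi.mulSingle (D.star s) γ⁻¹ * D.sact (D.star s) τ = 1 ↔
        τ = Pi.mulSingle (D.star s) γ⁻¹ := by
      rw [Pi.mulSingle_inv, inv_mul_eq_one, ← Pi.mulSingle_inv, ← sact_mulSingle]
      constructor
      · intro e; rw [e, sact_sact]
      · intro e; rw [e, sact_sact]
    have e2 : Function.Injective (D.starAct) := by
      intro x y hxy
      funext t
      have := congrFun hxy (D.star t)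
      change (x (D.star (D.star t)))⁻¹ = (y (D.star (D.star t)))⁻¹ at this
      rwa [star_star hw, inv_inj] at this
    rw [e1, hτ, ← starAct_mulSingle hw, e2.eq_iff, inv_mul_eq_iff_eq_mul]
    have e3 : h' * Pi.mulSingle s γ = D.sact s h' * Pi.mulSingle s a := by
      rw [sact, hγ, Pi.mulSingle_mul, mul_assoc]
    rw [e3]
    constructor
    · rintro rfl
      rw [sact_mul, sact_sact, sact_mulSingle, mul_left_comm, ← Pi.mulSingle_mul, mul_inv_cancel,
        Pi.mulSingle_one, mul_one]
    · rintro rfl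
      rw [sact_mul, sact_sact, sact_mulSingle, mul_right_comm, ← Pi.mulSingle_mul, inv_mul_cancel,
        Pi.mulSingle_one, one_mul]
  rw [hasUnitDist_iff, h1, h2, ← h3]
  constructor
  · rintro ⟨v, hv, v', hv', e⟩
    exact tor_mul_scr_double_coset hV (D.scx_mem_scU V _ _) (D.scx_mem_scU V _ _) hv hv' e
  · intro e
    refine ⟨_, D.scx_mem_scU V (D.star s) (γ⁻¹ : ℂˣ), _, D.scx_mem_scU V (D.star s) ρ, ?_⟩
    rw [e, map_one, mul_one]

end Splitting

end Pinnings

end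

/-! ### Positions in a word and the combinatorics of the coordinates -/

noncomputable section

namespace Pinnings

open scoped Classical

set_option linter.unusedSectionVars false

variable {L : Type*} [LieRing L] [LieAlgebra ℂ L] [FiniteDimensional ℂ L] [IsKilling ℂ L]
variable {H : LieSubalgebra ℂ L} [H.IsCartanSubalgebra]
variable {V : Type*} [AddCommGroup V] [Module ℂ V] [FiniteDimensional ℂ V]
  [LieRingModule L V] [LieModule ℂ L V]

namespace Splitting

variable {D : Splitting H}

/-! ### Positions in a word -/

theorem count_take_succ (l : List D.S) (s : D.S) (k : Fin l.length) :
    (l.take (k + 1)).count s = (l.take k).count s + if l[k] = s then 1 else 0 := by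
  rw [List.take_succ_eq_append_getElem k.2, List.count_append, List.count_singleton]
  simp [beq_iff_eq]

theorem count_take_mono (l : List D.S) (s : D.S) {j k : ℕ} (h : j ≤ k) :
    (l.take j).count s ≤ (l.take k).count s :=
  (List.take_sublist_take_left h).count_le s

theorem pos_zero (l : List D.S) (s : D.S) : pos l s 0 = 0 :=
  Nat.sInf_eq_zero.mpr (Or.inl (by simp))

/-- The count of `s` first reaches the new value right after the letter at `k`. Positions are
numbered from `1` and indices from `0`, hence `k + 1`. -/
theorem pos_succ {l : List D.S} {s : D.S} (k : Fin l.length) (hk : l[k] = s) :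
    pos l s ((l.take k).count s + 1) = k + 1 := by
  have hmem : (k : ℕ) + 1 ∈ {j | (l.take j).count s = (l.take k).count s + 1} := by
    rw [Set.mem_ofPred_eq, count_take_succ, if_pos hk]
  refine le_antisymm (Nat.sInf_le hmem) (le_csInf ⟨_, hmem⟩ fun j hj => ?_)
  by_contra! hlt
  have := count_take_mono l s (Nat.le_of_lt_succ hlt)
  rw [Set.mem_ofPred_eq] at hj
  omega

theorem exists_pos {l : List D.S} {s : D.S} {i : ℕ} (hi : i < l.count s) :
    ∃ k : Fin l.length, l[k] = s ∧ (l.take k).count s = i ∧ pos l s (i + 1) = k + 1 := by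
  have hex : ∃ n, i < (l.take n).count s := ⟨l.length, by rwa [List.take_length]⟩
  obtain ⟨k, hk⟩ : ∃ k, Nat.find hex = k + 1 := by
    refine Nat.exists_eq_succ_of_ne_zero fun h => ?_
    have := Nat.find_spec hex
    rw [h] at this
    simp at this
  have h1 := Nat.find_spec hex
  have h2 := Nat.find_min hex (m := k) (by omega)
  rw [hk] at h1
  have hkl : k < l.length := by
    by_contra! hle
    rw [List.take_of_length_le (by omega)] at h1
    rw [List.take_of_length_le hle] at h2
    exact h2 h1
  have h3 := count_take_succ l s ⟨k, hkl⟩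
  simp only at h3
  have h4 : l[(⟨k, hkl⟩ : Fin l.length)] = s := by
    by_contra hne
    rw [if_neg hne] at h3
    omega
  rw [if_pos h4] at h3
  have h5 : (l.take k).count s = i := by omega
  refine ⟨⟨k, hkl⟩, h4, h5, ?_⟩
  rw [← h5]
  exact pos_succ ⟨k, hkl⟩ h4

/-- The segment of the word between consecutive occurrences of `s` contains `s` only at its end.
Along it the potential picks up a single parameter. -/
theorem exists_segment (l : List D.S) (s : D.S) (k : Fin l.length) (hk : l[k] = s) :
    ∃ m : List D.S, s ∉ m ∧ pos l s ((l.take k).count s) + m.length = k ∧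
      l.take (k + 1) = l.take (pos l s ((l.take k).count s)) ++ (m ++ [s]) := by
  set j := pos l s ((l.take k).count s) with hj
  have hmem : (k : ℕ) ∈ {j | (l.take j).count s = (l.take k).count s} := rfl
  have h1 : j ≤ k := Nat.sInf_le hmem
  have h2 : (l.take j).count s = (l.take k).count s := Nat.sInf_mem ⟨_, hmem⟩
  have h3 : l.take k = l.take j ++ (l.take k).drop j := by
    conv_lhs => rw [← List.take_append_drop j (l.take k), List.take_take, min_eq_left h1]
  refine ⟨(l.take k).drop j, ?_, ?_, ?_⟩
  · have h4 := congrArg (List.count s) h3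
    rw [List.count_append, h2] at h4
    rw [← List.count_eq_zero]
    omega
  · rw [List.length_drop, List.length_take, min_eq_left k.2.le]
    omega
  · rw [← List.append_assoc, ← h3, List.take_succ_eq_append_getElem k.2]
    congr 2

theorem pos_le_length {l : List D.S} {s : D.S} {i : ℕ} (hi : i ≤ l.count s) :
    pos l s i ≤ l.length := by
  cases i with
  | zero => rw [pos_zero]; exact Nat.zero_le _
  | succ i =>
    obtain ⟨k, -, -, h⟩ := exists_pos (Nat.lt_of_succ_le hi)
    rw [h]
    exact k.2

/-! ### Partial products of the coordinates -/

/-- The coordinates `X^s_i`, extended by `1`. -/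
def ext (l : List D.S) (X : Idx l → ℂˣ) (s : D.S) (i : ℕ) : ℂˣ :=
  if h : i < l.count s + 1 then X ⟨s, ⟨i, h⟩⟩ else 1

/-- The partial products `X^s_0 ⋯ X^s_i`. -/
def pp (l : List D.S) (X : Idx l → ℂˣ) (s : D.S) (i : ℕ) : ℂˣ :=
  ∏ j ∈ Finset.range (i + 1), ext l X s j

theorem pp_zero (l : List D.S) (X : Idx l → ℂˣ) (s : D.S) : pp l X s 0 = X ⟨s, 0⟩ := by
  rw [pp, Finset.prod_range_one, ext, dif_pos (Nat.succ_pos _)]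
  rfl

theorem pp_succ (l : List D.S) (X : Idx l → ℂˣ) (s : D.S) (i : ℕ) (hi : i + 1 < l.count s + 1) :
    pp l X s (i + 1) = pp l X s i * X ⟨s, ⟨i + 1, hi⟩⟩ := by
  rw [pp, Finset.prod_range_succ, ext, dif_pos hi]
  rfl

theorem pp_injective (l : List D.S) {X Y : Idx l → ℂˣ}
    (h : ∀ s, ∀ i ≤ l.count s, pp l X s i = pp l Y s i) : X = Y := by
  funext ⟨s, i, hi⟩
  cases i with
  | zero =>
    have := h s 0 (Nat.zero_le _)
    rwa [pp_zero, pp_zero] at this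
  | succ i =>
    have h1 := h s (i + 1) (Nat.le_of_lt_succ hi)
    rw [pp_succ _ _ _ _ hi, pp_succ _ _ _ _ hi, h s i (by omega)] at h1
    exact mul_left_cancel h1

/-- The products of coordinates expressed through the parameters of a chain. -/
def pval (l : List D.S) (a : ℕ → ℂˣ) (z : D.S → ℂˣ) (s : D.S) (i : ℕ) : ℂˣ :=
  -- The subtraction of one converts a position into an index. At the last value of `i` the product
  -- is the torus parameter of `p₃₁` and no longer a chain parameter.
  if i < l.count s then a (pos l s (i + 1) - 1) else z s

theorem pval_count_take {l : List D.S} (a : ℕ → ℂˣ) (z : D.S → ℂˣ) (k : Fin l.length) :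
    pval l a z l[k] ((l.take k).count l[k]) = a k := by
  have h1 := count_take_succ l l[k] k
  rw [if_pos rfl] at h1
  have h2 : (l.take k).count l[k] < l.count l[k] := by
    have := (List.take_sublist (k + 1) l).count_le l[k]
    omega
  rw [pval, if_pos h2, pos_succ k rfl, Nat.add_sub_cancel]

theorem pval_count (l : List D.S) (a : ℕ → ℂˣ) (z : D.S → ℂˣ) (s : D.S) :
    pval l a z s (l.count s) = z s := by
  rw [pval, if_neg (lt_irrefl _)]

/-- Each index below the length is exactly one occurrence of one letter, so the values can be
prescribed freely. Outside the word the parameters are set to `1` to make them unique. -/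
theorem exists_pval_eq (l : List D.S) (f : D.S → ℕ → ℂˣ) : ∃ (a : ℕ → ℂˣ) (z : D.S → ℂˣ),
    (∀ k, l.length ≤ k → a k = 1) ∧ ∀ s, ∀ i ≤ l.count s, pval l a z s i = f s i := by
  refine ⟨fun k => if h : k < l.length then f l[k] ((l.take k).count l[k]) else 1,
    fun s => f s (l.count s), fun k hk => dif_neg (by omega), fun s i hi => ?_⟩
  rcases hi.lt_or_eq with h | rfl
  · obtain ⟨k, hk, hki, hpos⟩ := exists_pos h
    rw [pval, if_pos h, hpos, Nat.add_sub_cancel, dif_pos k.2]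
    change f l[k] ((l.take k).count l[k]) = _
    rw [hk, hki]
  · rw [pval_count]

/-! ### The torus parts of a decorated chain -/

variable (D) in
/-- The torus part of the last decorated flag of a chain. -/
def hseq : List D.S → (ℕ → ℂˣ) → (D.S → ℂˣ) → (D.S → ℂˣ)
  | [], _, h => h
  | s :: l, a, h => hseq l (fun n => a (n + 1)) (Pi.mulSingle s (a 0) * D.sact s h)

theorem hseq_concat (l : List D.S) (s : D.S) (a : ℕ → ℂˣ) (h : D.S → ℂˣ) :
    D.hseq (l ++ [s]) a h = Pi.mulSingle s (a l.length) * D.sact s (D.hseq l a h) := by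
  induction l generalizing a h with
  | nil => rfl
  | cons t l ih => rw [List.cons_append, hseq, ih]; rfl

theorem hseq_take_succ (l : List D.S) (a : ℕ → ℂˣ) (h : D.S → ℂˣ) (k : Fin l.length) :
    D.hseq (l.take (k + 1)) a h =
      Pi.mulSingle l[k] (a k) * D.sact l[k] (D.hseq (l.take k) a h) := by
  rw [List.take_succ_eq_append_getElem k.2, hseq_concat, List.length_take, min_eq_left k.2.le]
  rfl

/-- Each step applies a simple reflection and multiplies by a coroot value, so a root evaluated at
the end is a root evaluated at the start times a factor that depends on the parameters only. -/
theorem exists_chr_hseq (l : List D.S) (a : ℕ → ℂˣ) (α : H.root) : ∃ K : ℂˣ, ∀ h,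
    chr (D.rn α) (D.hseq l a h) = K * chr (D.rn (wordPerm D.base l α)) h := by
  induction l generalizing a with
  | nil => exact ⟨1, fun h => by rw [one_mul]; rfl⟩
  | cons s l ih =>
    obtain ⟨K, hK⟩ := ih fun n => a (n + 1)
    refine ⟨K * a 0 ^ D.rn (wordPerm D.base l α) s, fun h => ?_⟩
    rw [hseq, hK, map_mul, chr_mulSingle, chr_sact, ← rn_reflectionPerm, mul_assoc]
    rfl

/-- The constant relating the coordinates at `-∞` to the decoration at the start of a chain. -/
def botConst (l : List D.S) (a : ℕ → ℂˣ) (k : Fin l.length) : ℂˣ :=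
  (exists_chr_hseq (l.take k) a l[k].1).choose * (a k)⁻¹

/-- The left side is the ratio of `Λ` along step `k` of the chain; the right side isolates its
dependence on the initial decoration. -/
theorem chr_hseq (l : List D.S) (a : ℕ → ℂˣ) (k : Fin l.length) (h : D.S → ℂˣ) :
    chr (D.rn l[k].1) (D.hseq (l.take k) a h) * (a k)⁻¹ =
      botConst l a k * chr (D.rn (wordPerm D.base (l.take k) l[k].1)) h := by
  rw [(exists_chr_hseq (l.take k) a l[k].1).choose_spec, botConst]
  exact mul_right_comm _ _ _

theorem beta_eq_iff (l : List D.S) (k : Fin l.length) (s : D.S) : beta l k = coroot s.1.1 ↔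
    wordPerm D.base (l.drop (k + 1)).reverse l[k].1 = s.1 := by
  have h1 : beta l k =
      (rootSystem H).coroot (wordPerm D.base (l.drop (k + 1)).reverse l[k].1) := by
    rw [coroot_wordPerm]
    rfl
  rw [h1]
  exact (rootSystem H).coroot.injective.eq_iff (a := wordPerm D.base _ _) (b := s.1)

theorem split_at (l : List D.S) (k : Fin l.length) :
    l = l.take k ++ l[k] :: l.drop (k + 1) := by
  conv_lhs => rw [← List.take_append_drop k l, List.drop_eq_getElem_cons k.2]
  rfl

section Beta

variable {l : List D.S} (hl : LongWord D.base l)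

include hl

theorem exists_beta_eq (s : D.S) : ∃ k : Fin l.length, beta l k = coroot s.1.1 := by
  obtain ⟨l₁, t, l₂, rfl, h⟩ := hl.exists_split s
  refine ⟨⟨l₁.length, by simp⟩, ?_⟩
  rw [beta_eq_iff]
  simpa using h

/-- Distinct positions of a reduced word give distinct coroots, by `RedWord.split_ne`. -/
theorem beta_injective {s : D.S} {k k' : Fin l.length} (h : beta l k = coroot s.1.1)
    (h' : beta l k' = coroot s.1.1) : k = k' := by
  have key : ∀ {k k' : Fin l.length}, k < k' → beta l k = coroot s.1.1 →
      beta l k' ≠ coroot s.1.1 := by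
    intro k k' hlt h h'
    rw [beta_eq_iff] at h h'
    have h2 : l.drop (k + 1) = (l.drop (k + 1)).take (k' - (k + 1)) ++ l[k'] :: l.drop (k' + 1) := by
      conv_lhs => rw [← List.take_append_drop (k' - (k + 1)) (l.drop (k + 1)), List.drop_drop]
      have h3 : (k : ℕ) + 1 + (k' - (k + 1)) = k' := by
        have : (k : ℕ) < k' := hlt
        omega
      rw [h3, List.drop_eq_getElem_cons k'.2]
      rfl
    have h4 := split_at l k
    rw [h2] at h4
    have h5 : RedWord D.base (l.take k ++ l[k] ::
      ((l.drop (k + 1)).take (k' - (k + 1)) ++ l[k'] :: l.drop (k' + 1))) := h4 ▸ hl.1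
    apply h5.split_ne
    rw [← h2, h, h']
  rcases lt_trichotomy k k' with hlt | h0 | hlt
  · exact absurd h' (key hlt h)
  · exact h0
  · exact absurd h (key hlt h')

/-- This is why the coordinate at `(s, -∞)` measures the component of the decoration of `p₂₃` at
`s*`. -/
theorem wordPerm_take_of_beta_eq {s : D.S} {k : Fin l.length} (h : beta l k = coroot s.1.1) :
    wordPerm D.base (l.take k) l[k].1 = (D.star s).1 := by
  rw [beta_eq_iff] at h
  have hw := w0Word_spec hl
  apply (rootSystem H).root.injective
  rw [root_wordPerm, LongWord.root_split h, ← split_at, root_star hw, hw.wordRefl_eq hl]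

end Beta

end Splitting

end Pinnings

end

/-! ### Normalized triangles -/

noncomputable section

namespace Pinnings

open scoped Classical

set_option linter.unusedSectionVars false

variable {L : Type*} [LieRing L] [LieAlgebra ℂ L] [FiniteDimensional ℂ L] [IsKilling ℂ L]
variable {H : LieSubalgebra ℂ L} [H.IsCartanSubalgebra]
variable {V : Type*} [AddCommGroup V] [Module ℂ V] [FiniteDimensional ℂ V]
  [LieRingModule L V] [LieModule ℂ L V]

namespace Splitting

variable {D : Splitting H}

/-! ### Normalized triangles -/

theorem Triangle.conf_eq_iff {t t' : D.Triangle V} :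
    t.conf = t'.conf ↔ ∃ g : AdjGroup H V, g • t' = t := by
  rw [Triangle.conf, Triangle.conf, Quotient.eq]
  rfl

theorem Triangle.conf_smul (g : AdjGroup H V) (t : D.Triangle V) : (g • t).conf = t.conf :=
  Triangle.conf_eq_iff.mpr ⟨g, rfl⟩

/-- The triangle with `p₁₂ = p_std`, `B₃ = u.B⁻` and the torus parameters `z`, `d` of the two
other pinnings. -/
structure IsNormalized (t : D.Triangle V) (u : SCGroup H V) (z d : D.S → ℂˣ) : Prop where
  p12 : t.p12 = D.pstd V
  p31 : t.p31 = (proj H V u * D.adt V z * D.w0 V) • D.pstd V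
  dec : t.p23.dec = (D.adt V d * D.w0 V) • D.decBase V
  flag : t.p23.flag = proj H V u • D.flagMinus V

section Longest

variable (hV : GeneratesWeightLattice H V) (hw : LongWord D.base D.w0Word)

theorem IsNormalized.unique {t t' : D.Triangle V} {u : SCGroup H V} {z d : D.S → ℂˣ}
    (h : IsNormalized t u z d) (h' : IsNormalized t' u z d) : t = t' :=
  Triangle.ext (h.p12.trans h'.p12.symm)
    (Pinning.ext (h.dec.trans h'.dec.symm) (h.flag.trans h'.flag.symm)) (h.p31.trans h'.p31.symm)

include hV hw

theorem w0_smul_flagMinus : D.w0 V • D.flagMinus V = D.flagPlus V := by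
  rw [flagMinus, smul_smul, w0_mul_self hV hw, one_smul]

theorem adt_smul_flagMinus (z : D.S → ℂˣ) : D.adt V z • D.flagMinus V = D.flagMinus V := by
  obtain ⟨c, -, h⟩ := D.exists_adt_eq V z
  rw [h, tor_smul_flagMinus hV hw]

theorem adt_smul_flagPlus (z : D.S → ℂˣ) : D.adt V z • D.flagPlus V = D.flagPlus V := by
  obtain ⟨c, -, h⟩ := D.exists_adt_eq V z
  rw [h, smul_flagPlus_of_mem (D.tor_mem_scB c)]

theorem eq_of_smul_flagPlus {g : AdjGroup H V} (h : g • D.flagPlus V = D.flagPlus V) :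
    ∃ u ∈ D.scU V, ∃ z, g = proj H V u * D.adt V z := by
  obtain ⟨k, rfl⟩ := exists_proj_eq g
  have h1 : proj H V k • D.flagPlus V = proj H V 1 • D.flagPlus V := by
    rw [h, map_one, one_smul]
  rw [flag_eq_iff hV hw, mul_one] at h1
  obtain ⟨c, u, hu, hk⟩ := D.mem_scB'.mp (inv_mem_iff.mp h1)
  exact ⟨u, hu, fun t => chr (D.rn t.1) c, by rw [hk, map_mul, proj_tor fun t => rfl]⟩

theorem adt_inv_conj_mem {u : SCGroup H V} (hu : u ∈ D.scU V) (z : D.S → ℂˣ) :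
    (D.adt V z)⁻¹ * proj H V u * D.adt V z ∈ D.U V := by
  obtain ⟨c, -, h⟩ := D.exists_adt_eq V z
  rw [h, ← map_inv, ← map_mul, ← map_mul]
  exact proj_mem_U (D.tor_conj_mem_scU' c hu)

theorem adt_mem_U_iff {z : D.S → ℂˣ} : D.adt V z ∈ D.U V ↔ z = 1 := by
  refine ⟨fun ⟨u, hu, h⟩ => ?_, fun h => by rw [h, map_one]; exact one_mem _⟩
  have h1 : proj H V u • D.flagMinus V = proj H V 1 • D.flagMinus V := by
    rw [h, adt_smul_flagMinus hV hw, map_one, one_smul]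
  rw [flagMinus_eq_iff hV hw hu (one_mem _)] at h1
  apply adt_injective hV
  rw [← h, h1, map_one, map_one]

/-- The pinning `p₃₁*` lies over `B⁺`, so it is given by an element of the Borel subgroup, whose
unipotent part is forced by `B₃ = u.B⁻`. The decoration of `p₂₃` lies over `B⁻`, so only its torus
part is free. -/
theorem exists_isNormalized {t : D.Triangle V} (h12 : t.p12 = D.pstd V) {u : SCGroup H V}
    (hu : u ∈ D.scU V) (h31 : t.p31.fst = proj H V u • D.flagMinus V) :
    ∃ z d, IsNormalized t u z d := by
  have hfst : t.p12.fst = D.flagPlus V := by rw [h12]; rfl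
  have hsnd : t.p12.snd = D.flagMinus V := by rw [h12]; rfl
  obtain ⟨g, hg⟩ := exists_smul_pstd hV hw t.p31
  have h1 : (g * D.w0 V) • D.flagPlus V = D.flagPlus V := by
    have h2 := t.h1
    rw [hg, hfst] at h2
    rw [mul_smul]
    exact h2
  obtain ⟨v, hv, z, hvz⟩ := eq_of_smul_flagPlus hV hw h1
  have hgz : g = proj H V v * D.adt V z * D.w0 V := by
    rw [← hvz, mul_assoc, w0_mul_self hV hw, mul_one]
  have huv : u = v := by
    rw [← flagMinus_eq_iff hV hw hu hv, ← h31, hg]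
    change D.toFlag (g • D.decBase V) = _
    rw [toFlag_smul_decBase, hgz, mul_smul, mul_smul]
    change _ • _ • D.flagMinus V = _
    rw [adt_smul_flagMinus hV hw]
  obtain ⟨k, hk⟩ := exists_smul_pstd hV hw t.p23
  have h2 : (D.w0 V * k) • D.flagPlus V = D.flagPlus V := by
    have h3 : k • D.flagPlus V = D.flagMinus V := by
      rw [← hsnd, t.h2, hk, ← toFlag_smul_decBase]
      rfl
    rw [mul_smul, h3, w0_smul_flagMinus hV hw]
  obtain ⟨q, hq, y, hqy⟩ := eq_of_smul_flagPlus hV hw h2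
  refine ⟨z, D.starAct y, h12, by rw [huv, ← hgz, hg], ?_, ?_⟩
  · have hk' : k = D.w0 V * (proj H V q * D.adt V y) := by
      rw [← hqy, ← mul_assoc, w0_mul_self hV hw, one_mul]
    rw [hk, ← w0_mul_adt hV hw]
    change k • D.decBase V = _
    have h3 : k⁻¹ * (D.w0 V * D.adt V y) =
        (D.adt V y)⁻¹ * proj H V q⁻¹ * D.adt V y := by
      rw [hk', map_inv]; group
    rw [dec_eq_iff, h3]
    exact adt_inv_conj_mem hV hw (inv_mem hq) y
  · rw [← h31, ← t.h3]
    rfl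

/-- The only condition to check is that `(B⁻, u.B⁻)` is generic, that is, that `w̄₀ u w̄₀⁻¹` lies in
the big cell. -/
theorem exists_triangle {l : List D.S} (hl : LongWord D.base l) (a : ℕ → ℂˣ) (z d : D.S → ℂˣ) :
    ∃ t : D.Triangle V, IsNormalized t (D.xprod V l a) z d := by
  set u := D.xprod V l a with hu
  have hdec : D.toFlag ((D.adt V d * D.w0 V) • D.decBase V) = D.flagMinus V := by
    rw [toFlag_smul_decBase, mul_smul]
    exact adt_smul_flagMinus hV hw d
  have hgen : D.Generic (D.toFlag ((D.adt V d * D.w0 V) • D.decBase V))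
      (proj H V u • D.flagMinus V) := by
    rw [hdec]
    obtain ⟨b, hb, b', hb', h⟩ := cell_conj_xprod (V := V) hV hw hl.1 a
    rw [← scw0_eq_scrw hV (LongWord.map_star hw hl)] at h
    refine ⟨(proj H V b)⁻¹ * D.w0 V, ?_, ?_⟩
    · rw [mul_smul, w0_smul_flagMinus hV hw, inv_smul_eq_iff, smul_flagPlus_of_mem hb]
    · have h1 : proj H V (D.scw0 V * u) • D.flagMinus V =
          proj H V (D.scw0 V * u * (D.scw0 V)⁻¹) • D.flagPlus V := by
        rw [map_mul (proj H V) _ (D.scw0 V)⁻¹, mul_smul, map_inv]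
        congr 1
        exact eq_inv_smul_iff.mpr (w0_smul_flagMinus hV hw)
      rw [mul_smul, inv_smul_eq_iff, smul_smul]
      change (proj H V (D.scw0 V) * _) • _ = _
      rw [← map_mul, h1, h, map_mul, mul_smul, smul_flagPlus_of_mem hb', map_mul, mul_smul]
      rfl
  refine ⟨⟨D.pstd V, ⟨_, _, hgen⟩, (proj H V u * D.adt V z * D.w0 V) • D.pstd V, ?_, hdec.symm, ?_⟩,
    rfl, rfl, rfl, rfl⟩
  · change (proj H V u * D.adt V z * D.w0 V) • D.flagMinus V = D.flagPlus V
    rw [mul_smul, w0_smul_flagMinus hV hw, mul_smul, adt_smul_flagPlus hV hw,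
      smul_flagPlus_of_mem (D.scU_le_scB (xprod_mem_scU l a))]
  · change proj H V u • D.flagMinus V =
      D.toFlag ((proj H V u * D.adt V z * D.w0 V) • D.decBase V)
    rw [toFlag_smul_decBase, mul_smul, mul_smul]
    change _ = _ • _ • D.flagMinus V
    rw [adt_smul_flagMinus hV hw]

/-- A translation between two normalized triangles fixes the standard pinning, hence is trivial.
Then `u` is read off from `B₃`, `z` from `p₃₁` and `d` from the decoration of `p₂₃`. -/
theorem IsNormalized.eq_of_conf_eq {t t' : D.Triangle V} {u u' : SCGroup H V}
    {z d z' d' : D.S → ℂˣ} (hu : u ∈ D.scU V) (hu' : u' ∈ D.scU V) (h : IsNormalized t u z d)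
    (h' : IsNormalized t' u' z' d') (hc : t.conf = t'.conf) : u = u' ∧ z = z' ∧ d = d' := by
  obtain ⟨g, hg⟩ := Triangle.conf_eq_iff.mp hc
  have hg1 : g = 1 := by
    have h1 : g • t'.p12 = t.p12 := congrArg Triangle.p12 hg
    rw [h.p12, h'.p12] at h1
    exact smul_pstd_injective hV hw (h1.trans (one_smul _ _).symm)
  rw [hg1, one_smul] at hg
  subst hg
  have h1 : u = u' := by
    rw [← flagMinus_eq_iff hV hw hu hu', ← h.flag, h'.flag]
  subst h1
  refine ⟨rfl, ?_, ?_⟩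
  · have h2 := smul_pstd_injective hV hw (h.p31.symm.trans h'.p31)
    exact adt_injective hV (mul_left_cancel (mul_right_cancel h2))
  · have h2 := h.dec.symm.trans h'.dec
    rw [dec_eq_iff] at h2
    have h3 : (D.adt V d * D.w0 V)⁻¹ * (D.adt V d' * D.w0 V) = D.adt V (D.starAct (d⁻¹ * d')) := by
      rw [← mul_left_inj (D.w0 V), ← w0_mul_adt hV hw, map_mul, map_inv, mul_inv_rev,
        w0_inv hV hw]
      simp only [mul_assoc, w0_mul_self hV hw, mul_one]
    rw [h3, adt_mem_U_iff hV hw] at h2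
    have h4 : d⁻¹ * d' = 1 := by
      funext t
      have := congrFun h2 (D.star t)
      change ((d⁻¹ * d') (D.star (D.star t)))⁻¹ = 1 at this
      rw [Splitting.star_star hw, inv_eq_one] at this
      exact this
    exact inv_mul_eq_one.mp h4

end Longest

end Splitting

end Pinnings

end

/-! ### Invariance of the coordinates and normal form of chains -/

noncomputable section

namespace Pinnings

open scoped Classical

set_option linter.unusedSectionVars false

variable {L : Type*} [LieRing L] [LieAlgebra ℂ L] [FiniteDimensional ℂ L] [IsKilling ℂ L]
variable {H : LieSubalgebra ℂ L} [H.IsCartanSubalgebra]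
variable {V : Type*} [AddCommGroup V] [Module ℂ V] [FiniteDimensional ℂ V]
  [LieRingModule L V] [LieModule ℂ L V]

namespace Splitting

variable {D : Splitting H}

/-! ### Invariance of the coordinates -/

theorem HasDist.smul (g : AdjGroup H V) {t : D.S} {B₁ B₂ : D.Flag V} (h : D.HasDist t B₁ B₂) :
    D.HasDist t (g • B₁) (g • B₂) := by
  obtain ⟨k, rfl, rfl⟩ := h
  exact ⟨g * k, by rw [mul_smul], by rw [mul_smul]⟩

theorem HasUnitDist.smul (g : SCGroup H V) {t : D.S} {A₁ A₂ : D.SCDecFlag V}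
    (h : D.HasUnitDist t A₁ A₂) : D.HasUnitDist t (g • A₁) (g • A₂) := by
  obtain ⟨k, rfl, rfl⟩ := h
  exact ⟨g * k, by rw [mul_smul], by rw [mul_smul]⟩

theorem Lifts.smul (g : SCGroup H V) {A' : D.SCDecFlag V} {A : D.DecFlag V} (h : D.Lifts A' A) :
    D.Lifts (g • A') (proj H V g • A) := by
  obtain ⟨k, rfl, rfl⟩ := h
  exact ⟨g * k, rfl, by rw [map_mul]; rfl⟩

theorem W_smul (g : AdjGroup H V) (s : D.S) (A : D.DecFlag V) (B₂ B₃ : D.Flag V) :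
    D.W s (g • A) (g • B₂) (g • B₃) = D.W s A B₂ B₃ := by
  rw [W, W]
  congr 1
  funext z
  apply propext
  constructor
  · rintro ⟨k, u, h1, h2, h3, h4⟩
    exact ⟨k * g, u, by rw [mul_smul, h1], by rw [mul_smul, h2], by rw [mul_smul, h3], h4⟩
  · rintro ⟨k, u, h1, h2, h3, h4⟩
    exact ⟨k * g⁻¹, u, by rw [mul_smul, inv_smul_smul, h1], by rw [mul_smul, inv_smul_smul, h2],
      by rw [mul_smul, inv_smul_smul, h3], h4⟩

theorem Lam_smul (g : SCGroup H V) (s : D.S) (A₁ A₂ : D.SCDecFlag V) :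
    D.Lam s (g • A₁) (g • A₂) = D.Lam s A₁ A₂ := by
  rw [Lam, Lam]
  congr 1
  funext z
  apply propext
  constructor
  · rintro ⟨k, h, h1, h2, h3⟩
    exact ⟨g⁻¹ * k, h, by rw [mul_smul, ← h1, inv_smul_smul],
      by rw [mul_smul, ← h2, inv_smul_smul], h3⟩
  · rintro ⟨k, h, h1, h2, h3⟩
    exact ⟨g * k, h, by rw [mul_smul, ← h1], by rw [mul_smul, ← h2], h3⟩

/-- The formulas for the coordinates in terms of a chain `Φ` of flags and its lift `Ψ`. -/
def CoordFormulas (l : List D.S) (t : D.Triangle V) (Φ : ℕ → D.Flag V) (Ψ : ℕ → D.SCDecFlag V)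
    (A : D.SCDecFlag V) (X : IdxInf l → ℂˣ) : Prop :=
  ∀ s : D.S,
    (∀ i : Fin (l.count s + 1),
      ((i : ℕ) = 0 →
        (X ⟨s, i⟩ : ℂ) = D.W s t.p12.dec (Φ 0) (Φ (pos l s 1))) ∧
      (0 < (i : ℕ) → (i : ℕ) < l.count s →
        (X ⟨s, i⟩ : ℂ) = D.W s t.p12.dec (Φ (pos l s i)) (Φ (pos l s (i + 1))) /
          D.W s t.p12.dec (Φ (pos l s (i - 1))) (Φ (pos l s i))) ∧
      ((i : ℕ) = l.count s →
        (X ⟨s, i⟩ : ℂ) =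
          (D.W s t.p31.opp.dec (Φ (pos l s (i - 1))) (Φ (pos l s i)))⁻¹)) ∧
    ∃ k : Fin l.length, beta l k = coroot s.1.1 ∧
      X ⟨s, ⊥⟩ = D.Lam l[k] A (Ψ (k + 1)) / D.Lam l[k] A (Ψ k)

section Longest

variable (hV : GeneratesWeightLattice H V) (hw : LongWord D.base D.w0Word)

include hV hw

/-- All ingredients are `G`-invariant. The lifts to `G̃` are translated by a lift of the translating
element. -/
theorem IsGSCoord.exists_normalized {l : List D.S} {C : D.Conf3 V} {X : IdxInf l → ℂˣ}
    (h : IsGSCoord l C X) : ∃ (t : D.Triangle V) (Φ : ℕ → D.Flag V) (Ψ : ℕ → D.SCDecFlag V)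
      (A : D.SCDecFlag V), t.conf = C ∧ t.p12 = D.pstd V ∧ IsChain l t Φ ∧
        IsChainLift l t Φ Ψ ∧ D.Lifts A t.p12.dec ∧ CoordFormulas l t Φ Ψ A X := by
  obtain ⟨t, Φ, Ψ, A, h1, h2, h3, h4, h5⟩ := h
  obtain ⟨g, hg⟩ := exists_smul_pstd hV hw t.p12
  obtain ⟨k, hk⟩ := exists_proj_eq g⁻¹
  have hopp : (g⁻¹ • t).p31.opp.dec = g⁻¹ • t.p31.opp.dec :=
    congrArg Pinning.dec (opp_smul hV hw g⁻¹ t.p31)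
  refine ⟨g⁻¹ • t, fun n => g⁻¹ • Φ n, fun n => k • Ψ n, k • A, (Triangle.conf_smul _ t).trans h1,
    ?_, ⟨?_, ?_, fun k => (h2.dist k).smul _, fun k hk => ?_⟩,
    ⟨?_, fun n hn => ?_, fun k => (h3.dist k).smul _⟩, ?_, fun s => ⟨fun i => ?_, ?_⟩⟩
  · change g⁻¹ • t.p12 = _
    rw [hg, inv_smul_smul]
  · rw [h2.left]
    exact (Pinning.fst_smul _ _).symm
  · rw [h2.right]
    exact (Pinning.fst_smul _ _).symm
  · change D.Generic (g⁻¹ • t.p12).fst _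
    rw [Pinning.fst_smul]
    exact (h2.generic k hk).smul _
  · have := h3.left.smul k
    rw [← hk] at this
    exact this
  · obtain ⟨A', hA, hA'⟩ := h3.lift n hn
    refine ⟨g⁻¹ • A', ?_, by rw [toFlag_smul, hA']⟩
    rw [hk]
    exact hA.smul k
  · have := h4.smul k
    rw [← hk] at this
    exact this
  · rw [hopp]
    change (_ → _ = D.W s (g⁻¹ • t.p12.dec) _ _) ∧ (_ → _ → _ = D.W s (g⁻¹ • t.p12.dec) _ _ /
      D.W s (g⁻¹ • t.p12.dec) _ _) ∧ _
    simp only [W_smul]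
    exact (h5 s).1 i
  · simp only [Lam_smul]
    exact (h5 s).2

/-! ### Chains in normal form -/

/-- The chain starts at `B⁻`, and each generic step appends a factor `x_{s_k}(a_k)` with `a_k ≠ 0`.
-/
theorem IsChain.exists_eq {l : List D.S} {t : D.Triangle V} {Φ : ℕ → D.Flag V}
    (h : IsChain l t Φ) (h12 : t.p12 = D.pstd V) : ∃ a : ℕ → ℂˣ, (∀ k, l.length ≤ k → a k = 1) ∧
      ∀ k ≤ l.length, Φ k = proj H V (D.xprod V (l.take k) a) • D.flagMinus V := by
  have hfst : t.p12.fst = D.flagPlus V := by rw [h12]; rfl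
  have key : ∀ n ≤ l.length, ∃ a : ℕ → ℂˣ,
      ∀ k ≤ n, Φ k = proj H V (D.xprod V (l.take k) a) • D.flagMinus V := by
    intro n
    induction n with
    | zero =>
      refine fun _ => ⟨1, fun k hk => ?_⟩
      obtain rfl := Nat.le_zero.mp hk
      rw [List.take_zero, xprod_nil, map_one, one_smul, h.left, ← t.h2, h12]
      rfl
    | succ n ih =>
      intro hn
      obtain ⟨a, ha⟩ := ih (by omega)
      have h1 := h.dist ⟨n, hn⟩
      have h2 := h.generic (n + 1) hn
      rw [hfst] at h2
      simp only at h1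
      rw [ha n le_rfl] at h1
      obtain ⟨b, hb⟩ := (hasDist_and_generic_iff hV hw _ (xprod_mem_scU _ _)).mp ⟨h1, h2⟩
      -- Changing the parameter at `n` does not affect shorter prefixes.
      refine ⟨Function.update a n b, fun k hk => ?_⟩
      have hcongr : ∀ k ≤ n, D.xprod V (l.take k) (Function.update a n b) =
          D.xprod V (l.take k) a := by
        refine fun k hk => xprod_congr fun j hj => Function.update_of_ne ?_ _ _
        rw [List.length_take] at hj
        omega
      rcases hk.lt_or_eq with hlt | rfl
      · rw [hcongr k (by omega), ha k (by omega)]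
      · rw [hb, xprod_take_succ l _ ⟨n, hn⟩]
        simp only
        rw [hcongr n le_rfl, Function.update_self]
  obtain ⟨a, ha⟩ := key l.length le_rfl
  -- Parameters beyond the word do not occur in the products and are normalized to `1`.
  refine ⟨fun k => if k < l.length then a k else 1, fun k hk => if_neg (by omega), fun k hk => ?_⟩
  rw [ha k hk]
  congr 2
  refine xprod_congr fun j hj => (if_pos ?_).symm
  rw [List.length_take] at hj
  omega

/-- Two lifts differ by the centre, which lies in the torus. -/
theorem exists_eq_smul_scBase {A : D.SCDecFlag V} {g : SCGroup H V}
    (h : D.Lifts A (proj H V g • D.decBase V)) :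
    ∃ c : D.S → ℂˣ, (∀ t : D.S, chr (D.rn t.1) c = 1) ∧ A = (g * D.tor V c) • D.scBase V := by
  obtain ⟨k, rfl⟩ := exists_smul_scBase A
  rw [lifts_smul_scBase_iff, dec_eq_iff] at h
  obtain ⟨u, hu, h⟩ := h
  rw [← map_inv, ← map_mul, proj_eq_iff] at h
  obtain ⟨c, hc⟩ := center_le hV hw h
  refine ⟨c, chr_rn_of_mem_center hV (hc ▸ h), ?_⟩
  have h1 := Subgroup.mem_center_iff.mp h u
  have h2 : k⁻¹ * (g * (u⁻¹ * (g⁻¹ * k))) = u⁻¹ := by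
    calc _ = (u * (u⁻¹ * (g⁻¹ * k)))⁻¹ * (u⁻¹ * (g⁻¹ * k)) := by group
      _ = _ := by rw [h1]; group
  rw [scdec_eq_iff, ← hc, h2]
  exact inv_mem hu

theorem IsChainLift.exists_eq {l : List D.S} {t : D.Triangle V} {Φ : ℕ → D.Flag V}
    {Ψ : ℕ → D.SCDecFlag V} (h : IsChainLift l t Φ Ψ) {a : ℕ → ℂˣ}
    (ha : ∀ k ≤ l.length, Φ k = proj H V (D.xprod V (l.take k) a) • D.flagMinus V)
    {d : D.S → ℂˣ} (hd : t.p23.dec = (D.adt V d * D.w0 V) • D.decBase V) :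
    ∃ e : D.S → ℂˣ, (∀ t : D.S, chr (D.rn t.1) e = d t) ∧ ∀ k ≤ l.length,
      Ψ k = (D.xprod V (l.take k) a * D.tor V (D.hseq (l.take k) a e) * D.scw0 V) • D.scBase V := by
  obtain ⟨e, he, hd'⟩ := D.exists_adt_eq V d
  have h0 := h.left
  rw [hd, hd', w0, ← map_mul] at h0
  obtain ⟨c, hc, h0⟩ := exists_eq_smul_scBase hV hw h0
  refine ⟨c * e, fun t => by rw [map_mul, hc, he, one_mul], fun k => ?_⟩
  induction k with
  | zero =>
    intro _
    rw [h0, List.take_zero, xprod_nil, one_mul, hseq, map_mul, mul_assoc (D.tor V c)]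
    rw [Subgroup.mem_center_iff.mp (tor_mem_center hc)]
  | succ k ih =>
    intro hk
    have h1 := h.dist ⟨k, hk⟩
    simp only at h1
    rw [ih (by omega)] at h1
    -- The underlying flag is known, so the lift is determined up to a torus element; the condition
    -- on the `h`-invariant then fixes this element by the recursion of `hseq`.
    obtain ⟨A, hA, hA'⟩ := h.lift (k + 1) hk
    obtain ⟨g, hg⟩ := exists_smul_scBase (Ψ (k + 1))
    rw [hg, lifts_smul_scBase_iff] at hA
    rw [hA, toFlag_smul_decBase, ha (k + 1) hk, proj_smul_flagMinus, eq_comm,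
      flag_eq_iff hV hw] at hA'
    obtain ⟨c', v, hv, hcv⟩ := hA'
    have h2 : Ψ (k + 1) = (D.xprod V (l.take (k + 1)) a * D.tor V (D.starAct c') *
        D.scw0 V) • D.scBase V := by
      rw [hg, mul_assoc, ← scw0_mul_tor hw hV, ← mul_assoc, eq_comm, scdec_eq_iff]
      have h3 : (D.xprod V (l.take (k + 1)) a * D.scw0 V * D.tor V c')⁻¹ * g = v := by
        rw [mul_inv_rev, mul_assoc, hcv, inv_mul_cancel_left]
      rwa [h3]
    rw [h2, hseq_take_succ l a _ ⟨k, hk⟩]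
    rw [h2, xprod_take_succ l a ⟨k, hk⟩, hasUnitDist_star_iff hV hw] at h1
    rw [h1]

end Longest

end Splitting

end Pinnings

end

/-! ### The coordinates of a normalized triangle and the chart -/

noncomputable section

namespace Pinnings

open scoped Classical

set_option linter.unusedSectionVars false

variable {L : Type*} [LieRing L] [LieAlgebra ℂ L] [FiniteDimensional ℂ L] [IsKilling ℂ L]
variable {H : LieSubalgebra ℂ L} [H.IsCartanSubalgebra]
variable {V : Type*} [AddCommGroup V] [Module ℂ V] [FiniteDimensional ℂ V]
  [LieRingModule L V] [LieModule ℂ L V]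

namespace Splitting

variable {D : Splitting H}

/-! ### The coordinates of a normalized triangle -/

/-- The relation between the coordinates and the parameters of a normalized triangle. -/
def CoordRel (l : List D.S) (a : ℕ → ℂˣ) (z d : D.S → ℂˣ) (X : IdxInf l → ℂˣ) : Prop :=
  (∀ s, ∀ i ≤ l.count s, pp l (restr l X) s i = pval l a z s i) ∧
    ∀ s : D.S, ∃ k : Fin l.length, beta l k = coroot s.1.1 ∧
      X ⟨s, ⊥⟩ = botConst l a k * d (D.star s)

/-- Coordinates given as quotients of consecutive values are the same as partial products equal to
these values. The letter must occur, so that the first and last index differ and the clauses do not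
overlap. -/
theorem pp_eq_iff (l : List D.S) (X : Idx l → ℂˣ) (s : D.S) (hs : 0 < l.count s) (p : ℕ → ℂˣ) :
    (∀ i : Fin (l.count s + 1), ((i : ℕ) = 0 → X ⟨s, i⟩ = p 0) ∧
      (0 < (i : ℕ) → (i : ℕ) < l.count s → X ⟨s, i⟩ = p i / p (i - 1)) ∧
      ((i : ℕ) = l.count s → X ⟨s, i⟩ = p (l.count s) / p (i - 1))) ↔
    ∀ i ≤ l.count s, pp l X s i = p i := by
  constructor
  · intro h i hi
    induction i with
    | zero => rw [pp_zero]; exact (h 0).1 rfl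
    | succ i ih =>
      rw [pp_succ l X s i (Nat.lt_succ_of_le hi), ih (by omega)]
      have h1 : X ⟨s, ⟨i + 1, Nat.lt_succ_of_le hi⟩⟩ = p (i + 1) / p i := by
        rcases hi.lt_or_eq with hlt | heq
        · exact (h ⟨i + 1, Nat.lt_succ_of_le hi⟩).2.1 (Nat.succ_pos i) hlt
        · exact ((h ⟨i + 1, Nat.lt_succ_of_le hi⟩).2.2 heq).trans (by simp only [← heq]; rfl)
      rw [h1, mul_div_cancel]
  · intro h
    have key : ∀ i (hi : i + 1 < l.count s + 1), X ⟨s, ⟨i + 1, hi⟩⟩ = p (i + 1) / p i := by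
      intro i hi
      rw [← h i (by omega), ← h (i + 1) (by omega), pp_succ l X s i hi, mul_div_cancel_left]
    rintro ⟨i, hi⟩
    cases i with
    | zero =>
      refine ⟨fun _ => ?_, fun h0 => absurd h0 (lt_irrefl _), fun h0 => ?_⟩
      · rw [← h 0 (Nat.zero_le _), pp_zero]
        rfl
      · simp only at h0
        omega
    | succ i =>
      refine ⟨fun h0 => absurd h0 (Nat.succ_ne_zero i), fun _ _ => key i hi, fun h0 => ?_⟩
      exact (key i hi).trans (by simp only [← h0]; rfl)

section Longest

variable (hV : GeneratesWeightLattice H V) (hw : LongWord D.base D.w0Word)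

include hV hw

/-- One segment of the chain contains a single letter `s`; changing the decoration from `p₁₂` to
`p₃₁*` only divides the potential by `z_s`. -/
theorem W_chain {l : List D.S} {Φ : ℕ → D.Flag V} {a : ℕ → ℂˣ}
    (hΦ : ∀ k ≤ l.length, Φ k = proj H V (D.xprod V (l.take k) a) • D.flagMinus V)
    {u : SCGroup H V} (hu : u ∈ D.scU V) (z y : D.S → ℂˣ) (s : D.S) (i : ℕ)
    (hi : i < l.count s) :
    D.W s ((proj H V u * D.adt V z) • D.decBase V) (Φ (pos l s i)) (Φ (pos l s (i + 1))) =
      (((z s)⁻¹ * pval l a y s i : ℂˣ) : ℂ) := by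
  obtain ⟨k, hks, hki, hpos⟩ := exists_pos hi
  obtain ⟨m, hm, hmk, hseg⟩ := exists_segment l s k hks
  obtain ⟨c, hc, hz⟩ := D.exists_adt_eq V z
  rw [hki] at hmk hseg
  have hp : pval l a y s i = a k := by rw [pval, if_pos hi, hpos, Nat.add_sub_cancel]
  have hlen : (l.take (pos l s i)).length = pos l s i := by
    rw [List.length_take, min_eq_left (pos_le_length hi.le)]
  have h := W_segment hV hw s u (mul_mem (inv_mem hu) (xprod_mem_scU (l.take (pos l s i)) a)) c hm
    (fun n => a (pos l s i + n))
  have e1 : ∀ v w : SCGroup H V, u * (u⁻¹ * v * w) = v * w := fun v w => by group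
  rw [mul_inv_cancel_left, e1] at h
  have h2 : D.xprod V (l.take (k + 1)) a = D.xprod V (l.take (pos l s i)) a *
      D.xprod V (m ++ [s]) fun n => a (pos l s i + n) := by
    rw [hseg, xprod_append, hlen]
  rw [hΦ _ (pos_le_length hi.le), hpos, hΦ _ k.2, hz, ← map_mul, h2, hp, ← hc s, ← hmk, ← h]

/-- The torus part of the lift of `B₁` cancels in the quotient, so the choice of this lift does not
matter. -/
theorem Lam_chain {l : List D.S} {Ψ : ℕ → D.SCDecFlag V} {a : ℕ → ℂˣ} {d e : D.S → ℂˣ}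
    (hl : LongWord D.base l) (he : ∀ t : D.S, chr (D.rn t.1) e = d t)
    (hΨ : ∀ k ≤ l.length, Ψ k = (D.xprod V (l.take k) a * D.tor V (D.hseq (l.take k) a e) *
      D.scw0 V) • D.scBase V) (ζ : D.S → ℂˣ) {s : D.S} {k : Fin l.length}
    (hk : beta l k = coroot s.1.1) :
    D.Lam l[k] (D.tor V ζ • D.scBase V) (Ψ (k + 1)) / D.Lam l[k] (D.tor V ζ • D.scBase V) (Ψ k) =
      botConst l a k * d (D.star s) := by
  rw [hΨ _ k.2.le, hΨ _ k.2, Lam_eq hV hw _ _ _ (xprod_mem_scU _ _),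
    Lam_eq hV hw _ _ _ (xprod_mem_scU _ _), ← he, ← wordPerm_take_of_beta_eq hl hk, ← chr_hseq,
    hseq_take_succ, sact]
  simp only [Pi.mul_apply, Pi.mulSingle_eq_same]
  simp only [div_eq_mul_inv, mul_inv_rev, inv_inv]
  have key : ∀ x y z w : ℂˣ, x * (z * y⁻¹ * w⁻¹) * (y * x⁻¹) = z * w⁻¹ := by
    intro x y z w
    rw [mul_comm y, ← mul_assoc, mul_right_comm x, mul_inv_cancel, one_mul, mul_right_comm,
      inv_mul_cancel_right]
  exact key _ _ _ _

theorem coordFormulas_iff {l : List D.S} (hl : LongWord D.base l) {t : D.Triangle V}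
    {a : ℕ → ℂˣ} {z d e : D.S → ℂˣ} (ht : IsNormalized t (D.xprod V l a) z d)
    {Φ : ℕ → D.Flag V} {Ψ : ℕ → D.SCDecFlag V}
    (hΦ : ∀ k ≤ l.length, Φ k = proj H V (D.xprod V (l.take k) a) • D.flagMinus V)
    (he : ∀ t : D.S, chr (D.rn t.1) e = d t)
    (hΨ : ∀ k ≤ l.length, Ψ k = (D.xprod V (l.take k) a * D.tor V (D.hseq (l.take k) a e) *
      D.scw0 V) • D.scBase V) (ζ : D.S → ℂˣ) (X : IdxInf l → ℂˣ) :
    CoordFormulas l t Φ Ψ (D.tor V ζ • D.scBase V) X ↔ CoordRel l a z d X := by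
  have hopp : t.p31.opp.dec = (proj H V (D.xprod V l a) * D.adt V z) • D.decBase V := by
    rw [ht.p31, opp_smul_pstd hV hw, mul_assoc _ (D.w0 V), w0_mul_self hV hw, mul_one]
    rfl
  have hW1 : ∀ s i, i < l.count s →
      D.W s t.p12.dec (Φ (pos l s i)) (Φ (pos l s (i + 1))) = (pval l a z s i : ℂˣ) := by
    intro s i hi
    have := W_chain hV hw hΦ (one_mem (D.scU V)) 1 z s i hi
    rw [map_one, map_one, one_mul, one_smul, Pi.one_apply, inv_one, one_mul] at this
    rw [ht.p12]
    exact this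
  have hW2 : ∀ s i, i < l.count s → D.W s t.p31.opp.dec (Φ (pos l s i)) (Φ (pos l s (i + 1))) =
      ((z s)⁻¹ * pval l a z s i : ℂˣ) := by
    intro s i hi
    rw [hopp]
    exact W_chain hV hw hΦ (xprod_mem_scU l a) z z s i hi
  rw [CoordFormulas, CoordRel, ← forall_and]
  refine forall_congr' fun s => and_congr ?_ (exists_congr fun k => and_congr_right fun hk => ?_)
  -- Every letter occurs in a word of `w₀`.
  · have hs : 0 < l.count s := List.count_pos_iff.mpr (hl.mem s)
    rw [← pp_eq_iff l _ s hs]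
    refine forall_congr' fun i => and_congr ?_ (and_congr ?_ ?_)
    · refine imp_congr_right fun _ => ?_
      have h1 := hW1 s 0 hs
      rw [pos_zero] at h1
      rw [h1, Units.val_inj]
      rfl
    · refine imp_congr_right fun h0 => imp_congr_right fun h1 => ?_
      have h2 := hW1 s (i - 1) (by omega)
      rw [Nat.sub_add_cancel h0] at h2
      rw [hW1 s i h1, h2, ← Units.val_div_eq_div_val, Units.val_inj]
      rfl
    · refine imp_congr_right fun h0 => ?_
      have h2 := hW2 s (i - 1) (by omega)
      rw [Nat.sub_add_cancel (by omega)] at h2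
      rw [h2, ← Units.val_inv_eq_inv_val, Units.val_inj, pval_count, mul_inv, inv_inv,
        ← div_eq_mul_inv]
      rfl
  · rw [Lam_chain hV hw hl he hΨ ζ hk]

theorem isGSCoord_iff {l : List D.S} (hl : LongWord D.base l) {C : D.Conf3 V}
    {X : IdxInf l → ℂˣ} : IsGSCoord l C X ↔ ∃ (t : D.Triangle V) (a : ℕ → ℂˣ) (z d : D.S → ℂˣ),
      t.conf = C ∧ (∀ k, l.length ≤ k → a k = 1) ∧ IsNormalized t (D.xprod V l a) z d ∧
        CoordRel l a z d X := by
  constructor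
  · intro h
    obtain ⟨t, Φ, Ψ, A, hC, h12, h1, h2, h3, h4⟩ := h.exists_normalized hV hw
    obtain ⟨a, ha, hΦ⟩ := h1.exists_eq hV hw h12
    have h31 := hΦ l.length le_rfl
    rw [h1.right, List.take_length] at h31
    obtain ⟨z, d, ht⟩ := exists_isNormalized hV hw h12 (xprod_mem_scU l a) h31
    obtain ⟨e, he, hΨ⟩ := h2.exists_eq hV hw hΦ ht.dec
    rw [h12] at h3
    obtain ⟨ζ, -, hζ⟩ := exists_eq_smul_scBase (D := D) (V := V) (g := 1) (A := A) hV hw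
      (by rw [map_one, one_smul]; exact h3)
    rw [one_mul] at hζ
    rw [hζ, coordFormulas_iff hV hw hl ht hΦ he hΨ] at h4
    exact ⟨t, a, z, d, hC, ha, ht, h4⟩
  · rintro ⟨t, a, z, d, hC, -, ht, h⟩
    obtain ⟨e, he, hd⟩ := D.exists_adt_eq V d
    have hfst : t.p12.fst = D.flagPlus V := by rw [ht.p12]; rfl
    refine ⟨t, fun k => proj H V (D.xprod V (l.take k) a) • D.flagMinus V,
      fun k => (D.xprod V (l.take k) a * D.tor V (D.hseq (l.take k) a e) * D.scw0 V) • D.scBase V,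
      D.tor V 1 • D.scBase V, hC, ⟨?_, ?_, fun k => ?_, fun k _ => ?_⟩, ⟨?_, fun k _ => ?_,
        fun k => ?_⟩, ?_, (coordFormulas_iff hV hw hl ht (fun _ _ => rfl) he
          (fun _ _ => rfl) 1 X).mpr h⟩
    · rw [List.take_zero, xprod_nil, map_one, one_smul, ← t.h2, ht.p12]
      rfl
    · rw [List.take_length, ← t.h3, ← ht.flag]
      rfl
    · refine ((hasDist_and_generic_iff hV hw _ (xprod_mem_scU _ _)).mpr ⟨a k, ?_⟩).1
      rw [xprod_take_succ]
    · rw [hfst]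
      exact (generic_flagPlus_iff hV hw).mpr ⟨_, xprod_mem_scU _ _, rfl⟩
    · rw [List.take_zero, xprod_nil, one_mul, lifts_smul_scBase_iff, ht.dec, hd, map_mul]
      rfl
    · refine ⟨_, lifts_smul_scBase_iff.mpr rfl, ?_⟩
      rw [toFlag_smul_decBase, ← proj_smul_flagMinus, map_mul, mul_smul,
        tor_smul_flagMinus hV hw]
    · rw [xprod_take_succ, hasUnitDist_star_iff hV hw, hseq_take_succ]
    · rw [map_one, lifts_smul_scBase_iff, ht.p12, map_one, one_smul]
      rfl

/-- The partial products prescribe `a` and `z`. Then `botConst` is fixed and the coordinates at `-∞`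
prescribe `d`. -/
theorem exists_coordRel {l : List D.S} (hl : LongWord D.base l) (X : IdxInf l → ℂˣ) :
    ∃ (a : ℕ → ℂˣ) (z d : D.S → ℂˣ), (∀ k, l.length ≤ k → a k = 1) ∧ CoordRel l a z d X := by
  obtain ⟨a, z, ha, h⟩ := exists_pval_eq l (pp l (restr l X))
  choose k hk using exists_beta_eq hl
  refine ⟨a, z, fun s => (botConst l a (k (D.star s)))⁻¹ * X ⟨D.star s, ⊥⟩, ha,
    fun s i hi => (h s i hi).symm, fun s => ⟨k s, hk s, ?_⟩⟩
  simp only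
  rw [Splitting.star_star hw, mul_inv_cancel_left]

omit hV hw in
theorem CoordRel.params_unique {l : List D.S} (hl : LongWord D.base l) (hw : LongWord D.base D.w0Word)
    {X : IdxInf l → ℂˣ} {a a' : ℕ → ℂˣ} {z d z' d' : D.S → ℂˣ} (ha : ∀ k, l.length ≤ k → a k = 1)
    (ha' : ∀ k, l.length ≤ k → a' k = 1) (h : CoordRel l a z d X) (h' : CoordRel l a' z' d' X) :
    a = a' ∧ z = z' ∧ d = d' := by
  have hp : ∀ s, ∀ i ≤ l.count s, pval l a z s i = pval l a' z' s i := fun s i hi =>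
    (h.1 s i hi).symm.trans (h'.1 s i hi)
  have h1 : a = a' := by
    funext k
    rcases lt_or_ge k l.length with hk | hk
    · have := hp l[(⟨k, hk⟩ : Fin l.length)] _ ((List.take_sublist k l).count_le _)
      have e1 := pval_count_take a z ⟨k, hk⟩
      have e2 := pval_count_take a' z' ⟨k, hk⟩
      exact e1.symm.trans (this.trans e2)
    · rw [ha k hk, ha' k hk]
  subst h1
  refine ⟨rfl, funext fun s => ?_, funext fun s => ?_⟩
  · have := hp s _ le_rfl
    rwa [pval_count, pval_count] at this
  · obtain ⟨k, hk, hX⟩ := h.2 (D.star s)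
    obtain ⟨k', hk', hX'⟩ := h'.2 (D.star s)
    obtain rfl := beta_injective hl hk hk'
    rw [Splitting.star_star hw] at hX hX'
    exact mul_left_cancel (hX.symm.trans hX')

omit hV hw in
theorem CoordRel.coords_unique {l : List D.S} (hl : LongWord D.base l) {X X' : IdxInf l → ℂˣ}
    {a : ℕ → ℂˣ} {z d : D.S → ℂˣ} (h : CoordRel l a z d X) (h' : CoordRel l a z d X') :
    X = X' := by
  have h1 : restr l X = restr l X' :=
    pp_injective l fun s i hi => (h.1 s i hi).trans (h'.1 s i hi).symm
  funext ⟨s, i⟩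
  cases i with
  | bot =>
    obtain ⟨k, hk, hX⟩ := h.2 s
    obtain ⟨k', hk', hX'⟩ := h'.2 s
    obtain rfl := beta_injective hl hk hk'
    exact hX.trans hX'.symm
  | coe i => exact congrFun h1 ⟨s, i⟩

/-- Coordinates and parameters determine each other, and parameters correspond to configurations by
the normal form. Injectivity is the uniqueness of the factors of `u`. -/
theorem exists_chart {l : List D.S} (hl : LongWord D.base l) :
    ∃ ψ : (IdxInf l → ℂˣ) → D.Conf3 V, IsGSChart l ψ := by
  choose a z d ha hrel using exists_coordRel (V := V) hV hw hl
  choose t ht using fun X => exists_triangle hV hw hl (a X) (z X) (d X)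
  refine ⟨fun X => (t X).conf, fun X X' hX => ?_, fun C X => ?_⟩
  · obtain ⟨h1, h2, h3⟩ := (ht X).eq_of_conf_eq hV hw (xprod_mem_scU _ _) (xprod_mem_scU _ _)
      (ht X') hX
    have h4 : a X = a X' := by
      funext k
      rcases lt_or_ge k l.length with hk | hk
      · exact xprod_injective hV hw hl h1 k hk
      · rw [ha X k hk, ha X' k hk]
    have h5 := hrel X'
    rw [← h4, ← h2, ← h3] at h5
    exact (hrel X).coords_unique hl h5
  · rw [isGSCoord_iff hV hw hl]
    constructor
    · rintro ⟨t', a', z', d', hC, ha', ht', hrel'⟩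
      obtain ⟨rfl, rfl, rfl⟩ := hrel'.params_unique hl hw ha' (ha X) (hrel X)
      exact (congrArg Triangle.conf ((ht X).unique ht')).trans hC
    · rintro rfl
      exact ⟨t X, a X, z X, d X, rfl, ha X, ht X, hrel X⟩

end Longest

end Splitting

end Pinnings

end

/-! ### Wilson lines and evaluation maps -/

noncomputable section

namespace Pinnings

open scoped Classical

set_option linter.unusedSectionVars false

variable {L : Type*} [LieRing L] [LieAlgebra ℂ L] [FiniteDimensional ℂ L] [IsKilling ℂ L]
variable {H : LieSubalgebra ℂ L} [H.IsCartanSubalgebra]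
variable {V : Type*} [AddCommGroup V] [Module ℂ V] [FiniteDimensional ℂ V]
  [LieRingModule L V] [LieModule ℂ L V]

namespace Splitting

variable {D : Splitting H}

/-! ### Wilson lines -/

section Longest

variable (hV : GeneratesWeightLattice H V) (hw : LongWord D.base D.w0Word)

include hV hw

theorem IsNormalized.bL_eq {t : D.Triangle V} {u : SCGroup H V} {z d : D.S → ℂˣ}
    (h : IsNormalized t u z d) : D.bL V t.conf = proj H V u * D.adt V z := by
  have hex : ∃ b : AdjGroup H V, ∃ t' : D.Triangle V, t'.conf = t.conf ∧ t'.p12 = D.pstd V ∧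
      t'.p31 = (b • D.pstd V).opp :=
    ⟨_, t, rfl, h.p12, by rw [h.p31, opp_smul_pstd hV hw]⟩
  obtain ⟨t', h1, h2, h3⟩ := Classical.epsilon_spec hex
  obtain ⟨g, rfl⟩ := Triangle.conf_eq_iff.mp h1
  have hg : g = 1 := by
    change g • t.p12 = _ at h2
    rw [h.p12] at h2
    exact smul_pstd_injective hV hw (h2.trans (one_smul _ _).symm)
  rw [hg, one_smul, h.p31, opp_smul_pstd hV hw] at h3
  exact (mul_right_cancel (smul_pstd_injective hV hw h3)).symm

/-- Translating by `(q w̄₀)⁻¹`, with `q = b_L`, makes `p₃₁` standard and `p₁₂` equal to `(q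
w̄₀)⁻¹.p_std`. Since `w̄₀² = 1` in the adjoint group, this gives `b_R = w̄₀ q⁻¹ w̄₀`. -/
theorem IsNormalized.bR_eq {t : D.Triangle V} {u : SCGroup H V} {z d : D.S → ℂˣ}
    (h : IsNormalized t u z d) :
    D.bR V t.conf = D.w0 V * (proj H V u * D.adt V z)⁻¹ * D.w0 V := by
  set q := proj H V u * D.adt V z with hq
  have hopp : ∀ b : AdjGroup H V, (q * D.w0 V)⁻¹ • D.pstd V = (b • D.pstd V).opp ↔
      b = D.w0 V * q⁻¹ * D.w0 V := by
    intro b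
    rw [opp_smul_pstd hV hw, mul_inv_rev, w0_inv hV hw]
    constructor
    · intro hb
      rw [smul_pstd_injective hV hw hb, mul_assoc, w0_mul_self hV hw, mul_one]
    · rintro rfl
      rw [mul_assoc _ (D.w0 V), w0_mul_self hV hw, mul_one]
  have hex : ∃ b : AdjGroup H V, ∃ t' : D.Triangle V, t'.conf = t.conf ∧ t'.p31 = D.pstd V ∧
      t'.p12 = (b • D.pstd V).opp := by
    refine ⟨D.w0 V * q⁻¹ * D.w0 V, (q * D.w0 V)⁻¹ • t, Triangle.conf_smul _ t, ?_, ?_⟩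
    · change (q * D.w0 V)⁻¹ • t.p31 = _
      rw [h.p31, inv_smul_smul]
    · change (q * D.w0 V)⁻¹ • t.p12 = _
      rw [h.p12]
      exact (hopp _).mpr rfl
  obtain ⟨t', h1, h2, h3⟩ := Classical.epsilon_spec hex
  obtain ⟨g, rfl⟩ := Triangle.conf_eq_iff.mp h1
  have hg : g = (q * D.w0 V)⁻¹ := by
    change g • t.p31 = _ at h2
    rw [h.p31, smul_smul] at h2
    exact eq_inv_of_mul_eq_one_left
      (smul_pstd_injective hV hw (h2.trans (one_smul _ _).symm))
  change g • t.p12 = _ at h3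
  rw [hg, h.p12] at h3
  exact (hopp _).mp h3

end Longest

/-! ### Evaluation maps -/

theorem prod_coweight (hV : GeneratesWeightLattice H V) (f : D.S → ℂˣ) :
    (Finset.univ.toList.map fun s : D.S => D.coweight V s (f s)).prod = D.adt V f := by
  have h := map_list_prod (D.adt V)
    (Finset.univ.toList.map fun s : D.S => (Pi.mulSingle s (f s) : D.S → ℂˣ))
  rw [Finset.prod_map_toList, Finset.univ_prod_mulSingle, List.map_map] at h
  simp only [coweight_eq hV]
  exact h.symm

/-- Moving all torus factors to the right, each `M^{s_k}` is conjugated by the torus elements to its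
left. Only the component at `s_k` acts, and it is the partial product over the occurrences of `s_k`
before position `k`, including `X_0`. -/
theorem evMap_eq (hV : GeneratesWeightLattice H V) {M : D.S → AdjGroup H V}
    {m : D.S → ℂˣ → AdjGroup H V}
    (hM : ∀ (z : D.S → ℂˣ) s, D.adt V z * M s = m s (z s) * D.adt V z) (l : List D.S)
    (X : Idx l → ℂˣ) : evMap V M l X =
      (List.ofFn fun k : Fin l.length => m l[k] (pp l X l[k] ((l.take k).count l[k]))).prod *
        D.adt V fun s => pp l X s (l.count s) := by
  set A := List.ofFn fun k : Fin l.length => M l[k] * D.coweight V l[k] (X (letterIdx l k)) with hA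
  set B := List.ofFn fun k : Fin l.length => m l[k] (pp l X l[k] ((l.take k).count l[k])) with hB
  -- The formula is proved for prefixes; at each letter exactly one component of the accumulated
  -- torus element is multiplied by a new coordinate.
  have key : ∀ k ≤ l.length, D.adt V (fun s => X ⟨s, 0⟩) * (A.take k).prod =
      (B.take k).prod * D.adt V fun s => pp l X s ((l.take k).count s) := by
    intro k
    induction k with
    | zero => intro _; simp [pp_zero]
    | succ k ih =>
      intro hk
      have hkA : k < A.length := by rw [hA, List.length_ofFn]; exact hk
      have hkB : k < B.length := by rw [hB, List.length_ofFn]; exact hk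
      have hA' : A[k] = M l[k] * D.coweight V l[k] (X (letterIdx l ⟨k, hk⟩)) := by
        simp only [hA, List.getElem_ofFn]
        rfl
      have hB' : B[k] = m l[k] (pp l X l[k] ((l.take k).count l[k])) := by
        simp only [hB, List.getElem_ofFn]
        rfl
      have hY : (fun s => pp l X s ((l.take (k + 1)).count s)) =
          (fun s => pp l X s ((l.take k).count s)) *
            Pi.mulSingle l[k] (X (letterIdx l ⟨k, hk⟩)) := by
        funext s
        have h1 := count_take_succ l s ⟨k, hk⟩
        simp only at h1
        rw [Pi.mul_apply]
        by_cases hs : l[k] = s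
        · subst hs
          have h2 : (l.take k).count l[k] + 1 = (l.take (k + 1)).count l[k] := by
            rw [h1]; exact (congrArg _ (if_pos rfl)).symm
          have h3 : (l.take k).count l[k] + 1 < l.count l[k] + 1 := by
            rw [h2]
            exact Nat.lt_succ_of_le ((List.take_sublist _ l).count_le _)
          rw [Pi.mulSingle_eq_same, ← h2, pp_succ l X _ _ h3]
          congr 2
          simp only [letterIdx, Fin.getElem_fin, h2]
        · rw [Pi.mulSingle_eq_of_ne (Ne.symm hs), mul_one, h1]
          congr 1
          exact (congrArg _ (if_neg hs)).trans (add_zero _)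
      rw [List.prod_take_succ A k hkA, List.prod_take_succ B k hkB, ← mul_assoc, ih (by omega),
        hA', hB', hY, map_mul, coweight_eq hV, ← mul_assoc, mul_assoc _ _ (M _), hM]
      simp only [mul_assoc]
  have h := key l.length le_rfl
  rw [List.take_of_length_le (by rw [hA, List.length_ofFn]),
    List.take_of_length_le (by rw [hB, List.length_ofFn]), List.take_length] at h
  rw [evMap, prod_coweight hV fun s => X ⟨s, 0⟩]
  exact h

theorem proj_xprod (l : List D.S) (a : ℕ → ℂˣ) : proj H V (D.xprod V l a) =
    (List.ofFn fun k : Fin l.length => D.x V l[k] (a k)).prod := by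
  induction l generalizing a with
  | nil => simp
  | cons s l ih =>
    rw [xprod_cons, map_mul, ih]
    simp only [List.length_cons, List.ofFn_succ, List.prod_cons]
    rfl

/-! ### The opposite word -/

section StarOp

variable (hw : LongWord D.base D.w0Word)

include hw

theorem count_star_map (l : List D.S) (s : D.S) : (l.map D.star).count (D.star s) = l.count s :=
  List.count_map_of_injective l D.star (star_injective hw) s

theorem count_starOp (l : List D.S) (t : D.S) : (starOp l).count t = l.count (D.star t) := by
  have h := count_star_map hw l (D.star t)
  rw [Splitting.star_star hw] at h
  rw [starOp, List.count_reverse, h]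

omit hw in
theorem length_starOp (l : List D.S) : (starOp l).length = l.length := by
  rw [starOp, List.length_reverse, List.length_map]

theorem count_take_starOp (l : List D.S) (s : D.S) (j : ℕ) :
    ((starOp l).take j).count (D.star s) + (l.take (l.length - j)).count s = l.count s := by
  rw [starOp, List.take_reverse, List.count_reverse, List.length_map, ← List.map_drop,
    count_star_map hw, add_comm, ← List.count_append, List.take_append_drop]

theorem ext_iotaPull (l : List D.S) (X : Idx l → ℂˣ) (t : D.S) {i : ℕ}
    (hi : i ≤ l.count (D.star t)) :
    ext (starOp l) (iotaPull l X) t i = ext l X (D.star t) (l.count (D.star t) - i) := by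
  rw [ext, ext, dif_pos (by rw [count_starOp hw]; omega), dif_pos (by omega)]
  rfl

omit hw in
theorem pp_succ_eq_mul_ext (l : List D.S) (X : Idx l → ℂˣ) (s : D.S) (i : ℕ) :
    pp l X s (i + 1) = pp l X s i * ext l X s (i + 1) := Finset.prod_range_succ _ _

/-- The first `i + 1` coordinates of the reversed family and the remaining ones of the original
family together make up the full product. -/
theorem pp_iotaPull (l : List D.S) (X : Idx l → ℂˣ) (t : D.S) {i : ℕ}
    (hi : i < l.count (D.star t)) : pp (starOp l) (iotaPull l X) t i *
      pp l X (D.star t) (l.count (D.star t) - i - 1) = pp l X (D.star t) (l.count (D.star t)) := by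
  induction i with
  | zero =>
    obtain ⟨n, hn⟩ := Nat.exists_eq_succ_of_ne_zero hi.ne'
    rw [pp, Finset.prod_range_one, ext_iotaPull hw l X t (Nat.zero_le _), hn,
      pp_succ_eq_mul_ext, mul_comm]
    rfl
  | succ i ih =>
    obtain ⟨n, hn⟩ : ∃ n, l.count (D.star t) - i - 1 = n + 1 :=
      ⟨l.count (D.star t) - i - 2, by omega⟩
    rw [← ih (by omega), pp_succ_eq_mul_ext, ext_iotaPull hw l X t hi.le, hn,
      show l.count (D.star t) - (i + 1) - 1 = n by omega,
      show l.count (D.star t) - (i + 1) = n + 1 by omega, pp_succ_eq_mul_ext l, mul_assoc,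
      mul_comm (ext l _ _ _)]

theorem pp_iotaPull_count (l : List D.S) (X : Idx l → ℂˣ) (t : D.S) :
    pp (starOp l) (iotaPull l X) t (l.count (D.star t)) =
      pp l X (D.star t) (l.count (D.star t)) := by
  rw [pp, pp, ← Finset.prod_range_reflect]
  refine Finset.prod_congr rfl fun j hj => ?_
  rw [Finset.mem_range] at hj
  rw [Nat.add_sub_cancel, ext_iotaPull hw l X t (Nat.sub_le _ _),
    Nat.sub_sub_self (Nat.le_of_lt_succ hj)]

end StarOp

section Longest

variable (hV : GeneratesWeightLattice H V) (hw : LongWord D.base D.w0Word)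

include hV

theorem CoordRel.evPlus_eq {l : List D.S} {a : ℕ → ℂˣ} {z d : D.S → ℂˣ} {X : IdxInf l → ℂˣ}
    (h : CoordRel l a z d X) :
    evPlus V l (restr l X) = proj H V (D.xprod V l a) * D.adt V z := by
  rw [evPlus, evMap_eq hV (m := fun s a => D.x V s a)
    fun z s => by rw [E, adt_mul_x, mul_one], proj_xprod]
  have h1 : (fun s => pp l (restr l X) s (l.count s)) = z := by
    funext s
    rw [h.1 s _ le_rfl, pval_count]
  have h2 : ∀ k : Fin l.length, pp l (restr l X) l[k] ((l.take k).count l[k]) = a k := fun k => by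
    rw [h.1 _ _ ((List.take_sublist _ l).count_le _), pval_count_take]
  simp only [h1, h2]

include hw

theorem conj_adt_w0_x_inv (c : D.S → ℂˣ) (s : D.S) (b : ℂˣ) :
    MulAut.conj (D.adt V c * D.w0 V) (D.x V s b)⁻¹ =
      D.y V (D.star s) (((c (D.star s))⁻¹ * b : ℂˣ) : ℂ) := by
  have hx : (D.x V s b)⁻¹ = D.x V s (-(b : ℂ)) := by
    rw [x, x, scx_neg, map_inv]
  rw [hx, MulAut.conj_apply, mul_assoc (D.adt V c), w0_mul_x hV hw, neg_neg, mul_inv_rev,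
    ← mul_assoc (D.adt V c), adt_mul_y]
  simp only [mul_assoc, mul_inv_cancel_left, mul_inv_cancel, mul_one, Units.val_mul]

/-- Inverting `u z` reverses the factors, and conjugation by `w̄₀` turns `x_s` into `y_{s*}`; the
torus moved to the right is `z` with indices starred. The factors then match those of `evMap_eq` one
by one. -/
theorem CoordRel.evMinus_eq {l : List D.S} {a : ℕ → ℂˣ} {z d : D.S → ℂˣ} {X : IdxInf l → ℂˣ}
    (h : CoordRel l a z d X) :
    evMinus V (starOp l) (iotaPull l (restr l X)) =
      D.w0 V * (proj H V (D.xprod V l a) * D.adt V z)⁻¹ * D.w0 V := by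
  set c := D.starAct z⁻¹ with hc
  have hcs : ∀ s, c s = z (D.star s) := fun s => inv_inv _
  have h1 : (fun t => pp (starOp l) (iotaPull l (restr l X)) t ((starOp l).count t)) = c := by
    funext t
    rw [count_starOp hw, pp_iotaPull_count hw, h.1 _ _ le_rfl, pval_count, hcs]
  have h2 : D.w0 V * (proj H V (D.xprod V l a) * D.adt V z)⁻¹ * D.w0 V =
      MulAut.conj (D.adt V c * D.w0 V) (proj H V (D.xprod V l a))⁻¹ * D.adt V c := by
    rw [MulAut.conj_apply, mul_inv_rev, ← map_inv (D.adt V), ← mul_assoc, w0_mul_adt hV hw,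
      mul_inv_rev (D.adt V c), w0_inv hV hw, ← hc,
      ← mul_assoc _ (D.w0 V), inv_mul_cancel_right]
  rw [h2, evMinus, evMap_eq hV (m := fun s a => D.y V s (a⁻¹ : ℂˣ))
    fun z s => by rw [F, adt_mul_y, mul_one], h1, proj_xprod, List.prod_inv_reverse, map_list_prod]
  congr 2
  refine List.ext_getElem (by simp [length_starOp]) fun j hj hj' => ?_
  have hjN : j < l.length := by simpa [length_starOp] using hj
  simp only [List.getElem_ofFn, List.getElem_map, List.getElem_reverse, List.length_map,
    List.length_ofFn]
  -- Position `j` of the opposite word carries the letter `s_k*` with `k = N - 1 - j`.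
  set k : Fin l.length := ⟨l.length - 1 - j, by omega⟩ with hk
  have hkv : (k : ℕ) = l.length - 1 - j := rfl
  have hlet : (starOp l)[j]'(by simpa using hj) = D.star l[k] := by
    simp only [starOp, List.getElem_reverse, List.getElem_map, List.length_map]
    rfl
  have hcount := count_take_starOp hw l l[k] j
  rw [show l.length - j = k + 1 by omega, count_take_succ, if_pos rfl] at hcount
  -- Here the partial product of the opposite word times `a_k` equals `z` at `s_k`, so its inverse
  -- is the parameter produced by the conjugation.
  have hpp := pp_iotaPull hw l (restr l X) (D.star l[k]) (i := ((starOp l).take j).count (D.star l[k]))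
    (by rw [Splitting.star_star hw]; omega)
  rw [Splitting.star_star hw, show l.count l[k] - ((starOp l).take j).count (D.star l[k]) - 1 =
    (l.take k).count l[k] by omega, h.1 _ _ le_rfl, pval_count,
    h.1 _ _ ((List.take_sublist _ l).count_le _), pval_count_take] at hpp
  have hval : (pp (starOp l) (iotaPull l (restr l X)) (D.star l[k])
      (((starOp l).take j).count (D.star l[k])))⁻¹ = (c (D.star l[k]))⁻¹ * a k := by
    rw [hcs, Splitting.star_star hw, ← hpp, mul_inv, mul_assoc, inv_mul_cancel, mul_one]
  refine (congrArg (fun t => D.y V t ((pp (starOp l) (iotaPull l (restr l X)) t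
    (((starOp l).take j).count t))⁻¹ : ℂˣ)) hlet).trans ?_
  simp only [hval]
  exact (conj_adt_w0_x_inv hV hw c l[k] (a k)).symm

end Longest

end Splitting

end Pinnings

end

/-! ### The theorem -/

theorem theorem3p12 {L : Type*} [LieRing L] [LieAlgebra ℂ L] [FiniteDimensional ℂ L]
    [LieAlgebra.IsKilling ℂ L] (H : LieSubalgebra ℂ L) [H.IsCartanSubalgebra]
    (V : Type*) [AddCommGroup V] [Module ℂ V] [FiniteDimensional ℂ V]
    [LieRingModule L V] [LieModule ℂ L V] (hV : Pinnings.GeneratesWeightLattice H V)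
    (D : Pinnings.Splitting H) (l : List D.S) (hl : D.IsLongestWord l) :
    (∃! ψ : (Pinnings.Splitting.IdxInf l → ℂˣ) → D.Conf3 V,
      Pinnings.Splitting.IsGSChart l ψ) ∧
    ∀ ψ : (Pinnings.Splitting.IdxInf l → ℂˣ) → D.Conf3 V,
      Pinnings.Splitting.IsGSChart l ψ →
        D.bL V ∘ ψ = Pinnings.Splitting.evPlus V l ∘ Pinnings.Splitting.restr l ∧
        D.bR V ∘ ψ = Pinnings.Splitting.evMinus V (Pinnings.Splitting.starOp l) ∘
          Pinnings.Splitting.iotaPull l ∘ Pinnings.Splitting.restr l := by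
  have hl' : Pinnings.LongWord D.base l := hl
  have hw := Pinnings.Splitting.w0Word_spec hl'
  obtain ⟨ψ, hψ⟩ := Pinnings.Splitting.exists_chart hV hw hl'
  -- A chart is determined by the relation between configurations and coordinates, so two charts
  -- agree.
  refine ⟨⟨ψ, hψ, fun ψ' hψ' => funext fun X => (hψ'.2 _ X).mp ((hψ.2 _ X).mpr rfl)⟩,
    fun ψ hψ => ?_⟩
  have key : ∀ X, D.bL V (ψ X) = Pinnings.Splitting.evPlus V l (Pinnings.Splitting.restr l X) ∧
      D.bR V (ψ X) = Pinnings.Splitting.evMinus V (Pinnings.Splitting.starOp l)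
        (Pinnings.Splitting.iotaPull l (Pinnings.Splitting.restr l X)) := by
    intro X
    obtain ⟨t, a, z, d, hC, -, ht, hX⟩ :=
      (Pinnings.Splitting.isGSCoord_iff hV hw hl').mp ((hψ.2 _ X).mpr rfl)
    rw [← hC, ht.bL_eq hV hw, ht.bR_eq hV hw, hX.evPlus_eq hV, hX.evMinus_eq hV hw]
    exact ⟨rfl, rfl⟩
  exact ⟨funext fun X => (key X).1, funext fun X => (key X).2⟩
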